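/- Let $(M,g)$ be a smooth Riemannian manifold without boundary of dimension $m\ge 1$, with distance $d_g$, let $\tilde{\bf A}$ be a smooth real vector field on $M$, let $n\in\mathbb N$ (for instance $n=m$ or $n=m+1$), and let $$Q=(i\nabla_g+\tilde{\bf A})^2+\tfrac{(n-2)^2}{4},\qquad (i\nabla_g+\tilde{\bf A})^2f=i\,\mathrm{div}_g X+\langle\tilde{\bf A},X\rangle_g,\quad X=i\nabla_g f+\tilde{\bf A}f .$$ For $\nu=0,1,2,\dots$ let $E_\nu$ be the distribution $$E_\nu(t,r)=2^{-2\nu-1}\pi^{-\frac{m-1}2}\,\frac{(t^2-r^2)_+^{a}}{\Gamma(a+1)}\quad(t>0),\qquad E_\nu=0\quad(t<0),\qquad a=\nu-\tfrac{m-1}{2},$$ where $s_+^{a}/\Gamma(a+1)$ is, for every real $a$, defined by $\frac{d}{ds}\frac{s_+^{a+1}}{\Gamma(a+2)}=\frac{s_+^{a}}{\Gamma(a+1)}$; equivalently $2\partial_tE_{\nu+1}=tE_{\nu}$. (On $\mathbb R\times\mathbb R^m$, with $r=|x|$, these are the distributions supported in $\{|x|\le t\}$ with $(\partial_t^2-\Delta)E_0=\delta_{0,0}$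 and $(\partial_t^2-\Delta)E_\nu=\nu E_{\nu-1}$ for $\nu\ge1$.) Let $\Omega\subset M$ be open and relatively compact. Then there are a constant $\delta>0$ and functions $\alpha_\nu\in C^\infty(M\times\Omega;\mathbb C)$, $\nu=0,1,2,\dots$, with $\alpha_0(y,y)=1$ for $y\in\Omega$, such that for every $y\in\Omega$ and every $N\ge 0$, in the sense of distributions in $(t,x)\in(-\infty,\delta)\times M$, $$(\partial_t^2+Q)\sum_{\nu=0}^N\alpha_\nu(x,y)E_\nu(t,d_g(x,y))=|g(y)|^{-\frac12}\delta_{0,y}(t,x)+(Q\alpha_N(x,y))\,E_N(t,d_g(x,y)).$$ Here $Q$ acts in the variable $x$, and the identity is to be read in every local coordinate system of $M$, where $|g|=\det(g_{jk})$ and distributions, $\delta_{0,y}$ among them, are taken relative to Lebesgue measure in the coordinates (if $y$ is outside the coordinate domain, the term with $\delta_{0,y}$ is $0$ there); in particular all the pairings of $E_\nu(t,d_g(x,y))$ with test functions supported in $t<\delta$ are well defined. Moreover, for $y\in\Omega$ and $d_g(x,y)<\delta$ the coefficients solve the transport equations $$\rho\,\alpha_0=\langle\nabla_g\sigma,\nabla_g\alpha_0\rangle_g,\qquad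 2\nu\alpha_\nu-\rho\,\alpha_\nu+\langle\nabla_g\sigma,\nabla_g\alpha_\nu\rangle_g+2Q\alpha_{\nu-1}=0\quad(\nu\ge1),$$ where $\sigma=d_g(\cdot,y)^2$ and $\rho=m-\tfrac12\Delta_g\sigma+i\langle\tilde{\bf A},\nabla_g\sigma\rangle_g$; in geodesic normal coordinates $x$ centred at $y$ the operator $\langle\nabla_g\sigma,\nabla_g\,\cdot\,\rangle_g$ is $2\langle x,\nabla_x\,\cdot\,\rangle$. -/

import Mathlib

open scoped Manifold ContDiff ENNReal
open Bundle Set MeasureTheory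

noncomputable section

namespace HadamardParametrix

/-- `ℝ^m` with its Euclidean norm. -/
abbrev Euc (m : ℕ) : Type := EuclideanSpace ℝ (Fin m)

/-- The partial derivative `∂_j f (u)` of a complex-valued function on (a part of) `ℝ^m`. -/
def pd {m : ℕ} (j : Fin m) (f : Euc m → ℂ) (u : Euc m) : ℂ :=
  fderiv ℝ f u (EuclideanSpace.single j 1)

/-! ### Riemannian quantities in a coordinate chart

`e` is a chart of the manifold `M`, and `u` stands for a point of `e.target ⊆ ℝ^m`. -/

section Coordinates

variable {m : ℕ} {M : Type*} [TopologicalSpace M] [ChartedSpace (Euc m) M]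

/-- The coordinate vector field `∂/∂x_j` of the chart `e`, at the point with coordinates `u`. -/
def coordVec (e : OpenPartialHomeomorph M (Euc m)) (u : Euc m) (j : Fin m) :
    TangentSpace (𝓡 m) (e.symm u) :=
  mfderiv (𝓡 m) (𝓡 m) e.symm u (EuclideanSpace.single j (1 : ℝ) : Euc m)

/-- The component `A^j` of the vector field `A` in the chart `e`. -/
def vecCoord (e : OpenPartialHomeomorph M (Euc m)) (A : (x : M) → TangentSpace (𝓡 m) x)
    (u : Euc m) (j : Fin m) : ℝ :=
  let a : Euc m := mfderiv (𝓡 m) (𝓡 m) e (e.symm u) (A (e.symm u))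
  a j

variable [RiemannianBundle (fun x : M => TangentSpace (𝓡 m) x)]

/-- The matrix `(g_{jk})` of the metric in the chart `e`. -/
def metric (e : OpenPartialHomeomorph M (Euc m)) (u : Euc m) : Matrix (Fin m) (Fin m) ℝ :=
  Matrix.of fun j k => inner ℝ (coordVec e u j) (coordVec e u k)

/-- The inverse matrix `(g^{jk})`. -/
def metricInv (e : OpenPartialHomeomorph M (Euc m)) (u : Euc m) : Matrix (Fin m) (Fin m) ℝ :=
  (metric e u)⁻¹

/-- The volume factor `|g|^{1/2}`, where `|g| = det (g_{jk})`. -/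
def volFactor (e : OpenPartialHomeomorph M (Euc m)) (u : Euc m) : ℝ :=
  √(metric e u).det

/-- The divergence `|g|^{-1/2} ∑_j ∂_j (|g|^{1/2} X^j)` of a (complex) vector field. -/
def divergence (e : OpenPartialHomeomorph M (Euc m)) (X : Fin m → Euc m → ℂ) (u : Euc m) : ℂ :=
  ((volFactor e u)⁻¹ : ℝ) * ∑ j, pd j (fun v => (volFactor e v : ℂ) * X j v) u

/-- The gradient `(∇_g f)^j = ∑_k g^{jk} ∂_k f`. -/
def gradient (e : OpenPartialHomeomorph M (Euc m)) (f : Euc m → ℂ) (j : Fin m) (u : Euc m) : ℂ :=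
  ∑ k, (metricInv e u j k : ℂ) * pd k f u

/-- The (nonpositive) Laplace–Beltrami operator `Δ_g f = div ∇_g f`. -/
def laplaceBeltrami (e : OpenPartialHomeomorph M (Euc m)) (f : Euc m → ℂ) : Euc m → ℂ :=
  divergence e (gradient e f)

/-- The vector field `(i∇_g + A) f`. -/
def magneticGradient (e : OpenPartialHomeomorph M (Euc m)) (A : (x : M) → TangentSpace (𝓡 m) x)
    (f : Euc m → ℂ) (j : Fin m) (u : Euc m) : ℂ :=
  Complex.I * gradient e f j u + (vecCoord e A u j : ℂ) * f u

/-- The operator `(i∇_g + A)² + c` on functions in the chart `e`: with `X = (i∇_g + A) f`, its value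
is `i div X + ⟨A, X⟩_g + c f`. -/
def magneticOp (e : OpenPartialHomeomorph M (Euc m)) (A : (x : M) → TangentSpace (𝓡 m) x)
    (c : ℝ) (f : Euc m → ℂ) (u : Euc m) : ℂ :=
  Complex.I * divergence e (magneticGradient e A f) u
    + ∑ j, ∑ k, (metric e u j k : ℂ) * (vecCoord e A u j : ℂ) * magneticGradient e A f k u
    + (c : ℂ) * f u

end Coordinates

/-! ### Distributions on open subsets of `ℝ × ℝ^m`

A distribution is handled through its values on test functions; multiplication by smooth functions
and partial derivatives are defined by transposition. -/

/-- Smooth compactly supported complex-valued functions with support in the open set `U`. -/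
structure IsTestFunction {m : ℕ} (U : Set (ℝ × Euc m)) (φ : ℝ × Euc m → ℂ) : Prop where
  contDiff : ContDiff ℝ ∞ φ
  hasCompactSupport : HasCompactSupport φ
  tsupport_subset : tsupport φ ⊆ U

/-- Functionals on test functions. -/
abbrev Functional (m : ℕ) : Type := (ℝ × Euc m → ℂ) → ℂ

/-- The product `f T`: `⟨f T, φ⟩ = ⟨T, f φ⟩`. -/
def distMul {m : ℕ} (f : ℝ × Euc m → ℂ) (T : Functional m) : Functional m :=
  fun φ => T (fun p => f p * φ p)

/-- The derivative of `T` in the direction `v`: `⟨∂_v T, φ⟩ = -⟨T, ∂_v φ⟩`. -/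
def distDeriv {m : ℕ} (v : ℝ × Euc m) (T : Functional m) : Functional m :=
  fun φ => -T (fun p => fderiv ℝ φ p v)

/-- The time derivative `∂_t T`. -/
def distDt {m : ℕ} (T : Functional m) : Functional m := distDeriv ((1 : ℝ), (0 : Euc m)) T

/-- The space derivative `∂_j T`. -/
def distPd {m : ℕ} (j : Fin m) (T : Functional m) : Functional m :=
  distDeriv ((0 : ℝ), (EuclideanSpace.single j (1 : ℝ) : Euc m)) T

/-- The product of `T` with a function of the space variable. -/
def spaceMul {m : ℕ} (f : Euc m → ℂ) (T : Functional m) : Functional m :=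
  distMul (fun p => f p.2) T

section WaveOperator

variable {m : ℕ} {M : Type*} [TopologicalSpace M] [ChartedSpace (Euc m) M]
  [RiemannianBundle (fun x : M => TangentSpace (𝓡 m) x)]

/-- `magneticGradient` on distributions: `X^j = i ∑_k g^{jk} ∂_k T + A^j T`. -/
def distMagneticGradient (e : OpenPartialHomeomorph M (Euc m))
    (A : (x : M) → TangentSpace (𝓡 m) x) (T : Functional m) (j : Fin m) : Functional m :=
  Complex.I • ∑ k, spaceMul (fun u => (metricInv e u j k : ℂ)) (distPd k T)
    + spaceMul (fun u => (vecCoord e A u j : ℂ)) T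

/-- `magneticOp`, that is `(i∇_g + A)² + c`, on distributions. -/
def distMagneticOp (e : OpenPartialHomeomorph M (Euc m)) (A : (x : M) → TangentSpace (𝓡 m) x)
    (c : ℝ) (T : Functional m) : Functional m :=
  Complex.I • spaceMul (fun u => ((volFactor e u)⁻¹ : ℝ))
      (∑ j, distPd j (spaceMul (fun u => (volFactor e u : ℂ)) (distMagneticGradient e A T j)))
    + ∑ j, ∑ k, spaceMul (fun u => (metric e u j k : ℂ) * (vecCoord e A u j : ℂ))
        (distMagneticGradient e A T k)
    + (c : ℂ) • T

/-- The magnetic wave operator `∂_t² + (i∇_g + A)² + c` on distributions. -/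
def distWaveOp (e : OpenPartialHomeomorph M (Euc m)) (A : (x : M) → TangentSpace (𝓡 m) x)
    (c : ℝ) (T : Functional m) : Functional m :=
  distDt (distDt T) + distMagneticOp e A c T

open Classical in
/-- `|g(y)|^{-1/2} δ_{0,y}(t,x)` in the chart `e`, with `δ` the Dirac distribution relative to
Lebesgue measure in the coordinates. It vanishes on the domain of `e` if `y` is not in it. -/
def pointSource (e : OpenPartialHomeomorph M (Euc m)) (y : M) : Functional m :=
  fun φ => if y ∈ e.source then ((volFactor e (e y))⁻¹ : ℝ) * φ (0, e y) else 0

end WaveOperator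

/-! ### The distributions `E_ν(t, d_g(x, y))` -/

/-- The function `E_μ(t, d) = 2^{-2μ-1} π^{-(m-1)/2} (t² - d²)_+^a / Γ(a + 1)`, `a = μ - (m-1)/2`,
for `t > 0`, and `0` for `t ≤ 0`. It is used below only for `a > 0`, where it is continuous. -/
def waveFun (m μ : ℕ) (t : ℝ) (d : ℝ≥0∞) : ℝ :=
  if d < ENNReal.ofReal t then
    (2 : ℝ) ^ (-(2 * (μ : ℝ) + 1)) * Real.pi ^ (-(((m : ℝ) - 1) / 2))
      * (t ^ 2 - d.toReal ^ 2) ^ ((μ : ℝ) - ((m : ℝ) - 1) / 2)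
      / Real.Gamma ((μ : ℝ) - ((m : ℝ) - 1) / 2 + 1)
  else 0

/-- The transpose `φ ↦ -∂_t (2 φ / t)` of `(2/t) ∂_t`. -/
def lowerTranspose {m : ℕ} (φ : ℝ × Euc m → ℂ) : ℝ × Euc m → ℂ :=
  fun p => -deriv (fun s : ℝ => 2 * φ (s, p.2) / (s : ℂ)) p.1

section Hadamard

variable {m : ℕ} {M : Type*} [EMetricSpace M] [ChartedSpace (Euc m) M]

/-- The integrand of the pairing of `E_ν(t, d_g(·, y))` with `φ`. -/
def waveIntegrand (ν : ℕ) (e : OpenPartialHomeomorph M (Euc m)) (y : M) (φ : ℝ × Euc m → ℂ)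
    (p : ℝ × Euc m) : ℂ :=
  (waveFun m (ν + m) p.1 (edist (e.symm p.2) y) : ℂ) * (lowerTranspose^[m] φ) p

/-- The distribution `E_ν(t, d_g(x, y))`, in the chart `e`, for all `ν ≥ 0`. The exponent
`ν - (m-1)/2` of `t² - d²` may be `≤ -1`; then `(t² - d²)_+^a / Γ(a + 1)` means, as always, the
`k`-th derivative with respect to `s = t² - d²` of the same expression with `a + k` for `a`. As
`∂_s = (1/2t) ∂_t`, this is the relation `2 ∂_t E_{ν+1} = t E_ν`, that is
`E_ν = ((2/t) ∂_t)^k E_{ν+k}`, and `k = m` is used; the integral converges absolutely up to `t = 0`,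
since the ball of radius `t` about `y` has volume `O(t^m)`. -/
def waveDist (ν : ℕ) (e : OpenPartialHomeomorph M (Euc m)) (y : M) : Functional m :=
  fun φ => ∫ p : ℝ × Euc m, waveIntegrand ν e y φ p

variable [RiemannianBundle (fun x : M => TangentSpace (𝓡 m) x)]

/-- The function `d_g(·, y)²` in the chart `e`. -/
def sqDist (e : OpenPartialHomeomorph M (Euc m)) (y : M) (u : Euc m) : ℂ :=
  (((edist (e.symm u) y).toReal ^ 2 : ℝ) : ℂ)

/-- The derivative `2 ⟨x, ∇_x f⟩` along the geodesics issuing from `y`, where `x` are geodesic normal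
coordinates centred at `y`; invariantly, `⟨∇_g d_g(·, y)², ∇_g f⟩_g`. -/
def radialDeriv (e : OpenPartialHomeomorph M (Euc m)) (y : M) (f : Euc m → ℂ) (u : Euc m) : ℂ :=
  ∑ k, gradient e (sqDist e y) k u * pd k f u

/-- The coefficient `ρ = m - ½ Δ_g d_g(·, y)² + i ⟨A, ∇_g d_g(·, y)²⟩_g` of the transport equations.
In geodesic normal coordinates `x = rω` centred at `y` it is
`-r ∂_r log |g|^{1/2} + 2 i ∑_k A_k x_k`. -/
def transportCoeff (e : OpenPartialHomeomorph M (Euc m)) (A : (x : M) → TangentSpace (𝓡 m) x)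
    (y : M) (u : Euc m) : ℂ :=
  (m : ℂ) - laplaceBeltrami e (sqDist e y) u / 2
    + Complex.I * ∑ k, (vecCoord e A u k : ℂ) * pd k (sqDist e y) u

end Hadamard

end HadamardParametrix

end

open scoped Topology

noncomputable section

namespace HadamardParametrix

set_option linter.unusedSectionVars false
set_option maxSynthPendingDepth 3

/-! ### Superposition operators on spaces of continuous functions -/

section Superposition

variable {K : Type} [TopologicalSpace K] [CompactSpace K]
  {E F : Type} [NormedAddCommGroup E] [NormedSpace ℝ E] [NormedAddCommGroup F] [NormedSpace ℝ F]

/-! Write σ = d(·, y)². The functions E_ν(t, d) depend on t² - σ only, and the relation 2∂_t E_{ν+1}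
= t E_ν, the homogeneity of E_ν and the eikonal equation ⟨∇σ, ∇σ⟩ = 4σ give formally (∂_t² +
Q)(αE_ν) = (Qα)E_ν + E_{ν-1}(να + (-ρα + ⟨∇σ, ∇α⟩)/2). The transport equations say exactly that the
sum of these expressions telescopes to (Qα_N)E_N, and the point source is what the singularity at t
= 0 contributes.

Geometry. Smoothness of σ near the diagonal comes from geodesics with prescribed endpoints. The
unknown is the acceleration a in the Banach space C([0,1], E): with the endpoints fixed, a
determines the curve c, and the geodesic equation is a + Γ(c, c') = 0. As Γ is quadratic in the
velocity, the linearization at a constant curve is the identity, so the implicit function theorem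
yields a family depending smoothly on both endpoints (`exists_isGeodesicFamily`). The first
variation of energy (`fderiv_sqLength`) identifies ∇σ with twice the final velocity; with
Cauchy-Schwarz it shows that these geodesics are shorter than any competing curve, so that the
squared speed is the squared Riemannian distance (`exists_isMinimizingFamily`).

Transport. The operator ⟨∇σ, ∇·⟩ is twice the derivative along the final velocity, and the geodesics
from y to the intermediate points are rescaled pieces of the same geodesic. Hence α_0 = exp(½∫₀¹ρ
ds/s) and α_{ν+1} = α_0∫₀¹ s^ν(-Qα_ν/α_0) ds. Since ρ vanishes on the diagonal, integration by parts
replaces 1/s by the integrable weight log s, and both formulas are visibly smooth. The equations are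
linear and differentiate in x only, so local solutions may be averaged with weights depending on y;
this produces coefficients on M × Ω (`exists_coefficients`).

Distributions. E_ν is by definition k-fold transposed onto the test function, in terms of E_{ν+k}.
The value of k is immaterial (`integral_waveFun_shift`), and for k = m + 2 the function of x is C²
at each t > 0: Q may be applied pointwise, and only the integration by parts in time leaves a
boundary term. The derivative of that term (`hasDerivAt_timeFlux`) together with the telescoping sum
(`IsMinimizingFamily.sum_waveOp`) reduces the identity to a limit as t → 0. Rescaling x = y + tz
turns the limit into an integral over ℝ^m of a profile of the metric at y: it gives
|g(y)|^{-1/2}φ(0, y) for ν = 0 and zero for ν > 0 (`IsMinimizingFamily.tendsto_timeFlux`). -/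

open Classical in
/-- The superposition operator `f ↦ Φ ∘ f`, with the value `0` if `Φ ∘ f` is not continuous. -/
def superpose (Φ : E → F) (f : C(K, E)) : C(K, F) :=
  if h : Continuous (Φ ∘ f) then ⟨Φ ∘ f, h⟩ else 0

/-- The continuous functions with values in `U`. -/
def valuedIn (K : Type) [TopologicalSpace K] (U : Set E) : Set C(K, E) := {f | ∀ s, f s ∈ U}


lemma isOpen_valuedIn {U : Set E} (hU : IsOpen U) : IsOpen (valuedIn K U) := by
  have := ContinuousMap.isOpen_setOfPred_mapsTo (X := K) (isCompact_univ) hU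
  convert this using 1
  ext f; simp [valuedIn, MapsTo]

lemma superpose_apply {Φ : E → F} {U : Set E} (hΦ : ContinuousOn Φ U) {f : C(K, E)}
    (hf : f ∈ valuedIn K U) (s : K) : superpose Φ f s = Φ (f s) := by
  have h : Continuous (Φ ∘ f) := hΦ.comp_continuous f.continuous hf
  rw [superpose, dif_pos h]; rfl

lemma continuousOn_superpose {Φ : E → F} {U : Set E} (hΦ : ContinuousOn Φ U) :
    ContinuousOn (superpose (K := K) Φ) (valuedIn K U) := by
  rw [continuousOn_iff_continuous_domRestrict]
  refine ContinuousMap.continuous_of_continuous_uncurry _ ?_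
  have : (Function.uncurry fun (x : valuedIn K U) (y : K) =>
      ((valuedIn K U).domRestrict (superpose Φ) x) y)
      = fun p : valuedIn K U × K => Φ (p.1.1 p.2) := by
    ext p
    exact superpose_apply hΦ p.1.2 p.2
  rw [this]
  refine hΦ.comp_continuous ?_ (fun p => p.1.2 p.2)
  fun_prop

/-- Pointwise application of a continuous family of linear maps. -/
def pointwiseApply : C(K, E →L[ℝ] F) →L[ℝ] C(K, E) →L[ℝ] C(K, F) :=
  LinearMap.mkContinuous₂
    (LinearMap.mk₂ ℝ (fun (a : C(K, E →L[ℝ] F)) (h : C(K, E)) =>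
      (⟨fun s => a s (h s), by fun_prop⟩ : C(K, F)))
      (by intros; ext; simp) (by intros; ext; simp) (by intros; ext; simp)
      (by intros; ext; simp)) 1 (by
    intro a h
    rw [ContinuousMap.norm_le _ (by positivity)]
    intro s
    rw [one_mul]
    refine ((a s).le_opNorm _).trans ?_
    gcongr
    · exact a.norm_coe_le_norm s
    · exact h.norm_coe_le_norm s)

@[simp] lemma pointwiseApply_apply (a : C(K, E →L[ℝ] F)) (h : C(K, E)) (s : K) :
    pointwiseApply a h s = a s (h s) := rfl

/-- The mean value inequality is applied at each s to Φ on the segment from f s to f s + h s. The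
bound is uniform in s because superposition with `fderiv ℝ Φ` is continuous in the sup norm. -/
lemma hasFDerivAt_superpose {Φ : E → F} {U : Set E} (hU : IsOpen U)
    (hΦ : ∀ x ∈ U, DifferentiableAt ℝ Φ x) (hΦ' : ContinuousOn (fderiv ℝ Φ) U) {f : C(K, E)}
    (hf : f ∈ valuedIn K U) :
    HasFDerivAt (superpose Φ) (pointwiseApply (superpose (fderiv ℝ Φ) f)) f := by
  have hc : ContinuousOn Φ U := fun x hx => (hΦ x hx).continuousAt.continuousWithinAt
  rw [hasFDerivAt_iff_isLittleO_nhds_zero, Asymptotics.isLittleO_iff]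
  intro ε hε
  have h1 : ∀ᶠ g in 𝓝 f, g ∈ valuedIn K U ∧
      dist (superpose (fderiv ℝ Φ) g) (superpose (fderiv ℝ Φ) f) < ε := by
    have h2 := (continuousOn_superpose (K := K) hΦ').continuousAt
      ((isOpen_valuedIn hU).mem_nhds hf)
    exact ((isOpen_valuedIn hU).eventually_mem hf).and (h2 (Metric.ball_mem_nhds _ hε))
  obtain ⟨r, hr, h2⟩ := Metric.eventually_nhds_iff.1 h1
  filter_upwards [Metric.ball_mem_nhds (0 : C(K, E)) hr] with h hh
  rw [mem_ball_zero_iff] at hh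
  rw [ContinuousMap.norm_le _ (by positivity)]
  intro s
  have hseg : ∀ z ∈ segment ℝ (f s) (f s + h s), z ∈ U ∧
      ‖fderiv ℝ Φ z - fderiv ℝ Φ (f s)‖ ≤ ε := by
    intro z hz
    rw [segment_eq_image'] at hz
    obtain ⟨τ, hτ, rfl⟩ := hz
    -- Each point of the segment is the value at s of the curve f + τh, which is within r of f in
    -- the sup norm.
    have h3 := @h2 (f + τ • h) (by
      rw [dist_eq_norm, add_sub_cancel_left, norm_smul, Real.norm_eq_abs, abs_of_nonneg hτ.1]
      exact (mul_le_of_le_one_left (norm_nonneg _) hτ.2).trans_lt hh)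
    have h4 : f s + τ • (f s + h s - f s) = (f + τ • h) s := by simp
    simp only [h4]
    refine ⟨h3.1 s, ?_⟩
    rw [← superpose_apply hΦ' h3.1, ← superpose_apply hΦ' hf, ← dist_eq_norm]
    exact (ContinuousMap.dist_apply_le_dist s).trans h3.2.le
  have h5 := (convex_segment (𝕜 := ℝ) (f s) (f s + h s)).norm_image_sub_le_of_norm_hasFDerivWithin_le'
    (f := Φ) (f' := fderiv ℝ Φ) (φ := fderiv ℝ Φ (f s)) (C := ε)
    (fun z hz => (hΦ z (hseg z hz).1).hasFDerivAt.hasFDerivWithinAt) (fun z hz => (hseg z hz).2)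
    (left_mem_segment _ _ _) (right_mem_segment _ _ _)
  have hfh : f + h ∈ valuedIn K U := (@h2 (f + h) (by simpa [dist_eq_norm] using hh)).1
  simp only [ContinuousMap.sub_apply, pointwiseApply_apply, superpose_apply hc hf,
    superpose_apply hc hfh, superpose_apply hΦ' hf, ContinuousMap.add_apply]
  simp only [add_sub_cancel_left] at h5
  exact h5.trans (mul_le_mul_of_nonneg_left (h.norm_coe_le_norm s) hε.le)

/-- Induction through the derivative, which is a bounded bilinear map applied to the superposition
operator of `fderiv ℝ Φ`. The target space is quantified inside since it changes to E →L[ℝ] F at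
each step. -/
lemma contDiffOn_superpose_nat (n : ℕ) : ∀ {F : Type} [NormedAddCommGroup F] [NormedSpace ℝ F]
    {Φ : E → F} {U : Set E}, IsOpen U → ContDiffOn ℝ n Φ U →
    ContDiffOn ℝ n (superpose (K := K) Φ) (valuedIn K U) := by
  induction n with
  | zero =>
    intro F _ _ Φ U hU hΦ
    simp only [CharP.cast_eq_zero, contDiffOn_zero] at hΦ ⊢
    exact continuousOn_superpose hΦ
  | succ n ih =>
    intro F _ _ Φ U hU hΦ
    have h1 := (contDiffOn_succ_iff_fderiv_of_isOpen (n := (n : WithTop ℕ∞)) hU).1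
      (by exact_mod_cast hΦ)
    have hd : ∀ x ∈ U, DifferentiableAt ℝ Φ x := fun x hx =>
      (h1.1 x hx).differentiableAt (hU.mem_nhds hx)
    have hD : ∀ f ∈ valuedIn K U, HasFDerivAt (superpose Φ)
        (pointwiseApply (superpose (fderiv ℝ Φ) f)) f := fun f hf =>
      hasFDerivAt_superpose hU hd h1.2.2.continuousOn hf
    have h2 : ContDiffOn ℝ ((n : WithTop ℕ∞) + 1) (superpose (K := K) Φ) (valuedIn K U) := by
      rw [contDiffOn_succ_iff_fderiv_of_isOpen (isOpen_valuedIn hU)]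
      refine ⟨fun f hf => (hD f hf).differentiableAt.differentiableWithinAt, by simp, ?_⟩
      refine ContDiffOn.congr (f := fun f => pointwiseApply (superpose (fderiv ℝ Φ) f)) ?_
        (fun f hf => (hD f hf).fderiv)
      exact (pointwiseApply (K := K) (E := E) (F := F)).contDiff.comp_contDiffOn (ih hU h1.2.2)
    exact_mod_cast h2

lemma contDiffOn_superpose {Φ : E → F} {U : Set E} (hU : IsOpen U) (hΦ : ContDiffOn ℝ ∞ Φ U) :
    ContDiffOn ℝ ∞ (superpose (K := K) Φ) (valuedIn K U) := by
  rw [contDiffOn_infty]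
  exact fun n => contDiffOn_superpose_nat n hU (hΦ.of_le (by exact_mod_cast le_top))

end Superposition

/-! ### A smooth implicit function theorem -/

/-- The inverse function theorem for (z, a) ↦ (z, R(z, a)), whose derivative is unipotent
triangular. Uniqueness within an explicit radius ε is kept, as it is what later identifies constant
and rescaled geodesics with members of the solution family. -/
lemma exists_contDiffOn_implicit {Z X : Type} [NormedAddCommGroup Z] [NormedSpace ℝ Z]
    [CompleteSpace Z] [NormedAddCommGroup X] [NormedSpace ℝ X] [CompleteSpace X]
    {R : Z × X → X} {D : Set (Z × X)} (hD : IsOpen D) (hR : ContDiffOn ℝ ∞ R D) {z₀ : Z} {a₀ : X}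
    (h₀ : (z₀, a₀) ∈ D) (hR₀ : R (z₀, a₀) = 0)
    (hR' : ∀ a, fderiv ℝ R (z₀, a₀) (0, a) = a) :
    ∃ (N : Set Z) (ε : ℝ) (sol : Z → X), IsOpen N ∧ z₀ ∈ N ∧ 0 < ε ∧ ContDiffOn ℝ ∞ sol N ∧
      (∀ z ∈ N, (z, sol z) ∈ D ∧ R (z, sol z) = 0 ∧ ‖sol z - a₀‖ < ε) ∧
      ∀ z ∈ N, ∀ a, ‖a - a₀‖ < ε → (z, a) ∈ D → R (z, a) = 0 → a = sol z := by
  set Ψ : Z × X → Z × X := fun q => (q.1, R q) with hΨ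
  have hΨs : ContDiffOn ℝ ∞ Ψ D := contDiffOn_fst.prodMk hR
  have hcd : ∀ q ∈ D, ContDiffAt ℝ ∞ Ψ q := fun q hq => hΨs.contDiffAt (hD.mem_nhds hq)
  have hRd : HasFDerivAt R (fderiv ℝ R (z₀, a₀)) (z₀, a₀) :=
    ((hR.contDiffAt (hD.mem_nhds h₀)).differentiableAt (by simp)).hasFDerivAt
  set R' := fderiv ℝ R (z₀, a₀) with hR'd
  have hsplit : ∀ z a, R' (z, a) = R' (z, 0) + a := by
    intro z a
    have : ((z, a) : Z × X) = (z, 0) + (0, a) := by simp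
    rw [this, map_add, hR' a]
  let Φ : (Z × X) ≃L[ℝ] (Z × X) := ContinuousLinearEquiv.equivOfInverse
    ((ContinuousLinearMap.fst ℝ Z X).prod R')
    ((ContinuousLinearMap.fst ℝ Z X).prod
      (ContinuousLinearMap.snd ℝ Z X - R'.comp ((ContinuousLinearMap.inl ℝ Z X).comp
        (ContinuousLinearMap.fst ℝ Z X))))
    (by
      rintro ⟨z, a⟩
      simp [hsplit z a])
    (by
      rintro ⟨z, a⟩
      simp [hsplit z (a - R' (z, 0))])
  have hΨ' : HasFDerivAt Ψ (Φ : (Z × X) →L[ℝ] (Z × X)) (z₀, a₀) := hasFDerivAt_fst.prodMk hRd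
  have hn : (∞ : WithTop ℕ∞) ≠ 0 := by simp
  let T := (hcd _ h₀).toOpenPartialHomeomorph Ψ hΨ' hn
  have hT : ∀ q, T q = Ψ q := fun q => rfl
  have hsrc : (z₀, a₀) ∈ T.source := (hcd _ h₀).mem_toOpenPartialHomeomorph_source hΨ' hn
  have hT0 : T (z₀, a₀) = (z₀, 0) := by rw [hT]; simp [hΨ, hR₀]
  have hTs0 : T.symm (z₀, 0) = (z₀, a₀) := by rw [← hT0, T.left_inv hsrc]
  -- Smoothness of the local inverse at a point requires an invertible derivative there. Invertible
  -- maps form an open set, so this holds near the base point and gives smoothness on a whole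
  -- neighbourhood.
  have hinv : ∀ᶠ q in 𝓝 (z₀, a₀), fderiv ℝ Ψ q ∈ range
      (fun e : (Z × X) ≃L[ℝ] (Z × X) => (e : (Z × X) →L[ℝ] (Z × X))) := by
    have hc : ContinuousAt (fderiv ℝ Ψ) (z₀, a₀) :=
      ((hcd _ h₀).fderiv_right (m := 0) (by simp)).continuousAt
    refine hc.eventually_mem ?_
    rw [hΨ'.fderiv]
    exact ContinuousLinearEquiv.nhds Φ
  have hW : ∀ᶠ q in 𝓝 (z₀, a₀), q ∈ T.source ∧ q ∈ D ∧ fderiv ℝ Ψ q ∈ range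
      (fun e : (Z × X) ≃L[ℝ] (Z × X) => (e : (Z × X) →L[ℝ] (Z × X))) :=
    (T.open_source.eventually_mem hsrc).and ((hD.eventually_mem h₀).and hinv)
  obtain ⟨ε, hε, hball⟩ := Metric.eventually_nhds_iff_ball.1 hW
  have htgt : ((z₀, 0) : Z × X) ∈ T.target := hT0 ▸ T.map_source hsrc
  have hcs : ContinuousAt (fun z : Z => T.symm (z, 0)) z₀ := by
    have h1 : ContinuousAt T.symm (z₀, 0) := T.continuousAt_symm htgt
    exact ContinuousAt.comp (g := T.symm) (f := fun z : Z => ((z, 0) : Z × X)) h1 (by fun_prop)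
  have hev : ∀ᶠ z in 𝓝 z₀, (z, (0 : X)) ∈ T.target ∧
      T.symm (z, 0) ∈ Metric.ball (z₀, a₀) ε ∧ z ∈ Metric.ball z₀ ε := by
    refine ((ContinuousAt.eventually_mem (f := fun z : Z => ((z, 0) : Z × X)) (by fun_prop)
      (T.open_target.mem_nhds htgt))).and ((hcs.eventually_mem ?_).and
        (Metric.ball_mem_nhds _ hε))
    rw [hTs0]; exact Metric.ball_mem_nhds _ hε
  obtain ⟨N, hN, hNo, hzN⟩ := eventually_nhds_iff.1 hev
  have hfst : ∀ z ∈ N, T.symm (z, 0) = (z, (T.symm (z, 0)).2) ∧ R (T.symm (z, 0)) = 0 := by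
    intro z hz
    have h1 : Ψ (T.symm (z, 0)) = (z, 0) := T.right_inv (hN z hz).1
    rw [hΨ, Prod.ext_iff] at h1
    exact ⟨Prod.ext h1.1 rfl, h1.2⟩
  refine ⟨N, ε, fun z => (T.symm (z, 0)).2, hNo, hzN, hε, ?_, ?_, ?_⟩
  · intro z hz
    obtain ⟨-, hd, e, he⟩ := hball _ (hN z hz).2.1
    have h1 : ContDiffAt ℝ ∞ T.symm (z, 0) := by
      refine T.contDiffAt_symm (hN z hz).1 (f₀' := e) ?_ (hcd _ hd)
      simp only at he
      rw [he]
      exact ((hcd _ hd).differentiableAt hn).hasFDerivAt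
    have h2 : ContDiffAt ℝ ∞ (fun z : Z => T.symm (z, 0)) z :=
      ContDiffAt.comp (g := T.symm) (f := fun z : Z => ((z, 0) : Z × X)) z h1 (by fun_prop)
    exact h2.snd.contDiffWithinAt
  · intro z hz
    have h1 := hball _ (hN z hz).2.1
    refine ⟨?_, ?_, ?_⟩
    · rw [← (hfst z hz).1]; exact h1.2.1
    · rw [← (hfst z hz).1]; exact (hfst z hz).2
    · have := (hN z hz).2.1
      rw [mem_ball_iff_norm] at this
      exact (norm_snd_le (T.symm (z, 0) - (z₀, a₀))).trans_lt this
  · intro z hz a ha hd h0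
    have h1 : (z, a) ∈ Metric.ball (z₀, a₀) ε := by
      rw [← ball_prod_same]; exact ⟨(hN z hz).2.2, by simpa [dist_eq_norm] using ha⟩
    have h2 := T.left_inv (hball _ h1).1
    have h3 : T (z, a) = (z, 0) := by rw [hT]; simp [hΨ, h0]
    rw [h3] at h2
    simp [h2]

/-! ### Primitives of curves on the unit interval -/

section Curves

variable {E : Type} [NormedAddCommGroup E] [NormedSpace ℝ E]

/-- The extension of a curve on `[0, 1]` to the real line, constant outside `[0, 1]`. -/
def extendCurve (a : C(unitInterval, E)) (t : ℝ) : E := a (projIcc 0 1 zero_le_one t)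

lemma continuous_extendCurve (a : C(unitInterval, E)) : Continuous (extendCurve a) :=
  a.continuous.comp continuous_projIcc

lemma extendCurve_coe (a : C(unitInterval, E)) (s : unitInterval) : extendCurve a s = a s := by
  simp [extendCurve]

lemma extendCurve_of_mem (a : C(unitInterval, E)) {t : ℝ} (ht : t ∈ Icc (0 : ℝ) 1) :
    extendCurve a t = a ⟨t, ht⟩ := by
  rw [extendCurve, projIcc_of_mem]

/-- The primitive of a curve, vanishing at `0`. -/
def primitiveFun (a : C(unitInterval, E)) (t : ℝ) : E := ∫ τ in (0 : ℝ)..t, extendCurve a τ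

variable [CompleteSpace E]

lemma hasDerivAt_primitiveFun (a : C(unitInterval, E)) (t : ℝ) :
    HasDerivAt (primitiveFun a) (extendCurve a t) t :=
  (continuous_extendCurve a).integral_hasStrictDerivAt 0 t |>.hasDerivAt

/-- The operator taking a curve to its primitive. -/
def primitive : C(unitInterval, E) →L[ℝ] C(unitInterval, E) :=
  LinearMap.mkContinuous
    { toFun := fun a => ⟨fun s => primitiveFun a s, by
        have : Continuous (primitiveFun a) :=
          continuous_iff_continuousAt.2 fun t => (hasDerivAt_primitiveFun a t).continuousAt
        exact this.comp continuous_subtype_val⟩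
      map_add' := by
        intro a b
        ext s
        simp only [primitiveFun, ContinuousMap.coe_mk, ContinuousMap.add_apply]
        rw [← intervalIntegral.integral_add ((continuous_extendCurve a).intervalIntegrable _ _)
          ((continuous_extendCurve b).intervalIntegrable _ _)]
        rfl
      map_smul' := by
        intro c a
        ext s
        simp only [primitiveFun, ContinuousMap.coe_mk, ContinuousMap.smul_apply, RingHom.id_apply]
        rw [← intervalIntegral.integral_smul]
        rfl } 1 (by
    intro a
    rw [ContinuousMap.norm_le _ (by positivity)]
    intro s
    have h := intervalIntegral.norm_integral_le_of_norm_le_const (a := (0 : ℝ)) (b := s)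
      (f := extendCurve a) (C := ‖a‖) (fun x _ => a.norm_coe_le_norm _)
    refine h.trans ?_
    rw [sub_zero, abs_of_nonneg s.2.1, one_mul]
    exact mul_le_of_le_one_right (norm_nonneg _) s.2.2)

lemma primitive_apply (a : C(unitInterval, E)) (s : unitInterval) :
    primitive a s = primitiveFun a s := rfl

/-- The constant curves. -/
def constCurve : E →L[ℝ] C(unitInterval, E) :=
  LinearMap.mkContinuous
    { toFun := fun v => ContinuousMap.const _ v
      map_add' := by intros; rfl
      map_smul' := by intros; rfl } 1 (by
    intro v
    rw [ContinuousMap.norm_le _ (by positivity), one_mul]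
    intro s
    exact le_rfl)

@[simp] lemma constCurve_apply (v : E) (s : unitInterval) : constCurve v s = v := rfl

/-- Evaluation of curves at a point. -/
def evalCurve (s : unitInterval) : C(unitInterval, E) →L[ℝ] E := ContinuousMap.evalCLM ℝ s

@[simp] lemma evalCurve_apply (s : unitInterval) (a : C(unitInterval, E)) :
    evalCurve s a = a s := rfl

/-- The curve in `E × E` with two given components. -/
def pairCurve : C(unitInterval, E) × C(unitInterval, E) →L[ℝ] C(unitInterval, E × E) :=
  LinearMap.mkContinuous
    { toFun := fun q => q.1.prodMk q.2
      map_add' := by intros; rfl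
      map_smul' := by intros; rfl } 1 (by
    intro q
    rw [ContinuousMap.norm_le _ (by positivity)]
    intro s
    rw [one_mul]
    exact max_le_max (q.1.norm_coe_le_norm s) (q.2.norm_coe_le_norm s))

@[simp] lemma pairCurve_apply (q : C(unitInterval, E) × C(unitInterval, E)) (s : unitInterval) :
    pairCurve q s = (q.1 s, q.2 s) := rfl

/-- The velocity of the curve from `z.2` to `z.1` with acceleration `a`. -/
def velocityCurve : ((E × E) × C(unitInterval, E)) →L[ℝ] C(unitInterval, E) :=
  constCurve.comp
    ((ContinuousLinearMap.fst ℝ E E - ContinuousLinearMap.snd ℝ E E).comp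
        (ContinuousLinearMap.fst ℝ (E × E) _)
      - (evalCurve 1).comp (primitive.comp (primitive.comp
        (ContinuousLinearMap.snd ℝ (E × E) _))))
    + primitive.comp (ContinuousLinearMap.snd ℝ (E × E) _)

/-- The curve from `z.2` to `z.1` with acceleration `a`. -/
def positionCurve : ((E × E) × C(unitInterval, E)) →L[ℝ] C(unitInterval, E) :=
  constCurve.comp ((ContinuousLinearMap.snd ℝ E E).comp (ContinuousLinearMap.fst ℝ (E × E) _))
    + primitive.comp velocityCurve

lemma primitiveFun_constCurve (v : E) (t : ℝ) : primitiveFun (constCurve v) t = t • v := by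
  simp [primitiveFun, extendCurve]

/-- The initial velocity is z.1 - z.2 minus the double primitive of the acceleration at time 1, the
one choice for which the curve ends at z.1. -/
lemma velocityCurve_apply (z : E × E) (a : C(unitInterval, E)) (s : unitInterval) :
    velocityCurve (z, a) s = z.1 - z.2 - primitiveFun (primitive a) 1 + primitiveFun a s := by
  simp [velocityCurve, primitive_apply]

lemma positionCurve_apply (z : E × E) (a : C(unitInterval, E)) (s : unitInterval) :
    positionCurve (z, a) s = z.2 + primitiveFun (velocityCurve (z, a)) s := by
  simp [positionCurve, primitive_apply]

lemma positionCurve_apply' (z : E × E) (a : C(unitInterval, E)) (s : unitInterval) :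
    positionCurve (z, a) s = z.2 + (s : ℝ) • (z.1 - z.2 - primitiveFun (primitive a) 1)
      + primitiveFun (primitive a) s := by
  have h : velocityCurve (z, a)
      = constCurve (z.1 - z.2 - primitiveFun (primitive a) 1) + primitive a := by
    ext s; rw [velocityCurve_apply]; rfl
  rw [positionCurve_apply, h, ← primitive_apply, map_add, ContinuousMap.add_apply, primitive_apply,
    primitive_apply, primitiveFun_constCurve, add_assoc]

@[simp] lemma positionCurve_zero (z : E × E) (a : C(unitInterval, E)) :
    positionCurve (z, a) 0 = z.2 := by
  rw [positionCurve_apply]; simp [primitiveFun]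

@[simp] lemma positionCurve_one (z : E × E) (a : C(unitInterval, E)) :
    positionCurve (z, a) 1 = z.1 := by
  rw [positionCurve_apply']; simp; abel

end Curves

/-! ### Geodesics with given endpoints -/

section Geodesics

variable {E : Type} [NormedAddCommGroup E] [NormedSpace ℝ E]

lemma integral_extendCurve_deriv [CompleteSpace E] {f : ℝ → E} {a : C(unitInterval, E)}
    (h : ∀ t ∈ Icc (0 : ℝ) 1, HasDerivAt f (extendCurve a t) t) {t : ℝ} (ht : t ∈ Icc (0 : ℝ) 1) :
    primitiveFun a t = f t - f 0 := by
  refine intervalIntegral.integral_eq_sub_of_hasDerivAt ?_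
    ((continuous_extendCurve a).intervalIntegrable _ _)
  intro x hx
  rw [uIcc_of_le ht.1] at hx
  exact h x ⟨hx.1, hx.2.trans ht.2⟩

/-- Two integrations recover a curve from its endpoints and its second derivative. Constant and
rescaled curves are recognized in this way. -/
lemma curve_eq_of_hasDerivAt [CompleteSpace E] {c b : ℝ → E} {a : C(unitInterval, E)}
    (hc : ∀ t ∈ Icc (0 : ℝ) 1, HasDerivAt c (b t) t)
    (hb : ∀ t ∈ Icc (0 : ℝ) 1, HasDerivAt b (extendCurve a t) t) (s : unitInterval) :
    velocityCurve ((c 1, c 0), a) s = b s ∧ positionCurve ((c 1, c 0), a) s = c s := by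
  have hb' : ∀ t ∈ Icc (0 : ℝ) 1, b t = b 0 + primitiveFun a t := fun t ht => by
    rw [integral_extendCurve_deriv hb ht]; abel
  have hc' : ∀ t ∈ Icc (0 : ℝ) 1, c t = c 0 + t • b 0 + primitiveFun (primitive a) t := by
    intro t ht
    have h1 : ∀ t ∈ Icc (0 : ℝ) 1, HasDerivAt (fun t => c t - t • b 0)
        (extendCurve (primitive a) t) t := by
      intro t ht
      have h2 := (hc t ht).sub ((hasDerivAt_id t).smul_const (b 0))
      rw [extendCurve_of_mem _ ht, primitive_apply]
      refine h2.congr_deriv ?_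
      change _ = primitiveFun a t
      rw [hb' t ht]; simp
    rw [integral_extendCurve_deriv h1 ht]; simp; abel
  have h0 : b 0 = c 1 - c 0 - primitiveFun (primitive a) 1 := by
    rw [hc' 1 (by simp)]; simp; abel
  constructor
  · rw [velocityCurve_apply, hb' s s.2, h0]
  · rw [positionCurve_apply', hc' s s.2, h0]

/-- The rescaled acceleration `s ↦ r² a (r s)`. -/
def rescale (r : unitInterval) (a : C(unitInterval, E)) : C(unitInterval, E) :=
  ⟨fun s => (r : ℝ) ^ 2 • a (r * s), by fun_prop⟩

lemma norm_rescale_le (r : unitInterval) (a : C(unitInterval, E)) : ‖rescale r a‖ ≤ ‖a‖ := by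
  rw [ContinuousMap.norm_le _ (norm_nonneg _)]
  intro s
  change ‖(r : ℝ) ^ 2 • a (r * s)‖ ≤ _
  rw [norm_smul, Real.norm_eq_abs, abs_of_nonneg (by positivity)]
  exact (mul_le_of_le_one_left (norm_nonneg _) (pow_le_one₀ r.2.1 r.2.2)).trans
    (a.norm_coe_le_norm _)

/-- The curve t ↦ c(rt) goes from z.2 to c(r), with velocity r c'(rt) and acceleration r² a(rt);
these data determine it. -/
lemma curve_rescale [CompleteSpace E] (z : E × E) (a : C(unitInterval, E)) (r s : unitInterval) :
    velocityCurve ((positionCurve (z, a) r, z.2), rescale r a) s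
        = (r : ℝ) • velocityCurve (z, a) (r * s) ∧
      positionCurve ((positionCurve (z, a) r, z.2), rescale r a) s
        = positionCurve (z, a) (r * s) := by
  set v : ℝ → E := fun t => z.1 - z.2 - primitiveFun (primitive a) 1 + primitiveFun a t
  set c : ℝ → E := fun t => z.2 + primitiveFun (velocityCurve (z, a)) t
  have hmem : ∀ t ∈ Icc (0 : ℝ) 1, (r : ℝ) * t ∈ Icc (0 : ℝ) 1 := fun t ht =>
    (r * (⟨t, ht⟩ : unitInterval)).2
  have hc : ∀ t ∈ Icc (0 : ℝ) 1, HasDerivAt c (v t) t := by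
    intro t ht
    have h := (hasDerivAt_primitiveFun (velocityCurve (z, a)) t).const_add z.2
    rw [extendCurve_of_mem _ ht, velocityCurve_apply] at h
    exact h
  have hv : ∀ t, HasDerivAt v (extendCurve a t) t := fun t =>
    (hasDerivAt_primitiveFun a t).const_add _
  have h := curve_eq_of_hasDerivAt (c := fun t => c (r * t)) (b := fun t => (r : ℝ) • v (r * t))
    (a := rescale r a) (fun t ht => by
      have := (hc _ (hmem t ht)).scomp t ((hasDerivAt_id t).const_mul (r : ℝ))
      simpa [Function.comp_def] using this)
    (fun t ht => by
      have := ((hv (r * t)).scomp t ((hasDerivAt_id t).const_mul (r : ℝ))).const_smul (r : ℝ)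
      rw [extendCurve_of_mem _ (hmem t ht)] at this
      rw [extendCurve_of_mem _ ht]
      refine this.congr_deriv ?_
      simp only [rescale, ContinuousMap.coe_mk, smul_smul, sq, mul_one]
      rfl) s
  have h0 : c (r * 0) = z.2 := by simp [c, primitiveFun]
  have h1 : c (r * 1) = positionCurve (z, a) r := by rw [mul_one, positionCurve_apply]
  beta_reduce at h
  rw [h0, h1] at h
  refine ⟨h.1.trans ?_, h.2.trans ?_⟩
  · rw [velocityCurve_apply]; rfl
  · rw [positionCurve_apply]; rfl

/-- Along (w, 0) the function is constantly zero, and along (0, v) it is t² times a constant, so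
both kinds of directional derivative vanish. -/
lemma fderiv_eq_zero_of_quadratic {F : Type} [NormedAddCommGroup F] [NormedSpace ℝ F]
    {Γ : E × E → F} (hq : ∀ (u v : E) (r : ℝ), Γ (u, r • v) = r ^ 2 • Γ (u, v)) {u : E}
    (hd : DifferentiableAt ℝ Γ (u, 0)) : fderiv ℝ Γ (u, 0) = 0 := by
  have h0 : ∀ w : E, Γ (w, 0) = 0 := fun w => by simpa using hq w 0 0
  refine ContinuousLinearMap.ext fun ⟨w, v⟩ => ?_
  have h1 : fderiv ℝ Γ (u, 0) (w, 0) = 0 := by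
    have h := (hd.hasFDerivAt.hasLineDerivAt (w, 0)).lineDeriv
    rw [← h, lineDeriv]
    simp [h0]
  have h2 : fderiv ℝ Γ (u, 0) (0, v) = 0 := by
    have h := (hd.hasFDerivAt.hasLineDerivAt (0, v)).lineDeriv
    rw [← h, lineDeriv]
    have : (fun t : ℝ => Γ ((u, (0 : E)) + t • ((0 : E), v))) = fun t => t ^ 2 • Γ (u, v) := by
      ext t; simp [hq]
    rw [this]
    have := ((hasDerivAt_id (0 : ℝ)).pow 2).smul_const (Γ (u, v))
    simpa using this.deriv
  have : ((w, v) : E × E) = (w, 0) + (0, v) := by simp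
  rw [this, map_add, h1, h2]; simp

/-- The position and velocity of a curve with given endpoints and acceleration. -/
def phaseCurve [CompleteSpace E] :
    ((E × E) × C(unitInterval, E)) →L[ℝ] C(unitInterval, E × E) :=
  pairCurve.comp (positionCurve.prod velocityCurve)

lemma phaseCurve_apply [CompleteSpace E] (q : (E × E) × C(unitInterval, E)) (s : unitInterval) :
    phaseCurve q s = (positionCurve q s, velocityCurve q s) := rfl

lemma curve_diag [CompleteSpace E] (y : E) (s : unitInterval) :
    positionCurve ((y, y), (0 : C(unitInterval, E))) s = y ∧
      velocityCurve ((y, y), (0 : C(unitInterval, E))) s = 0 := by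
  have h := curve_eq_of_hasDerivAt (c := fun _ => y) (b := fun _ => (0 : E)) (a := 0)
    (fun t _ => hasDerivAt_const _ _) (fun t _ => by simpa [extendCurve] using hasDerivAt_const _ _) s
  exact ⟨h.2, h.1⟩

/-- A family of curves `c z` from `z.2` to `z.1`, with velocity `b z`, which solve `c'' = -Γ(c, c')`
in `U`, depends smoothly on the endpoints and is compatible with restriction to `[0, r]`. -/
structure IsGeodesicFamily [CompleteSpace E] (Γ : E × E → E) (U : Set E) (N : Set (E × E))
    (b : E × E → C(unitInterval, E)) (c : E × E → C(unitInterval, E)) : Prop where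
  isOpen : IsOpen N
  contDiffOn_velocity : ContDiffOn ℝ ∞ b N
  curve_eq : ∀ z ∈ N, c z = constCurve z.2 + primitive (b z)
  curve_one : ∀ z ∈ N, c z 1 = z.1
  mem : ∀ z ∈ N, ∀ s, c z s ∈ U
  velocity_eq : ∀ z ∈ N, ∀ s : unitInterval, HasDerivWithinAt (extendCurve (b z))
    (-Γ (c z s, b z s)) (Icc 0 1) s
  velocity_rescale : ∀ z ∈ N, ∀ r s : unitInterval, (c z r, z.2) ∈ N →
    b (c z r, z.2) s = (r : ℝ) • b z (r * s)
  curve_rescale : ∀ z ∈ N, ∀ r s : unitInterval, (c z r, z.2) ∈ N →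
    c (c z r, z.2) s = c z (r * s)
  velocity_diag : ∀ y, (y, y) ∈ N → b (y, y) = 0
  fderiv_velocity_diag : ∀ y, (y, y) ∈ N → ∀ w : E, fderiv ℝ b (y, y) (w, 0) = constCurve w

/-- The implicit function theorem for R(z, a) = a + Γ(c, c') at the constant curve p. The term in Γ
has zero derivative there, being quadratic in a velocity that vanishes, so that the partial
derivative in a is the identity. -/
lemma exists_isGeodesicFamily [CompleteSpace E] {Γ : E × E → E} {U : Set E} (hU : IsOpen U)
    (hΓ : ContDiffOn ℝ ∞ Γ (U ×ˢ univ))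
    (hq : ∀ (u v : E) (r : ℝ), Γ (u, r • v) = r ^ 2 • Γ (u, v)) {p : E} (hp : p ∈ U) :
    ∃ N b c, (p, p) ∈ N ∧ IsGeodesicFamily Γ U N b c := by
  set D : Set ((E × E) × C(unitInterval, E)) := phaseCurve ⁻¹' (valuedIn unitInterval (U ×ˢ univ))
    with hDdef
  have hUo : IsOpen (U ×ˢ (univ : Set E)) := hU.prod isOpen_univ
  have hD : IsOpen D := (isOpen_valuedIn hUo).preimage phaseCurve.continuous
  set R : (E × E) × C(unitInterval, E) → C(unitInterval, E) :=
    fun q => q.2 + superpose Γ (phaseCurve q) with hRdef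
  have hsup : ContDiffOn ℝ ∞ (fun q => superpose Γ (phaseCurve q)) D :=
    (contDiffOn_superpose hUo hΓ).comp (phaseCurve (E := E)).contDiff.contDiffOn (fun q hq => hq)
  have hR : ContDiffOn ℝ ∞ R D := contDiffOn_snd.add hsup
  have hΓ0 : ∀ w : E, Γ (w, 0) = 0 := fun w => by simpa using hq w 0 0
  have hΓd : ∀ q ∈ U ×ˢ (univ : Set E), DifferentiableAt ℝ Γ q := fun q hq =>
    (hΓ.contDiffAt (hUo.mem_nhds hq)).differentiableAt (by simp)
  have hΓ' : ContinuousOn (fderiv ℝ Γ) (U ×ˢ univ) :=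
    hΓ.continuousOn_fderiv_of_isOpen hUo (by simp)
  have hdiagD : ∀ y ∈ U, ((y, y), (0 : C(unitInterval, E))) ∈ D := by
    intro y hy s
    rw [phaseCurve_apply, (curve_diag y s).1]
    exact ⟨hy, trivial⟩
  have hdiagR : ∀ y ∈ U, R ((y, y), 0) = 0 := by
    intro y hy
    ext s
    simp only [hRdef, zero_add]
    rw [superpose_apply hΓ.continuousOn (hdiagD y hy), phaseCurve_apply, (curve_diag y s).2, hΓ0]
    rfl
  have hsd : ∀ y ∈ U, HasFDerivAt (fun q => superpose Γ (phaseCurve q))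
      (0 : ((E × E) × C(unitInterval, E)) →L[ℝ] C(unitInterval, E)) ((y, y), 0) := by
    intro y hy
    have h1 := (hasFDerivAt_superpose hUo hΓd hΓ' (hdiagD y hy)).comp _
      (phaseCurve (E := E)).hasFDerivAt
    refine h1.congr_fderiv (ContinuousLinearMap.ext fun q => ContinuousMap.ext fun s => ?_)
    rw [ContinuousLinearMap.comp_apply, pointwiseApply_apply]
    rw [superpose_apply hΓ' (hdiagD y hy), phaseCurve_apply, (curve_diag y s).2,
      fderiv_eq_zero_of_quadratic hq (hΓd _ ⟨(by rw [(curve_diag y s).1]; exact hy), trivial⟩)]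
    rfl
  obtain ⟨N, ε, sol, hN, hpN, hε, hsol, hsolN, huniq⟩ := exists_contDiffOn_implicit hD hR
    (hdiagD p hp) (hdiagR p hp) (by
      intro a
      have h := (hasFDerivAt_snd (𝕜 := ℝ) (E := E × E) (F := C(unitInterval, E))
        (p := ((p, p), 0))).add (hsd p hp)
      have h2 : fderiv ℝ R ((p, p), 0) = _ := h.fderiv
      rw [h2]; simp)
  simp only [sub_zero] at hsolN huniq
  have hdiagU : ∀ y, (y, y) ∈ N → y ∈ U := by
    intro y hy
    have h := (hsolN _ hy).1 0
    rw [phaseCurve_apply, positionCurve_zero] at h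
    exact h.1
  have hsol0 : ∀ y, (y, y) ∈ N → sol (y, y) = 0 := fun y hy =>
    (huniq _ hy 0 (by simpa using hε) (hdiagD y (hdiagU y hy)) (hdiagR y (hdiagU y hy))).symm
  have hsolapp : ∀ z ∈ N, ∀ s, sol z s
      = -Γ (positionCurve (z, sol z) s, velocityCurve (z, sol z) s) := by
    intro z hz s
    have h := DFunLike.congr_fun (hsolN z hz).2.1 s
    simp only [hRdef, ContinuousMap.add_apply, ContinuousMap.zero_apply] at h
    rw [superpose_apply hΓ.continuousOn (hsolN z hz).1, phaseCurve_apply] at h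
    exact eq_neg_of_add_eq_zero_left h
  -- The rescaled acceleration solves the equation for the new endpoints by homogeneity of Γ, and
  -- its norm does not exceed that of the original. It therefore lies in the ball where solutions
  -- are unique.
  have hscale : ∀ z ∈ N, ∀ r : unitInterval, (positionCurve (z, sol z) r, z.2) ∈ N →
      sol (positionCurve (z, sol z) r, z.2) = rescale r (sol z) := by
    intro z hz r hr
    have hm : ((positionCurve (z, sol z) r, z.2), rescale r (sol z)) ∈ D := by
      intro s
      rw [phaseCurve_apply, (curve_rescale z (sol z) r s).2]
      exact ⟨((hsolN z hz).1 (r * s)).1, trivial⟩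
    refine (huniq _ hr _ ((norm_rescale_le r _).trans_lt (hsolN z hz).2.2) hm ?_).symm
    ext s
    simp only [hRdef, ContinuousMap.add_apply, ContinuousMap.zero_apply]
    rw [superpose_apply hΓ.continuousOn hm, phaseCurve_apply, (curve_rescale z (sol z) r s).2,
      (curve_rescale z (sol z) r s).1, hq]
    change (r : ℝ) ^ 2 • sol z (r * s) + _ = 0
    rw [hsolapp z hz (r * s)]
    simp
  refine ⟨N, fun z => velocityCurve (z, sol z), fun z => positionCurve (z, sol z), hpN, hN,
    ?_, ?_, ?_, ?_, ?_, ?_, ?_, ?_, ?_⟩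
  · exact velocityCurve.contDiff.comp_contDiffOn (contDiffOn_id.prodMk hsol)
  · intro z _; rfl
  · intro z _; exact positionCurve_one _ _
  · intro z hz s; exact ((hsolN z hz).1 s).1
  · intro z hz s
    rw [← hsolapp z hz s, ← extendCurve_coe (sol z)]
    have h := ((hasDerivAt_primitiveFun (sol z) s).const_add
      (z.1 - z.2 - primitiveFun (primitive (sol z)) 1)).hasDerivWithinAt (s := Icc 0 1)
    refine h.congr (fun t ht => ?_) ?_
    · rw [extendCurve_of_mem _ ht, velocityCurve_apply]
    · rw [extendCurve_coe, velocityCurve_apply]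
  · intro z hz r s hr
    simp only [hscale z hz r hr]
    exact (curve_rescale z (sol z) r s).1
  · intro z hz r s hr
    simp only [hscale z hz r hr]
    exact (curve_rescale z (sol z) r s).2
  · intro y hy
    simp only [hsol0 y hy]
    ext s
    exact (curve_diag y s).2
  · intro y hy w
    -- Near (y, y) the solution equals minus the superposition term evaluated at (z, sol z), whose
    -- derivative at the diagonal is zero. To first order the geodesics are therefore straight
    -- segments.
    have hsd' : HasFDerivAt sol (0 : (E × E) →L[ℝ] C(unitInterval, E)) (y, y) := by
      have h1 : HasFDerivAt (fun z : E × E => (z, sol z))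
          ((ContinuousLinearMap.id ℝ (E × E)).prod (fderiv ℝ sol (y, y))) (y, y) :=
        (hasFDerivAt_id _).prodMk
          ((hsol.contDiffAt (hN.mem_nhds hy)).differentiableAt (by simp)).hasFDerivAt
      have h2 : HasFDerivAt (fun q => superpose Γ (phaseCurve q))
          (0 : ((E × E) × C(unitInterval, E)) →L[ℝ] C(unitInterval, E)) ((y, y), sol (y, y)) := by
        rw [hsol0 y hy]; exact hsd y (hdiagU y hy)
      have h3 := (h2.comp (y, y) h1).neg
      simp only [ContinuousLinearMap.zero_comp, neg_zero] at h3
      refine h3.congr_of_eventuallyEq ?_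
      filter_upwards [hN.mem_nhds hy] with z hz
      exact eq_neg_of_add_eq_zero_left (hsolN z hz).2.1
    have h4 : HasFDerivAt (fun z : E × E => velocityCurve (z, sol z)) _ (y, y) :=
      (velocityCurve (E := E)).hasFDerivAt.comp (y, y) ((hasFDerivAt_id _).prodMk hsd')
    rw [h4.fderiv]
    ext s
    simp [velocityCurve]

end Geodesics

/-! ### Geodesics of a Riemannian metric on an open set and the first variation of energy -/

section LocalMetric

variable {E : Type} [NormedAddCommGroup E] [NormedSpace ℝ E]

/-- `G` is a smooth Riemannian metric on the open set `U`. -/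
structure IsMetricOn (G : E → E →L[ℝ] E →L[ℝ] ℝ) (U : Set E) : Prop where
  isOpen : IsOpen U
  contDiffOn : ContDiffOn ℝ ∞ G U
  symm : ∀ u ∈ U, ∀ v w, G u v w = G u w v
  pos : ∀ u ∈ U, ∀ v, v ≠ 0 → 0 < G u v v

/-- The covector `w ↦ (D_v G)(v, w) - ½ (D_w G)(v, v)`. -/
def christoffelCovector (G : E → E →L[ℝ] E →L[ℝ] ℝ) (q : E × E) : E →L[ℝ] ℝ :=
  fderiv ℝ G q.1 q.2 q.2
    - (1 / 2 : ℝ) • ContinuousLinearMap.flip (ContinuousLinearMap.flip (fderiv ℝ G q.1) q.2) q.2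

lemma christoffelCovector_apply (G : E → E →L[ℝ] E →L[ℝ] ℝ) (u v w : E) :
    christoffelCovector G (u, v) w = fderiv ℝ G u v v w - 1 / 2 * fderiv ℝ G u w v v := by
  simp [christoffelCovector]

/-- The quadratic form `Γ(u, v)` of the geodesic equation `c'' = -Γ(c, c')`. -/
def geodesicTerm (G : E → E →L[ℝ] E →L[ℝ] ℝ) (q : E × E) : E :=
  ContinuousLinearMap.inverse (G q.1) (christoffelCovector G q)

variable {G : E → E →L[ℝ] E →L[ℝ] ℝ} {U : Set E}

lemma IsMetricOn.exists_equiv [FiniteDimensional ℝ E] (hG : IsMetricOn G U) {u : E} (hu : u ∈ U) :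
    ∃ e : E ≃L[ℝ] (E →L[ℝ] ℝ), (e : E →L[ℝ] E →L[ℝ] ℝ) = G u := by
  have hinj : Function.Injective (G u : E →ₗ[ℝ] (E →L[ℝ] ℝ)) := by
    rw [injective_iff_map_eq_zero]
    intro v hv
    by_contra hne
    have h := hG.pos u hu v hne
    have h2 : G u v = 0 := hv
    simp [h2] at h
  have hdim : Module.finrank ℝ E = Module.finrank ℝ (E →L[ℝ] ℝ) := by
    rw [← (LinearMap.toContinuousLinearMap (𝕜 := ℝ) (E := E) (F' := ℝ)).finrank_eq]
    exact (Subspace.dual_finrank_eq (K := ℝ) (V := E)).symm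
  refine ⟨(LinearMap.linearEquivOfInjective _ hinj hdim).toContinuousLinearEquiv, ?_⟩
  ext v w
  rfl

/-- With the index lowered, Γ is explicit in the first derivatives of the metric. Only this form
enters the computations, so the inverse metric is never expanded. -/
lemma IsMetricOn.apply_geodesicTerm [FiniteDimensional ℝ E] (hG : IsMetricOn G U) {u : E}
    (hu : u ∈ U) (v : E) : G u (geodesicTerm G (u, v)) = christoffelCovector G (u, v) := by
  obtain ⟨e, he⟩ := hG.exists_equiv hu
  rw [geodesicTerm]
  simp only [← he, ContinuousLinearMap.inverse_equiv]
  exact e.apply_symm_apply _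

lemma geodesicTerm_smul (u v : E) (r : ℝ) :
    geodesicTerm G (u, r • v) = r ^ 2 • geodesicTerm G (u, v) := by
  have : christoffelCovector G (u, r • v) = r ^ 2 • christoffelCovector G (u, v) := by
    ext w
    simp only [christoffelCovector_apply, map_smul, smul_apply, smul_eq_mul]
    ring
  simp only [geodesicTerm, this, map_smul]

lemma IsMetricOn.contDiffOn_fderiv (hG : IsMetricOn G U) : ContDiffOn ℝ ∞ (fderiv ℝ G) U :=
  hG.contDiffOn.fderiv_of_isOpen hG.isOpen (by simp)

lemma IsMetricOn.contDiffOn_geodesicTerm [FiniteDimensional ℝ E] (hG : IsMetricOn G U) :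
    ContDiffOn ℝ ∞ (geodesicTerm G) (U ×ˢ univ) := by
  have hfst : MapsTo Prod.fst (U ×ˢ (univ : Set E)) U := fun q hq => hq.1
  have h1 : ContDiffOn ℝ ∞ (fun q : E × E => fderiv ℝ G q.1) (U ×ˢ univ) :=
    hG.contDiffOn_fderiv.comp contDiffOn_fst hfst
  have h2 : ContDiffOn ℝ ∞ (fun q : E × E => fderiv ℝ G q.1 q.2 q.2) (U ×ˢ univ) :=
    (h1.clm_apply contDiffOn_snd).clm_apply contDiffOn_snd
  have h3 : ContDiffOn ℝ ∞ (fun q : E × E => ContinuousLinearMap.flip (fderiv ℝ G q.1))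
      (U ×ˢ univ) :=
    (ContinuousLinearMap.flipₗᵢ ℝ E E (E →L[ℝ] ℝ)).contDiff.comp_contDiffOn h1
  have h4 : ContDiffOn ℝ ∞ (fun q : E × E => ContinuousLinearMap.flip
      (ContinuousLinearMap.flip (fderiv ℝ G q.1) q.2)) (U ×ˢ univ) :=
    (ContinuousLinearMap.flipₗᵢ ℝ E E ℝ).contDiff.comp_contDiffOn (h3.clm_apply contDiffOn_snd)
  have h5 : ContDiffOn ℝ ∞ (christoffelCovector G) (U ×ˢ univ) :=
    h2.sub ((h4.clm_apply contDiffOn_snd).const_smul (1 / 2 : ℝ))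
  have h6 : ContDiffOn ℝ ∞ (fun q : E × E => ContinuousLinearMap.inverse (G q.1))
      (U ×ˢ univ) := by
    intro q hq
    obtain ⟨e, he⟩ := hG.exists_equiv hq.1
    have h7 : ContDiffAt ℝ ∞ (ContinuousLinearMap.inverse (R := ℝ) (M := E) (M₂ := E →L[ℝ] ℝ))
        (G q.1) := by
      rw [← he]; exact contDiffAt_map_inverse e
    exact h7.comp_contDiffWithinAt q ((hG.contDiffOn.comp contDiffOn_fst hfst) q hq)
  exact h6.clm_apply h5

variable [FiniteDimensional ℝ E] [CompleteSpace E] {N : Set (E × E)}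
  {b c : E × E → C(unitInterval, E)}

namespace IsGeodesicFamily

section General

variable {Γ : E × E → E}

lemma contDiffOn_curve (h : IsGeodesicFamily Γ U N b c) : ContDiffOn ℝ ∞ c N := by
  have h1 : ContDiffOn ℝ ∞ (fun z : E × E => constCurve z.2 + primitive (b z)) N :=
    ((constCurve (E := E)).contDiff.comp_contDiffOn contDiffOn_snd).add
      ((primitive (E := E)).contDiff.comp_contDiffOn h.contDiffOn_velocity)
  exact h1.congr fun z hz => h.curve_eq z hz

lemma curve_zero (h : IsGeodesicFamily Γ U N b c) {z : E × E} (hz : z ∈ N) : c z 0 = z.2 := by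
  rw [h.curve_eq z hz]; simp [primitive_apply, primitiveFun]

lemma hasDerivWithinAt_curve (h : IsGeodesicFamily Γ U N b c) {z : E × E} (hz : z ∈ N)
    (s : unitInterval) : HasDerivWithinAt (extendCurve (c z)) (b z s) (Icc 0 1) s := by
  rw [← extendCurve_coe (b z)]
  refine ((hasDerivAt_primitiveFun (b z) s).const_add z.2).hasDerivWithinAt.congr
    (fun t ht => ?_) ?_
  · rw [extendCurve_of_mem _ ht, h.curve_eq z hz]; rfl
  · rw [extendCurve_coe, h.curve_eq z hz]; rfl

lemma curve_mem_one (h : IsGeodesicFamily Γ U N b c) {z : E × E} (hz : z ∈ N) : z.1 ∈ U :=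
  h.curve_one z hz ▸ h.mem z hz 1

end General

/-- The geodesic equation, inserted for c'', cancels the term (D_{c'}G)(c', η) and leaves
½(D_ηG)(c', c'). The choice η = c' gives constancy of the speed; a variation field η gives the first
variation formula. -/
lemma hasDerivWithinAt_metric (hG : IsMetricOn G U)
    (h : IsGeodesicFamily (geodesicTerm G) U N b c) {z : E × E} (hz : z ∈ N)
    {η : ℝ → E} {ξ : E} {s : unitInterval} (hη : HasDerivWithinAt η ξ (Icc 0 1) s) :
    HasDerivWithinAt (fun t => G (extendCurve (c z) t) (extendCurve (b z) t) (η t))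
      (G (c z s) (b z s) ξ + 1 / 2 * fderiv ℝ G (c z s) (η s) (b z s) (b z s)) (Icc 0 1) s := by
  have hu : c z s ∈ U := h.mem z hz s
  have h1 : HasDerivWithinAt (fun t => G (extendCurve (c z) t))
      (fderiv ℝ G (c z s) (b z s)) (Icc 0 1) s := by
    have hd : HasFDerivAt G (fderiv ℝ G (c z s)) (extendCurve (c z) s) := by
      rw [extendCurve_coe]
      exact ((hG.contDiffOn.contDiffAt (hG.isOpen.mem_nhds hu)).differentiableAt
        (by simp)).hasFDerivAt
    exact hd.comp_hasDerivWithinAt (s : ℝ) (h.hasDerivWithinAt_curve hz s)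
  have h2 := (h1.clm_apply (h.velocity_eq z hz s)).clm_apply hη
  refine h2.congr_deriv ?_
  simp only [extendCurve_coe, add_apply, map_neg, neg_apply,
    hG.apply_geodesicTerm hu, christoffelCovector_apply]
  ring

/-- The speed of a geodesic is constant. -/
lemma energy_const (hG : IsMetricOn G U) (h : IsGeodesicFamily (geodesicTerm G) U N b c)
    {z : E × E} (hz : z ∈ N) (s : unitInterval) :
    G (c z s) (b z s) (b z s) = G z.1 (b z 1) (b z 1) := by
  have hd : ∀ t ∈ Icc (0 : ℝ) 1, HasDerivWithinAt
      (fun t => G (extendCurve (c z) t) (extendCurve (b z) t) (extendCurve (b z) t)) 0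
      (Icc 0 1) t := by
    intro t ht
    -- Here η is the velocity and ξ = -Γ, so G(c', ξ) = -½(D_{c'}G)(c', c') cancels the remaining
    -- term.
    have h1 := h.hasDerivWithinAt_metric hG hz (s := ⟨t, ht⟩) (h.velocity_eq z hz ⟨t, ht⟩)
    refine h1.congr_deriv ?_
    have hu : c z ⟨t, ht⟩ ∈ U := h.mem z hz _
    rw [map_neg, hG.symm _ hu, hG.apply_geodesicTerm hu, christoffelCovector_apply,
      extendCurve_of_mem _ ht]
    ring
  have h2 := (convex_Icc (0 : ℝ) 1).is_const_of_fderivWithin_eq_zero (𝕜 := ℝ)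
    (fun t ht => (hd t ht).differentiableWithinAt) (fun t ht => by
      rw [(hd t ht).hasFDerivWithinAt.fderivWithin (uniqueDiffOn_Icc_zero_one t ht)]
      ext; simp) s.2 (by simp : (1 : ℝ) ∈ Icc (0 : ℝ) 1)
  simp only [extendCurve_coe] at h2
  rw [h2]
  have h3 : ∀ a : C(unitInterval, E), extendCurve a 1 = a 1 := fun a => extendCurve_coe a 1
  rw [h3, h3, h.curve_one z hz]

end IsGeodesicFamily

/-- The energy `∫₀¹ G(c, c')` of a curve. -/
def energy (G : E → E →L[ℝ] E →L[ℝ] ℝ) (q : C(unitInterval, E × E)) : ℝ :=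
  evalCurve 1 (primitive (superpose (fun p : E × E => G p.1 p.2 p.2) q))

/-- The squared velocity at the endpoint, which is the squared distance function. -/
def sqLength (G : E → E →L[ℝ] E →L[ℝ] ℝ) (b : E × E → C(unitInterval, E)) (z : E × E) : ℝ :=
  G z.1 (b z 1) (b z 1)

namespace IsGeodesicFamily

lemma contDiffOn_sqLength (hG : IsMetricOn G U) (h : IsGeodesicFamily (geodesicTerm G) U N b c) :
    ContDiffOn ℝ ∞ (sqLength G b) N := by
  have h1 : ContDiffOn ℝ ∞ (fun z : E × E => G z.1) N :=
    hG.contDiffOn.comp contDiffOn_fst fun z hz => h.curve_mem_one hz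
  have h2 : ContDiffOn ℝ ∞ (fun z : E × E => b z 1) N :=
    (evalCurve (E := E) 1).contDiff.comp_contDiffOn h.contDiffOn_velocity
  exact (h1.clm_apply h2).clm_apply h2

/-- The first variation formula. -/
lemma fderiv_sqLength (hG : IsMetricOn G U) (h : IsGeodesicFamily (geodesicTerm G) U N b c)
    {z : E × E} (hz : z ∈ N) (w : E) :
    fderiv ℝ (sqLength G b) z (w, 0) = 2 * G z.1 (b z 1) w := by
  set Φ : E × E → ℝ := fun p => G p.1 p.2 p.2 with hΦ
  have hfst : MapsTo Prod.fst (U ×ˢ (univ : Set E)) U := fun q hq => hq.1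
  have hUo : IsOpen (U ×ˢ (univ : Set E)) := hG.isOpen.prod isOpen_univ
  have hΦs : ContDiffOn ℝ ∞ Φ (U ×ˢ univ) :=
    ((hG.contDiffOn.comp contDiffOn_fst hfst).clm_apply contDiffOn_snd).clm_apply contDiffOn_snd
  have hΦd : ∀ q ∈ U ×ˢ (univ : Set E), DifferentiableAt ℝ Φ q := fun q hq =>
    (hΦs.contDiffAt (hUo.mem_nhds hq)).differentiableAt (by simp)
  have hΦ' : ContinuousOn (fderiv ℝ Φ) (U ×ˢ univ) :=
    hΦs.continuousOn_fderiv_of_isOpen hUo (by simp)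
  have hΦf : ∀ u ∈ U, ∀ v η ξ : E, fderiv ℝ Φ (u, v) (η, ξ)
      = fderiv ℝ G u η v v + 2 * G u v ξ := by
    intro u hu v η ξ
    have hGd : HasFDerivAt G (fderiv ℝ G u) u :=
      ((hG.contDiffOn.contDiffAt (hG.isOpen.mem_nhds hu)).differentiableAt (by simp)).hasFDerivAt
    have h1 : HasFDerivAt (fun p : E × E => G p.1) ((fderiv ℝ G u).comp
        (ContinuousLinearMap.fst ℝ E E)) (u, v) :=
      HasFDerivAt.comp (g := G) (u, v) hGd hasFDerivAt_fst
    have h2 : HasFDerivAt Φ _ (u, v) :=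
      (h1.clm_apply hasFDerivAt_snd).clm_apply hasFDerivAt_snd
    rw [h2.fderiv]
    simp [hG.symm u hu ξ v]
    ring
  have hcurve : ∀ z' ∈ N, pairCurve (c z', b z') ∈ valuedIn unitInterval (U ×ˢ (univ : Set E)) :=
    fun z' hz' s => ⟨h.mem z' hz' s, trivial⟩
  -- Since the speed is constant, its square at the endpoint equals the energy integral, which is a
  -- composition of operators with known derivatives on spaces of curves.
  have hS : ∀ z' ∈ N, sqLength G b z' = energy G (pairCurve (c z', b z')) := by
    intro z' hz'
    have h1 : superpose Φ (pairCurve (c z', b z')) = constCurve (sqLength G b z') := by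
      ext s
      rw [superpose_apply hΦs.continuousOn (hcurve z' hz')]
      exact h.energy_const hG hz' s
    rw [energy, h1, evalCurve_apply, primitive_apply, primitiveFun_constCurve]
    simp
  have hbd : HasFDerivAt b (fderiv ℝ b z) z :=
    ((h.contDiffOn_velocity.contDiffAt (h.isOpen.mem_nhds hz)).differentiableAt
      (by simp)).hasFDerivAt
  have hcd : HasFDerivAt c (fderiv ℝ c z) z :=
    ((h.contDiffOn_curve.contDiffAt (h.isOpen.mem_nhds hz)).differentiableAt
      (by simp)).hasFDerivAt
  -- The starting point z.2 does not move, so the variation field is the primitive of its derivative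
  -- vanishing at 0.
  have hceq : fderiv ℝ c z (w, 0) = primitive (fderiv ℝ b z (w, 0)) := by
    have h1 : HasFDerivAt (fun z : E × E => constCurve z.2 + primitive (b z)) _ z :=
      ((constCurve (E := E)).hasFDerivAt.comp z hasFDerivAt_snd).add
        ((primitive (E := E)).hasFDerivAt.comp z hbd)
    have h2 := h1.congr_of_eventuallyEq (f₁ := c) (by
      filter_upwards [h.isOpen.mem_nhds hz] with z' hz' using h.curve_eq z' hz')
    rw [h2.fderiv]
    simp
  have hend : fderiv ℝ c z (w, 0) 1 = w := by
    have h1 : HasFDerivAt (fun z => c z 1) ((evalCurve 1).comp (fderiv ℝ c z)) z :=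
      (evalCurve (E := E) 1).hasFDerivAt.comp z hcd
    have h2 := (hasFDerivAt_fst (𝕜 := ℝ) (E := E) (F := E) (p := z)).congr_of_eventuallyEq
      (f₁ := fun z => c z 1) (by
      filter_upwards [h.isOpen.mem_nhds hz] with z' hz' using h.curve_one z' hz')
    have h3 := h1.unique h2
    have h4 := DFunLike.congr_fun h3 ((w, 0) : E × E)
    simpa using h4
  set ξ := fderiv ℝ b z (w, 0) with hξ
  have hSd : HasFDerivAt (sqLength G b) _ z :=
    (((evalCurve (E := ℝ) 1).comp (primitive (E := ℝ))).hasFDerivAt.comp z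
      ((hasFDerivAt_superpose hUo hΦd hΦ' (hcurve z hz)).comp z
        ((pairCurve (E := E)).hasFDerivAt.comp z (hcd.prodMk hbd)))).congr_of_eventuallyEq (by
      filter_upwards [h.isOpen.mem_nhds hz] with z' hz' using hS z' hz')
  rw [hSd.fderiv]
  have hη : ∀ s : unitInterval, HasDerivWithinAt (primitiveFun ξ) (ξ s) (Icc 0 1) s := fun s => by
    rw [← extendCurve_coe ξ]; exact (hasDerivAt_primitiveFun ξ s).hasDerivWithinAt
  -- The first variation of the energy density is the total derivative of 2G(c', η). Only the
  -- endpoint t = 1, where η = w, contributes.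
  have hint : ∀ t ∈ Icc (0 : ℝ) 1, HasDerivWithinAt
      (fun t => 2 * G (extendCurve (c z) t) (extendCurve (b z) t) (primitiveFun ξ t))
      (extendCurve (pointwiseApply (superpose (fderiv ℝ Φ) (pairCurve (c z, b z)))
        (pairCurve (fderiv ℝ c z (w, 0), ξ))) t) (Icc 0 1) t := by
    intro t ht
    have h1 := (h.hasDerivWithinAt_metric hG hz (hη ⟨t, ht⟩)).const_mul 2
    refine h1.congr_deriv ?_
    rw [extendCurve_of_mem _ ht, pointwiseApply_apply, superpose_apply hΦ' (hcurve z hz),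
      pairCurve_apply, pairCurve_apply, hceq, primitive_apply]
    rw [hΦf _ (h.mem z hz _)]
    ring
  have hfin := intervalIntegral.integral_eq_sub_of_hasDerivAt_of_le zero_le_one
    (fun t ht => (hint t ht).continuousWithinAt)
    (fun t ht => (hint t (Ioo_subset_Icc_self ht)).hasDerivAt (Icc_mem_nhds ht.1 ht.2))
    ((continuous_extendCurve _).intervalIntegrable _ _)
  refine Eq.trans hfin ?_
  have h3 : ∀ a : C(unitInterval, E), extendCurve a 1 = a 1 := fun a => extendCurve_coe a 1
  rw [h3, h3, h.curve_one z hz]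
  have h5 : primitiveFun ξ 1 = w := by
    rw [← hend, hceq]; rfl
  rw [h5]
  simp [primitiveFun]

end IsGeodesicFamily

end LocalMetric

/-! ### Transport equations along geodesics -/

section Transport

/-- The functional `a ↦ ∫₀¹ w(s) a(s) ds`. -/
def weightedIntegral (w : ℝ → ℝ) (hw : IntervalIntegrable w volume 0 1) :
    C(unitInterval, ℂ) →L[ℝ] ℂ :=
  have hi : ∀ a : C(unitInterval, ℂ),
      IntervalIntegrable (fun s => w s • extendCurve a s) volume 0 1 := fun a =>
    hw.smul_continuousOn (continuous_extendCurve a).continuousOn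
  LinearMap.mkContinuous
    { toFun := fun a => ∫ s in (0 : ℝ)..1, w s • extendCurve a s
      map_add' := by
        intro a b
        rw [← intervalIntegral.integral_add (hi a) (hi b)]
        simp [extendCurve]
      map_smul' := by
        intro r a
        rw [RingHom.id_apply, ← intervalIntegral.integral_smul]
        refine intervalIntegral.integral_congr fun s _ => ?_
        simp only [extendCurve, ContinuousMap.smul_apply]
        exact smul_comm _ _ _ } (∫ s in (0 : ℝ)..1, |w s|) (by
    intro a
    refine (intervalIntegral.norm_integral_le_integral_norm zero_le_one).trans ?_
    rw [← intervalIntegral.integral_mul_const]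
    refine intervalIntegral.integral_mono_on zero_le_one (hi a).norm (hw.abs.mul_const _) ?_
    intro s _
    rw [norm_smul, Real.norm_eq_abs]
    exact mul_le_mul_of_nonneg_left (a.norm_coe_le_norm _) (abs_nonneg _))

lemma weightedIntegral_apply (w : ℝ → ℝ) (hw : IntervalIntegrable w volume 0 1)
    (a : C(unitInterval, ℂ)) :
    weightedIntegral w hw a = ∫ s in (0 : ℝ)..1, w s • extendCurve a s := rfl

variable {E : Type} [NormedAddCommGroup E] [NormedSpace ℝ E] [FiniteDimensional ℝ E]
  [CompleteSpace E] {Γ : E × E → E} {U : Set E} {N W : Set (E × E)}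
  {b c : E × E → C(unitInterval, E)}

/-- `W` contains, with `z`, the points `(c z s, z.2)` of the geodesic from `z.2` to `z.1`. -/
def IsStar (c : E × E → C(unitInterval, E)) (W : Set (E × E)) : Prop :=
  ∀ z ∈ W, ∀ s : unitInterval, (c z s, z.2) ∈ W

namespace IsGeodesicFamily

/-- The geodesic from `z.2` to `z.1` as a curve in `E × E`. -/
lemma contDiffOn_path (h : IsGeodesicFamily Γ U N b c) :
    ContDiffOn ℝ ∞ (fun z => pairCurve (c z, constCurve z.2)) N :=
  (pairCurve (E := E)).contDiff.comp_contDiffOn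
    (h.contDiffOn_curve.prodMk ((constCurve (E := E)).contDiff.comp_contDiffOn contDiffOn_snd))

lemma hasDerivWithinAt_comp_path (h : IsGeodesicFamily Γ U N b c) (hWN : W ⊆ N) (hW : IsOpen W)
    {f : E × E → ℂ} (hf : ContDiffOn ℝ ∞ f W) (hs : IsStar c W) {z : E × E} (hz : z ∈ W)
    (s : unitInterval) :
    HasDerivWithinAt (fun t => f (extendCurve (c z) t, z.2))
      (fderiv ℝ f (c z s, z.2) (b z s, 0)) (Icc 0 1) s := by
  have h1 : HasFDerivAt f (fderiv ℝ f (c z s, z.2)) (extendCurve (c z) s, z.2) := by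
    rw [extendCurve_coe]
    exact ((hf.contDiffAt (hW.mem_nhds (hs z hz s))).differentiableAt (by simp)).hasFDerivAt
  have h2 : HasDerivWithinAt (fun t => (extendCurve (c z) t, z.2)) (b z s, 0) (Icc 0 1) s :=
    (h.hasDerivWithinAt_curve (hWN hz) s).prodMk (hasDerivWithinAt_const _ _ _)
  exact h1.comp_hasDerivWithinAt (s : ℝ) h2

lemma hasDerivWithinAt_comp_path_one (h : IsGeodesicFamily Γ U N b c) (hWN : W ⊆ N)
    (hW : IsOpen W) {f : E × E → ℂ} (hf : ContDiffOn ℝ ∞ f W) (hs : IsStar c W) {z : E × E}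
    (hz : z ∈ W) :
    HasDerivWithinAt (fun t => f (extendCurve (c z) t, z.2))
      (fderiv ℝ f z (b z 1, 0)) (Icc 0 1) 1 := by
  have h1 := h.hasDerivWithinAt_comp_path hWN hW hf hs hz 1
  rw [h.curve_one z (hWN hz)] at h1
  exact h1

lemma continuous_comp_path {F : Type} [NormedAddCommGroup F] (_h : IsGeodesicFamily Γ U N b c)
    {f : E × E → F} (hf : ContinuousOn f W) (hs : IsStar c W) {z : E × E} (hz : z ∈ W) :
    Continuous fun t => f (extendCurve (c z) t, z.2) :=
  hf.comp_continuous ((continuous_extendCurve _).prodMk continuous_const) fun _ => hs z hz _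

/-- `u(z) = ∫₀¹ s^k f(c z s, z.2) ds`. -/
def radialAverage (c : E × E → C(unitInterval, E)) (k : ℕ) (f : E × E → ℂ) (z : E × E) : ℂ :=
  ∫ s in (0 : ℝ)..1, s ^ k • f (extendCurve (c z) s, z.2)

/-- A bounded functional composed with a superposition operator and the smooth map from endpoints to
paths; no differentiation under the integral is needed. -/
lemma contDiffOn_radialAverage (h : IsGeodesicFamily Γ U N b c) (hWN : W ⊆ N)
    (hW : IsOpen W) {f : E × E → ℂ} (hf : ContDiffOn ℝ ∞ f W) (hs : IsStar c W) (k : ℕ) :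
    ContDiffOn ℝ ∞ (radialAverage c k f) W := by
  have hw : IntervalIntegrable (fun s : ℝ => s ^ k) volume 0 1 :=
    (continuous_pow k).intervalIntegrable _ _
  have h1 : ContDiffOn ℝ ∞ (fun z => weightedIntegral _ hw
      (superpose f (pairCurve (c z, constCurve z.2)))) W :=
    (weightedIntegral _ hw).contDiff.comp_contDiffOn
      ((contDiffOn_superpose hW hf).comp (h.contDiffOn_path.mono hWN) fun z hz s => hs z hz s)
  refine h1.congr fun z hz => ?_
  rw [weightedIntegral_apply, radialAverage]
  refine intervalIntegral.integral_congr fun s _ => ?_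
  simp only [extendCurve]
  rw [superpose_apply hf.continuousOn fun s => hs z hz s]
  rfl

lemma extendCurve_rescale (h : IsGeodesicFamily Γ U N b c) (hWN : W ⊆ N) (hs : IsStar c W)
    {z : E × E} (hz : z ∈ W) {r t : ℝ} (hr : r ∈ Icc (0 : ℝ) 1) (ht : t ∈ Icc (0 : ℝ) 1) :
    extendCurve (c (extendCurve (c z) r, z.2)) t = extendCurve (c z) (r * t) := by
  have hm : r * t ∈ Icc (0 : ℝ) 1 := ((⟨r, hr⟩ : unitInterval) * ⟨t, ht⟩).2
  rw [extendCurve_of_mem _ hr, extendCurve_of_mem _ ht, extendCurve_of_mem _ hm]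
  exact h.curve_rescale z (hWN hz) ⟨r, hr⟩ ⟨t, ht⟩ (hWN (hs z hz _))

lemma extendCurve_velocity_rescale (h : IsGeodesicFamily Γ U N b c) (hWN : W ⊆ N)
    (hs : IsStar c W) {z : E × E} (hz : z ∈ W) {r t : ℝ} (hr : r ∈ Icc (0 : ℝ) 1)
    (ht : t ∈ Icc (0 : ℝ) 1) :
    extendCurve (b (extendCurve (c z) r, z.2)) t = r • extendCurve (b z) (r * t) := by
  have hm : r * t ∈ Icc (0 : ℝ) 1 := ((⟨r, hr⟩ : unitInterval) * ⟨t, ht⟩).2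
  rw [extendCurve_of_mem _ hr, extendCurve_of_mem _ ht, extendCurve_of_mem _ hm]
  exact h.velocity_rescale z (hWN hz) ⟨r, hr⟩ ⟨t, ht⟩ (hWN (hs z hz _))

/-- By the rescaling of geodesics, r^{k+1}u(c(r)) = ∫₀^r τ^k f(c(τ)) dτ. Differentiation at r = 1
gives the equation. -/
lemma fderiv_radialAverage (h : IsGeodesicFamily Γ U N b c) (hWN : W ⊆ N)
    (hW : IsOpen W) {f : E × E → ℂ} (hf : ContDiffOn ℝ ∞ f W) (hs : IsStar c W) (k : ℕ)
    {z : E × E} (hz : z ∈ W) :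
    fderiv ℝ (radialAverage c k f) z (b z 1, 0) + (k + 1) * radialAverage c k f z = f z := by
  set g : ℝ → ℂ := fun τ => τ ^ k • f (extendCurve (c z) τ, z.2) with hg
  have hgc : Continuous g :=
    (continuous_pow k).smul (h.continuous_comp_path hf.continuousOn hs hz)
  have key : ∀ r ∈ Icc (0 : ℝ) 1, r ^ (k + 1) • radialAverage c k f (extendCurve (c z) r, z.2)
      = ∫ τ in (0 : ℝ)..r, g τ := by
    intro r hr
    have h1 := intervalIntegral.smul_integral_comp_mul_left (a := 0) (b := 1) g r
    rw [mul_zero, mul_one] at h1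
    rw [← h1, radialAverage, pow_succ', mul_smul, ← intervalIntegral.integral_smul]
    congr 1
    refine intervalIntegral.integral_congr fun s hs' => ?_
    rw [uIcc_of_le zero_le_one] at hs'
    simp only [hg, h.extendCurve_rescale hWN hs hz hr hs', mul_pow, smul_smul]
  have hu := h.hasDerivWithinAt_comp_path_one hWN hW (h.contDiffOn_radialAverage hWN hW hf hs k)
    hs hz
  have h3 : ∀ a : C(unitInterval, E), extendCurve a 1 = a 1 := fun a => extendCurve_coe a 1
  have hz1 : (extendCurve (c z) 1, z.2) = z := by rw [h3, h.curve_one z (hWN hz)]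
  have h4 := ((hasDerivAt_pow (k + 1) (1 : ℝ)).hasDerivWithinAt (s := Icc 0 1)).smul hu
  have h5 : HasDerivWithinAt (fun r => ∫ τ in (0 : ℝ)..r, g τ) (g 1) (Icc 0 1) 1 :=
    (hgc.integral_hasStrictDerivAt 0 1).hasDerivAt.hasDerivWithinAt
  have h6 := h4.congr_of_mem (f₁ := fun r => ∫ τ in (0 : ℝ)..r, g τ)
    (fun r hr => (key r hr).symm) (by simp)
  have h7 := (uniqueDiffOn_Icc_zero_one (1 : ℝ) (by simp)).eq_deriv _ h5 h6
  simp only [hg, hz1, one_pow, one_smul] at h7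
  rw [h7]
  simp

/-- `θ(z) = -∫₀¹ log(s) (d/ds) ρ(c z s, z.2) ds`, that is `∫₀¹ ρ(c z s, z.2) / s ds` if `ρ` vanishes
on the diagonal. -/
def logAverage (b c : E × E → C(unitInterval, E)) (ρ : E × E → ℂ) (z : E × E) : ℂ :=
  ∫ s in (0 : ℝ)..1, (-Real.log s) •
    fderiv ℝ ρ (extendCurve (c z) s, z.2) (extendCurve (b z) s, 0)

/-- The weight log s is integrable on [0, 1], unlike 1/s, so the integral is again a bounded
functional of a curve depending smoothly on the endpoints. -/
lemma contDiffOn_logAverage (h : IsGeodesicFamily Γ U N b c) (hWN : W ⊆ N)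
    (hW : IsOpen W) {ρ : E × E → ℂ} (hρ : ContDiffOn ℝ ∞ ρ W) (hs : IsStar c W) :
    ContDiffOn ℝ ∞ (logAverage b c ρ) W := by
  have hw : IntervalIntegrable (fun s : ℝ => -Real.log s) volume 0 1 :=
    intervalIntegral.intervalIntegrable_log'.neg
  set Φ : (E × E) × E → ℂ := fun q => fderiv ℝ ρ q.1 (q.2, 0) with hΦ
  have hWo : IsOpen (W ×ˢ (univ : Set E)) := hW.prod isOpen_univ
  have hΦs : ContDiffOn ℝ ∞ Φ (W ×ˢ univ) := by
    have h1 : ContDiffOn ℝ ∞ (fun q : (E × E) × E => fderiv ℝ ρ q.1) (W ×ˢ univ) :=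
      (hρ.fderiv_of_isOpen hW (m := ∞) (by simp)).comp contDiffOn_fst fun q hq => hq.1
    exact h1.clm_apply (contDiffOn_snd.prodMk contDiffOn_const)
  have hpath : ContDiffOn ℝ ∞ (fun z => ((pairCurve (c z, constCurve z.2)).prodMk (b z) :
      C(unitInterval, (E × E) × E))) W := by
    have e1 : ∀ z, ((pairCurve (c z, constCurve z.2)).prodMk (b z) :
      C(unitInterval, (E × E) × E))
      = (ContinuousLinearMap.compLeftContinuous ℝ unitInterval
          (ContinuousLinearMap.inl ℝ (E × E) E)) (pairCurve (c z, constCurve z.2))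
        + (ContinuousLinearMap.compLeftContinuous ℝ unitInterval
          (ContinuousLinearMap.inr ℝ (E × E) E)) (b z) := by
      intro z
      ext s <;> simp
    simp only [e1]
    exact ((ContinuousLinearMap.contDiff _).comp_contDiffOn (h.contDiffOn_path.mono hWN)).add
      ((ContinuousLinearMap.contDiff _).comp_contDiffOn (h.contDiffOn_velocity.mono hWN))
  have hmem : ∀ z ∈ W, ((pairCurve (c z, constCurve z.2)).prodMk (b z) :
      C(unitInterval, (E × E) × E)) ∈ valuedIn unitInterval (W ×ˢ (univ : Set E)) :=
    fun z hz s => ⟨hs z hz s, trivial⟩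
  have h1 : ContDiffOn ℝ ∞ (fun z => weightedIntegral _ hw
      (superpose Φ ((pairCurve (c z, constCurve z.2)).prodMk (b z)))) W :=
    (weightedIntegral _ hw).contDiff.comp_contDiffOn
      ((contDiffOn_superpose hWo hΦs).comp hpath hmem)
  refine h1.congr fun z hz => ?_
  rw [weightedIntegral_apply, logAverage]
  refine intervalIntegral.integral_congr fun s _ => ?_
  simp only [extendCurve]
  rw [superpose_apply hΦs.continuousOn (hmem z hz)]
  rfl

lemma logAverage_diag (h : IsGeodesicFamily Γ U N b c) {y : E} (hy : (y, y) ∈ N)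
    (ρ : E × E → ℂ) : logAverage b c ρ (y, y) = 0 := by
  have h0 : ∀ s, extendCurve (b (y, y)) s = 0 := fun s => by
    rw [extendCurve, h.velocity_diag y hy]; rfl
  have h1 : ((0, 0) : E × E) = 0 := rfl
  simp [logAverage, h0, h1]

lemma fderiv_logAverage (h : IsGeodesicFamily Γ U N b c) (hWN : W ⊆ N)
    (hW : IsOpen W) {ρ : E × E → ℂ} (hρ : ContDiffOn ℝ ∞ ρ W) (hs : IsStar c W)
    (hρ0 : ∀ y, (y, y) ∈ W → ρ (y, y) = 0) {z : E × E} (hz : z ∈ W) :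
    fderiv ℝ (logAverage b c ρ) z (b z 1, 0) = ρ z := by
  set q : ℝ → ℂ := fun τ => fderiv ℝ ρ (extendCurve (c z) τ, z.2) (extendCurve (b z) τ, 0) with hq
  have hqc : Continuous q := by
    have h1 : Continuous fun t => fderiv ℝ ρ (extendCurve (c z) t, z.2) :=
      h.continuous_comp_path (hρ.continuousOn_fderiv_of_isOpen hW (by simp)) hs hz
    exact h1.clm_apply ((continuous_extendCurve _).prodMk continuous_const)
  have hlog : ∀ r : ℝ, IntervalIntegrable (fun τ => Real.log τ • q τ) volume 0 r := fun r =>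
    intervalIntegral.intervalIntegrable_log'.smul_continuousOn hqc.continuousOn
  -- The substitution τ = rs and log s = log τ - log r express the average at an intermediate point
  -- through integrals over [0, r]. In the derivative at r = 1 the two terms carrying log 1 vanish,
  -- and ∫₀¹q = ρ(z) remains because ρ is zero on the diagonal.
  have key : ∀ r ∈ Ioc (0 : ℝ) 1, logAverage b c ρ (extendCurve (c z) r, z.2)
      = Real.log r • (∫ τ in (0 : ℝ)..r, q τ) - ∫ τ in (0 : ℝ)..r, Real.log τ • q τ := by
    intro r hr
    have hr' : r ∈ Icc (0 : ℝ) 1 := ⟨hr.1.le, hr.2⟩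
    have hi : IntervalIntegrable (fun τ => Real.log r • q τ) volume 0 r :=
      Continuous.intervalIntegrable (by fun_prop) _ _
    rw [← intervalIntegral.integral_smul, ← intervalIntegral.integral_sub hi (hlog r)]
    have h1 := intervalIntegral.smul_integral_comp_mul_left (a := 0) (b := 1)
      (fun τ => Real.log r • q τ - Real.log τ • q τ) r
    rw [mul_zero, mul_one] at h1
    rw [← h1, logAverage, ← intervalIntegral.integral_smul]
    refine intervalIntegral.integral_congr_ae (ae_of_all _ fun s hs' => ?_)
    rw [uIoc_of_le zero_le_one] at hs'
    have hs'' : s ∈ Icc (0 : ℝ) 1 := ⟨hs'.1.le, hs'.2⟩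
    have h2 : ((r • extendCurve (b z) (r * s), 0) : E × E) = r • (extendCurve (b z) (r * s), 0) := by
      simp
    rw [h.extendCurve_rescale hWN hs hz hr' hs'', h.extendCurve_velocity_rescale hWN hs hz hr' hs'',
      Real.log_mul hr.1.ne' hs'.1.ne', h2, map_smul]
    simp only [hq, smul_smul, ← sub_smul]
    congr 1
    ring
  have hu := h.hasDerivWithinAt_comp_path_one hWN hW (h.contDiffOn_logAverage hWN hW hρ hs) hs hz
  have hρz : ∫ τ in (0 : ℝ)..1, q τ = ρ z := by
    have h1 := intervalIntegral.integral_eq_sub_of_hasDerivAt_of_le (f' := q) zero_le_one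
      (f := fun t => ρ (extendCurve (c z) t, z.2))
      (h.continuous_comp_path hρ.continuousOn hs hz).continuousOn
      (fun t ht => by
        have h2 := h.hasDerivWithinAt_comp_path hWN hW hρ hs hz ⟨t, Ioo_subset_Icc_self ht⟩
        have h3 := h2.hasDerivAt (Icc_mem_nhds ht.1 ht.2)
        simp only [← extendCurve_of_mem _ (Ioo_subset_Icc_self ht)] at h3
        exact h3) (hqc.intervalIntegrable _ _)
    have h3 : ∀ a : C(unitInterval, E), extendCurve a 1 = a 1 := fun a => extendCurve_coe a 1
    have h4 : ∀ a : C(unitInterval, E), extendCurve a 0 = a 0 := fun a => extendCurve_coe a 0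
    have h5 := hs z hz 0
    rw [h.curve_zero (hWN hz)] at h5
    rw [h1, h3, h4, h.curve_zero (hWN hz), h.curve_one z (hWN hz), hρ0 _ h5, sub_zero]
  have hd1 : HasDerivAt (fun r => ∫ τ in (0 : ℝ)..r, q τ) (q 1) 1 :=
    (hqc.integral_hasStrictDerivAt 0 1).hasDerivAt
  have hd2 : HasDerivAt (fun r => ∫ τ in (0 : ℝ)..r, Real.log τ • q τ) (Real.log 1 • q 1) 1 := by
    refine intervalIntegral.integral_hasDerivAt_right (hlog 1) ?_ ?_
    · exact (Measurable.stronglyMeasurable (by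
        have := hqc.measurable
        fun_prop)).stronglyMeasurableAtFilter
    · exact (Real.continuousAt_log one_ne_zero).smul hqc.continuousAt
  have hd3 := ((Real.hasDerivAt_log (one_ne_zero)).smul hd1).sub hd2
  have hd4 : HasDerivWithinAt (fun t => logAverage b c ρ (extendCurve (c z) t, z.2))
      (ρ z) (Icc 0 1) 1 := by
    refine (hd3.hasDerivWithinAt (s := Icc 0 1)).congr_of_eventuallyEq ?_ ?_ |>.congr_deriv ?_
    · have : Ioi (0 : ℝ) ∈ 𝓝[Icc 0 1] (1 : ℝ) := mem_nhdsWithin_of_mem_nhds (Ioi_mem_nhds one_pos)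
      filter_upwards [this, self_mem_nhdsWithin] with r hr1 hr2
      exact key r ⟨hr1, hr2.2⟩
    · exact key 1 (by simp)
    · simp [hρz]
  exact (uniqueDiffOn_Icc_zero_one (1 : ℝ) (by simp)).eq_deriv _ hu hd4

end IsGeodesicFamily

end Transport

/-! ### The metric and the vector field in a chart -/

section
variable {m : ℕ} {M : Type*} [TopologicalSpace M] [ChartedSpace (Euc m) M]
  [IsManifold (𝓡 m) ∞ M] {e : OpenPartialHomeomorph M (Euc m)}

lemma mdifferentiable_chart_of_mem (he : e ∈ IsManifold.maximalAtlas (𝓡 m) ∞ M) :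
    e.MDifferentiable (𝓡 m) (𝓡 m) :=
  ⟨(contMDiffOn_of_mem_maximalAtlas he).mdifferentiableOn (by simp),
    (contMDiffOn_symm_of_mem_maximalAtlas he).mdifferentiableOn (by simp)⟩

lemma contMDiffOn_coordVec (he : e ∈ IsManifold.maximalAtlas (𝓡 m) ∞ M) (j : Fin m) :
    ContMDiffOn (𝓡 m) (𝓡 m).tangent ∞
      (fun u => (⟨e.symm u, coordVec e u j⟩ : TangentBundle (𝓡 m) M)) e.target := by
  have h1 := (contMDiffOn_symm_of_mem_maximalAtlas he).contMDiffOn_tangentMapWithin (m := ∞)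
    (by simp) e.open_target.uniqueMDiffOn
  have h2 : ContMDiff (𝓡 m) (𝓡 m).tangent ∞ (fun u : Euc m =>
      (⟨u, EuclideanSpace.single j (1 : ℝ)⟩ : TangentBundle (𝓡 m) (Euc m))) := by
    intro u
    exact contMDiffAt_vectorSpace_iff_contDiffAt.2 contDiffAt_const
  refine (h1.comp h2.contMDiffOn (fun u hu => hu)).congr ?_
  intro u hu
  simp only [tangentMapWithin, Function.comp, coordVec]
  rw [mfderivWithin_of_mem_nhds (e.open_target.mem_nhds hu)]

lemma contDiffOn_vecCoord (he : e ∈ IsManifold.maximalAtlas (𝓡 m) ∞ M)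
    {A : (x : M) → TangentSpace (𝓡 m) x}
    (hA : ContMDiff (𝓡 m) (𝓡 m).tangent ∞ (fun x => (⟨x, A x⟩ : TangentBundle (𝓡 m) M)))
    (j : Fin m) : ContDiffOn ℝ ∞ (fun u => vecCoord e A u j) e.target := by
  have h1 := (contMDiffOn_of_mem_maximalAtlas he).contMDiffOn_tangentMapWithin (m := ∞)
    (by simp) e.open_source.uniqueMDiffOn
  have h2 := hA.comp_contMDiffOn (contMDiffOn_symm_of_mem_maximalAtlas he)
  have h3 := h1.comp h2 (fun u hu => e.map_target hu)
  have h4 : ContMDiffOn (𝓡 m) (𝓡 m).tangent ∞ (fun u : Euc m =>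
      (⟨u, mfderiv (𝓡 m) (𝓡 m) e (e.symm u) (A (e.symm u))⟩ : TangentBundle (𝓡 m) (Euc m)))
      e.target := by
    refine h3.congr ?_
    intro u hu
    simp only [tangentMapWithin, Function.comp]
    rw [mfderivWithin_of_mem_nhds (e.open_source.mem_nhds (e.map_target hu))]
    -- The base points e(e.symm u) and u agree, and the tangent fibres of the model space are all
    -- the same type.
    exact TotalSpace.ext (e.right_inv hu).symm HEq.rfl
  have h5 : ContDiffOn ℝ ∞ (fun u : Euc m =>
      (mfderiv (𝓡 m) (𝓡 m) e (e.symm u) (A (e.symm u)) : Euc m)) e.target := by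
    intro u hu
    exact contMDiffWithinAt_vectorSpace_iff_contDiffWithinAt.1 (h4 u hu)
  exact (EuclideanSpace.proj (𝕜 := ℝ) j).contDiff.comp_contDiffOn h5

variable [RiemannianBundle (fun x : M => TangentSpace (𝓡 m) x)]
    [IsContMDiffRiemannianBundle (𝓡 m) ∞ (HadamardParametrix.Euc m)
      (fun x : M => TangentSpace (𝓡 m) x)]
lemma contDiffOn_metric (he : e ∈ IsManifold.maximalAtlas (𝓡 m) ∞ M) (j k : Fin m) :
    ContDiffOn ℝ ∞ (fun u => metric e u j k) e.target := by
  rw [← contMDiffOn_iff_contDiffOn]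
  exact (contMDiffOn_coordVec he j).inner_bundle (contMDiffOn_coordVec he k)

/-- The inner product of the tangent space at `x`, on vectors of the model space. -/
def tangentInner (x : M) (v w : Euc m) : ℝ :=
  @inner ℝ (TangentSpace (𝓡 m) x) _ v w

/-- The differential of `e.symm`, with values in the model space. -/
def chartSymmDeriv (e : OpenPartialHomeomorph M (Euc m)) (u : Euc m) : Euc m →L[ℝ] Euc m :=
  mfderiv (𝓡 m) (𝓡 m) e.symm u

/-- The differential of `e`, with values in the model space. -/
def chartDeriv (e : OpenPartialHomeomorph M (Euc m)) (x : M) : Euc m →L[ℝ] Euc m :=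
  mfderiv (𝓡 m) (𝓡 m) e x

lemma chartSymmDeriv_injective (he : e ∈ IsManifold.maximalAtlas (𝓡 m) ∞ M) {u : Euc m}
    (hu : u ∈ e.target) : Function.Injective (chartSymmDeriv e u) :=
  (mdifferentiable_chart_of_mem he).symm.mfderiv_injective (x := u) hu

/-- The metric in the chart `e` as a bilinear form. -/
def metricForm (e : OpenPartialHomeomorph M (Euc m)) (u : Euc m) :
    Euc m →L[ℝ] Euc m →L[ℝ] ℝ :=
  ∑ j, ∑ k, metric e u j k •
    (EuclideanSpace.proj (𝕜 := ℝ) j : Euc m →L[ℝ] ℝ).smulRight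
      (EuclideanSpace.proj (𝕜 := ℝ) k : Euc m →L[ℝ] ℝ)

lemma metricForm_apply (u v w : Euc m) :
    metricForm e u v w = ∑ j, ∑ k, metric e u j k * v j * w k := by
  simp only [metricForm, FunLike.coe_sum, Finset.sum_apply, FunLike.coe_smul, Pi.smul_apply,
    ContinuousLinearMap.smulRight_apply, PiLp.proj_apply, smul_eq_mul, mul_assoc]

lemma euc_eq_sum (v : Euc m) : v = ∑ j, v j • (EuclideanSpace.single j (1 : ℝ) : Euc m) := by
  ext i
  simp [Finset.sum_apply, Pi.single_apply]

/-- The coordinate form is the pullback of the inner product by the differential of `e.symm`.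
Positivity, the transformation rule and the comparison with Riemannian lengths all use it in this
form. -/
lemma metricForm_eq_inner (u v w : Euc m) :
    metricForm e u v w = tangentInner (e.symm u) (chartSymmDeriv e u v) (chartSymmDeriv e u w) := by
  rw [metricForm_apply]
  conv_rhs => rw [euc_eq_sum v, euc_eq_sum w]
  simp only [map_sum, map_smul]
  have h : ∀ (x : M) (a b : Fin m → Euc m) (v w : Euc m),
      tangentInner x (∑ j, v j • a j) (∑ k, w k • b k)
        = ∑ j, ∑ k, v j * w k * tangentInner x (a j) (b k) := by
    intro x a b v w
    refine Eq.trans (sum_inner (𝕜 := ℝ) (E := TangentSpace (𝓡 m) x) Finset.univ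
      (fun j => v j • a j) (∑ k, w k • b k)) ?_
    refine Finset.sum_congr rfl fun j _ => ?_
    refine Eq.trans (inner_sum (𝕜 := ℝ) (E := TangentSpace (𝓡 m) x) Finset.univ
      (fun k => w k • b k) (v j • a j)) ?_
    refine Finset.sum_congr rfl fun k _ => ?_
    refine Eq.trans (real_inner_smul_left (F := TangentSpace (𝓡 m) x) _ _ _) ?_
    rw [mul_assoc]
    congr 1
    exact real_inner_smul_right (F := TangentSpace (𝓡 m) x) _ _ _
  rw [h]
  refine Finset.sum_congr rfl fun j _ => Finset.sum_congr rfl fun k _ => ?_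
  have : metric e u j k = tangentInner (e.symm u)
    (chartSymmDeriv e u (EuclideanSpace.single j 1)) (chartSymmDeriv e u (EuclideanSpace.single k 1)) := rfl
  rw [this]; ring

lemma isMetricOn_metricForm (he : e ∈ IsManifold.maximalAtlas (𝓡 m) ∞ M) :
    IsMetricOn (metricForm e) e.target where
  isOpen := e.open_target
  contDiffOn := by
    refine ContDiffOn.sum fun j _ => ContDiffOn.sum fun k _ => ?_
    exact (contDiffOn_metric he j k).smul contDiffOn_const
  symm u _ v w := by
    rw [metricForm_eq_inner, metricForm_eq_inner]
    exact real_inner_comm (F := TangentSpace (𝓡 m) (e.symm u)) _ _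
  pos u hu v hv := by
    rw [metricForm_eq_inner]
    refine (real_inner_self_pos (F := TangentSpace (𝓡 m) (e.symm u))).2 fun h => hv ?_
    exact chartSymmDeriv_injective he hu (h.trans (map_zero (chartSymmDeriv e u)).symm)

lemma metric_posDef (he : e ∈ IsManifold.maximalAtlas (𝓡 m) ∞ M) {u : Euc m}
    (hu : u ∈ e.target) : (metric e u).PosDef := by
  refine Matrix.PosDef.of_dotProduct_mulVec_pos ?_ ?_
  · ext j k
    exact real_inner_comm (F := TangentSpace (𝓡 m) (e.symm u)) _ _
  · intro x hx
    have h := (isMetricOn_metricForm he).pos u hu (WithLp.toLp 2 x) (by simpa using hx)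
    rw [metricForm_apply] at h
    simp only [dotProduct, Matrix.mulVec, star_trivial, Finset.mul_sum]
    refine h.trans_eq (Finset.sum_congr rfl fun j _ => Finset.sum_congr rfl fun k _ => ?_)
    simp; ring

lemma metric_det_pos (he : e ∈ IsManifold.maximalAtlas (𝓡 m) ∞ M) {u : Euc m}
    (hu : u ∈ e.target) : 0 < (metric e u).det := (metric_posDef he hu).det_pos

lemma volFactor_pos (he : e ∈ IsManifold.maximalAtlas (𝓡 m) ∞ M) {u : Euc m}
    (hu : u ∈ e.target) : 0 < volFactor e u := Real.sqrt_pos.2 (metric_det_pos he hu)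

lemma contDiffOn_det {E ι : Type*} [NormedAddCommGroup E] [NormedSpace ℝ E] [Fintype ι]
    [DecidableEq ι] {F : E → Matrix ι ι ℝ} {s : Set E}
    (h : ∀ i j, ContDiffOn ℝ ∞ (fun x => F x i j) s) : ContDiffOn ℝ ∞ (fun x => (F x).det) s := by
  simp only [Matrix.det_apply]
  refine ContDiffOn.sum fun σ _ => ContDiffOn.const_smul _ ?_
  exact contDiffOn_prod fun i _ => h _ _

lemma contDiffOn_inv {E ι : Type*} [NormedAddCommGroup E] [NormedSpace ℝ E] [Fintype ι]
    [DecidableEq ι] {F : E → Matrix ι ι ℝ} {s : Set E}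
    (h : ∀ i j, ContDiffOn ℝ ∞ (fun x => F x i j) s) (h0 : ∀ x ∈ s, (F x).det ≠ 0) (i j : ι) :
    ContDiffOn ℝ ∞ (fun x => (F x)⁻¹ i j) s := by
  simp only [Matrix.inv_def, Ring.inverse_eq_inv', Matrix.smul_apply, smul_eq_mul,
    Matrix.adjugate_apply]
  refine ((contDiffOn_det h).inv h0).mul (contDiffOn_det fun a b => ?_)
  simp only [Matrix.updateRow_apply]
  split_ifs
  · exact contDiffOn_const
  · exact h _ _

lemma contDiffOn_metricInv (he : e ∈ IsManifold.maximalAtlas (𝓡 m) ∞ M) (j k : Fin m) :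
    ContDiffOn ℝ ∞ (fun u => metricInv e u j k) e.target :=
  contDiffOn_inv (contDiffOn_metric he) (fun _ hu => (metric_det_pos he hu).ne') j k

lemma contDiffOn_volFactor (he : e ∈ IsManifold.maximalAtlas (𝓡 m) ∞ M) :
    ContDiffOn ℝ ∞ (volFactor e) e.target :=
  (contDiffOn_det (contDiffOn_metric he)).sqrt fun _ hu => (metric_det_pos he hu).ne'

/-! ### Change of charts -/

variable {e' : OpenPartialHomeomorph M (Euc m)}

/-- The change of coordinates from `e` to `e'`. -/
def transition (e e' : OpenPartialHomeomorph M (Euc m)) (u : Euc m) : Euc m := e' (e.symm u)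

/-- The Jacobian matrix of the change of coordinates. -/
def jacobian (e e' : OpenPartialHomeomorph M (Euc m)) (u : Euc m) : Matrix (Fin m) (Fin m) ℝ :=
  Matrix.of fun a j => fderiv ℝ (transition e e') u (EuclideanSpace.single j (1 : ℝ)) a

/-- The points of the chart `e` which lie in the domain of `e'`. -/
def overlap (e e' : OpenPartialHomeomorph M (Euc m)) : Set (Euc m) :=
  e.target ∩ e.symm ⁻¹' e'.source

lemma isOpen_overlap : IsOpen (overlap e e') := e.isOpen_inter_preimage_symm e'.open_source

lemma contDiffOn_transition (he : e ∈ IsManifold.maximalAtlas (𝓡 m) ∞ M)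
    (he' : e' ∈ IsManifold.maximalAtlas (𝓡 m) ∞ M) :
    ContDiffOn ℝ ∞ (transition e e') (overlap e e') := by
  rw [← contMDiffOn_iff_contDiffOn]
  exact (contMDiffOn_of_mem_maximalAtlas he').comp
    ((contMDiffOn_symm_of_mem_maximalAtlas he).mono inter_subset_left) fun u hu => hu.2

lemma transition_mem {u : Euc m} (hu : u ∈ overlap e e') : transition e e' u ∈ e'.target :=
  e'.map_source hu.2

lemma symm_transition {u : Euc m} (hu : u ∈ overlap e e') :
    e'.symm (transition e e' u) = e.symm u := e'.left_inv hu.2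

lemma differentiableAt_transition (he : e ∈ IsManifold.maximalAtlas (𝓡 m) ∞ M)
    (he' : e' ∈ IsManifold.maximalAtlas (𝓡 m) ∞ M) {u : Euc m} (hu : u ∈ overlap e e') :
    DifferentiableAt ℝ (transition e e') u :=
  ((contDiffOn_transition he he').contDiffAt (isOpen_overlap.mem_nhds hu)).differentiableAt
    (by simp)

lemma chartSymmDeriv_transition (he : e ∈ IsManifold.maximalAtlas (𝓡 m) ∞ M)
    (he' : e' ∈ IsManifold.maximalAtlas (𝓡 m) ∞ M) {u : Euc m} (hu : u ∈ overlap e e') :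
    chartSymmDeriv e u
      = (chartSymmDeriv e' (transition e e' u)).comp (fderiv ℝ (transition e e') u) := by
  have h1 : HasMFDerivAt (𝓡 m) (𝓡 m) (e'.symm ∘ transition e e') u
      ((mfderiv (𝓡 m) (𝓡 m) e'.symm (transition e e' u)).comp (fderiv ℝ (transition e e') u)) :=
    HasMFDerivAt.comp u
      ((mdifferentiable_chart_of_mem he').mdifferentiableAt_symm (transition_mem hu)).hasMFDerivAt
      (differentiableAt_transition he he' hu).hasFDerivAt.hasMFDerivAt
  have h2 : e.symm =ᶠ[𝓝 u] e'.symm ∘ transition e e' := by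
    filter_upwards [isOpen_overlap.mem_nhds hu] with v hv using (symm_transition hv).symm
  exact (h1.congr_of_eventuallyEq h2).mfderiv

lemma chartDeriv_transition (he : e ∈ IsManifold.maximalAtlas (𝓡 m) ∞ M)
    (he' : e' ∈ IsManifold.maximalAtlas (𝓡 m) ∞ M) {u : Euc m} (hu : u ∈ overlap e e') :
    chartDeriv e' (e.symm u) = (fderiv ℝ (transition e e') u).comp (chartDeriv e (e.symm u)) := by
  have hx : e.symm u ∈ e.source := e.map_target hu.1
  have hd := (differentiableAt_transition he he' hu).hasFDerivAt.hasMFDerivAt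
  have h1 : HasMFDerivAt (𝓡 m) (𝓡 m) (transition e e' ∘ e) (e.symm u)
      ((fderiv ℝ (transition e e') u).comp (mfderiv (𝓡 m) (𝓡 m) e (e.symm u))) := by
    refine HasMFDerivAt.comp (e.symm u) ?_
      ((mdifferentiable_chart_of_mem he).mdifferentiableAt hx).hasMFDerivAt
    rw [e.right_inv hu.1]
    exact hd
  have h2 : e' =ᶠ[𝓝 (e.symm u)] transition e e' ∘ e := by
    filter_upwards [e.open_source.mem_nhds hx] with x hx
    simp [transition, e.left_inv hx]
  exact (h1.congr_of_eventuallyEq h2).mfderiv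

lemma metricForm_transition (he : e ∈ IsManifold.maximalAtlas (𝓡 m) ∞ M)
    (he' : e' ∈ IsManifold.maximalAtlas (𝓡 m) ∞ M) {u : Euc m} (hu : u ∈ overlap e e')
    (v w : Euc m) : metricForm e u v w = metricForm e' (transition e e' u)
      (fderiv ℝ (transition e e') u v) (fderiv ℝ (transition e e') u w) := by
  rw [metricForm_eq_inner, metricForm_eq_inner, symm_transition hu,
    chartSymmDeriv_transition he he' hu]
  rfl

lemma fderiv_transition_apply (u v : Euc m) (a : Fin m) :
    fderiv ℝ (transition e e') u v a = ∑ j, jacobian e e' u a j * v j := by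
  conv_lhs => rw [euc_eq_sum v]
  simp [jacobian, mul_comm]

lemma vecCoord_transition (he : e ∈ IsManifold.maximalAtlas (𝓡 m) ∞ M)
    (he' : e' ∈ IsManifold.maximalAtlas (𝓡 m) ∞ M) {u : Euc m} (hu : u ∈ overlap e e')
    (A : (x : M) → TangentSpace (𝓡 m) x) (a : Fin m) :
    vecCoord e' A (transition e e' u) a = ∑ j, jacobian e e' u a j * vecCoord e A u j := by
  have h : ∀ (f : OpenPartialHomeomorph M (Euc m)) (v : Euc m) (i : Fin m),
      vecCoord f A v i = chartDeriv f (f.symm v) (A (f.symm v)) i := fun _ _ _ => rfl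
  simp only [h]
  rw [symm_transition hu, chartDeriv_transition he he' hu]
  exact fderiv_transition_apply _ _ _

end

/-! ### Partial derivatives -/

section PartialDerivatives

variable {m : ℕ}

lemma pd_congr {f g : Euc m → ℂ} {u : Euc m} (h : f =ᶠ[𝓝 u] g) (j : Fin m) :
    pd j f u = pd j g u := by
  rw [pd, pd, h.fderiv_eq]

lemma pd_eventuallyEq {f g : Euc m → ℂ} {u : Euc m} (h : f =ᶠ[𝓝 u] g) (j : Fin m) :
    pd j f =ᶠ[𝓝 u] pd j g := by
  filter_upwards [h.eventuallyEq_nhds] with v hv using pd_congr hv j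

lemma pd_add {f g : Euc m → ℂ} {u : Euc m} (hf : DifferentiableAt ℝ f u)
    (hg : DifferentiableAt ℝ g u) (j : Fin m) :
    pd j (fun v => f v + g v) u = pd j f u + pd j g u := by
  simp [pd, fderiv_fun_add hf hg]

lemma pd_mul {f g : Euc m → ℂ} {u : Euc m} (hf : DifferentiableAt ℝ f u)
    (hg : DifferentiableAt ℝ g u) (j : Fin m) :
    pd j (fun v => f v * g v) u = f u * pd j g u + g u * pd j f u := by
  simp [pd, fderiv_fun_mul hf hg]

lemma pd_const_mul {f : Euc m → ℂ} {u : Euc m} (hf : DifferentiableAt ℝ f u) (a : ℂ) (j : Fin m) :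
    pd j (fun v => a * f v) u = a * pd j f u := by
  simp [pd, fderiv_const_mul hf]

lemma pd_sum {ι : Type*} (s : Finset ι) {f : ι → Euc m → ℂ} {u : Euc m}
    (hf : ∀ i ∈ s, DifferentiableAt ℝ (f i) u) (j : Fin m) :
    pd j (fun v => ∑ i ∈ s, f i v) u = ∑ i ∈ s, pd j (f i) u := by
  simp [pd, fderiv_fun_sum hf]

lemma pd_ofReal {g : Euc m → ℝ} {u : Euc m} (hg : DifferentiableAt ℝ g u) (j : Fin m) :
    pd j (fun v => (g v : ℂ)) u = (fderiv ℝ g u (EuclideanSpace.single j 1) : ℝ) := by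
  have h : HasFDerivAt (fun v => (g v : ℂ)) (Complex.ofRealCLM.comp (fderiv ℝ g u)) u :=
    Complex.ofRealCLM.hasFDerivAt.comp u hg.hasFDerivAt
  rw [pd, h.fderiv]; rfl

lemma contDiffOn_ofReal {E : Type*} [NormedAddCommGroup E] [NormedSpace ℝ E] {g : E → ℝ}
    {s : Set E} (hg : ContDiffOn ℝ ∞ g s) : ContDiffOn ℝ ∞ (fun v => (g v : ℂ)) s :=
  Complex.ofRealCLM.contDiff.comp_contDiffOn hg

lemma pd_slice {F : Euc m × Euc m → ℂ} {z : Euc m × Euc m} (hF : DifferentiableAt ℝ F z)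
    (j : Fin m) :
    pd j (fun v => F (v, z.2)) z.1 = fderiv ℝ F z (EuclideanSpace.single j 1, 0) := by
  have h1 : HasFDerivAt (fun v : Euc m => (v, z.2)) (ContinuousLinearMap.inl ℝ _ _) z.1 :=
    (hasFDerivAt_id z.1).prodMk (hasFDerivAt_const _ _)
  have h2 : HasFDerivAt (fun v => F (v, z.2)) _ z.1 :=
    HasFDerivAt.comp (g := F) z.1 hF.hasFDerivAt h1
  rw [pd, h2.fderiv]; simp

/-- The operators differentiate in x with y frozen, while the coefficients must be smooth in the
pair (x, y). -/
lemma contDiffOn_pd_slice {F : Euc m × Euc m → ℂ} {W : Set (Euc m × Euc m)} (hW : IsOpen W)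
    (hF : ContDiffOn ℝ ∞ F W) (j : Fin m) :
    ContDiffOn ℝ ∞ (fun z => pd j (fun v => F (v, z.2)) z.1) W := by
  refine ((hF.fderiv_of_isOpen hW (m := ∞) (by simp)).clm_apply contDiffOn_const).congr
    fun z hz => pd_slice ((hF.contDiffAt (hW.mem_nhds hz)).differentiableAt (by simp)) j

/-- With a dummy second variable, smoothness statements in one variable follow from those with a
parameter. -/
lemma contDiffOn_of_slice {f : Euc m → ℂ} {V : Set (Euc m)}
    (h : ContDiffOn ℝ ∞ (fun z : Euc m × Euc m => f z.1) (V ×ˢ univ)) : ContDiffOn ℝ ∞ f V :=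
  h.comp (f := fun v : Euc m => (v, (0 : Euc m))) (by fun_prop) fun v hv => ⟨hv, trivial⟩

lemma contDiffOn_slice {f : Euc m → ℂ} {V : Set (Euc m)} (h : ContDiffOn ℝ ∞ f V) :
    ContDiffOn ℝ ∞ (fun z : Euc m × Euc m => f z.1) (V ×ˢ univ) :=
  h.comp contDiffOn_fst fun _ hz => hz.1

end PartialDerivatives

/-! ### Smoothness of the differential operators -/

section Smoothness

variable {m : ℕ} {M : Type*} [TopologicalSpace M] [ChartedSpace (Euc m) M]
  [IsManifold (𝓡 m) ∞ M] [RiemannianBundle (fun x : M => TangentSpace (𝓡 m) x)]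
  [IsContMDiffRiemannianBundle (𝓡 m) ∞ (Euc m) (fun x : M => TangentSpace (𝓡 m) x)]
  {e e' : OpenPartialHomeomorph M (Euc m)} {A : (x : M) → TangentSpace (𝓡 m) x}

lemma contDiffOn_gradient_slice (he : e ∈ IsManifold.maximalAtlas (𝓡 m) ∞ M)
    {W : Set (Euc m × Euc m)} (hW : IsOpen W) (hWe : ∀ z ∈ W, z.1 ∈ e.target)
    {F : Euc m × Euc m → ℂ} (hF : ContDiffOn ℝ ∞ F W) (j : Fin m) :
    ContDiffOn ℝ ∞ (fun z => gradient e (fun v => F (v, z.2)) j z.1) W := by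
  refine ContDiffOn.sum fun k _ => ContDiffOn.mul ?_ (contDiffOn_pd_slice hW hF k)
  exact (contDiffOn_ofReal (contDiffOn_metricInv he j k)).comp contDiffOn_fst hWe

lemma contDiffOn_divergence_slice (he : e ∈ IsManifold.maximalAtlas (𝓡 m) ∞ M)
    {W : Set (Euc m × Euc m)} (hW : IsOpen W) (hWe : ∀ z ∈ W, z.1 ∈ e.target)
    {X : Fin m → Euc m × Euc m → ℂ} (hX : ∀ j, ContDiffOn ℝ ∞ (X j) W) :
    ContDiffOn ℝ ∞ (fun z => divergence e (fun j v => X j (v, z.2)) z.1) W := by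
  have hv : ContDiffOn ℝ ∞ (fun z : Euc m × Euc m => volFactor e z.1) W :=
    (contDiffOn_volFactor he).comp contDiffOn_fst hWe
  refine ContDiffOn.mul (contDiffOn_ofReal (hv.inv fun z hz => (volFactor_pos he (hWe z hz)).ne'))
    (ContDiffOn.sum fun j _ => ?_)
  exact contDiffOn_pd_slice (F := fun z => (volFactor e z.1 : ℂ) * X j z) hW
    ((contDiffOn_ofReal hv).mul (hX j)) j

lemma contDiffOn_magneticGradient_slice (he : e ∈ IsManifold.maximalAtlas (𝓡 m) ∞ M)
    (hA : ContMDiff (𝓡 m) (𝓡 m).tangent ∞ (fun x => (⟨x, A x⟩ : TangentBundle (𝓡 m) M)))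
    {W : Set (Euc m × Euc m)} (hW : IsOpen W) (hWe : ∀ z ∈ W, z.1 ∈ e.target)
    {F : Euc m × Euc m → ℂ} (hF : ContDiffOn ℝ ∞ F W) (j : Fin m) :
    ContDiffOn ℝ ∞ (fun z => magneticGradient e A (fun v => F (v, z.2)) j z.1) W := by
  refine (contDiffOn_const.mul (contDiffOn_gradient_slice he hW hWe hF j)).add
    (ContDiffOn.mul ?_ hF)
  exact (contDiffOn_ofReal (contDiffOn_vecCoord he hA j)).comp contDiffOn_fst hWe

lemma contDiffOn_magneticOp_slice (he : e ∈ IsManifold.maximalAtlas (𝓡 m) ∞ M)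
    (hA : ContMDiff (𝓡 m) (𝓡 m).tangent ∞ (fun x => (⟨x, A x⟩ : TangentBundle (𝓡 m) M)))
    {W : Set (Euc m × Euc m)} (hW : IsOpen W) (hWe : ∀ z ∈ W, z.1 ∈ e.target)
    {F : Euc m × Euc m → ℂ} (hF : ContDiffOn ℝ ∞ F W) (c : ℝ) :
    ContDiffOn ℝ ∞ (fun z => magneticOp e A c (fun v => F (v, z.2)) z.1) W := by
  have hm := contDiffOn_magneticGradient_slice he hA hW hWe hF
  refine ((contDiffOn_const.mul (contDiffOn_divergence_slice he hW hWe
    (X := fun j z => magneticGradient e A (fun v => F (v, z.2)) j z.1) hm)).add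
    (ContDiffOn.sum fun j _ => ContDiffOn.sum fun k _ => (ContDiffOn.mul ?_ ?_).mul (hm k))).add
    (contDiffOn_const.mul hF)
  · exact (contDiffOn_ofReal (contDiffOn_metric he j k)).comp contDiffOn_fst hWe
  · exact (contDiffOn_ofReal (contDiffOn_vecCoord he hA j)).comp contDiffOn_fst hWe

lemma contDiffOn_laplaceBeltrami_slice (he : e ∈ IsManifold.maximalAtlas (𝓡 m) ∞ M)
    {W : Set (Euc m × Euc m)} (hW : IsOpen W) (hWe : ∀ z ∈ W, z.1 ∈ e.target)
    {F : Euc m × Euc m → ℂ} (hF : ContDiffOn ℝ ∞ F W) :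
    ContDiffOn ℝ ∞ (fun z => laplaceBeltrami e (fun v => F (v, z.2)) z.1) W :=
  contDiffOn_divergence_slice he hW hWe
    (X := fun j z => gradient e (fun v => F (v, z.2)) j z.1)
    (contDiffOn_gradient_slice he hW hWe hF)

lemma contDiffOn_gradient (he : e ∈ IsManifold.maximalAtlas (𝓡 m) ∞ M) {V : Set (Euc m)}
    (hV : IsOpen V) (hVe : V ⊆ e.target) {f : Euc m → ℂ} (hf : ContDiffOn ℝ ∞ f V) (j : Fin m) :
    ContDiffOn ℝ ∞ (gradient e f j) V :=
  contDiffOn_of_slice (contDiffOn_gradient_slice he (hV.prod isOpen_univ)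
    (fun _ hz => hVe hz.1) (contDiffOn_slice hf) j)

lemma contDiffOn_magneticGradient (he : e ∈ IsManifold.maximalAtlas (𝓡 m) ∞ M)
    (hA : ContMDiff (𝓡 m) (𝓡 m).tangent ∞ (fun x => (⟨x, A x⟩ : TangentBundle (𝓡 m) M)))
    {V : Set (Euc m)}
    (hV : IsOpen V) (hVe : V ⊆ e.target) {f : Euc m → ℂ} (hf : ContDiffOn ℝ ∞ f V) (j : Fin m) :
    ContDiffOn ℝ ∞ (magneticGradient e A f j) V :=
  contDiffOn_of_slice (contDiffOn_magneticGradient_slice he hA (hV.prod isOpen_univ)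
    (fun _ hz => hVe hz.1) (contDiffOn_slice hf) j)

lemma contDiffOn_magneticOp (he : e ∈ IsManifold.maximalAtlas (𝓡 m) ∞ M)
    (hA : ContMDiff (𝓡 m) (𝓡 m).tangent ∞ (fun x => (⟨x, A x⟩ : TangentBundle (𝓡 m) M)))
    {V : Set (Euc m)}
    (hV : IsOpen V) (hVe : V ⊆ e.target) {f : Euc m → ℂ} (hf : ContDiffOn ℝ ∞ f V) (c : ℝ) :
    ContDiffOn ℝ ∞ (magneticOp e A c f) V :=
  contDiffOn_of_slice (contDiffOn_magneticOp_slice he hA (hV.prod isOpen_univ)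
    (fun _ hz => hVe hz.1) (contDiffOn_slice hf) c)

/-! ### Congruence lemmas -/

lemma gradient_eventuallyEq {f g : Euc m → ℂ} {u : Euc m} (h : f =ᶠ[𝓝 u] g) (j : Fin m) :
    gradient e f j =ᶠ[𝓝 u] gradient e g j := by
  have h1 : ∀ᶠ v in 𝓝 u, ∀ k, pd k f v = pd k g v :=
    Filter.eventually_all.2 fun k => pd_eventuallyEq h k
  filter_upwards [h1] with v hv
  simp only [gradient, hv]

lemma divergence_congr {X Y : Fin m → Euc m → ℂ} {u : Euc m} (h : ∀ j, X j =ᶠ[𝓝 u] Y j) :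
    divergence e X u = divergence e Y u := by
  rw [divergence, divergence]
  congr 1
  refine Finset.sum_congr rfl fun j _ => pd_congr ?_ j
  filter_upwards [h j] with v hv
  rw [hv]

lemma magneticGradient_eventuallyEq {f g : Euc m → ℂ} {u : Euc m} (h : f =ᶠ[𝓝 u] g) (j : Fin m) :
    magneticGradient e A f j =ᶠ[𝓝 u] magneticGradient e A g j := by
  filter_upwards [gradient_eventuallyEq (e := e) h j, h] with v h1 h2
  rw [magneticGradient, magneticGradient, h1, h2]

lemma magneticOp_congr {f g : Euc m → ℂ} {u : Euc m} (h : f =ᶠ[𝓝 u] g) (c : ℝ) :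
    magneticOp e A c f u = magneticOp e A c g u := by
  have h1 := fun j => magneticGradient_eventuallyEq (e := e) (A := A) h j
  simp only [magneticOp, divergence_congr h1, h.eq_of_nhds, (h1 _).eq_of_nhds]

lemma radialDeriv_congr {M : Type*} [EMetricSpace M] [ChartedSpace (Euc m) M]
    [RiemannianBundle (fun x : M => TangentSpace (𝓡 m) x)] {e : OpenPartialHomeomorph M (Euc m)}
    {y : M} {f g : Euc m → ℂ} {u : Euc m} (h : f =ᶠ[𝓝 u] g) :
    radialDeriv e y f u = radialDeriv e y g u := by
  simp only [radialDeriv, pd_congr h]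

/-! ### The divergence -/

/-- The logarithmic derivative of the volume factor. -/
def logVol (e : OpenPartialHomeomorph M (Euc m)) (j : Fin m) (u : Euc m) : ℂ :=
  ((volFactor e u)⁻¹ : ℝ) * pd j (fun v => (volFactor e v : ℂ)) u

lemma differentiableAt_volFactor (he : e ∈ IsManifold.maximalAtlas (𝓡 m) ∞ M) {u : Euc m}
    (hu : u ∈ e.target) : DifferentiableAt ℝ (volFactor e) u :=
  ((contDiffOn_volFactor he).contDiffAt (e.open_target.mem_nhds hu)).differentiableAt (by simp)

/-- The density is expanded into its logarithmic derivative. In this form the Leibniz rules are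
termwise, and the effect of a change of charts can be read off. -/
lemma divergence_eq (he : e ∈ IsManifold.maximalAtlas (𝓡 m) ∞ M) {u : Euc m}
    (hu : u ∈ e.target) {X : Fin m → Euc m → ℂ} (hX : ∀ j, DifferentiableAt ℝ (X j) u) :
    divergence e X u = ∑ j, pd j (X j) u + ∑ j, X j u * logVol e j u := by
  have hv := differentiableAt_volFactor he hu
  have hv' : DifferentiableAt ℝ (fun v => (volFactor e v : ℂ)) u :=
    Complex.ofRealCLM.differentiableAt.comp u hv
  have h0 : (volFactor e u : ℂ) ≠ 0 := by exact_mod_cast (volFactor_pos he hu).ne'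
  rw [divergence, Finset.mul_sum, ← Finset.sum_add_distrib]
  refine Finset.sum_congr rfl fun j _ => ?_
  rw [pd_mul hv' (hX j), logVol]
  push_cast
  field_simp

lemma divergence_mul (he : e ∈ IsManifold.maximalAtlas (𝓡 m) ∞ M) {u : Euc m}
    (hu : u ∈ e.target) {X : Fin m → Euc m → ℂ} (hX : ∀ j, DifferentiableAt ℝ (X j) u)
    {h : Euc m → ℂ} (hh : DifferentiableAt ℝ h u) :
    divergence e (fun j v => h v * X j v) u = h u * divergence e X u + ∑ j, X j u * pd j h u := by
  rw [divergence_eq he hu hX, divergence_eq he hu (fun j => hh.fun_mul (hX j))]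
  simp only [mul_add, Finset.mul_sum, ← Finset.sum_add_distrib]
  refine Finset.sum_congr rfl fun j _ => ?_
  rw [pd_mul hh (hX j) j]
  ring

lemma divergence_add (he : e ∈ IsManifold.maximalAtlas (𝓡 m) ∞ M) {u : Euc m}
    (hu : u ∈ e.target) {X Y : Fin m → Euc m → ℂ} (hX : ∀ j, DifferentiableAt ℝ (X j) u)
    (hY : ∀ j, DifferentiableAt ℝ (Y j) u) :
    divergence e (fun j v => X j v + Y j v) u = divergence e X u + divergence e Y u := by
  rw [divergence_eq he hu hX, divergence_eq he hu hY,
    divergence_eq he hu (fun j => (hX j).fun_add (hY j))]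
  simp only [pd_add (hX _) (hY _), add_mul, Finset.sum_add_distrib]
  ring

lemma divergence_const_mul (he : e ∈ IsManifold.maximalAtlas (𝓡 m) ∞ M) {u : Euc m}
    (hu : u ∈ e.target) {X : Fin m → Euc m → ℂ} (hX : ∀ j, DifferentiableAt ℝ (X j) u) (a : ℂ) :
    divergence e (fun j v => a * X j v) u = a * divergence e X u := by
  rw [divergence_mul he hu hX (differentiableAt_const a)]
  simp [pd]

end Smoothness

/-! ### Invariance under changes of charts -/

section Jacobi

lemma two_le_infty : (2 : WithTop ℕ∞) ≤ (∞ : WithTop ℕ∞) :=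
  WithTop.coe_le_coe.2 (le_top : (2 : ℕ∞) ≤ ⊤)

/-- Jacobi's formula for the derivative of the determinant. -/
lemma hasFDerivAt_det {E ι : Type*} [NormedAddCommGroup E] [NormedSpace ℝ E] [Fintype ι]
    [DecidableEq ι] {F : E → Matrix ι ι ℝ} {F' : ι → ι → E →L[ℝ] ℝ} {x : E}
    (h : ∀ i j, HasFDerivAt (fun x => F x i j) (F' i j) x) :
    HasFDerivAt (fun x => (F x).det) (∑ i, ∑ j, (F x).adjugate i j • F' j i) x := by
  have h1 : HasFDerivAt (fun x => ∑ σ : Equiv.Perm ι, ((Equiv.Perm.sign σ : ℤ) : ℝ) •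
        ∏ i, F x (σ i) i)
      (∑ σ : Equiv.Perm ι, ((Equiv.Perm.sign σ : ℤ) : ℝ) •
        ∑ i, (∏ j ∈ Finset.univ.erase i, F x (σ j) j) • F' (σ i) i) x :=
    HasFDerivAt.fun_sum fun σ _ => (HasFDerivAt.finsetProd fun i _ => h (σ i) i).fun_const_smul _
  have h0 : ∀ A : Matrix ι ι ℝ, A.det
      = ∑ σ : Equiv.Perm ι, ((Equiv.Perm.sign σ : ℤ) : ℝ) • ∏ i, A (σ i) i := by
    intro A
    rw [Matrix.det_apply]
    refine Finset.sum_congr rfl fun σ _ => ?_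
    rw [Units.smul_def, ← Int.cast_smul_eq_zsmul ℝ]
  simp only [h0]
  refine h1.congr_fderiv (ContinuousLinearMap.ext fun v => ?_)
  -- By Cramer's rule this is the determinant with column i replaced by its derivative, the i-th
  -- term of the product rule.
  have h3 : ∀ i, ∑ j, (F x).adjugate i j * F' j i v
      = ((F x).updateCol i fun j => F' j i v).det := by
    intro i
    rw [← Matrix.cramer_apply, Matrix.cramer_eq_adjugate_mulVec]
    rfl
  simp only [FunLike.coe_sum, Finset.sum_apply, FunLike.coe_smul, Pi.smul_apply, smul_eq_mul, h3,
    h0, Finset.mul_sum]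
  rw [Finset.sum_comm]
  refine Finset.sum_congr rfl fun i _ => Finset.sum_congr rfl fun σ _ => ?_
  congr 1
  rw [← Finset.mul_prod_erase Finset.univ _ (Finset.mem_univ i), Matrix.updateCol_self, mul_comm]
  congr 1
  refine Finset.prod_congr rfl fun j hj => ?_
  rw [Matrix.updateCol_ne (Finset.ne_of_mem_erase hj)]

/-- The linear algebra behind the invariance of the divergence. P holds the partial derivatives of
the new components, `key` is the chain rule PJ = J dXᵀ + (X·H), and the trace is taken after
multiplication by J⁻¹. Symmetry of H turns the last term into X_j tr(J⁻¹∂_jJ). -/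
lemma trace_transition {ι : Type*} [Fintype ι] [DecidableEq ι] {J Ji P dX : Matrix ι ι ℂ}
    {X : ι → ℂ} {H : ι → ι → ι → ℂ} (h : J * Ji = 1) (hH : ∀ k a j, H k a j = H j a k)
    (key : ∀ a k, ∑ b, J b k * P a b = ∑ j, (J a j * dX k j + X j * H k a j)) :
    ∑ a, P a a = ∑ k, dX k k + ∑ j, X j * ∑ k, ∑ a, Ji k a * H j a k := by
  have h' : Ji * J = 1 := mul_eq_one_comm.1 h
  have key' : P * J = J * dX.transpose + Matrix.of fun a k => ∑ j, X j * H k a j := by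
    ext a k
    simp only [Matrix.mul_apply, Matrix.add_apply, Matrix.of_apply, Matrix.transpose_apply]
    rw [← Finset.sum_add_distrib, ← key a k]
    exact Finset.sum_congr rfl fun b _ => mul_comm _ _
  have h1 : P.trace = (P * J * Ji).trace := by rw [mul_assoc, h, mul_one]
  rw [key', add_mul, Matrix.trace_add, Matrix.trace_mul_cycle, h', one_mul,
    Matrix.trace_transpose] at h1
  refine h1.trans ?_
  congr 1
  simp only [Matrix.trace, Matrix.diag, Matrix.mul_apply, Matrix.of_apply, Finset.mul_sum,
    Finset.sum_mul]
  rw [Finset.sum_congr rfl fun a _ => Finset.sum_comm]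
  rw [Finset.sum_comm]
  refine Finset.sum_congr rfl fun j _ => ?_
  rw [Finset.sum_comm]
  refine Finset.sum_congr rfl fun k _ => Finset.sum_congr rfl fun a _ => ?_
  rw [hH k a j]; ring

end Jacobi

section Invariance

variable {m : ℕ} {M : Type*} [TopologicalSpace M] [ChartedSpace (Euc m) M]
  [IsManifold (𝓡 m) ∞ M] [RiemannianBundle (fun x : M => TangentSpace (𝓡 m) x)]
  [IsContMDiffRiemannianBundle (𝓡 m) ∞ (Euc m) (fun x : M => TangentSpace (𝓡 m) x)]
  {e e' : OpenPartialHomeomorph M (Euc m)} {A : (x : M) → TangentSpace (𝓡 m) x}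

lemma metricForm_single (u : Euc m) (j k : Fin m) :
    metricForm e u (EuclideanSpace.single j 1) (EuclideanSpace.single k 1) = metric e u j k := by
  rw [metricForm_apply]
  simp

lemma metric_transition (he : e ∈ IsManifold.maximalAtlas (𝓡 m) ∞ M)
    (he' : e' ∈ IsManifold.maximalAtlas (𝓡 m) ∞ M) {u : Euc m} (hu : u ∈ overlap e e') :
    metric e u = (jacobian e e' u).transpose * metric e' (transition e e' u) * jacobian e e' u := by
  ext j k
  rw [← metricForm_single, metricForm_transition he he' hu, metricForm_apply]
  simp only [Matrix.mul_apply, Matrix.transpose_apply, Finset.sum_mul]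
  rw [Finset.sum_comm]
  refine Finset.sum_congr rfl fun b _ => Finset.sum_congr rfl fun a _ => ?_
  simp only [jacobian, Matrix.of_apply]
  ring

lemma jacobian_det_ne_zero (he : e ∈ IsManifold.maximalAtlas (𝓡 m) ∞ M)
    (he' : e' ∈ IsManifold.maximalAtlas (𝓡 m) ∞ M) {u : Euc m} (hu : u ∈ overlap e e') :
    (jacobian e e' u).det ≠ 0 := by
  intro h
  have h1 := metric_det_pos he hu.1
  rw [metric_transition he he' hu, Matrix.det_mul, h] at h1
  simp at h1

lemma metricInv_transition (he : e ∈ IsManifold.maximalAtlas (𝓡 m) ∞ M)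
    (he' : e' ∈ IsManifold.maximalAtlas (𝓡 m) ∞ M) {u : Euc m} (hu : u ∈ overlap e e') :
    metricInv e' (transition e e' u)
      = jacobian e e' u * metricInv e u * (jacobian e e' u).transpose := by
  have h1 : IsUnit (jacobian e e' u).det := (jacobian_det_ne_zero he he' hu).isUnit
  have h2 : IsUnit (jacobian e e' u).transpose.det := by rwa [Matrix.det_transpose]
  rw [metricInv, metricInv, metric_transition he he' hu, Matrix.mul_inv_rev, Matrix.mul_inv_rev,
    Matrix.mul_nonsing_inv_cancel_left _ _ h1, Matrix.nonsing_inv_mul_cancel_right _ _ h2]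

lemma volFactor_transition (he : e ∈ IsManifold.maximalAtlas (𝓡 m) ∞ M)
    (he' : e' ∈ IsManifold.maximalAtlas (𝓡 m) ∞ M) {u : Euc m} (hu : u ∈ overlap e e') :
    volFactor e u = |(jacobian e e' u).det| * volFactor e' (transition e e' u) := by
  rw [volFactor, volFactor, metric_transition he he' hu, Matrix.det_mul, Matrix.det_mul,
    Matrix.det_transpose, mul_right_comm, ← sq, Real.sqrt_mul (sq_nonneg _), Real.sqrt_sq_eq_abs]

lemma pd_transition (he : e ∈ IsManifold.maximalAtlas (𝓡 m) ∞ M)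
    (he' : e' ∈ IsManifold.maximalAtlas (𝓡 m) ∞ M) {u : Euc m} (hu : u ∈ overlap e e')
    {f f' : Euc m → ℂ} (hf : DifferentiableAt ℝ f' (transition e e' u))
    (hff' : f =ᶠ[𝓝 u] f' ∘ transition e e') (k : Fin m) :
    pd k f u = ∑ a, (jacobian e e' u a k : ℂ) * pd a f' (transition e e' u) := by
  have h1 := (hf.hasFDerivAt.comp u (differentiableAt_transition he he' hu).hasFDerivAt).congr_of_eventuallyEq hff'
  rw [pd, h1.fderiv, ContinuousLinearMap.comp_apply,
    euc_eq_sum (fderiv ℝ (transition e e') u (EuclideanSpace.single k 1)), map_sum]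
  refine Finset.sum_congr rfl fun a _ => ?_
  rw [map_smul, Complex.real_smul]
  rfl

lemma gradient_transition (he : e ∈ IsManifold.maximalAtlas (𝓡 m) ∞ M)
    (he' : e' ∈ IsManifold.maximalAtlas (𝓡 m) ∞ M) {u : Euc m} (hu : u ∈ overlap e e')
    {f f' : Euc m → ℂ} (hf : DifferentiableAt ℝ f' (transition e e' u))
    (hff' : f =ᶠ[𝓝 u] f' ∘ transition e e') (a : Fin m) :
    gradient e' f' a (transition e e' u) = ∑ j, (jacobian e e' u a j : ℂ) * gradient e f j u := by
  simp only [gradient, pd_transition he he' hu hf hff', metricInv_transition he he' hu,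
    Matrix.mul_apply, Matrix.transpose_apply, Complex.ofReal_sum, Complex.ofReal_mul,
    Finset.sum_mul, Finset.mul_sum]
  rw [Finset.sum_congr rfl fun b _ => Finset.sum_comm, Finset.sum_comm]
  refine Finset.sum_congr rfl fun j _ => ?_
  rw [Finset.sum_comm]
  refine Finset.sum_congr rfl fun k _ => Finset.sum_congr rfl fun b _ => ?_
  ring

lemma magneticGradient_transition (he : e ∈ IsManifold.maximalAtlas (𝓡 m) ∞ M)
    (he' : e' ∈ IsManifold.maximalAtlas (𝓡 m) ∞ M) {u : Euc m} (hu : u ∈ overlap e e')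
    {f f' : Euc m → ℂ} (hf : DifferentiableAt ℝ f' (transition e e' u))
    (hff' : f =ᶠ[𝓝 u] f' ∘ transition e e') (a : Fin m) :
    magneticGradient e' A f' a (transition e e' u)
      = ∑ j, (jacobian e e' u a j : ℂ) * magneticGradient e A f j u := by
  simp only [magneticGradient, gradient_transition he he' hu hf hff',
    vecCoord_transition he he' hu, mul_add, Finset.sum_add_distrib, Complex.ofReal_sum,
    Complex.ofReal_mul, Finset.mul_sum, Finset.sum_mul, hff'.eq_of_nhds, Function.comp]
  congr 1 <;> exact Finset.sum_congr rfl fun j _ => by ring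

lemma contDiffAt_jacobian (he : e ∈ IsManifold.maximalAtlas (𝓡 m) ∞ M)
    (he' : e' ∈ IsManifold.maximalAtlas (𝓡 m) ∞ M) {u : Euc m} (hu : u ∈ overlap e e')
    (a j : Fin m) : DifferentiableAt ℝ (fun v => jacobian e e' v a j) u := by
  have h1 : ContDiffAt ℝ 1 (fderiv ℝ (transition e e')) u :=
    ((contDiffOn_transition he he').contDiffAt (isOpen_overlap.mem_nhds hu)).fderiv_right
      (m := 1) (by rw [one_add_one_eq_two]; exact two_le_infty)
  have h2 : DifferentiableAt ℝ (fun v => fderiv ℝ (transition e e') v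
      (EuclideanSpace.single j (1 : ℝ))) u :=
    (h1.differentiableAt (by simp)).clm_apply (differentiableAt_const _)
  exact (EuclideanSpace.proj (𝕜 := ℝ) a).differentiableAt.comp u h2

/-- The second derivatives of the change of coordinates. -/
def transitionHess (e e' : OpenPartialHomeomorph M (Euc m)) (u : Euc m) (k a j : Fin m) : ℝ :=
  fderiv ℝ (fun v => jacobian e e' v a j) u (EuclideanSpace.single k 1)

lemma transitionHess_symm (he : e ∈ IsManifold.maximalAtlas (𝓡 m) ∞ M)
    (he' : e' ∈ IsManifold.maximalAtlas (𝓡 m) ∞ M) {u : Euc m} (hu : u ∈ overlap e e')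
    (k a j : Fin m) : transitionHess e e' u k a j = transitionHess e e' u j a k := by
  have h0 := (contDiffOn_transition he he').contDiffAt (isOpen_overlap.mem_nhds hu)
  have h1 : DifferentiableAt ℝ (fderiv ℝ (transition e e')) u :=
    (h0.fderiv_right (m := 1) (by rw [one_add_one_eq_two]; exact two_le_infty)).differentiableAt (by simp)
  have hs : IsSymmSndFDerivAt ℝ (transition e e') u :=
    h0.isSymmSndFDerivAt (by simp only [minSmoothness_of_isRCLikeNormedField]; exact two_le_infty)
  have key : ∀ k j : Fin m, transitionHess e e' u k a j
      = fderiv ℝ (fderiv ℝ (transition e e')) u (EuclideanSpace.single k 1)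
        (EuclideanSpace.single j 1) a := by
    intro k j
    have h2 : HasFDerivAt (fun v => fderiv ℝ (transition e e') v
        (EuclideanSpace.single j (1 : ℝ))) _ u :=
      h1.hasFDerivAt.clm_apply (hasFDerivAt_const _ _)
    have h3 : HasFDerivAt (fun v => jacobian e e' v a j) _ u :=
      (EuclideanSpace.proj (𝕜 := ℝ) a).hasFDerivAt.comp u h2
    rw [transitionHess, h3.fderiv]
    simp
  rw [key, key, hs]

/-- The logarithmic derivative of the Jacobian determinant. -/
def logJacobian (e e' : OpenPartialHomeomorph M (Euc m)) (u : Euc m) (j : Fin m) : ℝ :=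
  ∑ k, ∑ a, (jacobian e e' u)⁻¹ k a * transitionHess e e' u j a k

/-- The logarithmic derivative of the rule |g|^{1/2} = |det J| · |g'|^{1/2}, with Jacobi's formula
for det J. -/
lemma logVol_transition (he : e ∈ IsManifold.maximalAtlas (𝓡 m) ∞ M)
    (he' : e' ∈ IsManifold.maximalAtlas (𝓡 m) ∞ M) {u : Euc m} (hu : u ∈ overlap e e')
    (j : Fin m) :
    logVol e j u = ∑ a, (jacobian e e' u a j : ℂ) * logVol e' a (transition e e' u)
      + logJacobian e e' u j := by
  set d := (jacobian e e' u).det with hd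
  have hd0 : d ≠ 0 := jacobian_det_ne_zero he he' hu
  have hv := differentiableAt_volFactor he' (transition_mem hu)
  have hvp := volFactor_pos he' (transition_mem hu)
  have h1 : HasFDerivAt (fun v => |(jacobian e e' v).det|) _ u :=
    (hasFDerivAt_det fun a k => (contDiffAt_jacobian he he' hu a k).hasFDerivAt).abs hd0
  have h2 : HasFDerivAt (fun v => volFactor e' (transition e e' v)) _ u :=
    hv.hasFDerivAt.comp u (differentiableAt_transition he he' hu).hasFDerivAt
  have h3 : HasFDerivAt (volFactor e) _ u := (h1.mul h2).congr_of_eventuallyEq (by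
    filter_upwards [isOpen_overlap.mem_nhds hu] with v hv using volFactor_transition he he' hv)
  have h4 : fderiv ℝ (volFactor e') (transition e e' u)
      (fderiv ℝ (transition e e') u (EuclideanSpace.single j 1))
      = ∑ a, jacobian e e' u a j * fderiv ℝ (volFactor e') (transition e e' u)
        (EuclideanSpace.single a 1) := by
    rw [euc_eq_sum (fderiv ℝ (transition e e') u (EuclideanSpace.single j 1)), map_sum]
    refine Finset.sum_congr rfl fun a _ => ?_
    rw [map_smul]; rfl
  have h5 : (∑ k, ∑ a, (jacobian e e' u).adjugate k a •
      fderiv ℝ (fun v => jacobian e e' v a k) u) (EuclideanSpace.single j 1)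
      = d * logJacobian e e' u j := by
    simp only [FunLike.coe_sum, Finset.sum_apply, FunLike.coe_smul, Pi.smul_apply, smul_eq_mul,
      logJacobian, Matrix.inv_def, Ring.inverse_eq_inv', Matrix.smul_apply, Finset.mul_sum,
      transitionHess, ← hd]
    refine Finset.sum_congr rfl fun k _ => Finset.sum_congr rfl fun a _ => ?_
    field_simp
  have h6 : fderiv ℝ (volFactor e) u (EuclideanSpace.single j 1)
      = |d| * (∑ a, jacobian e e' u a j * fderiv ℝ (volFactor e') (transition e e' u)
        (EuclideanSpace.single a 1))
        + volFactor e' (transition e e' u) * (|d| * logJacobian e e' u j) := by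
    rw [h3.fderiv, ← h4]
    simp only [add_apply, FunLike.coe_smul, Pi.smul_apply, smul_eq_mul, h5,
      ContinuousLinearMap.comp_apply, ← hd]
    rw [← mul_assoc (SignType.sign d : ℝ), sign_mul_self]
  simp only [logVol, pd_ofReal (differentiableAt_volFactor he hu.1), pd_ofReal hv]
  rw [h6, volFactor_transition he he' hu, ← hd]
  norm_cast
  have : |d| ≠ 0 := abs_ne_zero.2 hd0
  have h7 : ∀ x y z : ℝ, (|d| * volFactor e' (transition e e' u))⁻¹ *
      (|d| * x + volFactor e' (transition e e' u) * (|d| * y))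
      = (volFactor e' (transition e e' u))⁻¹ * x + y := by
    intro x y z; field_simp
  rw [h7 _ _ 0, Finset.mul_sum]
  congr 1
  exact Finset.sum_congr rfl fun a _ => by ring

/-- The second derivatives of the coordinate change which enter through the derivatives of the
components are exactly those by which the logarithmic derivatives of the two densities differ. -/
lemma divergence_transition (he : e ∈ IsManifold.maximalAtlas (𝓡 m) ∞ M)
    (he' : e' ∈ IsManifold.maximalAtlas (𝓡 m) ∞ M) {u : Euc m} (hu : u ∈ overlap e e')
    {X Y : Fin m → Euc m → ℂ} (hX : ∀ j, DifferentiableAt ℝ (X j) u)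
    (hY : ∀ a, DifferentiableAt ℝ (Y a) (transition e e' u))
    (hXY : ∀ᶠ v in 𝓝 u, ∀ a, Y a (transition e e' v) = ∑ j, (jacobian e e' v a j : ℂ) * X j v) :
    divergence e X u = divergence e' Y (transition e e' u) := by
  rw [divergence_eq he hu.1 hX, divergence_eq he' (transition_mem hu) hY]
  have hJ : (jacobian e e' u).map (algebraMap ℝ ℂ) * (jacobian e e' u)⁻¹.map (algebraMap ℝ ℂ)
      = 1 := by
    rw [← Matrix.map_mul, Matrix.mul_nonsing_inv _ (jacobian_det_ne_zero he he' hu).isUnit]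
    simp
  have key := trace_transition (P := Matrix.of fun a b => pd b (Y a) (transition e e' u))
    (dX := Matrix.of fun k j => pd k (X j) u) (X := fun j => X j u)
    (H := fun k a j => (transitionHess e e' u k a j : ℂ)) hJ
    (fun k a j => by rw [transitionHess_symm he he' hu]) (by
      intro a k
      have h1 : (fun v => ∑ j, (jacobian e e' v a j : ℂ) * X j v)
          =ᶠ[𝓝 u] Y a ∘ transition e e' := by
        filter_upwards [hXY] with v hv using (hv a).symm
      have h2 := pd_transition he he' hu (hY a) h1 k
      have hJd : ∀ j, DifferentiableAt ℝ (fun v => (jacobian e e' v a j : ℂ)) u := fun j =>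
        Complex.ofRealCLM.differentiableAt.comp u (contDiffAt_jacobian he he' hu a j)
      rw [pd_sum _ fun j _ => (hJd j).fun_mul (hX j)] at h2
      refine h2.symm.trans (Finset.sum_congr rfl fun j _ => ?_)
      rw [pd_mul (hJd j) (hX j), pd_ofReal (contDiffAt_jacobian he he' hu a j)]
      rfl)
  simp only [Matrix.of_apply, Matrix.map_apply] at key
  rw [key, hXY.self_of_nhds |> funext |> congrArg (fun F : Fin m → ℂ => ∑ j, F j *
    logVol e' j (transition e e' u))]
  simp only [logVol_transition he he' hu, mul_add, Finset.sum_add_distrib]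
  have h3 : ∀ j, ∑ k, ∑ a, algebraMap ℝ ℂ ((jacobian e e' u)⁻¹ k a)
      * (transitionHess e e' u j a k : ℂ) = logJacobian e e' u j := by
    intro j
    simp [logJacobian]
  simp only [h3]
  have h4 : ∑ j, (∑ i, (jacobian e e' u j i : ℂ) * X i u) * logVol e' j (transition e e' u)
      = ∑ i, X i u * ∑ a, (jacobian e e' u a i : ℂ) * logVol e' a (transition e e' u) := by
    simp only [Finset.sum_mul, Finset.mul_sum]
    rw [Finset.sum_comm]
    exact Finset.sum_congr rfl fun i _ => Finset.sum_congr rfl fun a _ => by ring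
  rw [h4]
  ring

lemma eventually_overlap {u : Euc m} (hu : u ∈ overlap e e') :
    ∀ᶠ v in 𝓝 u, v ∈ overlap e e' := isOpen_overlap.mem_nhds hu

variable {V : Set (Euc m)} {f f' : Euc m → ℂ}

/-- The part of the chart `e` which corresponds to the subset `V` of the chart `e'`. -/
def pullbackSet (e e' : OpenPartialHomeomorph M (Euc m)) (V : Set (Euc m)) : Set (Euc m) :=
  overlap e e' ∩ transition e e' ⁻¹' V

lemma isOpen_pullbackSet (he : e ∈ IsManifold.maximalAtlas (𝓡 m) ∞ M)
    (he' : e' ∈ IsManifold.maximalAtlas (𝓡 m) ∞ M) (hV : IsOpen V) :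
    IsOpen (pullbackSet e e' V) :=
  (contDiffOn_transition he he').continuousOn.isOpen_inter_preimage isOpen_overlap hV

lemma contDiffOn_pullback (he : e ∈ IsManifold.maximalAtlas (𝓡 m) ∞ M)
    (he' : e' ∈ IsManifold.maximalAtlas (𝓡 m) ∞ M) (hf' : ContDiffOn ℝ ∞ f' V) :
    ContDiffOn ℝ ∞ (f' ∘ transition e e') (pullbackSet e e' V) :=
  hf'.comp ((contDiffOn_transition he he').mono inter_subset_left) fun _ hv => hv.2

lemma _root_.ContDiffOn.differentiableAt_of_isOpen {E F : Type*} [NormedAddCommGroup E] [NormedSpace ℝ E]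
    [NormedAddCommGroup F] [NormedSpace ℝ F] {g : E → F} {s : Set E} (h : ContDiffOn ℝ ∞ g s)
    (hs : IsOpen s) {x : E} (hx : x ∈ s) : DifferentiableAt ℝ g x :=
  (h.contDiffAt (hs.mem_nhds hx)).differentiableAt (by simp)

lemma laplaceBeltrami_congr {g : Euc m → ℂ} {u : Euc m} (h : f =ᶠ[𝓝 u] g) :
    laplaceBeltrami e f u = laplaceBeltrami e g u :=
  divergence_congr fun j => gradient_eventuallyEq h j

lemma laplaceBeltrami_transition (he : e ∈ IsManifold.maximalAtlas (𝓡 m) ∞ M)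
    (he' : e' ∈ IsManifold.maximalAtlas (𝓡 m) ∞ M) {u : Euc m} (hu : u ∈ overlap e e')
    (hV : IsOpen V) (hVe : V ⊆ e'.target) (huV : transition e e' u ∈ V)
    (hf' : ContDiffOn ℝ ∞ f' V) (hff' : f =ᶠ[𝓝 u] f' ∘ transition e e') :
    laplaceBeltrami e f u = laplaceBeltrami e' f' (transition e e' u) := by
  have hVo := isOpen_pullbackSet he he' hV
  rw [laplaceBeltrami_congr hff']
  refine divergence_transition he he' hu
    (fun j => (contDiffOn_gradient he hVo (fun v hv => hv.1.1)
      (contDiffOn_pullback he he' hf') j).differentiableAt_of_isOpen hVo ⟨hu, huV⟩)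
    (fun j => (contDiffOn_gradient he' hV hVe hf' j).differentiableAt_of_isOpen hV huV) ?_
  filter_upwards [hVo.mem_nhds ⟨hu, huV⟩] with v hv a
  exact gradient_transition he he' hv.1 (hf'.differentiableAt_of_isOpen hV hv.2) (by rfl) a

lemma pairing_transition (he : e ∈ IsManifold.maximalAtlas (𝓡 m) ∞ M)
    (he' : e' ∈ IsManifold.maximalAtlas (𝓡 m) ∞ M) {u : Euc m} (hu : u ∈ overlap e e')
    {a x a' x' : Fin m → ℂ} (ha : ∀ i, a' i = ∑ j, (jacobian e e' u i j : ℂ) * a j)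
    (hx : ∀ i, x' i = ∑ j, (jacobian e e' u i j : ℂ) * x j) :
    ∑ j, ∑ k, (metric e u j k : ℂ) * a j * x k
      = ∑ j, ∑ k, (metric e' (transition e e' u) j k : ℂ) * a' j * x' k := by
  have h1 : ∀ (g : Matrix (Fin m) (Fin m) ℂ) (v w : Fin m → ℂ),
      ∑ j, ∑ k, g j k * v j * w k = v ⬝ᵥ g.mulVec w := by
    intro g v w
    simp only [dotProduct, Matrix.mulVec, Finset.mul_sum]
    exact Finset.sum_congr rfl fun j _ => Finset.sum_congr rfl fun k _ => by ring
  have h2 : ∑ j, ∑ k, (metric e u j k : ℂ) * a j * x k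
      = a ⬝ᵥ ((metric e u).map (algebraMap ℝ ℂ)).mulVec x := h1 _ a x
  have h3 : ∑ j, ∑ k, (metric e' (transition e e' u) j k : ℂ) * a' j * x' k
      = a' ⬝ᵥ ((metric e' (transition e e' u)).map (algebraMap ℝ ℂ)).mulVec x' := h1 _ a' x'
  have ha' : a' = ((jacobian e e' u).map (algebraMap ℝ ℂ)).mulVec a := funext ha
  have hx' : x' = ((jacobian e e' u).map (algebraMap ℝ ℂ)).mulVec x := funext hx
  rw [h2, h3, metric_transition he he' hu, ha', hx', Matrix.map_mul, Matrix.map_mul,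
    Matrix.transpose_map, ← Matrix.mulVec_mulVec, ← Matrix.mulVec_mulVec, Matrix.dotProduct_mulVec,
    Matrix.vecMul_transpose]

/-- The coefficients are constructed in special charts, whereas the identity is claimed in every
chart of the maximal atlas. This invariance makes the passage possible. -/
lemma magneticOp_transition (he : e ∈ IsManifold.maximalAtlas (𝓡 m) ∞ M)
    (he' : e' ∈ IsManifold.maximalAtlas (𝓡 m) ∞ M)
    (hA : ContMDiff (𝓡 m) (𝓡 m).tangent ∞ (fun x => (⟨x, A x⟩ : TangentBundle (𝓡 m) M)))
    {u : Euc m} (hu : u ∈ overlap e e')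
    (hV : IsOpen V) (hVe : V ⊆ e'.target) (huV : transition e e' u ∈ V)
    (hf' : ContDiffOn ℝ ∞ f' V) (hff' : f =ᶠ[𝓝 u] f' ∘ transition e e') (c : ℝ) :
    magneticOp e A c f u = magneticOp e' A c f' (transition e e' u) := by
  have hVo := isOpen_pullbackSet he he' hV
  rw [magneticOp_congr hff']
  have hg : ∀ v ∈ pullbackSet e e' V, ∀ a, magneticGradient e' A f' a (transition e e' v)
      = ∑ j, (jacobian e e' v a j : ℂ) * magneticGradient e A (f' ∘ transition e e') j v :=
    fun v hv a => magneticGradient_transition he he' hv.1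
      (hf'.differentiableAt_of_isOpen hV hv.2) (by rfl) a
  rw [magneticOp, magneticOp, divergence_transition he he' hu
    (fun j => (contDiffOn_magneticGradient he hA hVo (fun v hv => hv.1.1)
      (contDiffOn_pullback he he' hf') j).differentiableAt_of_isOpen hVo ⟨hu, huV⟩)
    (fun j => (contDiffOn_magneticGradient he' hA hV hVe hf' j).differentiableAt_of_isOpen hV huV)
    (by filter_upwards [hVo.mem_nhds ⟨hu, huV⟩] with v hv using hg v hv),
    pairing_transition he he' hu (fun i => ?_) (hg u ⟨hu, huV⟩)]
  · rfl
  · rw [vecCoord_transition he he' hu]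
    push_cast
    rfl

lemma gradient_pairing_transition (he : e ∈ IsManifold.maximalAtlas (𝓡 m) ∞ M)
    (he' : e' ∈ IsManifold.maximalAtlas (𝓡 m) ∞ M) {u : Euc m} (hu : u ∈ overlap e e')
    {x x' : Fin m → ℂ} (hx : ∀ i, x' i = ∑ j, (jacobian e e' u i j : ℂ) * x j)
    (hf' : DifferentiableAt ℝ f' (transition e e' u)) (hff' : f =ᶠ[𝓝 u] f' ∘ transition e e') :
    ∑ k, x k * pd k f u = ∑ k, x' k * pd k f' (transition e e' u) := by
  simp only [pd_transition he he' hu hf' hff', hx, Finset.mul_sum, Finset.sum_mul]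
  rw [Finset.sum_comm]
  exact Finset.sum_congr rfl fun a _ => Finset.sum_congr rfl fun k _ => by ring

end Invariance

/-! ### Invariance of the transport equations -/

section TransportInvariance

variable {m : ℕ} {M : Type*} [EMetricSpace M] [ChartedSpace (Euc m) M]
  [IsManifold (𝓡 m) ∞ M] [RiemannianBundle (fun x : M => TangentSpace (𝓡 m) x)]
  [IsContMDiffRiemannianBundle (𝓡 m) ∞ (Euc m) (fun x : M => TangentSpace (𝓡 m) x)]
  {e e' : OpenPartialHomeomorph M (Euc m)} {A : (x : M) → TangentSpace (𝓡 m) x}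
  {V : Set (Euc m)} {f f' : Euc m → ℂ}

lemma sqDist_transition {u : Euc m} (hu : u ∈ overlap e e') (y : M) :
    sqDist e y =ᶠ[𝓝 u] sqDist e' y ∘ transition e e' := by
  filter_upwards [eventually_overlap hu] with v hv
  simp [sqDist, symm_transition hv]

lemma radialDeriv_transition (he : e ∈ IsManifold.maximalAtlas (𝓡 m) ∞ M)
    (he' : e' ∈ IsManifold.maximalAtlas (𝓡 m) ∞ M) {u : Euc m} (hu : u ∈ overlap e e') {y : M}
    (hσ : DifferentiableAt ℝ (sqDist e' y) (transition e e' u))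
    (hf' : DifferentiableAt ℝ f' (transition e e' u)) (hff' : f =ᶠ[𝓝 u] f' ∘ transition e e') :
    radialDeriv e y f u = radialDeriv e' y f' (transition e e' u) :=
  gradient_pairing_transition he he' hu
    (fun a => gradient_transition he he' hu hσ (sqDist_transition hu y) a) hf' hff'

lemma transportCoeff_transition (he : e ∈ IsManifold.maximalAtlas (𝓡 m) ∞ M)
    (he' : e' ∈ IsManifold.maximalAtlas (𝓡 m) ∞ M) {u : Euc m} (hu : u ∈ overlap e e') {y : M}
    (hV : IsOpen V) (hVe : V ⊆ e'.target) (huV : transition e e' u ∈ V)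
    (hσ : ContDiffOn ℝ ∞ (sqDist e' y) V) :
    transportCoeff e A y u = transportCoeff e' A y (transition e e' u) := by
  rw [transportCoeff, transportCoeff,
    laplaceBeltrami_transition he he' hu hV hVe huV hσ (sqDist_transition hu y),
    gradient_pairing_transition he he' hu (fun i => ?_) (hσ.differentiableAt_of_isOpen hV huV)
      (sqDist_transition hu y)]
  rw [vecCoord_transition he he' hu]
  push_cast
  rfl

end TransportInvariance

/-! ### The Riemannian distance near the diagonal -/

section LocalDistance

variable {m : ℕ} {M : Type*} [EMetricSpace M] [ChartedSpace (Euc m) M]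
  [IsManifold (𝓡 m) ∞ M] [RiemannianBundle (fun x : M => TangentSpace (𝓡 m) x)]
  [IsContMDiffRiemannianBundle (𝓡 m) ∞ (Euc m) (fun x : M => TangentSpace (𝓡 m) x)]
  {e : OpenPartialHomeomorph M (Euc m)}

lemma enorm_tangent (x : M) (v : TangentSpace (𝓡 m) x) :
    ‖v‖ₑ = ENNReal.ofReal √(tangentInner x v v) := by
  rw [← ofReal_norm]
  exact congrArg ENNReal.ofReal (norm_eq_sqrt_real_inner v)

lemma mfderiv_symm_comp (he : e ∈ IsManifold.maximalAtlas (𝓡 m) ∞ M) {c : ℝ → Euc m} {v : Euc m}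
    {t : ℝ} (hc : HasDerivAt c v t) (ht : c t ∈ e.target) :
    mfderiv 𝓘(ℝ, ℝ) (𝓡 m) (e.symm ∘ c) t (1 : ℝ) = chartSymmDeriv e (c t) v := by
  have h1 : MDifferentiableAt 𝓘(ℝ, ℝ) (𝓡 m) c t := hc.differentiableAt.mdifferentiableAt
  have h2 := (mdifferentiable_chart_of_mem he).mdifferentiableAt_symm ht
  rw [mfderiv_comp t h2 h1]
  have h3 : mfderiv 𝓘(ℝ, ℝ) (𝓡 m) c t (1 : ℝ) = v := by
    rw [mfderiv_eq_fderiv]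
    exact hc.deriv
  exact congrArg (chartSymmDeriv e (c t)) h3

lemma hasDerivAt_chart_comp (he : e ∈ IsManifold.maximalAtlas (𝓡 m) ∞ M) {γ : ℝ → M} {t : ℝ}
    (hγ : MDifferentiableAt 𝓘(ℝ, ℝ) (𝓡 m) γ t) (ht : γ t ∈ e.source) :
    HasDerivAt (e ∘ γ) (chartDeriv e (γ t) (mfderiv 𝓘(ℝ, ℝ) (𝓡 m) γ t (1 : ℝ))) t := by
  have h2 := (mdifferentiable_chart_of_mem he).mdifferentiableAt ht
  have h3 := h2.comp t hγ
  have h4 : mfderiv 𝓘(ℝ, ℝ) (𝓡 m) (e ∘ γ) t (1 : ℝ)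
      = chartDeriv e (γ t) (mfderiv 𝓘(ℝ, ℝ) (𝓡 m) γ t (1 : ℝ)) := by
    rw [mfderiv_comp t h2 hγ]; rfl
  rw [← h4, mfderiv_eq_fderiv]
  exact h3.differentiableAt.hasDerivAt

lemma tangentInner_mul_self_le (x : M) (v w : Euc m) :
    |tangentInner x v w| ≤ √(tangentInner x v v) * √(tangentInner x w w) := by
  exact (abs_real_inner_le_norm (F := TangentSpace (𝓡 m) x) v w).trans_eq
    (congrArg₂ (· * ·) (norm_eq_sqrt_real_inner (F := TangentSpace (𝓡 m) x) v)
      (norm_eq_sqrt_real_inner (F := TangentSpace (𝓡 m) x) w))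

variable {N : Set (Euc m × Euc m)} {b c : Euc m × Euc m → C(unitInterval, Euc m)}

lemma sqLength_nonneg (he : e ∈ IsManifold.maximalAtlas (𝓡 m) ∞ M)
    (h : IsGeodesicFamily (geodesicTerm (metricForm e)) e.target N b c) {z : Euc m × Euc m}
    (hz : z ∈ N) : 0 ≤ sqLength (metricForm e) b z := by
  by_cases h0 : b z 1 = 0
  · simp [sqLength, h0]
  · exact ((isMetricOn_metricForm he).pos _ (h.curve_mem_one hz) _ h0).le

variable [IsRiemannianManifold (𝓡 m) M]

/-- The geodesic has constant speed √S, S the squared speed, so its piece over [0, s] has length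
s√S, at most √S. -/
lemma edist_curve_le (he : e ∈ IsManifold.maximalAtlas (𝓡 m) ∞ M)
    (h : IsGeodesicFamily (geodesicTerm (metricForm e)) e.target N b c) {z : Euc m × Euc m}
    (hz : z ∈ N) (s : unitInterval) :
    edist (e.symm (c z s)) (e.symm z.2) ≤ ENNReal.ofReal √(sqLength (metricForm e) b z) := by
  -- The geodesic on [0, 1], continued to a C¹ curve on the whole line by the constant extension of
  -- its velocity.
  set f : ℝ → Euc m := fun t => z.2 + primitiveFun (b z) t with hf
  have hfd : ∀ t, HasDerivAt f (extendCurve (b z) t) t := fun t =>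
    (hasDerivAt_primitiveFun (b z) t).const_add _
  have hfc : ∀ t : unitInterval, f t = c z t := by
    intro t
    rw [h.curve_eq z hz]
    rfl
  have hft : ∀ t ∈ Icc (0 : ℝ) 1, f t ∈ e.target := fun t ht => by
    have := hfc ⟨t, ht⟩
    simp only at this
    rw [this]; exact h.mem z hz _
  have hf1 : ContDiff ℝ 1 f := by
    rw [contDiff_one_iff_deriv]
    refine ⟨fun t => (hfd t).differentiableAt, ?_⟩
    rw [show deriv f = extendCurve (b z) from funext fun t => (hfd t).deriv]
    exact continuous_extendCurve _
  have hs : Icc (0 : ℝ) s ⊆ Icc 0 1 := Icc_subset_Icc_right s.2.2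
  rw [IsRiemannianManifold.out (I := 𝓡 m), Manifold.riemannianEDist_comm]
  refine (Manifold.riemannianEDist_le_pathELength (γ := e.symm ∘ f) (a := 0) (b := s) ?_ ?_ ?_
    s.2.1).trans ?_
  · exact ((contMDiffOn_symm_of_mem_maximalAtlas he).of_le (by norm_num)).comp
      hf1.contMDiff.contMDiffOn fun t ht => hft t (hs ht)
  · simp [hf, primitiveFun]
  · simp only [Function.comp_apply, hfc]
  · rw [Manifold.pathELength_eq_lintegral_mfderiv_Icc]
    have h1 : ∀ t ∈ Icc (0 : ℝ) s, ‖mfderiv 𝓘(ℝ, ℝ) (𝓡 m) (e.symm ∘ f) t (1 : ℝ)‖ₑ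
        = ENNReal.ofReal √(sqLength (metricForm e) b z) := by
      intro t ht
      rw [enorm_tangent, mfderiv_symm_comp he (hfd t) (hft t (hs ht))]
      rw [show (e.symm ∘ f) t = e.symm (f t) from rfl, ← metricForm_eq_inner,
        extendCurve_of_mem _ (hs ht)]
      have := hfc ⟨t, hs ht⟩
      simp only at this
      rw [this, h.energy_const (isMetricOn_metricForm he) hz]
      rfl
    refine (setLIntegral_congr_fun measurableSet_Icc h1).trans_le ?_
    rw [setLIntegral_const, Real.volume_Icc, sub_zero]
    exact mul_le_of_le_one_right zero_le (by
      rw [ENNReal.ofReal_le_one]; exact s.2.2)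

/-- Gauss's argument: by the first variation formula the derivative of S(γ(t), γ(0)) is 2⟨b, γ'⟩,
where ⟨b, b⟩ = S. Cauchy-Schwarz then bounds the derivative of √S by the speed of γ, and integration
gives the length. -/
lemma sqrt_sqLength_le_pathELength (he : e ∈ IsManifold.maximalAtlas (𝓡 m) ∞ M)
    (h : IsGeodesicFamily (geodesicTerm (metricForm e)) e.target N b c) {γ : ℝ → M}
    (hγ : ContMDiff 𝓘(ℝ, ℝ) (𝓡 m) 1 γ) (hγe : ∀ t ∈ Icc (0 : ℝ) 1, γ t ∈ e.source)
    (hγN : ∀ t ∈ Icc (0 : ℝ) 1, (e (γ t), e (γ 0)) ∈ N) :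
    ENNReal.ofReal √(sqLength (metricForm e) b (e (γ 1), e (γ 0)))
      ≤ Manifold.pathELength (𝓡 m) γ 0 1 := by
  have hG := isMetricOn_metricForm he
  set S := sqLength (metricForm e) b with hS
  have hSs := h.contDiffOn_sqLength hG
  have hγd : ∀ t, MDifferentiableAt 𝓘(ℝ, ℝ) (𝓡 m) γ t := hγ.mdifferentiable one_ne_zero
  have hq : ContDiffOn ℝ 1 (fun t => S (e (γ t), e (γ 0))) (Icc 0 1) := by
    refine (hSs.of_le (by norm_num)).comp (t := N) (ContDiffOn.prodMk ?_ contDiffOn_const) hγN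
    rw [← contMDiffOn_iff_contDiffOn]
    exact ((contMDiffOn_of_mem_maximalAtlas he).of_le (by norm_num)).comp hγ.contMDiffOn hγe
  have hqd : ∀ t ∈ Icc (0 : ℝ) 1, HasDerivAt (fun t => S (e (γ t), e (γ 0)))
      (2 * tangentInner (γ t) (chartSymmDeriv e (e (γ t)) (b (e (γ t), e (γ 0)) 1))
        (mfderiv 𝓘(ℝ, ℝ) (𝓡 m) γ t (1 : ℝ))) t := by
    intro t ht
    have h1 := hasDerivAt_chart_comp he (hγd t) (hγe t ht)
    have h2 : HasDerivAt (fun t => (e (γ t), e (γ 0))) _ t := h1.prodMk (hasDerivAt_const t (e (γ 0)))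
    have h3 := (hSs.differentiableAt_of_isOpen h.isOpen (hγN t ht)).hasFDerivAt.comp_hasDerivAt t h2
    refine h3.congr_deriv ?_
    rw [h.fderiv_sqLength hG (hγN t ht), metricForm_eq_inner, e.left_inv (hγe t ht)]
    congr 2
    have h4 := (mdifferentiable_chart_of_mem he).symm_comp_deriv (hγe t ht)
    exact DFunLike.congr_fun h4 (mfderiv 𝓘(ℝ, ℝ) (𝓡 m) γ t (1 : ℝ))
  -- The square root is not differentiable where S = 0, in particular at t = 0. It is regularized to
  -- √(S + ε²), at the cost of an error ε.
  have key : ∀ ε : ℝ, 0 < ε → ENNReal.ofReal (√(S (e (γ 1), e (γ 0)))) ≤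
      Manifold.pathELength (𝓡 m) γ 0 1 + ENNReal.ofReal ε := by
    intro ε hε
    have hpos : ∀ t ∈ Icc (0 : ℝ) 1, 0 < S (e (γ t), e (γ 0)) + ε ^ 2 := fun t ht =>
      add_pos_of_nonneg_of_pos (sqLength_nonneg he h (hγN t ht)) (by positivity)
    have hf : ContDiffOn ℝ 1 (fun t => √(S (e (γ t), e (γ 0)) + ε ^ 2)) (Icc 0 1) :=
      (hq.add contDiffOn_const).sqrt fun t ht => (hpos t ht).ne'
    have h1 := enorm_sub_le_lintegral_derivWithin_Icc_of_contDiffOn_Icc hf zero_le_one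
    have h2 : ∫⁻ t in Icc (0 : ℝ) 1, ‖derivWithin (fun t => √(S (e (γ t), e (γ 0)) + ε ^ 2))
        (Icc 0 1) t‖ₑ ≤ Manifold.pathELength (𝓡 m) γ 0 1 := by
      rw [Manifold.pathELength_eq_lintegral_mfderiv_Icc]
      refine setLIntegral_mono' measurableSet_Icc fun t ht => ?_
      have h3 := ((hqd t ht).add_const (ε ^ 2)).sqrt (hpos t ht).ne'
      rw [h3.hasDerivWithinAt.derivWithin (uniqueDiffOn_Icc zero_lt_one t ht), enorm_tangent,
        Real.enorm_eq_ofReal_abs]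
      refine ENNReal.ofReal_le_ofReal ?_
      rw [mul_div_mul_left _ _ two_ne_zero, abs_div, abs_of_nonneg (Real.sqrt_nonneg _),
        div_le_iff₀ (Real.sqrt_pos.2 (hpos t ht)), mul_comm]
      refine (tangentInner_mul_self_le _ _ _).trans ?_
      refine mul_le_mul (Real.sqrt_le_sqrt ?_) le_rfl (Real.sqrt_nonneg _) (Real.sqrt_nonneg _)
      have h4 : tangentInner (γ t) (chartSymmDeriv e (e (γ t)) (b (e (γ t), e (γ 0)) 1))
          (chartSymmDeriv e (e (γ t)) (b (e (γ t), e (γ 0)) 1)) = S (e (γ t), e (γ 0)) := by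
        rw [hS, sqLength, metricForm_eq_inner, e.left_inv (hγe t ht)]
      rw [h4]
      linarith [sq_nonneg ε]
    have h0 : S (e (γ 0), e (γ 0)) = 0 := by
      rw [hS, sqLength, h.velocity_diag _ (hγN 0 (by simp))]; simp
    rw [h0, zero_add, Real.sqrt_sq hε.le, Real.enorm_eq_ofReal_abs] at h1
    refine le_trans ?_ (add_le_add_left (h1.trans h2) _)
    rw [← ENNReal.ofReal_add (abs_nonneg _) hε.le]
    refine ENNReal.ofReal_le_ofReal ?_
    have : √(S (e (γ 1), e (γ 0))) ≤ √(S (e (γ 1), e (γ 0)) + ε ^ 2) :=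
      Real.sqrt_le_sqrt (by linarith [sq_nonneg ε])
    linarith [le_abs_self (√(S (e (γ 1), e (γ 0)) + ε ^ 2) - ε)]
  refine ENNReal.le_of_forall_pos_le_add fun ε hε _ => ?_
  have := key ε hε
  rwa [ENNReal.ofReal_coe_nnreal] at this

/-- A chart `e` and a family of geodesics in it, which are minimizing for pairs `(x, y)` of points
such that `y ∈ V` and the distance of `x` and `y` is less than `r`. -/
structure IsMinimizingFamily (e : OpenPartialHomeomorph M (Euc m)) (V : Set M) (r : ℝ)
    (W N : Set (Euc m × Euc m)) (b c : Euc m × Euc m → C(unitInterval, Euc m)) : Prop where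
  mem_maximalAtlas : e ∈ IsManifold.maximalAtlas (𝓡 m) ∞ M
  isGeodesicFamily : IsGeodesicFamily (geodesicTerm (metricForm e)) e.target N b c
  isOpen : IsOpen V
  pos : 0 < r
  subset_source : V ⊆ e.source
  mem_source : ∀ x, ∀ y ∈ V, edist x y < ENNReal.ofReal r → x ∈ e.source
  mem_iff : ∀ z, z ∈ W ↔ z.1 ∈ e.target ∧ z.2 ∈ e.target ∧ e.symm z.2 ∈ V ∧
    edist (e.symm z.1) (e.symm z.2) < ENNReal.ofReal r
  isOpen_pairs : IsOpen W
  subset : W ⊆ N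
  isStar : IsStar c W
  edist_eq : ∀ z ∈ W, edist (e.symm z.1) (e.symm z.2)
    = ENNReal.ofReal √(sqLength (metricForm e) b z)

/-- All pairs of points within R of p are joined by a geodesic of the family. If y is within R/2 of
p and d(x, y) < R/2, then any curve from y of length less than R/2 stays within R of p, so the
length comparison applies to every relevant competitor. -/
theorem exists_isMinimizingFamily (p : M) : ∃ (e : OpenPartialHomeomorph M (Euc m)) (V : Set M)
    (r : ℝ) (W N : Set (Euc m × Euc m)) (b c : Euc m × Euc m → C(unitInterval, Euc m)),
    p ∈ V ∧ IsMinimizingFamily e V r W N b c := by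
  set e := chartAt (Euc m) p with hedef
  have he : e ∈ IsManifold.maximalAtlas (𝓡 m) ∞ M := IsManifold.chart_mem_maximalAtlas p
  have hp : p ∈ e.source := mem_chart_source _ p
  have hG := isMetricOn_metricForm he
  obtain ⟨N, b, c, hpN, h⟩ := exists_isGeodesicFamily hG.isOpen hG.contDiffOn_geodesicTerm
    geodesicTerm_smul (e.map_source hp)
  have hO : {q : M × M | (q.1 ∈ e.source ∧ q.2 ∈ e.source) ∧ (e q.1, e q.2) ∈ N} ∈ 𝓝 (p, p) := by
    have h1 : ContinuousAt (fun q : M × M => (e q.1, e q.2)) (p, p) :=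
      ((e.continuousAt hp).comp continuousAt_fst).prodMk
        ((e.continuousAt hp).comp continuousAt_snd)
    filter_upwards [prod_mem_nhds (e.open_source.mem_nhds hp) (e.open_source.mem_nhds hp),
      h1 (h.isOpen.mem_nhds hpN)] with q hq1 hq2 using ⟨hq1, hq2⟩
  obtain ⟨R, hR, hRO⟩ : ∃ R : ℝ, 0 < R ∧ ∀ x y, edist x p < ENNReal.ofReal R →
      edist y p < ENNReal.ofReal R → (x ∈ e.source ∧ y ∈ e.source) ∧ (e x, e y) ∈ N := by
    obtain ⟨R, hR, hRs⟩ := EMetric.mem_nhds_iff.1 hO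
    -- The extended radius may be infinite; the minimum with 1 makes it a real number.
    refine ⟨(min R 1).toReal, ENNReal.toReal_pos (by simp [hR.ne']) (by simp), fun x y hx hy => ?_⟩
    rw [ENNReal.ofReal_toReal (by simp)] at hx hy
    refine hRs (show (x, y) ∈ _ from ?_)
    rw [Metric.mem_eball, Prod.edist_eq]
    exact max_lt (hx.trans_le (min_le_left _ _)) (hy.trans_le (min_le_left _ _))
  have hhalf : ENNReal.ofReal (R / 2) + ENNReal.ofReal (R / 2) = ENNReal.ofReal R := by
    rw [← ENNReal.ofReal_add (by positivity) (by positivity)]; ring_nf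
  have hle : ENNReal.ofReal (R / 2) ≤ ENNReal.ofReal R :=
    ENNReal.ofReal_le_ofReal (by linarith)
  have hV : ∀ x y, edist y p < ENNReal.ofReal (R / 2) → edist x y < ENNReal.ofReal (R / 2) →
      (x ∈ e.source ∧ y ∈ e.source) ∧ (e x, e y) ∈ N := fun x y hy hxy =>
    hRO x y ((edist_triangle x y p).trans_lt (hhalf ▸ ENNReal.add_lt_add hxy hy))
      (hy.trans_le hle)
  have hlow : ∀ x y, edist y p < ENNReal.ofReal (R / 2) → edist x y < ENNReal.ofReal (R / 2) →
      ENNReal.ofReal √(sqLength (metricForm e) b (e x, e y)) ≤ edist x y := by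
    intro x y hy hxy
    refine le_of_forall_gt fun q hq => ?_
    -- A curve shorter than both q and R/2 exists because the distance is an infimum of lengths. The
    -- first bound gives the estimate, the second keeps the curve in the region where it can be
    -- compared.
    have hq' : edist x y < min q (ENNReal.ofReal (R / 2)) := lt_min hq hxy
    rw [edist_comm, IsRiemannianManifold.out (I := 𝓡 m)] at hq'
    obtain ⟨γ, h0, h1, hγ, hlen, -⟩ :=
      Manifold.exists_lt_locally_constant_of_riemannianEDist_lt hq' zero_lt_one
    have hball : ∀ t ∈ Icc (0 : ℝ) 1, edist (γ t) y < ENNReal.ofReal (R / 2) := by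
      intro t ht
      rw [edist_comm, IsRiemannianManifold.out (I := 𝓡 m), ← h0]
      exact (Manifold.riemannianEDist_le_pathELength hγ.contMDiffOn rfl rfl ht.1).trans_lt
        ((Manifold.pathELength_mono le_rfl ht.2).trans_lt (hlen.trans_le (min_le_right _ _)))
    have := sqrt_sqLength_le_pathELength he h hγ (fun t ht => (hV _ y hy (hball t ht)).1.1)
      (fun t ht => by rw [h0]; exact (hV _ y hy (hball t ht)).2)
    rw [h0, h1] at this
    exact this.trans_lt (hlen.trans_le (min_le_left _ _))
  set W : Set (Euc m × Euc m) := {z | z.1 ∈ e.target ∧ z.2 ∈ e.target ∧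
    e.symm z.2 ∈ {y | edist y p < ENNReal.ofReal (R / 2)} ∧
    edist (e.symm z.1) (e.symm z.2) < ENNReal.ofReal (R / 2)} with hW
  have hWN : W ⊆ N := fun z hz => by
    have := (hV _ _ hz.2.2.1 hz.2.2.2).2
    rwa [e.right_inv hz.1, e.right_inv hz.2.1] at this
  have hVo : IsOpen {y : M | edist y p < ENNReal.ofReal (R / 2)} := Metric.isOpen_eball
  have hWeq : ∀ z ∈ W, edist (e.symm z.1) (e.symm z.2)
      = ENNReal.ofReal √(sqLength (metricForm e) b z) := fun z hz => by
    refine le_antisymm ?_ ?_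
    · have := edist_curve_le he h (hWN hz) 1
      rwa [h.curve_one z (hWN hz)] at this
    · have := hlow _ _ hz.2.2.1 hz.2.2.2
      rwa [e.right_inv hz.1, e.right_inv hz.2.1] at this
  refine ⟨e, {y | edist y p < ENNReal.ofReal (R / 2)}, R / 2, W, N, b, c, by simp [hR],
    he, h, hVo, by positivity, fun y hy => (hRO y y (hy.trans_le hle) (hy.trans_le hle)).1.1,
    fun x y hy hxy => (hV x y hy hxy).1.1, fun z => Iff.rfl, ?_, hWN, ?_, hWeq⟩
  · have h1 : IsOpen (e.target ×ˢ e.target) := e.open_target.prod e.open_target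
    have h2 : ContinuousOn (fun z : Euc m × Euc m => (e.symm z.1, e.symm z.2))
        (e.target ×ˢ e.target) :=
      (e.continuousOn_symm.comp continuousOn_fst fun z hz => hz.1).prodMk
        (e.continuousOn_symm.comp continuousOn_snd fun z hz => hz.2)
    have h3 : IsOpen {q : M × M | q.2 ∈ {y : M | edist y p < ENNReal.ofReal (R / 2)} ∧
        edist q.1 q.2 < ENNReal.ofReal (R / 2)} :=
      (hVo.preimage continuous_snd).inter (isOpen_lt continuous_edist continuous_const)
    have h4 := h2.isOpen_inter_preimage h1 h3
    convert h4 using 1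
    ext z
    simp only [hW, mem_ofPred_eq, mem_inter_iff, mem_prod, mem_preimage]
    tauto
  -- Points of the geodesic are no farther from its origin than the geodesic is long, and that
  -- length is the distance between its endpoints.
  · intro z hz s
    refine ⟨h.mem z (hWN hz) s, hz.2.1, hz.2.2.1, ?_⟩
    exact (edist_curve_le he h (hWN hz) s).trans_lt ((hWeq z hz).symm.trans_lt hz.2.2.2)

end LocalDistance

/-! ### Solution of the transport equations near the diagonal -/

section LocalTransport

open IsGeodesicFamily (logAverage radialAverage)

variable {m : ℕ} {M : Type*} [EMetricSpace M] [ChartedSpace (Euc m) M]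
  [IsManifold (𝓡 m) ∞ M] [RiemannianBundle (fun x : M => TangentSpace (𝓡 m) x)]
  [IsContMDiffRiemannianBundle (𝓡 m) ∞ (Euc m) (fun x : M => TangentSpace (𝓡 m) x)]
  {e : OpenPartialHomeomorph M (Euc m)} {V : Set M} {r : ℝ}
  {W N : Set (Euc m × Euc m)} {b c : Euc m × Euc m → C(unitInterval, Euc m)}
  {A : (x : M) → TangentSpace (𝓡 m) x}

lemma sum_mul_pd (x : Fin m → ℝ) (f : Euc m → ℂ) (u : Euc m) :
    ∑ k, (x k : ℂ) * pd k f u = fderiv ℝ f u (WithLp.toLp 2 x) := by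
  conv_rhs => rw [euc_eq_sum (WithLp.toLp 2 x)]
  simp only [map_sum, map_smul, pd, Complex.real_smul]

lemma sum_mul_pd_vec (x : Euc m) (f : Euc m → ℂ) (u : Euc m) :
    ∑ k, (x k : ℂ) * pd k f u = fderiv ℝ f u x := sum_mul_pd (fun k => x k) f u

namespace IsMinimizingFamily

lemma mem_target (h : IsMinimizingFamily e V r W N b c) {z : Euc m × Euc m} (hz : z ∈ W) :
    z.1 ∈ e.target := ((h.mem_iff z).1 hz).1

lemma contDiffOn_sqLength (h : IsMinimizingFamily e V r W N b c) :
    ContDiffOn ℝ ∞ (sqLength (metricForm e) b) W :=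
  (h.isGeodesicFamily.contDiffOn_sqLength (isMetricOn_metricForm h.mem_maximalAtlas)).mono h.subset

lemma sqDist_eq (h : IsMinimizingFamily e V r W N b c) {z : Euc m × Euc m} (hz : z ∈ W) :
    sqDist e (e.symm z.2) z.1 = (sqLength (metricForm e) b z : ℂ) := by
  rw [sqDist, h.edist_eq z hz, ENNReal.toReal_ofReal (Real.sqrt_nonneg _),
    Real.sq_sqrt (sqLength_nonneg h.mem_maximalAtlas h.isGeodesicFamily (h.subset hz))]

lemma eventually_mem (h : IsMinimizingFamily e V r W N b c) {z : Euc m × Euc m} (hz : z ∈ W) :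
    ∀ᶠ v in 𝓝 z.1, (v, z.2) ∈ W :=
  (Continuous.prodMk_left z.2).continuousAt.eventually (h.isOpen_pairs.mem_nhds hz)

lemma sqDist_eventuallyEq (h : IsMinimizingFamily e V r W N b c) {z : Euc m × Euc m}
    (hz : z ∈ W) :
    sqDist e (e.symm z.2) =ᶠ[𝓝 z.1] fun v => (sqLength (metricForm e) b (v, z.2) : ℂ) := by
  filter_upwards [h.eventually_mem hz] with v hv using h.sqDist_eq hv

lemma pd_sqDist (h : IsMinimizingFamily e V r W N b c) {z : Euc m × Euc m} (hz : z ∈ W)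
    (k : Fin m) : pd k (sqDist e (e.symm z.2)) z.1
      = 2 * ∑ j, (metric e z.1 k j : ℂ) * (b z 1 j : ℂ) := by
  have hG := isMetricOn_metricForm h.mem_maximalAtlas
  rw [pd_congr (h.sqDist_eventuallyEq hz)]
  have h1 := pd_slice ((contDiffOn_ofReal h.contDiffOn_sqLength).differentiableAt_of_isOpen
    h.isOpen_pairs hz) k
  rw [h1]
  have h2 : HasFDerivAt (fun v => (sqLength (metricForm e) b v : ℂ)) _ z :=
    Complex.ofRealCLM.hasFDerivAt.comp z
      (h.contDiffOn_sqLength.differentiableAt_of_isOpen h.isOpen_pairs hz).hasFDerivAt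
  rw [h2.fderiv, ContinuousLinearMap.comp_apply,
    h.isGeodesicFamily.fderiv_sqLength hG (h.subset hz), hG.symm _ (h.mem_target hz),
    metricForm_apply]
  simp [Finset.mul_sum, Complex.ofRealCLM_apply]

/-- The first variation formula with the index raised. -/
lemma gradient_sqDist (h : IsMinimizingFamily e V r W N b c) {z : Euc m × Euc m} (hz : z ∈ W)
    (j : Fin m) : gradient e (sqDist e (e.symm z.2)) j z.1 = 2 * (b z 1 j : ℂ) := by
  have h0 : metricInv e z.1 * metric e z.1 = 1 :=
    Matrix.nonsing_inv_mul _ (metric_det_pos h.mem_maximalAtlas (h.mem_target hz)).ne'.isUnit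
  have h1 : ∑ k, metricInv e z.1 j k * (∑ l, metric e z.1 k l * b z 1 l) = b z 1 j := by
    have := congrFun (congrArg (fun B : Matrix (Fin m) (Fin m) ℝ => B.mulVec fun l => b z 1 l) h0) j
    simp only [Matrix.one_mulVec, ← Matrix.mulVec_mulVec] at this
    exact this
  rw [gradient, ← h1]
  push_cast
  rw [Finset.mul_sum]
  refine Finset.sum_congr rfl fun k _ => ?_
  rw [h.pd_sqDist hz]; ring

/-- This makes the transport equations ordinary differential equations along the geodesics from y.
-/
lemma radialDeriv_eq (h : IsMinimizingFamily e V r W N b c) {z : Euc m × Euc m} (hz : z ∈ W)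
    (f : Euc m → ℂ) : radialDeriv e (e.symm z.2) f z.1 = 2 * fderiv ℝ f z.1 (b z 1) := by
  rw [radialDeriv, ← sum_mul_pd_vec, Finset.mul_sum]
  refine Finset.sum_congr rfl fun k _ => ?_
  rw [h.gradient_sqDist hz]; ring

/-- The eikonal equation: ∇σ is twice the final velocity, whose squared length is σ. -/
lemma radialDeriv_sqDist (h : IsMinimizingFamily e V r W N b c) {z : Euc m × Euc m}
    (hz : z ∈ W) :
    radialDeriv e (e.symm z.2) (sqDist e (e.symm z.2)) z.1 = 4 * sqDist e (e.symm z.2) z.1 := by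
  rw [radialDeriv, h.sqDist_eq hz, sqLength, metricForm_apply]
  push_cast
  rw [Finset.mul_sum]
  refine Finset.sum_congr rfl fun k _ => ?_
  rw [h.pd_sqDist hz, h.gradient_sqDist hz]
  simp only [Finset.mul_sum]
  exact Finset.sum_congr rfl fun l _ => by ring

lemma fderiv_slice {F : Euc m × Euc m → ℂ} (h : IsMinimizingFamily e V r W N b c)
    (hF : ContDiffOn ℝ ∞ F W) {z : Euc m × Euc m} (hz : z ∈ W) (w : Euc m) :
    fderiv ℝ (fun v => F (v, z.2)) z.1 w = fderiv ℝ F z (w, 0) := by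
  have h1 : HasFDerivAt (𝕜 := ℝ) (fun v : Euc m => (v, z.2)) _ z.1 :=
    (hasFDerivAt_id z.1).prodMk (hasFDerivAt_const z.2 z.1)
  have h2 := (hF.differentiableAt_of_isOpen h.isOpen_pairs hz).hasFDerivAt
  have h3 : HasFDerivAt (fun v => F (v, z.2)) _ z.1 := HasFDerivAt.comp z.1 h2 h1
  rw [h3.fderiv]
  rfl

lemma transportCoeff_eventuallyEq_aux (h : IsMinimizingFamily e V r W N b c)
    {z : Euc m × Euc m} (hz : z ∈ W) :
    transportCoeff e A (e.symm z.2) z.1 = (m : ℂ)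
      - laplaceBeltrami e (fun v => (sqLength (metricForm e) b (v, z.2) : ℂ)) z.1 / 2
      + Complex.I * ∑ k, (vecCoord e A z.1 k : ℂ) *
        pd k (fun v => (sqLength (metricForm e) b (v, z.2) : ℂ)) z.1 := by
  rw [transportCoeff, laplaceBeltrami_congr (h.sqDist_eventuallyEq hz)]
  simp only [pd_congr (h.sqDist_eventuallyEq hz)]

lemma contDiffOn_transportCoeff (h : IsMinimizingFamily e V r W N b c)
    (hA : ContMDiff (𝓡 m) (𝓡 m).tangent ∞ (fun x => (⟨x, A x⟩ : TangentBundle (𝓡 m) M))) :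
    ContDiffOn ℝ ∞ (fun z : Euc m × Euc m => transportCoeff e A (e.symm z.2) z.1) W := by
  have hS := contDiffOn_ofReal h.contDiffOn_sqLength
  have hWe : ∀ z ∈ W, z.1 ∈ e.target := fun z hz => h.mem_target hz
  refine ContDiffOn.congr ?_ fun z hz => h.transportCoeff_eventuallyEq_aux hz
  refine (contDiffOn_const.sub
    ((contDiffOn_laplaceBeltrami_slice h.mem_maximalAtlas h.isOpen_pairs hWe hS).div_const 2)).add
    (contDiffOn_const.mul (ContDiffOn.sum fun k _ => ContDiffOn.mul ?_
      (contDiffOn_pd_slice h.isOpen_pairs hS k)))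
  exact contDiffOn_ofReal ((contDiffOn_vecCoord h.mem_maximalAtlas hA k).comp contDiffOn_fst hWe)

/-- To first order the final velocity is x - y. This yields the value of Δσ on the diagonal and the
infinitesimal shape of the distance. -/
lemma hasFDerivAt_velocity_one (h : IsMinimizingFamily e V r W N b c) {y : Euc m}
    (hy : (y, y) ∈ W) :
    HasFDerivAt (fun v => b (v, y) 1) (ContinuousLinearMap.id ℝ (Euc m)) y := by
  have h1 : HasFDerivAt (𝕜 := ℝ) (fun v : Euc m => (v, y)) _ y :=
    (hasFDerivAt_id y).prodMk (hasFDerivAt_const y y)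
  have h2 := ((h.isGeodesicFamily.contDiffOn_velocity).differentiableAt_of_isOpen
    h.isGeodesicFamily.isOpen (h.subset hy)).hasFDerivAt
  have h3 : HasFDerivAt (fun v => b (v, y)) _ y := HasFDerivAt.comp y h2 h1
  have h4 := (evalCurve (E := Euc m) 1).hasFDerivAt.comp y h3
  refine h4.congr_fderiv (ContinuousLinearMap.ext fun w => ?_)
  exact congrArg (fun f : C(unitInterval, Euc m) => f 1)
    (h.isGeodesicFamily.fderiv_velocity_diag y (h.subset hy) w)

/-- On the diagonal ∇σ = 0, and Δσ = 2m because ∇σ = 2b with Db the identity. The integral of ρ/s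
along geodesics therefore converges. -/
lemma transportCoeff_diag (h : IsMinimizingFamily e V r W N b c) {y : Euc m}
    (hy : (y, y) ∈ W) : transportCoeff e A (e.symm y) y = 0 := by
  have hb0 : b (y, y) 1 = 0 := by rw [h.isGeodesicFamily.velocity_diag y (h.subset hy)]; rfl
  have hpd : ∀ k, pd k (sqDist e (e.symm y)) y = 0 := fun k => by
    have := h.pd_sqDist hy k
    simp only [hb0] at this
    simpa using this
  have hgr : ∀ j, gradient e (sqDist e (e.symm y)) j =ᶠ[𝓝 y]
      fun v => 2 * ((b (v, y) 1 j : ℝ) : ℂ) := by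
    intro j
    filter_upwards [h.eventually_mem hy] with v hv using h.gradient_sqDist hv j
  have hbd := h.hasFDerivAt_velocity_one hy
  have hbj : ∀ j, HasFDerivAt (fun v => b (v, y) 1 j) (EuclideanSpace.proj j : Euc m →L[ℝ] ℝ) y :=
    fun j => ((EuclideanSpace.proj j : Euc m →L[ℝ] ℝ).hasFDerivAt.comp y
      hbd).congr_fderiv (ContinuousLinearMap.ext fun w => rfl)
  have hd' : ∀ j, DifferentiableAt ℝ (fun v => ((b (v, y) 1 j : ℝ) : ℂ)) y := fun j =>
    Complex.ofRealCLM.differentiableAt.comp y (hbj j).differentiableAt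
  have hd : ∀ j, DifferentiableAt ℝ (fun v => 2 * ((b (v, y) 1 j : ℝ) : ℂ)) y := fun j =>
    (hd' j).const_mul 2
  have hL : laplaceBeltrami e (sqDist e (e.symm y)) y = 2 * m := by
    rw [laplaceBeltrami, divergence_congr hgr, divergence_eq h.mem_maximalAtlas
      (h.mem_target hy) hd]
    simp only [hb0]
    have : ∀ j, pd j (fun v => 2 * ((b (v, y) 1 j : ℝ) : ℂ)) y = 2 := by
      intro j
      rw [pd_const_mul (hd' j),
        pd_ofReal (hbj j).differentiableAt, (hbj j).fderiv]
      simp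
    simp [this, mul_comm]
  rw [transportCoeff, hL]
  simp [hpd]

end IsMinimizingFamily

/-- The coefficient `α_0` near the diagonal. -/
def leadingCoeff (e : OpenPartialHomeomorph M (Euc m)) (A : (x : M) → TangentSpace (𝓡 m) x)
    (b c : Euc m × Euc m → C(unitInterval, Euc m)) (z : Euc m × Euc m) : ℂ :=
  Complex.exp (logAverage b c (fun z => transportCoeff e A (e.symm z.2) z.1) z / 2)

/-- The coefficients `α_ν` near the diagonal. -/
def localCoeff (e : OpenPartialHomeomorph M (Euc m)) (A : (x : M) → TangentSpace (𝓡 m) x)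
    (κ : ℝ) (b c : Euc m × Euc m → C(unitInterval, Euc m)) : ℕ → Euc m × Euc m → ℂ
  | 0 => leadingCoeff e A b c
  | ν + 1 => fun z => leadingCoeff e A b c z * radialAverage c ν (fun z =>
      -magneticOp e A κ (fun v => localCoeff e A κ b c ν (v, z.2)) z.1
        / leadingCoeff e A b c z) z

namespace IsMinimizingFamily

lemma contDiffOn_leadingCoeff (h : IsMinimizingFamily e V r W N b c)
    (hA : ContMDiff (𝓡 m) (𝓡 m).tangent ∞ (fun x => (⟨x, A x⟩ : TangentBundle (𝓡 m) M))) :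
    ContDiffOn ℝ ∞ (leadingCoeff e A b c) W :=
  ((h.isGeodesicFamily.contDiffOn_logAverage h.subset h.isOpen_pairs
    (h.contDiffOn_transportCoeff hA) h.isStar).div_const 2).cexp

lemma contDiffOn_localCoeff_aux (h : IsMinimizingFamily e V r W N b c)
    (hA : ContMDiff (𝓡 m) (𝓡 m).tangent ∞ (fun x => (⟨x, A x⟩ : TangentBundle (𝓡 m) M)))
    (κ : ℝ) {F : Euc m × Euc m → ℂ} (hF : ContDiffOn ℝ ∞ F W) :
    ContDiffOn ℝ ∞ (fun z : Euc m × Euc m => -magneticOp e A κ (fun v => F (v, z.2)) z.1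
        / leadingCoeff e A b c z) W := by
  simp only [div_eq_mul_inv]
  exact (contDiffOn_magneticOp_slice h.mem_maximalAtlas hA h.isOpen_pairs
    (fun z hz => h.mem_target hz) hF κ).neg.mul ((h.contDiffOn_leadingCoeff hA).inv
    fun z _ => Complex.exp_ne_zero _)

lemma contDiffOn_localCoeff (h : IsMinimizingFamily e V r W N b c)
    (hA : ContMDiff (𝓡 m) (𝓡 m).tangent ∞ (fun x => (⟨x, A x⟩ : TangentBundle (𝓡 m) M)))
    (κ : ℝ) (ν : ℕ) : ContDiffOn ℝ ∞ (localCoeff e A κ b c ν) W := by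
  induction ν with
  | zero => exact h.contDiffOn_leadingCoeff hA
  | succ ν ih =>
    exact (h.contDiffOn_leadingCoeff hA).mul (h.isGeodesicFamily.contDiffOn_radialAverage h.subset
      h.isOpen_pairs (h.contDiffOn_localCoeff_aux hA κ ih) h.isStar ν)

lemma localCoeff_zero_diag (h : IsMinimizingFamily e V r W N b c) (κ : ℝ) {y : Euc m}
    (hy : (y, y) ∈ W) : localCoeff e A κ b c 0 (y, y) = 1 := by
  rw [localCoeff, leadingCoeff, h.isGeodesicFamily.logAverage_diag (h.subset hy)]
  simp

lemma fderiv_leadingCoeff (h : IsMinimizingFamily e V r W N b c)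
    (hA : ContMDiff (𝓡 m) (𝓡 m).tangent ∞ (fun x => (⟨x, A x⟩ : TangentBundle (𝓡 m) M)))
    {z : Euc m × Euc m} (hz : z ∈ W) :
    2 * fderiv ℝ (leadingCoeff e A b c) z (b z 1, 0)
      = transportCoeff e A (e.symm z.2) z.1 * leadingCoeff e A b c z := by
  have h1 := h.isGeodesicFamily.contDiffOn_logAverage h.subset h.isOpen_pairs
    (h.contDiffOn_transportCoeff hA) h.isStar
  have h2 := h.isGeodesicFamily.fderiv_logAverage h.subset h.isOpen_pairs
    (h.contDiffOn_transportCoeff hA) h.isStar (fun y hy => h.transportCoeff_diag hy) hz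
  have h3 : HasFDerivAt (fun z => Complex.exp (logAverage b c
      (fun z => transportCoeff e A (e.symm z.2) z.1) z * 2⁻¹)) _ z :=
    (((h1.differentiableAt_of_isOpen h.isOpen_pairs hz).hasFDerivAt).mul_const (2⁻¹ : ℂ)).cexp
  have h4 : leadingCoeff e A b c = fun z => Complex.exp (logAverage b c
      (fun z => transportCoeff e A (e.symm z.2) z.1) z * 2⁻¹) := rfl
  rw [h4, h3.fderiv]
  simp only [FunLike.coe_smul, Pi.smul_apply, smul_eq_mul, h2]
  ring

lemma transport_zero (h : IsMinimizingFamily e V r W N b c)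
    (hA : ContMDiff (𝓡 m) (𝓡 m).tangent ∞ (fun x => (⟨x, A x⟩ : TangentBundle (𝓡 m) M)))
    (κ : ℝ) {z : Euc m × Euc m} (hz : z ∈ W) :
    transportCoeff e A (e.symm z.2) z.1 * localCoeff e A κ b c 0 z
      = radialDeriv e (e.symm z.2) (fun v => localCoeff e A κ b c 0 (v, z.2)) z.1 := by
  rw [h.radialDeriv_eq hz, h.fderiv_slice (h.contDiffOn_localCoeff hA κ 0) hz]
  exact (h.fderiv_leadingCoeff hA hz).symm

/-- Variation of constants: for α_{ν+1} = α_0 u the equation of α_0 removes ρ. What remains, (ν+1)u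
plus the derivative of u along the final velocity equals -Qα_ν/α_0, is solved by the average with
weight s^ν. -/
lemma transport_succ (h : IsMinimizingFamily e V r W N b c)
    (hA : ContMDiff (𝓡 m) (𝓡 m).tangent ∞ (fun x => (⟨x, A x⟩ : TangentBundle (𝓡 m) M)))
    (κ : ℝ) (ν : ℕ) {z : Euc m × Euc m} (hz : z ∈ W) :
    2 * ((ν : ℂ) + 1) * localCoeff e A κ b c (ν + 1) z
      - transportCoeff e A (e.symm z.2) z.1 * localCoeff e A κ b c (ν + 1) z
      + radialDeriv e (e.symm z.2) (fun v => localCoeff e A κ b c (ν + 1) (v, z.2)) z.1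
      + 2 * magneticOp e A κ (fun v => localCoeff e A κ b c ν (v, z.2)) z.1 = 0 := by
  rw [h.radialDeriv_eq hz, h.fderiv_slice (h.contDiffOn_localCoeff hA κ (ν + 1)) hz]
  have hf := h.contDiffOn_localCoeff_aux hA κ (h.contDiffOn_localCoeff hA κ ν)
  have h1 := h.isGeodesicFamily.fderiv_radialAverage h.subset h.isOpen_pairs hf h.isStar ν hz
  have hr := h.isGeodesicFamily.contDiffOn_radialAverage h.subset h.isOpen_pairs hf h.isStar ν
  have h2 := h.fderiv_leadingCoeff hA hz
  have h3 : HasFDerivAt (localCoeff e A κ b c (ν + 1)) _ z :=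
    ((h.contDiffOn_leadingCoeff hA).differentiableAt_of_isOpen h.isOpen_pairs hz).hasFDerivAt.mul
      (hr.differentiableAt_of_isOpen h.isOpen_pairs hz).hasFDerivAt
  have h0 : leadingCoeff e A b c z ≠ 0 := Complex.exp_ne_zero _
  rw [h3.fderiv]
  simp only [add_apply, FunLike.coe_smul, Pi.smul_apply, smul_eq_mul]
  rw [show localCoeff e A κ b c (ν + 1) z = leadingCoeff e A b c z * radialAverage c ν (fun z =>
      -magneticOp e A κ (fun v => localCoeff e A κ b c ν (v, z.2)) z.1
        / leadingCoeff e A b c z) z from rfl]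
  have h4 := congrArg (fun x => 2 * leadingCoeff e A b c z * x) h1
  simp only [mul_add] at h4
  rw [show 2 * leadingCoeff e A b c z * (-magneticOp e A κ
    (fun v => localCoeff e A κ b c ν (v, z.2)) z.1 / leadingCoeff e A b c z) =
    -(2 * magneticOp e A κ (fun v => localCoeff e A κ b c ν (v, z.2)) z.1) by field_simp] at h4
  linear_combination h4 + radialAverage c ν (fun z =>
      -magneticOp e A κ (fun v => localCoeff e A κ b c ν (v, z.2)) z.1
        / leadingCoeff e A b c z) z * h2

end IsMinimizingFamily

end LocalTransport

/-! ### The squared distance and the transport equations in an arbitrary chart -/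

section ArbitraryChart

variable {m : ℕ} {M : Type*} [EMetricSpace M] [ChartedSpace (Euc m) M]

/-- The ball of radius `r` about `y`, in the chart `e`. -/
def coordBall (e : OpenPartialHomeomorph M (Euc m)) (y : M) (r : ℝ) : Set (Euc m) :=
  {u ∈ e.target | edist (e.symm u) y < ENNReal.ofReal r}

lemma isOpen_coordBall {e : OpenPartialHomeomorph M (Euc m)} {y : M} {r : ℝ} :
    IsOpen (coordBall e y r) := by
  have h : IsOpen {x : M | edist x y < ENNReal.ofReal r} := Metric.isOpen_eball
  exact e.isOpen_inter_preimage_symm h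

lemma coordBall_subset {e : OpenPartialHomeomorph M (Euc m)} {y : M} {r : ℝ} :
    coordBall e y r ⊆ e.target := fun _ hu => hu.1

lemma coordBall_mono {e : OpenPartialHomeomorph M (Euc m)} {y : M} {r r' : ℝ} (h : r ≤ r') :
    coordBall e y r ⊆ coordBall e y r' :=
  fun _ hu => ⟨hu.1, hu.2.trans_le (ENNReal.ofReal_le_ofReal h)⟩

lemma mem_coordBall_self {e : OpenPartialHomeomorph M (Euc m)} {y : M} {r : ℝ} (hr : 0 < r)
    (hy : y ∈ e.source) : e y ∈ coordBall e y r :=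
  ⟨e.map_source hy, by rw [e.left_inv hy]; simpa using hr⟩

variable [IsManifold (𝓡 m) ∞ M] [RiemannianBundle (fun x : M => TangentSpace (𝓡 m) x)]
  [IsContMDiffRiemannianBundle (𝓡 m) ∞ (Euc m) (fun x : M => TangentSpace (𝓡 m) x)]
  {e e' : OpenPartialHomeomorph M (Euc m)} {V : Set M} {r : ℝ}
  {W N : Set (Euc m × Euc m)} {b c : Euc m × Euc m → C(unitInterval, Euc m)}
  {A : (x : M) → TangentSpace (𝓡 m) x} {y : M} {κ : ℝ}

/-- The functions `β_ν` solve the transport equations on the subset `D` of the chart `e`. -/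
structure SolvesTransport (e : OpenPartialHomeomorph M (Euc m))
    (A : (x : M) → TangentSpace (𝓡 m) x) (κ : ℝ) (y : M) (D : Set (Euc m))
    (β : ℕ → Euc m → ℂ) : Prop where
  contDiffOn : ∀ ν, ContDiffOn ℝ ∞ (β ν) D
  zero : ∀ u ∈ D, transportCoeff e A y u * β 0 u = radialDeriv e y (β 0) u
  succ : ∀ u ∈ D, ∀ ν : ℕ, 2 * ((ν : ℂ) + 1) * β (ν + 1) u
    - transportCoeff e A y u * β (ν + 1) u + radialDeriv e y (β (ν + 1)) u
    + 2 * magneticOp e A κ (β ν) u = 0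

/-- The functions E_{ν+m+2}(t, d) to which the operators are applied are only known to be C² in x,
hence these versions of finite order. -/
lemma contDiffOn_pd_one {D : Set (Euc m)} (hD : IsOpen D) {f : Euc m → ℂ}
    (hf : ContDiffOn ℝ 2 f D) (j : Fin m) : ContDiffOn ℝ 1 (pd j f) D :=
  (hf.fderiv_of_isOpen hD (by rw [one_add_one_eq_two])).clm_apply contDiffOn_const

lemma contDiffOn_gradient_one (he : e ∈ IsManifold.maximalAtlas (𝓡 m) ∞ M)
    {D : Set (Euc m)} (hD : IsOpen D) (hDe : D ⊆ e.target) {f : Euc m → ℂ}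
    (hf : ContDiffOn ℝ 2 f D) (j : Fin m) : ContDiffOn ℝ 1 (gradient e f j) D :=
  ContDiffOn.sum fun k _ => ContDiffOn.mul
    (((contDiffOn_ofReal (contDiffOn_metricInv he j k)).mono hDe).of_le (by simp))
    (contDiffOn_pd_one hD hf k)

lemma contDiffOn_magneticGradient_one (he : e ∈ IsManifold.maximalAtlas (𝓡 m) ∞ M)
    (hA : ContMDiff (𝓡 m) (𝓡 m).tangent ∞ (fun x => (⟨x, A x⟩ : TangentBundle (𝓡 m) M)))
    {D : Set (Euc m)} (hD : IsOpen D) (hDe : D ⊆ e.target) {f : Euc m → ℂ}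
    (hf : ContDiffOn ℝ 2 f D) (j : Fin m) : ContDiffOn ℝ 1 (magneticGradient e A f j) D :=
  (contDiffOn_const.mul (contDiffOn_gradient_one he hD hDe hf j)).add
    (ContDiffOn.mul (((contDiffOn_ofReal (contDiffOn_vecCoord he hA j)).mono hDe).of_le (by simp))
      (hf.of_le one_le_two))

lemma magneticOp_linear (he : e ∈ IsManifold.maximalAtlas (𝓡 m) ∞ M)
    (hA : ContMDiff (𝓡 m) (𝓡 m).tangent ∞ (fun x => (⟨x, A x⟩ : TangentBundle (𝓡 m) M)))
    {D : Set (Euc m)} (hD : IsOpen D) (hDe : D ⊆ e.target) {f g : Euc m → ℂ}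
    (hf : ContDiffOn ℝ 2 f D) (hg : ContDiffOn ℝ 2 g D) (a : ℂ) {u : Euc m} (hu : u ∈ D) :
    magneticOp e A κ (fun v => f v + a * g v) u
      = magneticOp e A κ f u + a * magneticOp e A κ g u := by
  have hdf := fun v (hv : v ∈ D) => (hf.contDiffAt (hD.mem_nhds hv)).differentiableAt two_ne_zero
  have hdg := fun v (hv : v ∈ D) => (hg.contDiffAt (hD.mem_nhds hv)).differentiableAt two_ne_zero
  have h1 : ∀ v ∈ D, ∀ j, magneticGradient e A (fun v => f v + a * g v) j v
      = magneticGradient e A f j v + a * magneticGradient e A g j v := by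
    intro v hv j
    simp only [magneticGradient, gradient, pd_add (hdf v hv) ((hdg v hv).const_mul a),
      pd_const_mul (hdg v hv), mul_add, Finset.sum_add_distrib, Finset.mul_sum]
    have : ∀ k, Complex.I * ((metricInv e v j k : ℂ) * (a * pd k g v))
        = a * (Complex.I * ((metricInv e v j k : ℂ) * pd k g v)) := fun k => by ring
    simp only [this]
    ring
  have h2 : ∀ j, magneticGradient e A (fun v => f v + a * g v) j =ᶠ[𝓝 u]
      fun v => magneticGradient e A f j v + a * magneticGradient e A g j v := fun j => by
    filter_upwards [hD.mem_nhds hu] with v hv using h1 v hv j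
  have hXf := fun j => ((contDiffOn_magneticGradient_one he hA hD hDe hf j).contDiffAt
    (hD.mem_nhds hu)).differentiableAt one_ne_zero
  have hXg := fun j => ((contDiffOn_magneticGradient_one he hA hD hDe hg j).contDiffAt
    (hD.mem_nhds hu)).differentiableAt one_ne_zero
  simp only [magneticOp]
  rw [divergence_congr h2, divergence_add he (hDe hu) hXf fun j => (hXg j).const_mul a,
    divergence_const_mul he (hDe hu) hXg]
  simp only [h1 u hu, mul_add, Finset.sum_add_distrib, Finset.mul_sum]
  have : ∀ j k, (metric e u j k : ℂ) * (vecCoord e A u j : ℂ) * (a * magneticGradient e A g k u)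
      = a * ((metric e u j k : ℂ) * (vecCoord e A u j : ℂ) * magneticGradient e A g k u) :=
    fun j k => by ring
  simp only [this]
  ring

lemma radialDeriv_linear {f g : Euc m → ℂ} {u : Euc m} (hf : DifferentiableAt ℝ f u)
    (hg : DifferentiableAt ℝ g u) (a : ℂ) :
    radialDeriv e y (fun v => f v + a * g v) u = radialDeriv e y f u + a * radialDeriv e y g u := by
  simp only [radialDeriv, pd_add hf (hg.const_mul a), pd_const_mul hg, mul_add,
    Finset.sum_add_distrib, Finset.mul_sum]
  congr 1
  exact Finset.sum_congr rfl fun k _ => by ring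

namespace SolvesTransport

variable {D : Set (Euc m)}

lemma mono {β : ℕ → Euc m → ℂ} {D' : Set (Euc m)} (h : SolvesTransport e A κ y D β)
    (hD : D' ⊆ D) : SolvesTransport e A κ y D' β :=
  ⟨fun ν => (h.contDiffOn ν).mono hD, fun u hu => h.zero u (hD hu),
    fun u hu => h.succ u (hD hu)⟩

lemma congr {β β' : ℕ → Euc m → ℂ} (h : SolvesTransport e A κ y D β) (hD : IsOpen D)
    (hβ : ∀ ν, ∀ u ∈ D, β' ν u = β ν u) : SolvesTransport e A κ y D β' := by
  have h1 : ∀ ν, ∀ u ∈ D, β' ν =ᶠ[𝓝 u] β ν := fun ν u hu => by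
    filter_upwards [hD.mem_nhds hu] with v hv using hβ ν v hv
  refine ⟨fun ν => (h.contDiffOn ν).congr (hβ ν), fun u hu => ?_, fun u hu ν => ?_⟩
  · rw [hβ 0 u hu, radialDeriv_congr (h1 0 u hu), h.zero u hu]
  · rw [hβ _ u hu, radialDeriv_congr (h1 _ u hu), magneticOp_congr (h1 _ u hu), h.succ u hu]

lemma zero_fun : SolvesTransport e A κ y D fun _ _ => 0 := by
  have h0 : ∀ k, pd k (fun _ : Euc m => (0 : ℂ)) = fun _ => 0 := fun k => by
    funext u; simp [pd]
  have h1 : ∀ k, gradient e (fun _ : Euc m => (0 : ℂ)) k = fun _ => 0 := fun k => by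
    funext u; simp [gradient, h0]
  refine ⟨fun ν => contDiffOn_const, fun u _ => ?_, fun u _ ν => ?_⟩
  · simp [radialDeriv, h0]
  · simp [radialDeriv, h0, magneticOp, magneticGradient, h1, divergence]

lemma add_mul {β β' : ℕ → Euc m → ℂ} (he : e ∈ IsManifold.maximalAtlas (𝓡 m) ∞ M)
    (hA : ContMDiff (𝓡 m) (𝓡 m).tangent ∞ (fun x => (⟨x, A x⟩ : TangentBundle (𝓡 m) M)))
    (hD : IsOpen D) (hDe : D ⊆ e.target) (h : SolvesTransport e A κ y D β)
    (h' : SolvesTransport e A κ y D β') (a : ℂ) :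
    SolvesTransport e A κ y D fun ν u => β ν u + a * β' ν u := by
  refine ⟨fun ν => (h.contDiffOn ν).add (contDiffOn_const.mul (h'.contDiffOn ν)),
    fun u hu => ?_, fun u hu ν => ?_⟩
  · rw [radialDeriv_linear ((h.contDiffOn 0).differentiableAt_of_isOpen hD hu)
      ((h'.contDiffOn 0).differentiableAt_of_isOpen hD hu), ← h.zero u hu, ← h'.zero u hu]
    ring
  · rw [radialDeriv_linear ((h.contDiffOn _).differentiableAt_of_isOpen hD hu)
      ((h'.contDiffOn _).differentiableAt_of_isOpen hD hu),
      magneticOp_linear he hA hD hDe ((h.contDiffOn ν).of_le two_le_infty)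
        ((h'.contDiffOn ν).of_le two_le_infty) a hu]
    linear_combination h.succ u hu ν + a * h'.succ u hu ν

/-- The equations are linear and homogeneous and differentiate only in x, so weights depending on y
alone act as constants. A partition of unity in y can thus be used without error terms. -/
lemma sum {ι : Type*} (s : Finset ι) {β : ι → ℕ → Euc m → ℂ} {a : ι → ℂ}
    (he : e ∈ IsManifold.maximalAtlas (𝓡 m) ∞ M)
    (hA : ContMDiff (𝓡 m) (𝓡 m).tangent ∞ (fun x => (⟨x, A x⟩ : TangentBundle (𝓡 m) M)))
    (hD : IsOpen D) (hDe : D ⊆ e.target) (h : ∀ i ∈ s, SolvesTransport e A κ y D (β i)) :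
    SolvesTransport e A κ y D fun ν u => ∑ i ∈ s, a i * β i ν u := by
  classical
  induction s using Finset.induction_on with
  | empty => simpa using zero_fun
  | insert i s hi ih =>
    have := (ih fun j hj => h j (Finset.mem_insert_of_mem hj)).add_mul he hA hD hDe
      (h i (Finset.mem_insert_self i s)) (a i)
    refine this.congr hD fun ν u _ => ?_
    rw [Finset.sum_insert hi, add_comm]

end SolvesTransport

namespace IsMinimizingFamily

lemma mem_overlap (h : IsMinimizingFamily e V r W N b c) (hy : y ∈ V) {u : Euc m}
    (hu : u ∈ coordBall e' y r) : u ∈ overlap e' e :=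
  ⟨hu.1, h.mem_source _ y hy hu.2⟩

lemma symm_apply (h : IsMinimizingFamily e V r W N b c) (hy : y ∈ V) : e.symm (e y) = y :=
  e.left_inv (h.subset_source hy)

lemma transition_pair_mem (h : IsMinimizingFamily e V r W N b c) (hy : y ∈ V) {u : Euc m}
    (hu : u ∈ coordBall e' y r) : (transition e' e u, e y) ∈ W := by
  refine (h.mem_iff _).2 ⟨transition_mem (h.mem_overlap hy hu), e.map_source (h.subset_source hy),
    by rwa [h.symm_apply hy], ?_⟩
  rw [h.symm_apply hy, symm_transition (h.mem_overlap hy hu)]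
  exact hu.2

lemma contDiffOn_sqDist_self (h : IsMinimizingFamily e V r W N b c) (hy : y ∈ V) :
    ContDiffOn ℝ ∞ (sqDist e y) {u | (u, e y) ∈ W} := by
  refine ContDiffOn.congr (f := fun u => ((sqLength (metricForm e) b (u, e y) : ℝ) : ℂ)) ?_ ?_
  · exact (contDiffOn_ofReal h.contDiffOn_sqLength).comp
      (contDiffOn_id.prodMk contDiffOn_const) fun u hu => hu
  · intro u hu
    have := h.sqDist_eq hu
    rwa [h.symm_apply hy] at this

lemma isOpen_slice (h : IsMinimizingFamily e V r W N b c) (w : Euc m) :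
    IsOpen {u | (u, w) ∈ W} := h.isOpen_pairs.preimage (Continuous.prodMk_left w)

lemma slice_subset (h : IsMinimizingFamily e V r W N b c) (w : Euc m) :
    {u | (u, w) ∈ W} ⊆ e.target := fun _ hu => h.mem_target hu

lemma contDiffOn_sqDist (h : IsMinimizingFamily e V r W N b c) (hy : y ∈ V)
    (he' : e' ∈ IsManifold.maximalAtlas (𝓡 m) ∞ M) :
    ContDiffOn ℝ ∞ (sqDist e' y) (coordBall e' y r) := by
  refine ContDiffOn.congr (f := sqDist e y ∘ transition e' e) ?_ ?_
  · exact (h.contDiffOn_sqDist_self hy).comp ((contDiffOn_transition he' h.mem_maximalAtlas).mono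
      fun u hu => h.mem_overlap hy hu) fun u hu => h.transition_pair_mem hy hu
  · intro u hu
    exact (sqDist_transition (h.mem_overlap hy hu) y).eq_of_nhds

lemma radialDeriv_sqDist_chart (h : IsMinimizingFamily e V r W N b c) (hy : y ∈ V)
    (he' : e' ∈ IsManifold.maximalAtlas (𝓡 m) ∞ M) {u : Euc m} (hu : u ∈ coordBall e' y r) :
    radialDeriv e' y (sqDist e' y) u = 4 * sqDist e' y u := by
  have hov := h.mem_overlap hy hu
  have hW := h.transition_pair_mem hy hu
  have hd := (h.contDiffOn_sqDist_self hy).differentiableAt_of_isOpen (h.isOpen_slice _) hW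
  rw [radialDeriv_transition he' h.mem_maximalAtlas hov hd hd (sqDist_transition hov y)]
  have := h.radialDeriv_sqDist hW
  simp only [h.symm_apply hy] at this
  rw [this, (sqDist_transition hov y).eq_of_nhds]
  rfl

lemma solvesTransport (h : IsMinimizingFamily e V r W N b c) (hy : y ∈ V)
    (he' : e' ∈ IsManifold.maximalAtlas (𝓡 m) ∞ M)
    (hA : ContMDiff (𝓡 m) (𝓡 m).tangent ∞ (fun x => (⟨x, A x⟩ : TangentBundle (𝓡 m) M))) :
    SolvesTransport e' A κ y (coordBall e' y r)
      fun ν u => localCoeff e A κ b c ν (transition e' e u, e y) := by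
  have hs : ∀ ν, ContDiffOn ℝ ∞ (fun v => localCoeff e A κ b c ν (v, e y)) {u | (u, e y) ∈ W} :=
    fun ν => (h.contDiffOn_localCoeff hA κ ν).comp (contDiffOn_id.prodMk contDiffOn_const)
      fun u hu => hu
  have hσ := h.contDiffOn_sqDist_self hy
  have hd : ∀ ν, ∀ u, (u, e y) ∈ W →
      DifferentiableAt ℝ (fun v => localCoeff e A κ b c ν (v, e y)) u := fun ν u hu =>
    (hs ν).differentiableAt_of_isOpen (h.isOpen_slice _) hu
  refine ⟨fun ν => (hs ν).comp ((contDiffOn_transition he' h.mem_maximalAtlas).mono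
      fun u hu => h.mem_overlap hy hu) fun u hu => h.transition_pair_mem hy hu,
    fun u hu => ?_, fun u hu ν => ?_⟩
  all_goals
    have hov := h.mem_overlap hy hu
    have hW := h.transition_pair_mem hy hu
    have hσd := hσ.differentiableAt_of_isOpen (h.isOpen_slice _) hW
    have h1 : transportCoeff e' A y u = transportCoeff e A y (transition e' e u) :=
      transportCoeff_transition he' h.mem_maximalAtlas hov (h.isOpen_slice (e y))
        (h.slice_subset (e y)) hW hσ
    have h2 := fun ν => radialDeriv_transition
      (f := fun v => localCoeff e A κ b c ν (transition e' e v, e y)) he' h.mem_maximalAtlas hov hσd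
      (hd ν _ hW) (by rfl)
    have h3 := fun ν => magneticOp_transition (c := κ)
      (f := fun v => localCoeff e A κ b c ν (transition e' e v, e y))
      he' h.mem_maximalAtlas hA hov (h.isOpen_slice (e y)) (h.slice_subset (e y)) hW (hs ν) (by rfl)
  · have := h.transport_zero hA κ hW
    simp only [h.symm_apply hy] at this
    rw [h1, h2 0, this]
  · have := h.transport_succ hA κ ν hW
    simp only [h.symm_apply hy] at this
    rw [h1, h2 (ν + 1), h3 ν, this]

end IsMinimizingFamily

end ArbitraryChart

/-! ### The behaviour of the distance near the diagonal, in an arbitrary chart -/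

section Infinitesimal

/-- The minimum over the unit sphere serves at p; by continuity of the metric half of it serves
nearby. -/
lemma IsMetricOn.exists_lower_bound {E : Type} [NormedAddCommGroup E] [NormedSpace ℝ E]
    [FiniteDimensional ℝ E] {G : E → E →L[ℝ] E →L[ℝ] ℝ} {U : Set E} (hG : IsMetricOn G U) {p : E}
    (hp : p ∈ U) : ∃ a : ℝ, 0 < a ∧ ∀ᶠ u in 𝓝 p, ∀ v, a * ‖v‖ ^ 2 ≤ G u v v := by
  obtain ⟨a, ha, hav⟩ : ∃ a : ℝ, 0 < a ∧ ∀ v, a * ‖v‖ ^ 2 ≤ G p v v := by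
    rcases (Metric.sphere (0 : E) 1).eq_empty_or_nonempty with h | h
    · refine ⟨1, one_pos, fun v => ?_⟩
      have hv : v = 0 := by
        by_contra hv
        have : (‖v‖⁻¹ • v) ∈ Metric.sphere (0 : E) 1 := by
          simp [norm_smul, hv]
        rw [h] at this
        exact this
      simp [hv]
    · have hc : Continuous fun v => G p v v :=
        (G p).continuous.clm_apply continuous_id
      obtain ⟨w, hw, hmin⟩ := (isCompact_sphere (0 : E) 1).exists_isMinOn h hc.continuousOn
      have hw0 : w ≠ 0 := by
        rintro rfl
        simp at hw
      refine ⟨G p w w, hG.pos p hp w hw0, fun v => ?_⟩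
      by_cases hv : v = 0
      · simp [hv]
      have h1 : (‖v‖⁻¹ • v) ∈ Metric.sphere (0 : E) 1 := by
        simp [norm_smul, hv]
      have h2 : G p w w ≤ G p (‖v‖⁻¹ • v) (‖v‖⁻¹ • v) := hmin h1
      simp only [map_smul, FunLike.coe_smul, Pi.smul_apply, smul_eq_mul] at h2
      have h3 : 0 < ‖v‖ := norm_pos_iff.2 hv
      calc G p w w * ‖v‖ ^ 2 ≤ (‖v‖⁻¹ * (‖v‖⁻¹ * G p v v)) * ‖v‖ ^ 2 := by gcongr
        _ = G p v v := by field_simp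
  refine ⟨a / 2, by positivity, ?_⟩
  have h1 : ContinuousAt G p := hG.contDiffOn.continuousOn.continuousAt (hG.isOpen.mem_nhds hp)
  filter_upwards [Metric.continuousAt_iff'.1 h1 (a / 2) (by positivity)] with u hu v
  rw [dist_eq_norm] at hu
  have h2 : |(G u - G p) v v| ≤ a / 2 * ‖v‖ * ‖v‖ :=
    ((G u - G p).le_opNorm₂ v v).trans (by gcongr)
  have h3 : G u v v = G p v v + (G u - G p) v v := by simp
  rw [h3]
  nlinarith [hav v, neg_abs_le ((G u - G p) v v)]

variable {m : ℕ} {M : Type*} [EMetricSpace M] [ChartedSpace (Euc m) M]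
  [IsManifold (𝓡 m) ∞ M] [RiemannianBundle (fun x : M => TangentSpace (𝓡 m) x)]
  [IsContMDiffRiemannianBundle (𝓡 m) ∞ (Euc m) (fun x : M => TangentSpace (𝓡 m) x)]
  {e e' : OpenPartialHomeomorph M (Euc m)} {V : Set M} {r : ℝ}
  {W N : Set (Euc m × Euc m)} {b c : Euc m × Euc m → C(unitInterval, Euc m)} {y : M}

namespace IsMinimizingFamily

lemma toReal_edist_sq (h : IsMinimizingFamily e V r W N b c) (hy : y ∈ V) {u : Euc m}
    (hu : u ∈ coordBall e' y r) : (edist (e'.symm u) y).toReal ^ 2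
      = metricForm e (transition e' e u) (b (transition e' e u, e y) 1)
        (b (transition e' e u, e y) 1) := by
  have hW := h.transition_pair_mem hy hu
  have h1 := h.edist_eq _ hW
  rw [symm_transition (h.mem_overlap hy hu), h.symm_apply hy] at h1
  rw [h1, ENNReal.toReal_ofReal (Real.sqrt_nonneg _),
    Real.sq_sqrt (sqLength_nonneg h.mem_maximalAtlas h.isGeodesicFamily (h.subset hW))]
  rfl

lemma transition_self (_h : IsMinimizingFamily e V r W N b c) (_hy : y ∈ V) (hy' : y ∈ e'.source) :
    transition e' e (e' y) = e y := by
  rw [transition, e'.left_inv hy']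

lemma self_pair_mem (h : IsMinimizingFamily e V r W N b c) (hy : y ∈ V) : (e y, e y) ∈ W :=
  (h.mem_iff _).2 ⟨e.map_source (h.subset_source hy), e.map_source (h.subset_source hy),
    by rwa [h.symm_apply hy], by simp [h.pos]⟩

lemma hasFDerivAt_velocity_chart (h : IsMinimizingFamily e V r W N b c) (hy : y ∈ V)
    (he' : e' ∈ IsManifold.maximalAtlas (𝓡 m) ∞ M) (hy' : y ∈ e'.source) :
    HasFDerivAt (fun v => b (transition e' e v, e y) 1)
      (fderiv ℝ (transition e' e) (e' y)) (e' y) := by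
  have h1 := (differentiableAt_transition he' h.mem_maximalAtlas
    (h.mem_overlap hy (mem_coordBall_self h.pos hy'))).hasFDerivAt
  have h2 := h.hasFDerivAt_velocity_one (h.self_pair_mem hy)
  rw [← h.transition_self hy hy'] at h2
  have h3 := HasFDerivAt.comp (e' y) h2 h1
  rw [h.transition_self hy hy'] at h3
  exact h3.congr_fderiv (ContinuousLinearMap.id_comp _)

lemma velocity_chart_self (h : IsMinimizingFamily e V r W N b c) (hy : y ∈ V)
    (hy' : y ∈ e'.source) : b (transition e' e (e' y), e y) 1 = 0 := by
  rw [h.transition_self hy hy',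
    h.isGeodesicFamily.velocity_diag _ (h.subset (h.self_pair_mem hy))]
  rfl

/-- The distance to `y` is asymptotic to the norm on the tangent space at `y`. -/
lemma tendsto_edist_sq (h : IsMinimizingFamily e V r W N b c) (hy : y ∈ V)
    (he' : e' ∈ IsManifold.maximalAtlas (𝓡 m) ∞ M) (hy' : y ∈ e'.source) (z : Euc m) :
    Filter.Tendsto (fun ε : ℝ => (edist (e'.symm (e' y + ε • z)) y).toReal ^ 2 / ε ^ 2)
      (𝓝[>] 0) (𝓝 (metricForm e' (e' y) z z)) := by
  set β : ℝ → Euc m := fun ε => b (transition e' e (e' y + ε • z), e y) 1 with hβ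
  have hmem := mem_coordBall_self (e := e') h.pos hy'
  have hov := h.mem_overlap hy hmem
  have hline : HasDerivAt (fun ε : ℝ => e' y + ε • z) z 0 := by
    simpa using ((hasDerivAt_id (0 : ℝ)).smul_const z).const_add (e' y)
  have h1 : HasDerivAt β (fderiv ℝ (transition e' e) (e' y) z) 0 := by
    have h2 := h.hasFDerivAt_velocity_chart hy he' hy'
    refine HasFDerivAt.comp_hasDerivAt (x := (0 : ℝ)) (f := fun ε : ℝ => e' y + ε • z)
      (l := fun v => b (transition e' e v, e y) 1) ?_ hline
    simpa using h2
  have hβ0 : β 0 = 0 := by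
    simp only [hβ, zero_smul, add_zero]
    exact h.velocity_chart_self hy hy'
  have h2 : Filter.Tendsto (fun ε : ℝ => ε⁻¹ • β ε) (𝓝[>] 0)
      (𝓝 (fderiv ℝ (transition e' e) (e' y) z)) := by
    have := (hasDerivAt_iff_tendsto_slope.1 h1).mono_left
      (nhdsWithin_mono 0 (fun x (hx : 0 < x) => hx.ne'))
    refine this.congr fun ε => ?_
    simp [slope, hβ0]
  have hG := isMetricOn_metricForm h.mem_maximalAtlas
  have h3 : Filter.Tendsto (fun ε : ℝ => metricForm e (transition e' e (e' y + ε • z))) (𝓝[>] 0)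
      (𝓝 (metricForm e (transition e' e (e' y)))) := by
    have h4 : ContinuousAt (metricForm e) (transition e' e (e' y)) :=
      hG.contDiffOn.continuousOn.continuousAt (hG.isOpen.mem_nhds (transition_mem hov))
    have h5 := (differentiableAt_transition he' h.mem_maximalAtlas hov).continuousAt
    have h6 : ContinuousAt (fun ε : ℝ => e' y + ε • z) 0 := hline.continuousAt
    have h7 : ContinuousAt (fun ε : ℝ => metricForm e (transition e' e (e' y + ε • z))) 0 := by
      refine ContinuousAt.comp (f := fun ε : ℝ => transition e' e (e' y + ε • z))
        (g := metricForm e) ?_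
        (ContinuousAt.comp (f := fun ε : ℝ => e' y + ε • z) (g := transition e' e) ?_ h6)
      · simpa using h4
      · simpa using h5
    simpa using h7.tendsto.mono_left nhdsWithin_le_nhds
  have happ : ∀ {F : Type} [NormedAddCommGroup F] [NormedSpace ℝ F] {T : ℝ → Euc m →L[ℝ] F}
      {T₀ : Euc m →L[ℝ] F} {x : ℝ → Euc m} {x₀ : Euc m}, Filter.Tendsto T (𝓝[>] 0) (𝓝 T₀) →
      Filter.Tendsto x (𝓝[>] 0) (𝓝 x₀) → Filter.Tendsto (fun ε => T ε (x ε)) (𝓝[>] 0) (𝓝 (T₀ x₀)) :=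
    fun {F} _ _ {T T₀ x x₀} hT hx =>
      ((isBoundedBilinearMap_apply (𝕜 := ℝ) (E := Euc m) (F := F)).continuous.tendsto
        (T₀, x₀)).comp (hT.prodMk_nhds hx)
  have h8 := happ (happ h3 h2) h2
  rw [metricForm_transition he' h.mem_maximalAtlas hov]
  refine h8.congr' ?_
  have h9 : ∀ᶠ ε in 𝓝[>] (0 : ℝ), e' y + ε • z ∈ coordBall e' y r :=
    (hline.continuousAt.mono_left nhdsWithin_le_nhds).eventually
      (isOpen_coordBall.mem_nhds (by simpa using hmem))
  filter_upwards [h9] with ε hε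
  rw [h.toReal_edist_sq hy hε]
  simp only [hβ, map_smul, FunLike.coe_smul, Pi.smul_apply, smul_eq_mul]
  ring

/-- The squared distance is G(b, b), at least a multiple of |b|², and b vanishes at y with an
injective derivative, so |b| is at least a multiple of |u - e' y|. -/
lemma exists_lower_bound_near (h : IsMinimizingFamily e V r W N b c) (hy : y ∈ V)
    (he' : e' ∈ IsManifold.maximalAtlas (𝓡 m) ∞ M) (hy' : y ∈ e'.source) :
    ∃ a : ℝ, 0 < a ∧ ∀ᶠ u in 𝓝 (e' y),
      ENNReal.ofReal (a * ‖u - e' y‖) ≤ edist (e'.symm u) y := by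
  have hmem := mem_coordBall_self (e := e') h.pos hy'
  have hov := h.mem_overlap hy hmem
  have hG := isMetricOn_metricForm h.mem_maximalAtlas
  obtain ⟨a, ha, hGa⟩ := hG.exists_lower_bound (transition_mem hov)
  have hD : Topology.IsInducing (fderiv ℝ (transition e' e) (e' y)) := by
    have hinj : Function.Injective (fderiv ℝ (transition e' e) (e' y)) := by
      intro v w hvw
      refine chartSymmDeriv_injective he' hmem.1 ?_
      rw [chartSymmDeriv_transition he' h.mem_maximalAtlas hov]
      exact congrArg (chartSymmDeriv e (transition e' e (e' y))) hvw
    obtain ⟨K, -, hK⟩ := LinearMap.exists_antilipschitzWith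
      (fderiv ℝ (transition e' e) (e' y)).toLinearMap (LinearMap.ker_eq_bot.2 hinj)
    exact (AntilipschitzWith.isUniformInducing hK
      (fderiv ℝ (transition e' e) (e' y)).uniformContinuous).isInducing
  have h1 := (h.hasFDerivAt_velocity_chart hy he' hy').isTheta_sub hD |>.isBigO_symm
  obtain ⟨C, hC, h2⟩ := h1.exists_pos
  rw [Asymptotics.isBigOWith_iff] at h2
  have h5 := (differentiableAt_transition he' h.mem_maximalAtlas hov).continuousAt.eventually hGa
  refine ⟨√a / C, by positivity, ?_⟩
  filter_upwards [h2, h5, isOpen_coordBall.mem_nhds hmem] with u hu1 hu2 hu3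
  rw [h.velocity_chart_self hy hy', sub_zero] at hu1
  have h6 := h.toReal_edist_sq hy hu3
  have h7 := hu2 (b (transition e' e u, e y) 1)
  rw [← h6] at h7
  have hfin : edist (e'.symm u) y ≠ ⊤ := (hu3.2.trans ENNReal.ofReal_lt_top).ne
  rw [← ENNReal.ofReal_toReal hfin]
  refine ENNReal.ofReal_le_ofReal ?_
  refine le_trans ?_ (Real.le_sqrt_of_sq_le (x := √a * ‖b (transition e' e u, e y) 1‖) ?_ |>.trans
    (Real.sqrt_sq ENNReal.toReal_nonneg).le)
  · rw [div_mul_eq_mul_div, div_le_iff₀ hC, mul_assoc]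
    exact mul_le_mul_of_nonneg_left (by rwa [mul_comm]) (Real.sqrt_nonneg _)
  · rwa [mul_pow, Real.sq_sqrt ha.le]

end IsMinimizingFamily

lemma exists_lower_bound_of_ne {K : Set (Euc m)} (hK : IsCompact K) (hKe : K ⊆ e'.target)
    (hy : ∀ u ∈ K, e'.symm u ≠ y) :
    ∃ a : ℝ, 0 < a ∧ ∀ u ∈ K, ENNReal.ofReal a ≤ edist (e'.symm u) y := by
  rcases K.eq_empty_or_nonempty with rfl | hne
  · exact ⟨1, one_pos, by simp⟩
  have hc : ContinuousOn (fun u => edist (e'.symm u) y) K :=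
    continuous_edist.comp_continuousOn
      ((e'.continuousOn_symm.mono hKe).prodMk continuousOn_const)
  obtain ⟨w, hw, hmin⟩ := hK.exists_isMinOn hne hc
  have h0 : edist (e'.symm w) y ≠ 0 := fun h => hy w hw (edist_eq_zero.1 h)
  refine ⟨(min (edist (e'.symm w) y) 1).toReal, ENNReal.toReal_pos (by simp [h0]) (by simp),
    fun u hu => ?_⟩
  rw [ENNReal.ofReal_toReal (by simp)]
  exact (min_le_left _ _).trans (hmin hu)

namespace IsMinimizingFamily

/-- Near y the bound is infinitesimal. Away from y the distance has a positive minimum on the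
compact set, and the coordinates are bounded. -/
lemma exists_lower_bound (h : IsMinimizingFamily e V r W N b c) (hy : y ∈ V)
    (he' : e' ∈ IsManifold.maximalAtlas (𝓡 m) ∞ M) (hy' : y ∈ e'.source) {K : Set (Euc m)}
    (hK : IsCompact K) (hKe : K ⊆ e'.target) :
    ∃ a : ℝ, 0 < a ∧ ∀ u ∈ K, ENNReal.ofReal (a * ‖u - e' y‖) ≤ edist (e'.symm u) y := by
  obtain ⟨a₁, ha₁, h₁⟩ := h.exists_lower_bound_near hy he' hy'
  obtain ⟨O, hO, hOo, hyO⟩ := eventually_nhds_iff.1 h₁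
  obtain ⟨a₂, ha₂, h₂⟩ := exists_lower_bound_of_ne (hK.diff hOo) (sdiff_subset.trans hKe)
    (y := y) (fun u hu hue => hu.2 (by
      rw [← hue, e'.right_inv (hKe hu.1)] at hyO; exact hyO))
  obtain ⟨R, hR⟩ := (hK.image (f := fun u => ‖u - e' y‖) (by fun_prop)).isBounded.subset_closedBall 0
  have hR' : ∀ u ∈ K, ‖u - e' y‖ ≤ |R| + 1 := fun u hu => by
    have := hR ⟨u, hu, rfl⟩
    simp only [mem_closedBall_zero_iff, norm_norm] at this
    linarith [le_abs_self R]
  refine ⟨min a₁ (a₂ / (|R| + 1)), lt_min ha₁ (by positivity), fun u hu => ?_⟩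
  by_cases huO : u ∈ O
  · exact (ENNReal.ofReal_le_ofReal (by gcongr; exact min_le_left _ _)).trans (hO u huO)
  · refine (ENNReal.ofReal_le_ofReal ?_).trans (h₂ u ⟨hu, huO⟩)
    calc min a₁ (a₂ / (|R| + 1)) * ‖u - e' y‖ ≤ a₂ / (|R| + 1) * (|R| + 1) := by
          gcongr
          · exact min_le_right _ _
          · exact hR' u hu
      _ = a₂ := by field_simp

end IsMinimizingFamily

end Infinitesimal

/-! ### The coefficients `α_ν` on the whole manifold -/

section GlobalCoefficients

/-- A smooth function equal to `1` on `s ≤ δ²` and to `0` on `s ≥ (2δ)²`. -/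
def distCutoff (δ s : ℝ) : ℝ := Real.smoothTransition ((4 * δ ^ 2 - s) / (3 * δ ^ 2))

lemma contDiff_distCutoff (δ : ℝ) : ContDiff ℝ ∞ (distCutoff δ) :=
  Real.smoothTransition.contDiff.comp ((contDiff_const.sub contDiff_id).div_const _)

lemma distCutoff_of_le {δ s : ℝ} (hδ : 0 < δ) (h : s ≤ δ ^ 2) : distCutoff δ s = 1 :=
  Real.smoothTransition.one_of_one_le (by rw [le_div_iff₀ (by positivity)]; linarith)

lemma distCutoff_of_ge {δ s : ℝ} (h : (2 * δ) ^ 2 ≤ s) : distCutoff δ s = 0 :=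
  Real.smoothTransition.zero_of_nonpos
    (div_nonpos_of_nonpos_of_nonneg (by linarith) (by positivity))

variable {m : ℕ} {M : Type*} [EMetricSpace M] [ChartedSpace (Euc m) M]
  [IsManifold (𝓡 m) ∞ M] [RiemannianBundle (fun x : M => TangentSpace (𝓡 m) x)]
  [IsContMDiffRiemannianBundle (𝓡 m) ∞ (Euc m) (fun x : M => TangentSpace (𝓡 m) x)]
  {e e' : OpenPartialHomeomorph M (Euc m)} {V : Set M} {r : ℝ}
  {W N : Set (Euc m × Euc m)} {b c : Euc m × Euc m → C(unitInterval, Euc m)}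
  {A : (x : M) → TangentSpace (𝓡 m) x} {y : M} {κ : ℝ}

open Classical in
/-- The function `β` of the coordinates in `e` of two points, cut off near `V` and the diagonal. -/
def patch (e : OpenPartialHomeomorph M (Euc m)) (V : Set M) (r δ : ℝ) (χ : M → ℝ)
    (β : Euc m × Euc m → ℂ) (p : M × M) : ℂ :=
  if p.2 ∈ V ∧ edist p.1 p.2 < ENNReal.ofReal r then
    (χ p.2 : ℂ) * (distCutoff δ ((edist p.1 p.2).toReal ^ 2) : ℂ) * β (e p.1, e p.2) else 0

namespace IsMinimizingFamily

/-- The function vanishes near points whose y is outside the support of χ, and where the distance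
exceeds 2δ. Since 2δ < r, all other points lie in the open set where the squared distance is the
smooth function `sqLength`. -/
lemma contMDiff_patch (h : IsMinimizingFamily e V r W N b c) {δ : ℝ} (hδ : 0 < δ)
    (hδr : 2 * δ < r) {χ : M → ℝ} (hχ : ContMDiff (𝓡 m) 𝓘(ℝ, ℝ) ∞ χ) (hχV : tsupport χ ⊆ V)
    {β : Euc m × Euc m → ℂ} (hβ : ContDiffOn ℝ ∞ β W) :
    ContMDiff ((𝓡 m).prod (𝓡 m)) 𝓘(ℝ, ℂ) ∞ (patch e V r δ χ β) := by
  intro p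
  by_cases h1 : p.2 ∈ tsupport χ
  · by_cases h2 : edist p.1 p.2 ≤ ENNReal.ofReal (2 * δ)
    · have hO : IsOpen {q : M × M | q.2 ∈ V ∧ edist q.1 q.2 < ENNReal.ofReal r} :=
        (h.isOpen.preimage continuous_snd).inter (isOpen_lt continuous_edist continuous_const)
      have hp : p ∈ {q : M × M | q.2 ∈ V ∧ edist q.1 q.2 < ENNReal.ofReal r} :=
        ⟨hχV h1, h2.trans_lt ((ENNReal.ofReal_lt_ofReal_iff h.pos).2 hδr)⟩
      have hmem : ∀ q ∈ {q : M × M | q.2 ∈ V ∧ edist q.1 q.2 < ENNReal.ofReal r},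
          q.1 ∈ e.source ∧ q.2 ∈ e.source ∧ (e q.1, e q.2) ∈ W := by
        intro q hq
        have h3 := h.mem_source q.1 q.2 hq.1 hq.2
        have h4 := h.subset_source hq.1
        refine ⟨h3, h4, (h.mem_iff _).2 ⟨e.map_source h3, e.map_source h4, ?_⟩⟩
        have h5 : q.2 ∈ V ∧ edist q.1 q.2 < ENNReal.ofReal r := hq
        simpa only [e.left_inv h3, e.left_inv h4] using h5
      have hcoord : ContMDiffOn ((𝓡 m).prod (𝓡 m)) 𝓘(ℝ, Euc m × Euc m) ∞
          (fun q : M × M => (e q.1, e q.2))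
          {q : M × M | q.2 ∈ V ∧ edist q.1 q.2 < ENNReal.ofReal r} := by
        have he := contMDiffOn_of_mem_maximalAtlas h.mem_maximalAtlas
        exact (he.comp contMDiffOn_fst fun q hq => (hmem q hq).1).prodMk_space
          (he.comp contMDiffOn_snd fun q hq => (hmem q hq).2.1)
      have hg : ContMDiffOn ((𝓡 m).prod (𝓡 m)) 𝓘(ℝ, ℂ) ∞
          (fun q : M × M => (χ q.2 : ℂ) *
            ((distCutoff δ (sqLength (metricForm e) b (e q.1, e q.2)) : ℂ) * β (e q.1, e q.2)))
          {q : M × M | q.2 ∈ V ∧ edist q.1 q.2 < ENNReal.ofReal r} := by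
        have h5 : ContDiffOn ℝ ∞ (fun z : Euc m × Euc m =>
            (distCutoff δ (sqLength (metricForm e) b z) : ℂ) * β z) W :=
          (contDiffOn_ofReal ((contDiff_distCutoff δ).comp_contDiffOn h.contDiffOn_sqLength)).mul hβ
        have h6 : ContMDiff ((𝓡 m).prod (𝓡 m)) 𝓘(ℝ, ℂ) ∞ (fun q : M × M => (χ q.2 : ℂ)) :=
          (Complex.ofRealCLM.contDiff.contMDiff).comp (hχ.comp contMDiff_snd)
        have h7 : ContMDiffOn ((𝓡 m).prod (𝓡 m)) 𝓘(ℝ, ℂ) ∞ (fun q : M × M =>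
            (distCutoff δ (sqLength (metricForm e) b (e q.1, e q.2)) : ℂ) * β (e q.1, e q.2))
            {q : M × M | q.2 ∈ V ∧ edist q.1 q.2 < ENNReal.ofReal r} :=
          (contMDiffOn_iff_contDiffOn.2 h5).comp hcoord fun q hq => (hmem q hq).2.2
        exact (contDiff_mul (𝕜 := ℝ) (𝔸 := ℂ)).contMDiff.comp_contMDiffOn
          (h6.contMDiffOn.prodMk_space h7)
      refine (hg.contMDiffAt (hO.mem_nhds hp)).congr_of_eventuallyEq ?_
      filter_upwards [hO.mem_nhds hp] with q hq
      have h8 := h.edist_eq _ (hmem q hq).2.2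
      rw [e.left_inv (hmem q hq).1, e.left_inv (hmem q hq).2.1] at h8
      rw [patch, if_pos hq, h8, ENNReal.toReal_ofReal (Real.sqrt_nonneg _), Real.sq_sqrt
        (sqLength_nonneg h.mem_maximalAtlas h.isGeodesicFamily (h.subset (hmem q hq).2.2)), mul_assoc]
    · refine (contMDiffAt_const (c := (0 : ℂ))).congr_of_eventuallyEq ?_
      filter_upwards [(isOpen_lt continuous_const continuous_edist).mem_nhds (not_le.1 h2)]
        with q hq
      rw [patch]
      split_ifs with h3
      · rw [distCutoff_of_ge]
        · simp
        · have h4 : 2 * δ ≤ (edist q.1 q.2).toReal := by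
            rw [← ENNReal.ofReal_le_iff_le_toReal (h3.2.trans ENNReal.ofReal_lt_top).ne]
            exact hq.le
          gcongr
      · rfl
  · refine (contMDiffAt_const (c := (0 : ℂ))).congr_of_eventuallyEq ?_
    filter_upwards [((isClosed_tsupport χ).isOpen_compl.preimage continuous_snd).mem_nhds h1]
      with q hq
    rw [patch, image_eq_zero_of_notMem_tsupport hq]
    simp

lemma patch_of_lt (h : IsMinimizingFamily e V r W N b c) {δ : ℝ} (hδ : 0 < δ)
    (hδr : 2 * δ < r) {χ : M → ℝ} {β : Euc m × Euc m → ℂ} (hy : y ∈ V) {x : M}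
    (hx : edist x y < ENNReal.ofReal δ) : patch e V r δ χ β (x, y) = χ y * β (e x, e y) := by
  have h1 : edist x y < ENNReal.ofReal r :=
    hx.trans ((ENNReal.ofReal_lt_ofReal_iff h.pos).2 (by linarith))
  rw [patch, if_pos ⟨hy, h1⟩, distCutoff_of_le hδ]
  · simp
  · have h4 : (edist x y).toReal ≤ δ := by
      rw [← ENNReal.le_ofReal_iff_toReal_le (h1.trans ENNReal.ofReal_lt_top).ne hδ.le]
      exact hx.le
    gcongr

end IsMinimizingFamily

lemma patch_of_notMem {δ : ℝ} {χ : M → ℝ} {β : Euc m × Euc m → ℂ} (hy : y ∉ V) (x : M) :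
    patch e V r δ χ β (x, y) = 0 := by
  rw [patch, if_neg fun h => hy h.1]

variable [IsRiemannianManifold (𝓡 m) M]

/-- The local coefficients are averaged with weights f_p(y)/s(y), a partition of unity in y over Ω.
Where d(x, y) < δ the cutoffs in the distance equal 1, so the average is a combination of solutions
with weights constant in x; on the diagonal the weights add up to 1. -/
theorem exists_coefficients
    (hA : ContMDiff (𝓡 m) (𝓡 m).tangent ∞ (fun x => (⟨x, A x⟩ : TangentBundle (𝓡 m) M)))
    (κ : ℝ) {Ω : Set M} (hΩc : IsCompact (closure Ω)) :
    ∃ δ : ℝ, 0 < δ ∧ ∃ α : ℕ → M → M → ℂ,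
      (∀ ν, ContMDiffOn ((𝓡 m).prod (𝓡 m)) 𝓘(ℝ, ℂ) ∞ (fun p : M × M => α ν p.1 p.2)
        (univ ×ˢ Ω)) ∧
      (∀ y ∈ Ω, α 0 y y = 1) ∧
      (∀ y ∈ Ω, ∀ e ∈ IsManifold.maximalAtlas (𝓡 m) ∞ M,
        SolvesTransport e A κ y (coordBall e y δ) fun ν u => α ν (e.symm u) y) ∧
      ∀ y ∈ Ω, ∃ (e : OpenPartialHomeomorph M (Euc m)) (V : Set M)
        (r : ℝ) (W N : Set (Euc m × Euc m)) (b c : Euc m × Euc m → C(unitInterval, Euc m)),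
        y ∈ V ∧ δ ≤ r ∧ IsMinimizingFamily e V r W N b c := by
  choose e V r W N b c hpV hfam using exists_isMinimizingFamily (m := m) (M := M)
  have hbump : ∀ p : M, ∃ f : SmoothBumpFunction (𝓡 m) p, tsupport f ⊆ V p := fun p => by
    obtain ⟨f, -, hf⟩ := (SmoothBumpFunction.nhds_basis_tsupport (I := 𝓡 m) p).mem_iff.1
      ((hfam p).isOpen.mem_nhds (hpV p))
    exact ⟨f, hf⟩
  choose f hf using hbump
  obtain ⟨t, -, ht⟩ := hΩc.elim_nhds_subcover (fun p => {x | f p x = 1})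
    fun p _ => (f p).eventuallyEq_one
  set s : M → ℝ := fun y => ∑ p ∈ t, f p y with hs
  have hs_pos : ∀ y ∈ Ω, 0 < s y := fun y hy => by
    obtain ⟨p, hp, hpy⟩ := mem_iUnion₂.1 (ht (subset_closure hy))
    have : f p y ≤ s y := Finset.single_le_sum (f := fun p => f p y) (fun p _ => (f p).nonneg) hp
    rw [show f p y = 1 from hpy] at this
    linarith
  have hs_smooth : ContMDiff (𝓡 m) 𝓘(ℝ, ℝ) ∞ s :=
    contMDiff_finsetSum fun p _ => (f p).contMDiff
  obtain ⟨R, hR, hRt⟩ : ∃ R : ℝ, 0 < R ∧ ∀ p ∈ t, R ≤ r p := by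
    rcases t.eq_empty_or_nonempty with rfl | hne
    · exact ⟨1, one_pos, by simp⟩
    · obtain ⟨p, hp, hmin⟩ := t.exists_min_image r hne
      exact ⟨r p, (hfam p).pos, hmin⟩
  -- With δ = R/4 the cutoffs, supported in d ≤ 2δ, end strictly inside all the local radii.
  have hδr : ∀ p ∈ t, 2 * (R / 4) < r p := fun p hp => by linarith [hRt p hp]
  have hδ : 0 < R / 4 := by positivity
  refine ⟨R / 4, hδ, fun ν x y => ((s y)⁻¹ : ℝ) * ∑ p ∈ t, patch (e p) (V p) (r p) (R / 4) (f p)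
    (localCoeff (e p) A κ (b p) (c p) ν) (x, y), fun ν => ?_, fun y hy => ?_, fun y hy e' he' => ?_,
    fun y hy => ?_⟩
  · have h1 : ContMDiffOn ((𝓡 m).prod (𝓡 m)) 𝓘(ℝ, ℝ) ∞ (fun q : M × M => (s q.2)⁻¹)
        (univ ×ˢ Ω) :=
      ContMDiffOn.inv₀ (hs_smooth.comp contMDiff_snd).contMDiffOn fun q hq => (hs_pos _ hq.2).ne'
    have h2 : ContMDiffOn ((𝓡 m).prod (𝓡 m)) 𝓘(ℝ, ℂ) ∞ (fun q : M × M => (((s q.2)⁻¹ : ℝ) : ℂ))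
        (univ ×ˢ Ω) := (Complex.ofRealCLM.contDiff.contMDiff).comp_contMDiffOn h1
    refine (contDiff_mul (𝕜 := ℝ) (𝔸 := ℂ)).contMDiff.comp_contMDiffOn
      (h2.prodMk_space (contMDiff_finsetSum fun p hp => ?_).contMDiffOn)
    exact (hfam p).contMDiff_patch hδ (hδr p hp) (f p).contMDiff (hf p)
      ((hfam p).contDiffOn_localCoeff hA κ ν)
  · have h1 : ∀ p ∈ t, patch (e p) (V p) (r p) (R / 4) (f p)
        (localCoeff (e p) A κ (b p) (c p) 0) (y, y) = (f p y : ℂ) := by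
      intro p hp
      by_cases hpy : y ∈ V p
      · rw [(hfam p).patch_of_lt hδ (hδr p hp) hpy (by simpa using hR),
          (hfam p).localCoeff_zero_diag κ ((hfam p).self_pair_mem hpy), mul_one]
      · rw [patch_of_notMem hpy, image_eq_zero_of_notMem_tsupport fun h => hpy (hf p h)]
        simp
    simp only
    rw [Finset.sum_congr rfl h1, ← Complex.ofReal_sum, ← Complex.ofReal_mul,
      inv_mul_cancel₀ (hs_pos y hy).ne', Complex.ofReal_one]
  · classical
    have h1 := SolvesTransport.sum (κ := κ) (y := y) (D := coordBall e' y (R / 4))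
      (t.filter fun p => y ∈ V p)
      (β := fun p ν u => localCoeff (e p) A κ (b p) (c p) ν (transition e' (e p) u, e p y))
      (a := fun p => (((s y)⁻¹ * f p y : ℝ) : ℂ)) he' hA isOpen_coordBall coordBall_subset
      (fun p hp => ((hfam p).solvesTransport (Finset.mem_filter.1 hp).2 he' hA).mono
        (coordBall_mono (by linarith [hRt p (Finset.mem_filter.1 hp).1])))
    refine h1.congr isOpen_coordBall fun ν u hu => ?_
    beta_reduce
    rw [Finset.mul_sum, Finset.sum_filter]
    refine Finset.sum_congr rfl fun p hp => ?_
    split_ifs with hpy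
    · rw [(hfam p).patch_of_lt hδ (hδr p hp) hpy hu.2]
      push_cast
      rw [mul_assoc]
      rfl
    · rw [patch_of_notMem hpy, mul_zero]
  · obtain ⟨p, hp, hpy⟩ := mem_iUnion₂.1 (ht (subset_closure hy))
    refine ⟨e p, V p, r p, W p, N p, b p, c p, hf p (subset_closure ?_), by linarith [hRt p hp],
      hfam p⟩
    rw [Function.mem_support, show f p y = 1 from hpy]
    exact one_ne_zero

end GlobalCoefficients

/-! ### Powers of the positive part, and the functions `E_μ` -/

section Profile

lemma hasDerivAt_max_rpow {a : ℝ} (ha : 1 < a) (s : ℝ) :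
    HasDerivAt (fun s : ℝ => max s 0 ^ a) (a * max s 0 ^ (a - 1)) s := by
  rcases lt_trichotomy s 0 with hs | rfl | hs
  · have h1 : (fun s : ℝ => max s 0 ^ a) =ᶠ[𝓝 s] fun _ => 0 := by
      filter_upwards [Iio_mem_nhds hs] with x hx
      rw [max_eq_right (le_of_lt hx), Real.zero_rpow (by linarith)]
    rw [max_eq_right hs.le, Real.zero_rpow (by linarith), mul_zero]
    exact (hasDerivAt_const s (0 : ℝ)).congr_of_eventuallyEq h1
  · rw [max_self, Real.zero_rpow (by linarith), mul_zero, hasDerivAt_iff_isLittleO_nhds_zero]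
    have h1 : (fun h : ℝ => |h| ^ a) =o[𝓝 0] fun h => h := by
      have h3 : (fun x : ℝ => x ^ a) =o[𝓝 0] fun x => x := by
        have h4 := hasDerivAt_iff_isLittleO_nhds_zero.1
          (Real.hasDerivAt_rpow_const (x := 0) (p := a) (Or.inr ha.le))
        simpa [Real.zero_rpow (show a - 1 ≠ 0 by linarith),
          Real.zero_rpow (show a ≠ 0 by linarith)] using h4
      have h5 : Filter.Tendsto (fun h : ℝ => |h|) (𝓝 0) (𝓝 0) := by
        simpa using (continuous_abs.tendsto (0 : ℝ))
      exact (h3.comp_tendsto h5).trans_isBigO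
        (Asymptotics.isBigO_of_le _ fun x => by simp)
    refine (Asymptotics.isBigO_of_le (𝓝 (0 : ℝ)) fun h => ?_).trans_isLittleO h1
    simp only [zero_add, max_self, Real.zero_rpow (show a ≠ 0 by linarith), smul_zero, sub_zero]
    rw [Real.norm_of_nonneg (by positivity), Real.norm_of_nonneg (by positivity)]
    exact Real.rpow_le_rpow (le_max_right _ _) (max_le (le_abs_self h) (abs_nonneg h))
      (by linarith)
  · have h1 : (fun s : ℝ => max s 0 ^ a) =ᶠ[𝓝 s] fun s => s ^ a := by
      filter_upwards [Ioi_mem_nhds hs] with x hx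
      rw [max_eq_left (le_of_lt hx)]
    rw [max_eq_left hs.le]
    exact (Real.hasDerivAt_rpow_const (Or.inl hs.ne')).congr_of_eventuallyEq h1

/-- The exponent `a` in the definition of `E_μ`. -/
def waveExp (m μ : ℕ) : ℝ := (μ : ℝ) - ((m : ℝ) - 1) / 2

lemma waveExp_succ (m μ : ℕ) : waveExp m (μ + 1) = waveExp m μ + 1 := by
  simp only [waveExp]; push_cast; ring

/-- `E_μ` as a function of `s = t² - d²`. -/
def profile (m μ : ℕ) (s : ℝ) : ℝ :=
  (2 : ℝ) ^ (-(2 * (μ : ℝ) + 1)) * Real.pi ^ (-(((m : ℝ) - 1) / 2)) * max s 0 ^ waveExp m μ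
    / Real.Gamma (waveExp m μ + 1)

variable {m μ : ℕ}

lemma continuous_profile (ha : 0 < waveExp m μ) : Continuous (profile m μ) := by
  unfold profile
  refine Continuous.div_const (continuous_const.mul ?_) _
  exact (continuous_id.max continuous_const).rpow_const fun x => Or.inr ha.le

lemma profile_of_nonpos (ha : 0 < waveExp m μ) {s : ℝ} (hs : s ≤ 0) : profile m μ s = 0 := by
  rw [profile, max_eq_right hs, Real.zero_rpow ha.ne']
  simp

lemma profile_nonneg (ha : 0 < waveExp m μ) (s : ℝ) : 0 ≤ profile m μ s := by
  have := Real.Gamma_pos_of_pos (show 0 < waveExp m μ + 1 by linarith)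
  unfold profile
  positivity

lemma two_rpow_succ (μ : ℕ) : (2 : ℝ) ^ (-(2 * (μ : ℝ) + 1))
    = 4 * (2 : ℝ) ^ (-(2 * ((μ + 1 : ℕ) : ℝ) + 1)) := by
  have : -(2 * (μ : ℝ) + 1) = 2 + -(2 * ((μ + 1 : ℕ) : ℝ) + 1) := by push_cast; ring
  rw [this, Real.rpow_add two_pos]
  norm_num

/-- The factor 1/4 is the ratio of the powers of 2, and the exponent produced by the differentiation
is absorbed by the Gamma function. With s = t² - d² this is 2∂_tE_{μ+1} = tE_μ. -/
lemma hasDerivAt_profile (ha : 0 < waveExp m μ) (s : ℝ) :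
    HasDerivAt (profile m (μ + 1)) (profile m μ s / 4) s := by
  have h1 := ((hasDerivAt_max_rpow (a := waveExp m (μ + 1))
    (by rw [waveExp_succ]; linarith) s).const_mul
    ((2 : ℝ) ^ (-(2 * ((μ + 1 : ℕ) : ℝ) + 1)) * Real.pi ^ (-(((m : ℝ) - 1) / 2)))).div_const
    (Real.Gamma (waveExp m (μ + 1) + 1))
  refine h1.congr_deriv ?_
  rw [profile, two_rpow_succ μ, Real.Gamma_add_one (s := waveExp m (μ + 1))
    (by rw [waveExp_succ]; linarith), waveExp_succ]
  have h2 := Real.Gamma_pos_of_pos (show 0 < waveExp m μ + 1 by linarith)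
  have h3 : waveExp m μ + 1 ≠ 0 := by linarith
  rw [add_sub_cancel_right]
  field_simp

/-- Multiplication by s raises the exponent by one. In the wave equation it absorbs t² - σ, so that
E_μ disappears. -/
lemma mul_profile (ha : 0 < waveExp m μ) (s : ℝ) :
    s * profile m μ s = 4 * waveExp m (μ + 1) * profile m (μ + 1) s := by
  rcases le_or_gt s 0 with hs | hs
  · rw [profile_of_nonpos ha hs, profile_of_nonpos (by rw [waveExp_succ]; linarith) hs]; ring
  rw [profile, profile, two_rpow_succ μ, Real.Gamma_add_one (s := waveExp m (μ + 1))
    (by rw [waveExp_succ]; linarith), waveExp_succ, max_eq_left hs.le, Real.rpow_add_one hs.ne']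
  have h2 := Real.Gamma_pos_of_pos (show 0 < waveExp m μ + 1 by linarith)
  have h3 : waveExp m μ + 1 ≠ 0 := by linarith
  field_simp

lemma contDiff_profile (ha : 0 < waveExp m μ) : ContDiff ℝ 2 (profile m (μ + 2)) := by
  have ha1 : 0 < waveExp m (μ + 1) := by rw [waveExp_succ]; linarith
  have h1 : ContDiff ℝ 1 (profile m (μ + 1)) := by
    rw [contDiff_one_iff_deriv]
    refine ⟨fun s => (hasDerivAt_profile ha s).differentiableAt, ?_⟩
    rw [show deriv (profile m (μ + 1)) = fun s => profile m μ s / 4 from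
      funext fun s => (hasDerivAt_profile ha s).deriv]
    exact (continuous_profile ha).div_const 4
  rw [show (2 : WithTop ℕ∞) = 1 + 1 from by norm_num, contDiff_succ_iff_deriv]
  refine ⟨fun s => (hasDerivAt_profile ha1 s).differentiableAt, by simp, ?_⟩
  rw [show deriv (profile m (μ + 2)) = fun s => profile m (μ + 1) s / 4 from
      funext fun s => (hasDerivAt_profile ha1 s).deriv]
  exact h1.div_const 4

/-- Homogeneity of `E_μ`. -/
lemma profile_mul {r : ℝ} (hr : 0 ≤ r) (s : ℝ) :
    profile m μ (r * s) = r ^ waveExp m μ * profile m μ s := by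
  have : max (r * s) 0 = r * max s 0 := by
    rw [mul_max_of_nonneg _ _ hr, mul_zero]
  rw [profile, profile, this, Real.mul_rpow hr (le_max_right _ _)]
  ring

lemma profile_mono (ha : 0 < waveExp m μ) : Monotone (profile m μ) := by
  intro s s' h
  have := Real.Gamma_pos_of_pos (show 0 < waveExp m μ + 1 by linarith)
  unfold profile
  gcongr

lemma waveFun_of_nonpos {t : ℝ} (ht : t ≤ 0) (d : ℝ≥0∞) : waveFun m μ t d = 0 := by
  rw [waveFun, if_neg]
  simp [ENNReal.ofReal_of_nonpos ht]

lemma waveFun_of_le {t : ℝ} {d : ℝ≥0∞} (h : ENNReal.ofReal t ≤ d) : waveFun m μ t d = 0 := by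
  rw [waveFun, if_neg (not_lt.2 h)]

lemma waveFun_of_ne_top (ha : 0 < waveExp m μ) {t : ℝ} (ht : 0 < t) {d : ℝ≥0∞} (hd : d ≠ ⊤) :
    waveFun m μ t d = profile m μ (t ^ 2 - d.toReal ^ 2) := by
  by_cases h : d < ENNReal.ofReal t
  · rw [waveFun, if_pos h, profile, max_eq_left]
    · rfl
    · have : d.toReal ≤ t := by
        rw [← ENNReal.le_ofReal_iff_toReal_le hd ht.le]; exact h.le
      have h2 : d.toReal ^ 2 ≤ t ^ 2 := by gcongr
      linarith
  · rw [waveFun_of_le (not_lt.1 h), profile_of_nonpos ha]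
    have : t ≤ d.toReal := (ENNReal.ofReal_le_iff_le_toReal hd).1 (not_lt.1 h)
    have h2 : t ^ 2 ≤ d.toReal ^ 2 := by gcongr
    linarith

/-- Capping the distance at t does not change the value and keeps it finite, so `toReal` is
continuous even where the distance is infinite. -/
lemma waveFun_eq_min (ha : 0 < waveExp m μ) {t : ℝ} (ht : 0 < t) (d : ℝ≥0∞) :
    waveFun m μ t d = profile m μ (t ^ 2 - (min d (ENNReal.ofReal t)).toReal ^ 2) := by
  rcases le_total d (ENNReal.ofReal t) with h | h
  · rw [min_eq_left h, waveFun_of_ne_top ha ht (h.trans_lt ENNReal.ofReal_lt_top).ne]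
  · rw [min_eq_right h, waveFun_of_le h, ENNReal.toReal_ofReal ht.le, sub_self,
      profile_of_nonpos ha le_rfl]

lemma waveFun_nonneg (ha : 0 < waveExp m μ) (t : ℝ) (d : ℝ≥0∞) : 0 ≤ waveFun m μ t d := by
  rcases le_or_gt t 0 with h | h
  · rw [waveFun_of_nonpos h]
  · rw [waveFun_eq_min ha h]; exact profile_nonneg ha _

lemma waveFun_le (ha : 0 < waveExp m μ) {t : ℝ} (ht : 0 < t) (d : ℝ≥0∞) :
    waveFun m μ t d ≤ t ^ (2 * waveExp m μ) * profile m μ 1 := by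
  rw [waveFun_eq_min ha ht, Real.rpow_mul ht.le, Real.rpow_two, ← profile_mul (sq_nonneg t)]
  refine profile_mono ha ?_
  linarith [sq_nonneg ((min d (ENNReal.ofReal t)).toReal)]

/-- The relation `2 ∂_t E_{μ+1} = t E_μ`. -/
lemma hasDerivAt_waveFun (ha : 0 < waveExp m μ) {t : ℝ} (ht : 0 < t) (d : ℝ≥0∞) :
    HasDerivAt (fun t => waveFun m (μ + 1) t d) (t / 2 * waveFun m μ t d) t := by
  have ha1 : 0 < waveExp m (μ + 1) := by rw [waveExp_succ]; linarith
  by_cases hd : d = ⊤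
  · subst hd
    have h0 : ∀ μ t, waveFun m μ t ⊤ = 0 := fun μ t => waveFun_of_le le_top
    simp only [h0, mul_zero]
    exact hasDerivAt_const t 0
  · have h1 : (fun t => waveFun m (μ + 1) t d)
        =ᶠ[𝓝 t] fun t => profile m (μ + 1) (t ^ 2 - d.toReal ^ 2) := by
      filter_upwards [Ioi_mem_nhds ht] with s hs using waveFun_of_ne_top ha1 hs hd
    refine HasDerivAt.congr_of_eventuallyEq ?_ h1
    have h2 : HasDerivAt (fun t : ℝ => t ^ 2 - d.toReal ^ 2) (2 * t) t := by
      simpa using (hasDerivAt_pow 2 t).sub_const (d.toReal ^ 2)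
    refine ((hasDerivAt_profile ha _).comp t h2).congr_deriv ?_
    rw [waveFun_of_ne_top ha ht hd]
    ring

lemma continuousOn_waveFun {X : Type*} [TopologicalSpace X] (ha : 0 < waveExp m μ) {d : X → ℝ≥0∞}
    {s : Set X} (hd : ContinuousOn d s) :
    ContinuousOn (fun p : ℝ × X => waveFun m μ p.1 (d p.2)) (Ioi 0 ×ˢ s) := by
  refine ContinuousOn.congr (f := fun p : ℝ × X =>
    profile m μ (p.1 ^ 2 - (min (d p.2) (ENNReal.ofReal p.1)).toReal ^ 2)) ?_
    fun p hp => waveFun_eq_min ha hp.1 _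
  refine (continuous_profile ha).comp_continuousOn ((continuousOn_fst.pow 2).sub
    (ContinuousOn.pow ?_ 2))
  have h1 : ContinuousOn (fun p : ℝ × X => d p.2) (Ioi 0 ×ˢ s) :=
    hd.comp continuousOn_snd fun p hp => hp.2
  have h2 : ContinuousOn (fun p : ℝ × X => ENNReal.ofReal p.1) (Ioi 0 ×ˢ s) :=
    ENNReal.continuous_ofReal.comp_continuousOn continuousOn_fst
  refine ENNReal.continuousOn_toReal.comp (ContinuousOn.inf h1 h2) fun p hp => ?_
  exact (min_le_right _ _).trans_lt ENNReal.ofReal_lt_top |>.ne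

end Profile

/-! ### Test functions, and the iterates of `lowerTranspose` -/

section TestFunctions

variable {m : ℕ} {U : Set (ℝ × Euc m)} {φ ψ : ℝ × Euc m → ℂ}

/-- The time derivative of a function on `ℝ × ℝ^m`. -/
def timeDeriv (φ : ℝ × Euc m → ℂ) (p : ℝ × Euc m) : ℂ := fderiv ℝ φ p ((1 : ℝ), (0 : Euc m))

lemma contDiff_fderiv_apply (h : ContDiff ℝ ∞ φ) (v : ℝ × Euc m) :
    ContDiff ℝ ∞ fun p => fderiv ℝ φ p v :=
  (h.fderiv_right (m := ∞) (by norm_num)).clm_apply contDiff_const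

lemma contDiff_timeDeriv (h : ContDiff ℝ ∞ φ) : ContDiff ℝ ∞ (timeDeriv φ) :=
  contDiff_fderiv_apply h _

lemma tsupport_fderiv_apply_subset (φ : ℝ × Euc m → ℂ) (v : ℝ × Euc m) :
    tsupport (fun p => fderiv ℝ φ p v) ⊆ tsupport φ := by
  refine (closure_mono fun p hp => ?_).trans (tsupport_fderiv_subset ℝ (f := φ))
  rw [Function.mem_support] at hp ⊢
  intro h
  exact hp (by rw [h]; rfl)

lemma contDiff_of_contDiffOn_mul {f : ℝ × Euc m → ℂ} {O : Set (ℝ × Euc m)} (hO : IsOpen O)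
    (hf : ContDiffOn ℝ ∞ f O) (hφ : ContDiff ℝ ∞ φ) (hs : tsupport φ ⊆ O) :
    ContDiff ℝ ∞ fun p => f p * φ p := by
  rw [contDiff_iff_contDiffAt]
  intro p
  by_cases hp : p ∈ tsupport φ
  · exact (hf.contDiffAt (hO.mem_nhds (hs hp))).mul hφ.contDiffAt
  · refine (contDiffAt_const (c := (0 : ℂ))).congr_of_eventuallyEq ?_
    filter_upwards [(isClosed_tsupport φ).isOpen_compl.mem_nhds hp] with q hq
    rw [image_eq_zero_of_notMem_tsupport hq, mul_zero]

namespace IsTestFunction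

lemma fderiv_apply (h : IsTestFunction U φ) (v : ℝ × Euc m) :
    IsTestFunction U fun p => fderiv ℝ φ p v :=
  ⟨contDiff_fderiv_apply h.contDiff v,
    h.hasCompactSupport.of_isClosed_subset (isClosed_tsupport _)
      (tsupport_fderiv_apply_subset φ v),
    (tsupport_fderiv_apply_subset φ v).trans h.tsupport_subset⟩

lemma timeDeriv (h : IsTestFunction U φ) : IsTestFunction U (timeDeriv φ) := h.fderiv_apply _

lemma mul (h : IsTestFunction U φ) {f : ℝ × Euc m → ℂ} (hU : IsOpen U)
    (hf : ContDiffOn ℝ ∞ f U) : IsTestFunction U fun p => f p * φ p :=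
  ⟨contDiff_of_contDiffOn_mul hU hf h.contDiff h.tsupport_subset, h.hasCompactSupport.mul_left,
    (tsupport_mul_subset_right (f := f)).trans h.tsupport_subset⟩

lemma spaceMul {S : Set ℝ} {O : Set (Euc m)} (h : IsTestFunction (S ×ˢ O) φ) (hS : IsOpen S)
    (hO : IsOpen O) {f : Euc m → ℂ} (hf : ContDiffOn ℝ ∞ f O) :
    IsTestFunction (S ×ˢ O) fun p => f p.2 * φ p :=
  h.mul (f := fun p => f p.2) (hS.prod hO) (hf.comp contDiffOn_snd fun _ hp => hp.2)

lemma sub (h : IsTestFunction U φ) (h' : IsTestFunction U ψ) :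
    IsTestFunction U fun p => φ p - ψ p := by
  refine ⟨h.contDiff.sub h'.contDiff, h.hasCompactSupport.sub h'.hasCompactSupport, ?_⟩
  have h1 : tsupport (fun p => φ p - ψ p) ⊆ tsupport φ ∪ tsupport ψ := by
    refine closure_minimal (fun p hp => ?_) ((isClosed_tsupport _).union (isClosed_tsupport _))
    by_contra h2
    rw [mem_union, not_or] at h2
    exact hp (by simp only [image_eq_zero_of_notMem_tsupport h2.1,
      image_eq_zero_of_notMem_tsupport h2.2, sub_zero])
  exact h1.trans (union_subset h.tsupport_subset h'.tsupport_subset)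

lemma const_mul (h : IsTestFunction U φ) (hU : IsOpen U) (a : ℂ) :
    IsTestFunction U fun p => a * φ p := h.mul hU contDiffOn_const

end IsTestFunction

/-- `t^{2k}` times the `k`-th iterate of `lowerTranspose`. -/
def reduced : ℕ → (ℝ × Euc m → ℂ) → ℝ × Euc m → ℂ
  | 0, φ => φ
  | k + 1, φ => fun p => 2 * (2 * (k : ℂ) + 1) * reduced k φ p
      - 2 * ((p.1 : ℂ) * timeDeriv (reduced k φ) p)

lemma reduced_succ (k : ℕ) (φ : ℝ × Euc m → ℂ) (p : ℝ × Euc m) :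
    reduced (k + 1) φ p = 2 * (2 * (k : ℂ) + 1) * reduced k φ p
      - 2 * ((p.1 : ℂ) * timeDeriv (reduced k φ) p) := rfl

lemma contDiff_time : ContDiff ℝ ∞ fun p : ℝ × Euc m => (p.1 : ℂ) :=
  Complex.ofRealCLM.contDiff.comp contDiff_fst

lemma contDiff_reduced (h : ContDiff ℝ ∞ φ) (k : ℕ) : ContDiff ℝ ∞ (reduced k φ) := by
  induction k with
  | zero => exact h
  | succ k ih =>
    exact (contDiff_const.mul ih).sub (contDiff_const.mul
      (contDiff_time.mul (contDiff_timeDeriv ih)))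

lemma IsTestFunction.reduced (h : IsTestFunction U φ) (hU : IsOpen U) (k : ℕ) :
    IsTestFunction U (reduced k φ) := by
  induction k with
  | zero => exact h
  | succ k ih =>
    exact (ih.const_mul hU _).sub ((ih.timeDeriv.mul hU contDiff_time.contDiffOn).const_mul hU _)

lemma hasDerivAt_time {f : ℝ × Euc m → ℂ} (h : Differentiable ℝ f) (t : ℝ) (x : Euc m) :
    HasDerivAt (fun s => f (s, x)) (timeDeriv f (t, x)) t := by
  have h1 : HasDerivAt (fun s : ℝ => (s, x)) ((1 : ℝ), (0 : Euc m)) t :=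
    (hasDerivAt_id t).prodMk (hasDerivAt_const t x)
  exact (h (t, x)).hasFDerivAt.comp_hasDerivAt t h1

lemma hasDerivAt_space {f : ℝ × Euc m → ℂ} (h : Differentiable ℝ f) (t : ℝ) (x : Euc m) :
    HasFDerivAt (fun u => f (t, u)) ((fderiv ℝ f (t, x)).comp (ContinuousLinearMap.inr ℝ ℝ (Euc m)))
      x := by
  have h1 : HasFDerivAt (𝕜 := ℝ) (fun u : Euc m => (t, u)) (ContinuousLinearMap.inr ℝ ℝ (Euc m)) x :=
    hasFDerivAt_prodMk_right t x
  exact (h (t, x)).hasFDerivAt.comp x h1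

lemma hasDerivAt_ofReal_pow (n : ℕ) (t : ℝ) :
    HasDerivAt (fun s : ℝ => (s : ℂ) ^ n) ((n : ℂ) * (t : ℂ) ^ (n - 1)) t := by
  have h : HasDerivAt (fun s : ℝ => (s : ℂ)) 1 t := (hasDerivAt_id t).ofReal_comp
  simpa using h.fun_pow n

/-- Induction from -∂_t(2t^{-2k-1}R) = t^{-2k-2}(2(2k+1)R - 2t∂_tR). The singular power splits off,
leaving a genuine test function. -/
lemma lowerTranspose_iterate (h : ContDiff ℝ ∞ φ) (k : ℕ) {p : ℝ × Euc m} (hp : p.1 ≠ 0) :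
    (lowerTranspose^[k] φ) p = ((p.1 : ℂ) ^ (2 * k))⁻¹ * reduced k φ p := by
  induction k generalizing p with
  | zero => simp [reduced]
  | succ k ih =>
    rw [Function.iterate_succ_apply', lowerTranspose]
    have h1 : (fun s : ℝ => 2 * (lowerTranspose^[k] φ) (s, p.2) / (s : ℂ)) =ᶠ[𝓝 p.1]
        fun s => 2 * reduced k φ (s, p.2) / (s : ℂ) ^ (2 * k + 1) := by
      filter_upwards [isOpen_ne.mem_nhds hp] with s hs
      rw [ih (p := (s, p.2)) hs]
      have : (s : ℂ) ≠ 0 := Complex.ofReal_ne_zero.2 hs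
      rw [pow_succ]
      field_simp
    have hp' : (p.1 : ℂ) ≠ 0 := Complex.ofReal_ne_zero.2 hp
    have h2 := ((hasDerivAt_time ((contDiff_reduced h k).differentiable (by simp)) p.1
      p.2).const_mul 2).fun_div (hasDerivAt_ofReal_pow (2 * k + 1) p.1) (pow_ne_zero _ hp')
    rw [h1.deriv_eq, h2.deriv, reduced_succ]
    push_cast
    rw [show 2 * (k + 1) = 2 * k + 1 + 1 by ring, pow_succ, pow_succ]
    simp only [Prod.mk.eta]
    field_simp
    ring

lemma timeDeriv_fderiv_comm (h : ContDiff ℝ ∞ φ) (v : ℝ × Euc m) (p : ℝ × Euc m) :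
    timeDeriv (fun p => fderiv ℝ φ p v) p = fderiv ℝ (timeDeriv φ) p v := by
  have h1 : Differentiable ℝ (fderiv ℝ φ) :=
    (h.fderiv_right (m := ∞) (by norm_num)).differentiable (by simp)
  have h2 : ∀ v w, fderiv ℝ (fun p => fderiv ℝ φ p v) p w = fderiv ℝ (fderiv ℝ φ) p w v := by
    intro v w
    have := ((h1 p).hasFDerivAt).clm_apply (hasFDerivAt_const v p)
    rw [this.fderiv]
    simp
  have h3 : timeDeriv φ = fun p => fderiv ℝ φ p ((1 : ℝ), (0 : Euc m)) := rfl
  rw [h3, timeDeriv, h2, h2]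
  exact (h.contDiffAt.isSymmSndFDerivAt (by simpa using two_le_infty)).eq _ _

/-- The recursion involves the time variable only, so it commutes with multiplication by functions
of x. -/
lemma reduced_congr_mul {S : Set ℝ} {O : Set (Euc m)} (hO : IsOpen O)
    (h : IsTestFunction (S ×ˢ O) φ) (hS : IsOpen S) {f : Euc m → ℂ} (hf : ContDiffOn ℝ ∞ f O)
    (k : ℕ) : reduced k (fun p => f p.2 * φ p) = fun p => f p.2 * reduced k φ p := by
  induction k with
  | zero => rfl
  | succ k ih =>
    funext p
    rw [reduced_succ, reduced_succ, ih]
    have h1 := h.reduced (hS.prod hO) k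
    have h2 : timeDeriv (fun p => f p.2 * reduced k φ p) p = f p.2 * timeDeriv (reduced k φ) p := by
      have h3 := hasDerivAt_time ((h1.spaceMul hS hO hf).contDiff.differentiable (by simp)) p.1 p.2
      have h4 := (hasDerivAt_time (h1.contDiff.differentiable (by simp)) p.1 p.2).const_mul (f p.2)
      exact h3.unique h4
    rw [h2]; ring

lemma reduced_fderiv (h : ContDiff ℝ ∞ φ) (v : Euc m) (k : ℕ) :
    reduced k (fun p => fderiv ℝ φ p ((0 : ℝ), v))
      = fun p => fderiv ℝ (reduced k φ) p ((0 : ℝ), v) := by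
  induction k with
  | zero => rfl
  | succ k ih =>
    funext p
    have h1 := contDiff_reduced h k
    rw [reduced_succ, ih, timeDeriv_fderiv_comm h1]
    have h2 : Differentiable ℝ (reduced k φ) := h1.differentiable (by simp)
    have h3 : Differentiable ℝ (timeDeriv (reduced k φ)) :=
      (contDiff_timeDeriv h1).differentiable (by simp)
    have h4 : HasFDerivAt (fun p : ℝ × Euc m => (p.1 : ℂ))
        (Complex.ofRealCLM.comp (ContinuousLinearMap.fst ℝ ℝ (Euc m))) p :=
      Complex.ofRealCLM.hasFDerivAt.comp p hasFDerivAt_fst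
    have h5 := ((h2 p).hasFDerivAt.const_mul (2 * (2 * (k : ℂ) + 1))).fun_sub
      ((h4.fun_mul (h3 p).hasFDerivAt).const_mul 2)
    rw [show reduced (k + 1) φ = fun p => 2 * (2 * (k : ℂ) + 1) * reduced k φ p
      - 2 * ((p.1 : ℂ) * timeDeriv (reduced k φ) p) from rfl, h5.fderiv]
    simp

lemma timeDeriv_mul_time {f : ℝ × Euc m → ℂ} (h : Differentiable ℝ f) (p : ℝ × Euc m) :
    timeDeriv (fun p => (p.1 : ℂ) * f p) p = f p + (p.1 : ℂ) * timeDeriv f p := by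
  have h4 : HasFDerivAt (fun p : ℝ × Euc m => (p.1 : ℂ))
      (Complex.ofRealCLM.comp (ContinuousLinearMap.fst ℝ ℝ (Euc m))) p :=
    Complex.ofRealCLM.hasFDerivAt.comp p hasFDerivAt_fst
  rw [timeDeriv, (h4.fun_mul (h p).hasFDerivAt).fderiv]
  simp [timeDeriv]
  ring

lemma timeDeriv_lin {f g : ℝ × Euc m → ℂ} (hf : Differentiable ℝ f) (hg : Differentiable ℝ g)
    (a b : ℂ) (p : ℝ × Euc m) :
    timeDeriv (fun p => a * f p - b * g p) p = a * timeDeriv f p - b * timeDeriv g p := by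
  rw [timeDeriv, (((hf p).hasFDerivAt.const_mul a).fun_sub ((hg p).hasFDerivAt.const_mul b)).fderiv]
  simp [timeDeriv]

/-- For t ≠ 0 this says that t^{-2k} times the reduction of φ'' is ∂_t of t^{-2k}∂_tR_k, R_k being
the reduction of φ. Multiplied through by powers of t it holds at t = 0 too and can be
differentiated. -/
lemma reduced_timeDeriv_two (h : ContDiff ℝ ∞ φ) (k : ℕ) (p : ℝ × Euc m) :
    (p.1 : ℂ) * reduced k (timeDeriv (timeDeriv φ)) p
      = (p.1 : ℂ) * timeDeriv (timeDeriv (reduced k φ)) p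
        - 2 * (k : ℂ) * timeDeriv (reduced k φ) p := by
  induction k generalizing p with
  | zero => simp [reduced]
  | succ k ih =>
    have hR := contDiff_reduced h k
    have hR1 := contDiff_timeDeriv hR
    have hR2 := contDiff_timeDeriv hR1
    have hT := contDiff_reduced (contDiff_timeDeriv (contDiff_timeDeriv h)) k
    have d0 := hR.differentiable (by simp)
    have d1 := hR1.differentiable (by simp)
    have d2 := hR2.differentiable (by simp)
    have dT := hT.differentiable (by simp)
    have dt1 : Differentiable ℝ fun p : ℝ × Euc m => (p.1 : ℂ) * timeDeriv (reduced k φ) p :=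
      (contDiff_time.mul hR1).differentiable (by simp)
    have dt2 : Differentiable ℝ
        fun p : ℝ × Euc m => (p.1 : ℂ) * timeDeriv (timeDeriv (reduced k φ)) p :=
      (contDiff_time.mul hR2).differentiable (by simp)
    set R := reduced k φ with hRdef
    set T := reduced k (timeDeriv (timeDeriv φ)) with hTdef
    have e1 : reduced (k + 1) φ = fun p => 2 * (2 * (k : ℂ) + 1) * R p
      - 2 * ((p.1 : ℂ) * timeDeriv R p) := rfl
    have e2 : timeDeriv (reduced (k + 1) φ) = fun p => 4 * (k : ℂ) * timeDeriv R p
        - 2 * ((p.1 : ℂ) * timeDeriv (timeDeriv R) p) := by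
      funext p
      rw [e1, timeDeriv_lin d0 dt1, timeDeriv_mul_time d1]
      ring
    have e3 : timeDeriv (timeDeriv (reduced (k + 1) φ)) p = (4 * (k : ℂ) - 2)
        * timeDeriv (timeDeriv R) p - 2 * ((p.1 : ℂ) * timeDeriv (timeDeriv (timeDeriv R)) p) := by
      rw [e2, timeDeriv_lin d1 dt2, timeDeriv_mul_time d2]
      ring
    -- The time derivative of the induction hypothesis.
    have e4 : T p + (p.1 : ℂ) * timeDeriv T p
        = timeDeriv (timeDeriv R) p + (p.1 : ℂ) * timeDeriv (timeDeriv (timeDeriv R)) p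
          - 2 * (k : ℂ) * timeDeriv (timeDeriv R) p := by
      rw [← timeDeriv_mul_time dT, funext ih]
      have := timeDeriv_lin dt2 d1 1 (2 * (k : ℂ)) p
      simp only [one_mul] at this
      rw [this, timeDeriv_mul_time d2]
    rw [e3, e2, reduced_succ, ← hTdef]
    have e5 := ih p
    push_cast
    linear_combination (2 * (2 * (k : ℂ) + 1) + 2) * e5 - 2 * (p.1 : ℂ) * e4

lemma hasDerivAt_reduced_timeDeriv (h : ContDiff ℝ ∞ φ) (k : ℕ) {t : ℝ} (ht : t ≠ 0) (x : Euc m) :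
    HasDerivAt (fun s : ℝ => ((s : ℂ) ^ (2 * k))⁻¹ * timeDeriv (reduced k φ) (s, x))
      (((t : ℂ) ^ (2 * k))⁻¹ * reduced k (timeDeriv (timeDeriv φ)) (t, x)) t := by
  have ht' : (t : ℂ) ≠ 0 := Complex.ofReal_ne_zero.2 ht
  have h1 := hasDerivAt_time ((contDiff_timeDeriv (contDiff_reduced h k)).differentiable
    (by simp)) t x
  have h2 := ((hasDerivAt_ofReal_pow (2 * k) t).fun_inv (pow_ne_zero _ ht')).fun_mul h1
  refine h2.congr_deriv ?_
  have h3 := reduced_timeDeriv_two h k (t, x)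
  simp only at h3
  rw [← mul_right_inj' ht']
  rcases k with _ | k
  · simp at h3 ⊢
    tauto
  · have h4 : 2 * (k + 1) - 1 + 1 = 2 * (k + 1) := by omega
    have h5 : (t : ℂ) ^ (2 * (k + 1)) = (t : ℂ) ^ (2 * (k + 1) - 1) * t := by
      rw [← pow_succ, h4]
    rw [show (t : ℂ) * (((t : ℂ) ^ (2 * (k + 1)))⁻¹ *
      reduced (k + 1) (timeDeriv (timeDeriv φ)) (t, x)) = ((t : ℂ) ^ (2 * (k + 1)))⁻¹ *
      (t * reduced (k + 1) (timeDeriv (timeDeriv φ)) (t, x)) by ring, h3, h5]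
    push_cast
    field_simp
    ring

/-- At t = 0 each step of the recursion multiplies by 2(2k+1) = 4(k + ½), the recursion of 4^k Γ(k +
½). This constant normalizes the point source. -/
lemma reduced_time_zero (k : ℕ) (x : Euc m) :
    reduced k φ (0, x) = ((4 ^ k * Real.Gamma (k + 1 / 2) / √Real.pi : ℝ) : ℂ) * φ (0, x) := by
  induction k with
  | zero =>
    have : √Real.pi ≠ 0 := (Real.sqrt_pos.2 Real.pi_pos).ne'
    simp only [reduced, Nat.cast_zero, zero_add, pow_zero, one_mul, Real.Gamma_one_half_eq]
    rw [div_self this]; simp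
  | succ k ih =>
    rw [reduced_succ, ih]
    have : Real.Gamma ((k + 1 : ℕ) + 1 / 2) = (k + 1 / 2) * Real.Gamma (k + 1 / 2) := by
      rw [← Real.Gamma_add_one (by positivity)]
      push_cast; ring_nf
    rw [this]
    push_cast
    ring

end TestFunctions

/-! ### Integrability of the pairings of `E_μ` with test functions -/

section Integrability

variable {m : ℕ}

/-- On compact subsets of `O`, the function `d` grows at least linearly away from some point. -/
def HasLinearLowerBound (d : Euc m → ℝ≥0∞) (O : Set (Euc m)) : Prop :=
  ∀ K ⊆ O, IsCompact K → ∃ a : ℝ, 0 < a ∧ ∃ z : Euc m, ∀ u ∈ K, ENNReal.ofReal (a * ‖u - z‖) ≤ d u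

/-- The size of E_{ν+k} times the volume of a ball of radius of order t: after division by t^{2k}
the integrable power t^{2ν+1} is left. -/
lemma rpow_waveExp {ν k : ℕ} {t : ℝ} (ht : 0 < t) :
    t ^ (2 * waveExp m (ν + k)) * t ^ m = t ^ (2 * ν + 1) * t ^ (2 * k) := by
  rw [← Real.rpow_natCast t m, ← Real.rpow_add ht, ← pow_add, ← Real.rpow_natCast]
  congr 1
  simp only [waveExp]
  push_cast
  ring

variable {O : Set (Euc m)} {d : Euc m → ℝ≥0∞} {ψ : ℝ × Euc m → ℂ}

lemma aestronglyMeasurable_waveFun_mul {μ k : ℕ} (ha : 0 < waveExp m μ) (hO : IsOpen O)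
    (hd : ContinuousOn d O) (hψ : Continuous ψ) (hψO : ∀ p, p.2 ∉ O → ψ p = 0) :
    AEStronglyMeasurable
      (fun p : ℝ × Euc m => (waveFun m μ p.1 (d p.2) : ℂ) * (((p.1 : ℂ) ^ (2 * k))⁻¹ * ψ p)) := by
  have hmeas : MeasurableSet (Ioi (0 : ℝ) ×ˢ O) := measurableSet_Ioi.prod hO.measurableSet
  have h1 : (fun p : ℝ × Euc m => (waveFun m μ p.1 (d p.2) : ℂ) * (((p.1 : ℂ) ^ (2 * k))⁻¹ * ψ p))
      = (Ioi (0 : ℝ) ×ˢ O).indicator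
        (fun p => (waveFun m μ p.1 (d p.2) : ℂ) * (((p.1 : ℂ) ^ (2 * k))⁻¹ * ψ p)) := by
    funext p
    by_cases hp : p ∈ Ioi (0 : ℝ) ×ˢ O
    · rw [indicator_of_mem hp]
    · rw [indicator_of_notMem hp]
      by_cases h0 : 0 < p.1
      · rw [hψO p fun h => hp ⟨h0, h⟩]; simp
      · rw [waveFun_of_nonpos (not_lt.1 h0)]; simp
  rw [h1, aestronglyMeasurable_indicator_iff hmeas]
  refine ContinuousOn.aestronglyMeasurable ?_ hmeas
  refine (Complex.continuous_ofReal.comp_continuousOn (continuousOn_waveFun ha hd)).mul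
    (ContinuousOn.mul (ContinuousOn.inv₀ (by fun_prop) fun p hp => ?_) hψ.continuousOn)
  exact pow_ne_zero _ (Complex.ofReal_ne_zero.2 (ne_of_gt hp.1))

/-- The linear lower bound for d confines the support at time t to a ball of radius t/a. Its volume
t^m balances the factor t^{-2k} as t → 0. -/
lemma integrable_waveFun_mul {ν k : ℕ} (ha : 0 < waveExp m (ν + k)) (hO : IsOpen O)
    (hd : ContinuousOn d O) (hlow : HasLinearLowerBound d O) (hψ : Continuous ψ)
    (hψc : HasCompactSupport ψ) (hψO : ∀ p ∈ tsupport ψ, p.2 ∈ O) :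
    Integrable (fun p : ℝ × Euc m =>
      (waveFun m (ν + k) p.1 (d p.2) : ℂ) * (((p.1 : ℂ) ^ (2 * k))⁻¹ * ψ p)) := by
  have hmeas := aestronglyMeasurable_waveFun_mul (k := k) ha hO hd hψ
    fun p hp => image_eq_zero_of_notMem_tsupport fun h => hp (hψO p h)
  refine ⟨hmeas, ?_⟩
  obtain ⟨a, ha0, z, haz⟩ := hlow (Prod.snd '' tsupport ψ)
    (by rintro _ ⟨p, hp, rfl⟩; exact hψO p hp) (hψc.isCompact.image continuous_snd)
  obtain ⟨B, hB⟩ := hψ.bounded_above_of_compact_support hψc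
  have hB0 : 0 ≤ B := (norm_nonneg _).trans (hB 0)
  obtain ⟨T, hT⟩ : ∃ T : ℝ, ∀ p, T < p.1 → ψ p = 0 := by
    obtain ⟨T, hT⟩ := (hψc.isCompact.image continuous_fst).isBounded.subset_closedBall 0
    refine ⟨T, fun p hp => image_eq_zero_of_notMem_tsupport fun h => ?_⟩
    have := hT ⟨p, h, rfl⟩
    rw [mem_closedBall_zero_iff, Real.norm_eq_abs] at this
    linarith [le_abs_self p.1]
  rw [HasFiniteIntegral, Measure.volume_eq_prod,
    lintegral_prod _ (by rw [← Measure.volume_eq_prod]; exact hmeas.enorm)]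
  have hvol : volume (Metric.ball (0 : Euc m) 1) ≠ ⊤ := measure_ball_lt_top.ne
  set C : ℝ := profile m (ν + k) 1 * B * a⁻¹ ^ m * T ^ (2 * ν + 1) with hC
  have hp1 : 0 ≤ profile m (ν + k) 1 := profile_nonneg ha 1
  have hinner : ∀ t : ℝ, ∫⁻ x, ‖(waveFun m (ν + k) t (d x) : ℂ) * (((t : ℂ) ^ (2 * k))⁻¹ * ψ (t, x))‖ₑ
      ≤ (Ioc 0 T).indicator (fun _ => ENNReal.ofReal C * volume (Metric.ball (0 : Euc m) 1)) t := by
    intro t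
    by_cases ht : t ∈ Ioc 0 T
    · rw [indicator_of_mem ht]
      have hpt : ∀ x, ‖(waveFun m (ν + k) t (d x) : ℂ) * (((t : ℂ) ^ (2 * k))⁻¹ * ψ (t, x))‖ₑ
          ≤ (Metric.closedBall z (t / a)).indicator (fun _ => ENNReal.ofReal
            (t ^ (2 * waveExp m (ν + k)) * profile m (ν + k) 1 * ((t ^ (2 * k))⁻¹ * B))) x := by
        intro x
        by_cases hx : x ∈ Metric.closedBall z (t / a)
        · rw [indicator_of_mem hx, ← ofReal_norm]
          refine ENNReal.ofReal_le_ofReal ?_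
          rw [norm_mul, norm_mul, norm_inv, norm_pow, Complex.norm_real, Complex.norm_real,
            Real.norm_of_nonneg (waveFun_nonneg ha _ _), Real.norm_of_nonneg ht.1.le]
          have := ht.1
          exact mul_le_mul (waveFun_le ha ht.1 _) (by gcongr; exact hB _) (by positivity)
            (by positivity)
        · rw [indicator_of_notMem hx]
          refine le_of_eq ?_
          rw [enorm_eq_zero]
          by_cases hxs : (t, x) ∈ tsupport ψ
          · have h1 := haz x ⟨_, hxs, rfl⟩
            rw [waveFun_of_le]
            · simp
            · refine (ENNReal.ofReal_le_ofReal ?_).trans h1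
              rw [mem_closedBall_iff_norm, not_le, div_lt_iff₀ ha0] at hx
              linarith
          · rw [image_eq_zero_of_notMem_tsupport hxs]; simp
      refine (lintegral_mono hpt).trans ?_
      rw [lintegral_indicator_const measurableSet_closedBall, Measure.addHaar_closedBall _ _
        (div_pos ht.1 ha0).le, finrank_euclideanSpace_fin, ← mul_assoc]
      gcongr
      rw [← ENNReal.ofReal_mul (by have := ht.1; positivity)]
      refine ENNReal.ofReal_le_ofReal ?_
      have h2 := rpow_waveExp (m := m) (ν := ν) (k := k) ht.1
      have ht0 := ht.1
      calc t ^ (2 * waveExp m (ν + k)) * profile m (ν + k) 1 * ((t ^ (2 * k))⁻¹ * B) * (t / a) ^ m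
          = (t ^ (2 * waveExp m (ν + k)) * t ^ m) * (t ^ (2 * k))⁻¹ * (profile m (ν + k) 1 * B
            * a⁻¹ ^ m) := by rw [div_eq_mul_inv, mul_pow]; ring
        _ = t ^ (2 * ν + 1) * (profile m (ν + k) 1 * B * a⁻¹ ^ m) := by
            rw [h2]; field_simp
        _ ≤ T ^ (2 * ν + 1) * (profile m (ν + k) 1 * B * a⁻¹ ^ m) := by
            gcongr; exact ht.2
        _ = C := by rw [hC]; ring
    · rw [indicator_of_notMem ht]
      refine le_of_eq ?_
      have : ∀ x, (waveFun m (ν + k) t (d x) : ℂ) * (((t : ℂ) ^ (2 * k))⁻¹ * ψ (t, x)) = 0 := by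
        intro x
        rw [mem_Ioc, not_and_or, not_lt, not_le] at ht
        rcases ht with ht | ht
        · rw [waveFun_of_nonpos ht]; simp
        · rw [hT (t, x) ht]; simp
      simp [this]
  refine (lintegral_mono hinner).trans_lt ?_
  rw [lintegral_indicator_const measurableSet_Ioc, Real.volume_Ioc]
  exact ENNReal.mul_lt_top (ENNReal.mul_lt_top ENNReal.ofReal_lt_top hvol.lt_top)
    ENNReal.ofReal_lt_top

end Integrability

/-! ### Distributions represented by families of functions of the space variable -/

section Representation

variable {m : ℕ} {O : Set (Euc m)} {d : Euc m → ℝ≥0∞} {δ : ℝ} {φ ψ : ℝ × Euc m → ℂ}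

/-- At any zero of d in a compact set the bound forces u = z, so d has at most one zero in O, a null
set in positive dimension. -/
lemma HasLinearLowerBound.ae_pos [Nontrivial (Euc m)] (h : HasLinearLowerBound d O) :
    ∀ᵐ x, x ∈ O → 0 < d x := by
  have h1 : {x | x ∈ O ∧ d x = 0}.Subsingleton := by
    rintro u ⟨hu, hu0⟩ v ⟨hv, hv0⟩
    obtain ⟨a, ha, z, hz⟩ := h {u, v} (by rintro w (rfl | rfl) <;> assumption)
      (Set.toFinite _).isCompact
    have key : ∀ w ∈ ({u, v} : Set (Euc m)), d w = 0 → w = z := by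
      intro w hw hw0
      have h2 := hz w hw
      rw [hw0, nonpos_iff_eq_zero, ENNReal.ofReal_eq_zero] at h2
      have h3 : ‖w - z‖ ≤ 0 := by
        by_contra h4
        exact absurd (mul_pos ha (not_le.1 h4)) (not_lt.2 h2)
      exact sub_eq_zero.1 (norm_le_zero_iff.1 h3)
    rw [key u (by simp) hu0, key v (by simp) hv0]
  have h2 : volume {x | x ∈ O ∧ d x = 0} = 0 := h1.measure_zero volume
  filter_upwards [measure_eq_zero_iff_ae_notMem.1 h2] with x hx hxO
  exact pos_iff_ne_zero.2 fun h0 => hx ⟨hxO, h0⟩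

lemma integrable_waveFun_reduced {ν k : ℕ} (ha : 0 < waveExp m (ν + k)) (hO : IsOpen O)
    (hd : ContinuousOn d O) (hlow : HasLinearLowerBound d O)
    (hφ : IsTestFunction (Iio δ ×ˢ O) φ) :
    Integrable (fun p : ℝ × Euc m =>
      (waveFun m (ν + k) p.1 (d p.2) : ℂ) * (((p.1 : ℂ) ^ (2 * k))⁻¹ * reduced k φ p)) :=
  have h := hφ.reduced (isOpen_Iio.prod hO) k
  integrable_waveFun_mul ha hO hd hlow h.contDiff.continuous h.hasCompactSupport
    fun _ hp => (h.tsupport_subset hp).2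

/-- For fixed x the difference of the integrands is the time derivative of 2E_{ν+k+1}t^{-2k-1}R_k,
with R_k the reduced test function. For d(x) > 0, hence for almost every x, this primitive vanishes
for t < d(x) and has no singularity at t = 0. -/
lemma integral_waveFun_shift [Nontrivial (Euc m)] {ν k : ℕ} (ha : 0 < waveExp m (ν + k))
    (hO : IsOpen O) (hd : ContinuousOn d O) (hlow : HasLinearLowerBound d O)
    (hφ : IsTestFunction (Iio δ ×ˢ O) φ) :
    ∫ p : ℝ × Euc m,
      (waveFun m (ν + k) p.1 (d p.2) : ℂ) * (((p.1 : ℂ) ^ (2 * k))⁻¹ * reduced k φ p)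
    = ∫ p : ℝ × Euc m, (waveFun m (ν + (k + 1)) p.1 (d p.2) : ℂ)
      * (((p.1 : ℂ) ^ (2 * (k + 1)))⁻¹ * reduced (k + 1) φ p) := by
  have hR := hφ.reduced (isOpen_Iio.prod hO) k
  have ha1 : 0 < waveExp m (ν + (k + 1)) := by
    rw [← add_assoc, waveExp_succ]; linarith
  have I1 := integrable_waveFun_reduced ha hO hd hlow hφ
  have I2 := integrable_waveFun_reduced (k := k + 1) ha1 hO hd hlow hφ
  have hR' := hR.mul (isOpen_Iio.prod hO) contDiff_time.contDiffOn
  have I3 := integrable_waveFun_mul (k := k + 1) ha1 hO hd hlow hR'.contDiff.continuous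
    hR'.hasCompactSupport fun _ hp => (hR'.tsupport_subset hp).2
  rw [Measure.volume_eq_prod] at I1 I2 I3 ⊢
  rw [integral_prod_symm _ I1, integral_prod_symm _ I2]
  refine integral_congr_ae ?_
  filter_upwards [I1.prod_left_ae, I2.prod_left_ae, I3.prod_left_ae, hlow.ae_pos]
    with x J1 J2 J3 hx
  rw [← sub_eq_zero, ← integral_sub J1 J2]
  by_cases hxO : x ∈ O
  · have hdx := hx hxO
    refine integral_eq_zero_of_hasDerivAt_of_integrable (f := fun t : ℝ =>
      2 * ((waveFun m (ν + (k + 1)) t (d x) : ℂ) * (((t : ℂ) ^ (2 * (k + 1)))⁻¹ *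
        ((t : ℂ) * reduced k φ (t, x))))) (fun t => ?_) (J1.sub J2) (J3.const_mul 2)
    rcases le_or_gt t 0 with ht | ht
    · have h0 : ∀ μ, ∀ᶠ s in 𝓝 t, waveFun m μ s (d x) = 0 := by
        intro μ
        have h1 : ∀ᶠ s in 𝓝 t, ENNReal.ofReal s < d x := by
          refine ENNReal.continuous_ofReal.continuousAt.eventually_lt continuousAt_const ?_
          rwa [ENNReal.ofReal_of_nonpos ht]
        filter_upwards [h1] with s hs using waveFun_of_le hs.le
      refine ((hasDerivAt_const t (0 : ℂ)).congr_of_eventuallyEq ?_).congr_deriv ?_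
      · filter_upwards [h0 (ν + (k + 1))] with s hs
        rw [hs]; simp
      · rw [(h0 (ν + (k + 1))).self_of_nhds, (h0 (ν + k)).self_of_nhds]; simp
    · have ht' : (t : ℂ) ≠ 0 := Complex.ofReal_ne_zero.2 ht.ne'
      have h1 := (hasDerivAt_waveFun ha ht (d x)).ofReal_comp
      have h2 := hasDerivAt_time (hR.contDiff.differentiable (by simp)) t x
      have h3 := (hasDerivAt_ofReal_pow (2 * k + 1) t).fun_inv (pow_ne_zero _ ht')
      have h4 := (h1.fun_mul (h3.fun_mul h2)).const_mul 2
      refine (h4.congr_of_eventuallyEq ?_).congr_deriv ?_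
      · filter_upwards [Ioi_mem_nhds ht] with s hs
        have hs' : (s : ℂ) ≠ 0 := Complex.ofReal_ne_zero.2 (ne_of_gt hs)
        rw [show 2 * (k + 1) = 2 * k + 1 + 1 by ring, pow_succ, ← add_assoc]
        field_simp
      · rw [reduced_succ, show 2 * (k + 1) = 2 * k + 1 + 1 by ring, pow_succ, pow_succ]
        simp only [← add_assoc, add_tsub_cancel_right]
        push_cast
        field_simp
        ring
  · have h0 : ∀ k, ∀ t, reduced k φ (t, x) = 0 := fun k t =>
      image_eq_zero_of_notMem_tsupport fun h =>
        hxO ((hφ.reduced (isOpen_Iio.prod hO) k).tsupport_subset h).2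
    simp [h0]

/-- The function `∫ f(t,x) t^{-2k} (reduced k ψ)(t,x) dx` of `t`. -/
def slicePairing (k : ℕ) (f : ℝ → Euc m → ℂ) (ψ : ℝ × Euc m → ℂ) (t : ℝ) : ℂ :=
  ∫ x, f t x * (((t : ℂ) ^ (2 * k))⁻¹ * reduced k ψ (t, x))

/-- The functional `T` is given on test functions in `t < δ`, `x ∈ O` by the family of functions
`f t`, after application of the `k`-th iterate of `lowerTranspose`. -/
structure Represents (k : ℕ) (δ : ℝ) (O : Set (Euc m)) (T : Functional m) (f : ℝ → Euc m → ℂ) :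
    Prop where
  continuousOn : ∀ t ∈ Ioo 0 δ, ContinuousOn (f t) O
  integrableOn : ∀ ψ, IsTestFunction (Iio δ ×ˢ O) ψ → IntegrableOn (slicePairing k f ψ) (Ioi 0)
  eq_integral : ∀ ψ, IsTestFunction (Iio δ ×ˢ O) ψ → T ψ = ∫ t in Ioi 0, slicePairing k f ψ t

/-- The definition uses m transpositions; l further ones make the representing function as regular
in x as needed. Two of them give C². -/
lemma represents_waveFun [Nontrivial (Euc m)] (hO : IsOpen O) (hd : ContinuousOn d O)
    (hlow : HasLinearLowerBound d O) {ν l : ℕ} {T : Functional m}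
    (hT : ∀ φ, T φ = ∫ p : ℝ × Euc m, (waveFun m (ν + m) p.1 (d p.2) : ℂ)
      * (lowerTranspose^[m] φ) p) :
    Represents (m + l) δ O T fun t x => (waveFun m (ν + (m + l)) t (d x) : ℂ) := by
  have ha : ∀ l, 0 < waveExp m (ν + (m + l)) := fun l => by
    simp only [waveExp]; push_cast
    have : (0 : ℝ) ≤ m := Nat.cast_nonneg m
    have : (0 : ℝ) ≤ l := Nat.cast_nonneg l
    have : (0 : ℝ) ≤ ν := Nat.cast_nonneg ν
    linarith
  have hneg : ∀ ψ, ∀ t ≤ 0, slicePairing (m + l)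
      (fun t x => (waveFun m (ν + (m + l)) t (d x) : ℂ)) ψ t = 0 := fun ψ t ht => by
    simp [slicePairing, waveFun_of_nonpos ht]
  refine ⟨fun t ht => ?_, fun ψ hψ => ?_, fun ψ hψ => ?_⟩
  · refine Complex.continuous_ofReal.comp_continuousOn ?_
    exact (continuousOn_waveFun (ha l) hd).comp (f := fun x => (t, x))
      (Continuous.prodMk_right t).continuousOn fun x hx => ⟨ht.1, hx⟩
  · have h1 := integrable_waveFun_reduced (ha l) hO hd hlow hψ
    rw [Measure.volume_eq_prod] at h1
    exact h1.integral_prod_left.integrableOn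
  · have h1 : ∀ l, T ψ = ∫ p : ℝ × Euc m, (waveFun m (ν + (m + l)) p.1 (d p.2) : ℂ)
        * (((p.1 : ℂ) ^ (2 * (m + l)))⁻¹ * reduced (m + l) ψ p) := by
      intro l
      induction l with
      | zero =>
        rw [hT]
        refine integral_congr_ae (Filter.Eventually.of_forall fun p => ?_)
        by_cases hp : p.1 ≤ 0
        · simp [waveFun_of_nonpos hp]
        · simp only [add_zero]
          rw [lowerTranspose_iterate hψ.contDiff m (not_le.1 hp).ne']
      | succ l ih =>
        rw [ih, integral_waveFun_shift (ha l) hO hd hlow hψ]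
        rfl
    have h2 := integrable_waveFun_reduced (ha l) hO hd hlow hψ
    have h3 : ∫ t in Ioi (0 : ℝ), slicePairing (m + l)
        (fun t x => (waveFun m (ν + (m + l)) t (d x) : ℂ)) ψ t
        = ∫ t, slicePairing (m + l) (fun t x => (waveFun m (ν + (m + l)) t (d x) : ℂ)) ψ t :=
      setIntegral_eq_integral_of_forall_compl_eq_zero fun t ht => hneg ψ t (not_lt.1 ht)
    rw [h1 l, h3]
    rw [Measure.volume_eq_prod] at h2 ⊢
    exact integral_prod _ h2

lemma isOpen_strip (hO : IsOpen O) : IsOpen (Iio δ ×ˢ O) := isOpen_Iio.prod hO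

/-- At a fixed time, a test function vanishes outside of a compact subset of `O`. -/
lemma slice_support (h : IsTestFunction (Iio δ ×ˢ O) ψ) (t : ℝ) :
    HasCompactSupport (fun x => ψ (t, x)) ∧ tsupport (fun x => ψ (t, x)) ⊆ O := by
  have h1 : tsupport (fun x => ψ (t, x)) ⊆ Prod.snd '' tsupport ψ := by
    refine closure_minimal (fun x hx => ⟨(t, x), subset_tsupport _ hx, rfl⟩)
      (h.hasCompactSupport.isCompact.image continuous_snd).isClosed
  exact ⟨(h.hasCompactSupport.isCompact.image continuous_snd).of_isClosed_subset
    (isClosed_tsupport _) h1, h1.trans (by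
      rintro _ ⟨p, hp, rfl⟩; exact (h.tsupport_subset hp).2)⟩

lemma slice_eq_zero (h : IsTestFunction (Iio δ ×ˢ O) ψ) {t : ℝ} (ht : δ ≤ t) (x : Euc m) :
    ψ (t, x) = 0 :=
  image_eq_zero_of_notMem_tsupport fun hp => not_lt.2 ht (h.tsupport_subset hp).1

lemma continuous_of_continuousOn_mul {X : Type*} [TopologicalSpace X] {O : Set X} {f g : X → ℂ}
    (hO : IsOpen O) (hf : ContinuousOn f O)
    (hg : Continuous g) (hgO : tsupport g ⊆ O) : Continuous fun x => f x * g x := by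
  rw [continuous_iff_continuousAt]
  intro x
  by_cases hx : x ∈ tsupport g
  · exact (hf.continuousAt (hO.mem_nhds (hgO hx))).mul hg.continuousAt
  · refine (continuousAt_const (y := (0 : ℂ))).congr ?_
    filter_upwards [(isClosed_tsupport g).isOpen_compl.mem_nhds hx] with y hy
    rw [image_eq_zero_of_notMem_tsupport hy, mul_zero]

lemma integrable_slice (hO : IsOpen O) (h : IsTestFunction (Iio δ ×ˢ O) ψ) {f : Euc m → ℂ}
    (hf : ContinuousOn f O) (t : ℝ) (a : ℂ) : Integrable fun x => f x * (a * ψ (t, x)) := by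
  have h1 := slice_support h t
  have h2 : Continuous fun x => ψ (t, x) := h.contDiff.continuous.comp (Continuous.prodMk_right t)
  have h3 : Continuous fun x => f x * ψ (t, x) := continuous_of_continuousOn_mul hO hf h2 h1.2
  have h4 : Integrable (fun x => f x * ψ (t, x)) volume :=
    h3.integrable_of_hasCompactSupport h1.1.mul_left
  refine (h4.const_mul a).congr (Filter.Eventually.of_forall fun x => ?_)
  simp only; ring

namespace Represents

variable {k : ℕ} {T S : Functional m} {f g : ℝ → Euc m → ℂ}

lemma add (hO : IsOpen O) (h : Represents k δ O T f) (h' : Represents k δ O S g) :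
    Represents k δ O (T + S) fun t x => f t x + g t x := by
  have key : ∀ ψ, IsTestFunction (Iio δ ×ˢ O) ψ → ∀ t ∈ Ioi (0 : ℝ),
      slicePairing k f ψ t + slicePairing k g ψ t = slicePairing k (fun t x => f t x + g t x) ψ t := by
    intro ψ hψ t ht
    have hr := hψ.reduced (isOpen_strip hO) k
    simp only [slicePairing]
    -- For t ≥ δ the test functions vanish, so nothing is required of the representing functions
    -- there.
    rcases lt_or_ge t δ with h1 | h1
    · rw [← integral_add (integrable_slice hO hr (h.continuousOn t ⟨ht, h1⟩) t _)
        (integrable_slice hO hr (h'.continuousOn t ⟨ht, h1⟩) t _)]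
      simp only [add_mul]
    · simp [slice_eq_zero hr h1]
  refine ⟨fun t ht => (h.continuousOn t ht).add (h'.continuousOn t ht), fun ψ hψ => ?_,
    fun ψ hψ => ?_⟩
  · exact ((h.integrableOn ψ hψ).add (h'.integrableOn ψ hψ)).congr_fun (key ψ hψ) measurableSet_Ioi
  · rw [Pi.add_apply, h.eq_integral ψ hψ, h'.eq_integral ψ hψ,
      ← integral_add (h.integrableOn ψ hψ) (h'.integrableOn ψ hψ)]
    exact setIntegral_congr_fun measurableSet_Ioi (key ψ hψ)

lemma const_smul (h : Represents k δ O T f) (a : ℂ) :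
    Represents k δ O (a • T) fun t x => a * f t x := by
  have key : ∀ ψ t, slicePairing k (fun t x => a * f t x) ψ t = a * slicePairing k f ψ t := by
    intro ψ t
    simp only [slicePairing, mul_assoc]
    exact integral_const_mul a _
  refine ⟨fun t ht => continuousOn_const.mul (h.continuousOn t ht), fun ψ hψ => ?_, fun ψ hψ => ?_⟩
  · simp only [IntegrableOn, funext (key ψ)]
    exact (h.integrableOn ψ hψ).const_mul a
  · rw [Pi.smul_apply, h.eq_integral ψ hψ]
    simp only [key]
    rw [integral_const_mul, smul_eq_mul]

lemma zero : Represents k δ O 0 fun _ _ => 0 := by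
  have key : ∀ ψ, slicePairing k (fun _ (_ : Euc m) => 0) ψ = fun _ => 0 := fun ψ => by
    funext t; simp [slicePairing]
  refine ⟨fun t _ => continuousOn_const, fun ψ _ => ?_, fun ψ _ => ?_⟩
  · rw [key]; exact integrableOn_zero
  · rw [key]; simp

lemma sum (hO : IsOpen O) {ι : Type*} (s : Finset ι) {T : ι → Functional m}
    {f : ι → ℝ → Euc m → ℂ} (h : ∀ i ∈ s, Represents k δ O (T i) (f i)) :
    Represents k δ O (∑ i ∈ s, T i) fun t x => ∑ i ∈ s, f i t x := by
  classical
  induction s using Finset.induction_on with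
  | empty => simpa using zero
  | insert i s hi ih =>
    simp only [Finset.sum_insert hi]
    exact (h i (Finset.mem_insert_self i s)).add hO
      (ih fun j hj => h j (Finset.mem_insert_of_mem hj))

lemma spaceMul (hO : IsOpen O) (h : Represents k δ O T f) {a : Euc m → ℂ}
    (ha : ContDiffOn ℝ ∞ a O) :
    Represents k δ O (HadamardParametrix.spaceMul a T) fun t x => a x * f t x := by
  have key : ∀ ψ, IsTestFunction (Iio δ ×ˢ O) ψ → slicePairing k (fun t x => a x * f t x) ψ
      = slicePairing k f fun p => a p.2 * ψ p := by
    intro ψ hψ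
    funext t
    simp only [slicePairing]
    rw [reduced_congr_mul hO hψ isOpen_Iio ha]
    refine integral_congr_ae (Filter.Eventually.of_forall fun x => ?_)
    simp only; ring
  refine ⟨fun t ht => ha.continuousOn.mul (h.continuousOn t ht), fun ψ hψ => ?_, fun ψ hψ => ?_⟩
  · rw [key ψ hψ]
    exact h.integrableOn _ (hψ.spaceMul isOpen_Iio hO ha)
  · rw [key ψ hψ]
    exact h.eq_integral _ (hψ.spaceMul isOpen_Iio hO ha)

/-- Integration by parts in x at fixed t > 0, where the function is C¹ and the test function has
compact support in O; no boundary term arises. The reduction in time commutes with ∂_j. -/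
lemma distPd (hO : IsOpen O) (h : Represents k δ O T f)
    (hf : ∀ t ∈ Ioo 0 δ, ContDiffOn ℝ 1 (f t) O) (j : Fin m) :
    Represents k δ O (HadamardParametrix.distPd j T) fun t x => pd j (f t) x := by
  set v : ℝ × Euc m := ((0 : ℝ), (EuclideanSpace.single j (1 : ℝ) : Euc m)) with hv
  have hcont : ∀ t ∈ Ioo 0 δ, ContinuousOn (pd j (f t)) O := fun t ht =>
    (((hf t ht).continuousOn_fderiv_of_isOpen hO le_rfl)).clm_apply continuousOn_const
  have key : ∀ ψ, IsTestFunction (Iio δ ×ˢ O) ψ → ∀ t ∈ Ioi (0 : ℝ),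
      -slicePairing k f (fun p => fderiv ℝ ψ p v) t = slicePairing k (fun t => pd j (f t)) ψ t := by
    intro ψ hψ t ht
    have hr := hψ.reduced (isOpen_strip hO) k
    have hr' := (hψ.fderiv_apply v).reduced (isOpen_strip hO) k
    simp only [slicePairing]
    rcases lt_or_ge t δ with h1 | h1
    · set a : ℂ := ((t : ℂ) ^ (2 * k))⁻¹
      have hd := hasDerivAt_space (hr.contDiff.differentiable (by simp)) t
      have hfd : ∀ x, fderiv ℝ (fun u => a * reduced k ψ (t, u)) x (EuclideanSpace.single j 1)
          = a * reduced k (fun p => fderiv ℝ ψ p v) (t, x) := by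
        intro x
        rw [((hd x).const_mul a).fderiv, reduced_fderiv hψ.contDiff]
        rfl
      have hs := slice_support hr t
      have h2 := integral_mul_fderiv_eq_neg_fderiv_mul_of_integrable (𝕜 := ℂ) (μ := volume) (f := f t)
        (g := fun x => a * reduced k ψ (t, x)) (v := (EuclideanSpace.single j (1 : ℝ) : Euc m))
        (integrable_slice hO hr (hcont t ⟨ht, h1⟩) t a)
        (by simp only [hfd]; exact integrable_slice hO hr' (h.continuousOn t ⟨ht, h1⟩) t a)
        (integrable_slice hO hr (h.continuousOn t ⟨ht, h1⟩) t a)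
        (fun x hx => ((hf t ⟨ht, h1⟩).contDiffAt (hO.mem_nhds (hs.2
          (tsupport_mul_subset_right (f := fun _ => a) hx)))).differentiableAt one_ne_zero)
        (fun x _ => ((hd x).const_mul a).differentiableAt)
      simp only [hfd] at h2
      rw [h2, neg_neg]
      rfl
    · simp [slice_eq_zero hr h1, slice_eq_zero hr' h1]
  refine ⟨hcont, fun ψ hψ => ?_, fun ψ hψ => ?_⟩
  · exact (h.integrableOn _ (hψ.fderiv_apply v)).neg.congr_fun (key ψ hψ) measurableSet_Ioi
  · rw [← setIntegral_congr_fun measurableSet_Ioi (key ψ hψ), integral_neg]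
    exact congrArg Neg.neg (h.eq_integral _ (hψ.fderiv_apply v))

end Represents

end Representation

/-! ### The magnetic operator on families of functions -/

section MagneticRepresentation

variable {m : ℕ} {M : Type*} [EMetricSpace M] [ChartedSpace (Euc m) M]
  [IsManifold (𝓡 m) ∞ M] [RiemannianBundle (fun x : M => TangentSpace (𝓡 m) x)]
  [IsContMDiffRiemannianBundle (𝓡 m) ∞ (Euc m) (fun x : M => TangentSpace (𝓡 m) x)]
  {e e' : OpenPartialHomeomorph M (Euc m)} {A : (x : M) → TangentSpace (𝓡 m) x} {y : M}
  {κ δ : ℝ}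

/-- At level k the spatial operator has no singular part: on families of C² functions it is the
pointwise operator. -/
lemma Represents.magneticOp {k : ℕ} {T : Functional m} {f : ℝ → Euc m → ℂ}
    (he : e ∈ IsManifold.maximalAtlas (𝓡 m) ∞ M)
    (hA : ContMDiff (𝓡 m) (𝓡 m).tangent ∞ (fun x => (⟨x, A x⟩ : TangentBundle (𝓡 m) M)))
    (h : Represents k δ e.target T f) (hf : ∀ t ∈ Ioo 0 δ, ContDiffOn ℝ 2 (f t) e.target)
    (c : ℝ) :
    Represents k δ e.target (distMagneticOp e A c T) fun t x => magneticOp e A c (f t) x := by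
  have hO := e.open_target
  have hgrad : ∀ j, Represents k δ e.target (distMagneticGradient e A T j)
      fun t x => magneticGradient e A (f t) j x := fun j =>
    ((Represents.sum hO Finset.univ fun i _ => (h.distPd hO
      (fun t ht => (hf t ht).of_le one_le_two) i).spaceMul hO
        (contDiffOn_ofReal (contDiffOn_metricInv he j i))).const_smul Complex.I).add hO
      (h.spaceMul hO (contDiffOn_ofReal (contDiffOn_vecCoord he hA j)))
  have hvol := contDiffOn_ofReal (contDiffOn_volFactor he)
  have hinv : ContDiffOn ℝ ∞ (fun u => (((volFactor e u)⁻¹ : ℝ) : ℂ)) e.target :=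
    contDiffOn_ofReal ((contDiffOn_volFactor he).inv fun u hu => (volFactor_pos he hu).ne')
  have hdiv : Represents k δ e.target (HadamardParametrix.spaceMul
      (fun u => (((volFactor e u)⁻¹ : ℝ) : ℂ)) (∑ j, HadamardParametrix.distPd j
        (HadamardParametrix.spaceMul (fun u => (volFactor e u : ℂ))
          (distMagneticGradient e A T j))))
      fun t x => divergence e (magneticGradient e A (f t)) x :=
    (Represents.sum hO Finset.univ fun j _ => ((hgrad j).spaceMul hO hvol).distPd hO
      (fun t ht => (hvol.of_le (by simp)).mul
        (contDiffOn_magneticGradient_one he hA hO subset_rfl (hf t ht) j)) j).spaceMul hO hinv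
  exact ((hdiv.const_smul Complex.I).add hO (Represents.sum hO Finset.univ fun j _ =>
    Represents.sum hO Finset.univ fun i _ => (hgrad i).spaceMul hO
      ((contDiffOn_ofReal (contDiffOn_metric he j i)).mul
        (contDiffOn_ofReal (contDiffOn_vecCoord he hA j))))).add hO (h.const_smul c)

lemma magneticOp_zero (u : Euc m) : magneticOp e A κ (fun _ => 0) u = 0 := by
  have h0 : ∀ k, pd k (fun _ : Euc m => (0 : ℂ)) = fun _ => 0 := fun k => by
    funext u; simp [pd]
  have h1 : ∀ k, gradient e (fun _ : Euc m => (0 : ℂ)) k = fun _ => 0 := fun k => by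
    funext u; simp [gradient, h0]
  simp [magneticOp, magneticGradient, h1, divergence, h0]

lemma magneticOp_sum (he : e ∈ IsManifold.maximalAtlas (𝓡 m) ∞ M)
    (hA : ContMDiff (𝓡 m) (𝓡 m).tangent ∞ (fun x => (⟨x, A x⟩ : TangentBundle (𝓡 m) M)))
    {D : Set (Euc m)} (hD : IsOpen D) (hDe : D ⊆ e.target) {ι : Type*} (s : Finset ι)
    {f : ι → Euc m → ℂ} (hf : ∀ i ∈ s, ContDiffOn ℝ 2 (f i) D) {u : Euc m} (hu : u ∈ D) :
    magneticOp e A κ (fun v => ∑ i ∈ s, f i v) u = ∑ i ∈ s, magneticOp e A κ (f i) u := by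
  classical
  induction s using Finset.induction_on with
  | empty => simpa using magneticOp_zero u
  | insert i s hi ih =>
    have hs : ∀ j ∈ s, ContDiffOn ℝ 2 (f j) D := fun j hj => hf j (Finset.mem_insert_of_mem hj)
    have h1 := magneticOp_linear (κ := κ) he hA hD hDe (hf i (Finset.mem_insert_self i s))
      (ContDiffOn.sum hs) 1 hu
    simp only [one_mul] at h1
    simp only [Finset.sum_insert hi]
    rw [h1, ih hs]

lemma sum_metric_mul_gradient (he : e ∈ IsManifold.maximalAtlas (𝓡 m) ∞ M) {u : Euc m}
    (hu : u ∈ e.target) (h : Euc m → ℂ) (j : Fin m) :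
    ∑ k, (metric e u j k : ℂ) * gradient e h k u = pd j h u := by
  have h1 : metric e u * metricInv e u = 1 :=
    Matrix.mul_nonsing_inv _ (metric_det_pos he hu).ne'.isUnit
  have h2 : ∀ l, ∑ k, (metric e u j k : ℂ) * (metricInv e u k l : ℂ) = if j = l then 1 else 0 := by
    intro l
    have := congrFun (congrFun h1 j) l
    rw [Matrix.mul_apply, Matrix.one_apply] at this
    split_ifs at this ⊢ <;> exact_mod_cast this
  simp only [gradient, Finset.mul_sum]
  rw [Finset.sum_comm]
  simp only [← mul_assoc, ← Finset.sum_mul, h2]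
  simp

lemma metric_symm (u : Euc m) (j k : Fin m) : metric e u j k = metric e u k j :=
  real_inner_comm (coordVec e u k) (coordVec e u j)

lemma metricInv_symm (u : Euc m) (j k : Fin m) : metricInv e u j k = metricInv e u k j := by
  have h : (metric e u).transpose = metric e u := by
    ext j k; exact metric_symm u k j
  have h2 : (metricInv e u).transpose = metricInv e u := by
    rw [metricInv, Matrix.transpose_nonsing_inv, h]
  exact congrFun (congrFun h2 k) j

lemma sum_gradient_mul_pd_comm (f h : Euc m → ℂ) (u : Euc m) :
    ∑ k, gradient e f k u * pd k h u = ∑ k, gradient e h k u * pd k f u := by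
  simp only [gradient, Finset.sum_mul]
  rw [Finset.sum_comm]
  refine Finset.sum_congr rfl fun j _ => Finset.sum_congr rfl fun k _ => ?_
  rw [metricInv_symm u k j]; ring

/-- The product rule for the magnetic operator. -/
lemma magneticOp_mul (he : e ∈ IsManifold.maximalAtlas (𝓡 m) ∞ M)
    (hA : ContMDiff (𝓡 m) (𝓡 m).tangent ∞ (fun x => (⟨x, A x⟩ : TangentBundle (𝓡 m) M)))
    {D : Set (Euc m)} (hD : IsOpen D) (hDe : D ⊆ e.target) {a h : Euc m → ℂ}
    (ha : ContDiffOn ℝ 2 a D) (hh : ContDiffOn ℝ 2 h D) {u : Euc m} (hu : u ∈ D) :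
    magneticOp e A κ (fun v => a v * h v) u = h u * magneticOp e A κ a u
      - a u * laplaceBeltrami e h u - 2 * ∑ k, gradient e h k u * pd k a u
      + 2 * Complex.I * a u * ∑ k, (vecCoord e A u k : ℂ) * pd k h u := by
  have hda := fun v (hv : v ∈ D) => (ha.contDiffAt (hD.mem_nhds hv)).differentiableAt two_ne_zero
  have hdh := fun v (hv : v ∈ D) => (hh.contDiffAt (hD.mem_nhds hv)).differentiableAt two_ne_zero
  have h1 : ∀ v ∈ D, ∀ j, magneticGradient e A (fun v => a v * h v) j v
      = h v * magneticGradient e A a j v + (Complex.I * a v) * gradient e h j v := by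
    intro v hv j
    simp only [magneticGradient, gradient, pd_mul (hda v hv) (hdh v hv), mul_add,
      Finset.sum_add_distrib, Finset.mul_sum]
    have e1 : ∀ k, Complex.I * ((metricInv e v j k : ℂ) * (a v * pd k h v))
        = Complex.I * a v * ((metricInv e v j k : ℂ) * pd k h v) := fun k => by ring
    have e2 : ∀ k, Complex.I * ((metricInv e v j k : ℂ) * (h v * pd k a v))
        = h v * (Complex.I * ((metricInv e v j k : ℂ) * pd k a v)) := fun k => by ring
    simp only [e1, e2]
    ring
  have h2 : ∀ j, magneticGradient e A (fun v => a v * h v) j =ᶠ[𝓝 u]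
      fun v => h v * magneticGradient e A a j v + (Complex.I * a v) * gradient e h j v :=
    fun j => by filter_upwards [hD.mem_nhds hu] with v hv using h1 v hv j
  have hX := fun j => ((contDiffOn_magneticGradient_one he hA hD hDe ha j).contDiffAt
    (hD.mem_nhds hu)).differentiableAt one_ne_zero
  have hG := fun j => ((contDiffOn_gradient_one he hD hDe hh j).contDiffAt
    (hD.mem_nhds hu)).differentiableAt one_ne_zero
  have hIa : DifferentiableAt ℝ (fun v => Complex.I * a v) u := (hda u hu).const_mul _
  have hX' := fun j => (hdh u hu).fun_mul (hX j)
  have hG' := fun j => hIa.fun_mul (hG j)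
  have h3 : divergence e (magneticGradient e A fun v => a v * h v) u
      = h u * divergence e (magneticGradient e A a) u + ∑ j, magneticGradient e A a j u * pd j h u
        + (Complex.I * a u * laplaceBeltrami e h u
          + Complex.I * ∑ j, gradient e h j u * pd j a u) := by
    rw [divergence_congr h2, divergence_add he (hDe hu) hX' hG',
      divergence_mul he (hDe hu) hX (hdh u hu), divergence_mul he (hDe hu) hG hIa]
    congr 2
    rw [Finset.mul_sum]
    refine Finset.sum_congr rfl fun j _ => ?_
    rw [pd_const_mul (hda u hu)]; ring
  have h4 : ∑ j, magneticGradient e A a j u * pd j h u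
      = Complex.I * ∑ j, gradient e h j u * pd j a u
        + a u * ∑ k, (vecCoord e A u k : ℂ) * pd k h u := by
    rw [← sum_gradient_mul_pd_comm a h, Finset.mul_sum, Finset.mul_sum, ← Finset.sum_add_distrib]
    exact Finset.sum_congr rfl fun j _ => by rw [magneticGradient]; ring
  have h5 : ∑ j, ∑ k, (metric e u j k : ℂ) * (vecCoord e A u j : ℂ)
        * magneticGradient e A (fun v => a v * h v) k u
      = h u * ∑ j, ∑ k, (metric e u j k : ℂ) * (vecCoord e A u j : ℂ) * magneticGradient e A a k u
        + Complex.I * a u * ∑ k, (vecCoord e A u k : ℂ) * pd k h u := by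
    simp only [h1 u hu, ← sum_metric_mul_gradient he (hDe hu) h, Finset.mul_sum,
      ← Finset.sum_add_distrib]
    exact Finset.sum_congr rfl fun j _ => Finset.sum_congr rfl fun k _ => by ring
  rw [magneticOp, h3, h4, h5, magneticOp]
  linear_combination (2 * ∑ j, gradient e h j u * pd j a u + a u * laplaceBeltrami e h u)
    * Complex.I_mul_I

end MagneticRepresentation

/-! ### Functions of the distance -/

section RadialFunctions

variable {m : ℕ} {M : Type*} [EMetricSpace M] [ChartedSpace (Euc m) M]
  [IsManifold (𝓡 m) ∞ M] [RiemannianBundle (fun x : M => TangentSpace (𝓡 m) x)]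
  [IsContMDiffRiemannianBundle (𝓡 m) ∞ (Euc m) (fun x : M => TangentSpace (𝓡 m) x)]
  {e e' : OpenPartialHomeomorph M (Euc m)} {A : (x : M) → TangentSpace (𝓡 m) x} {y : M}
  {κ δ r : ℝ} {V : Set M}
  {W N : Set (Euc m × Euc m)} {b c : Euc m × Euc m → C(unitInterval, Euc m)}

lemma continuousOn_edist_symm (e : OpenPartialHomeomorph M (Euc m)) (y : M) :
    ContinuousOn (fun u => edist (e.symm u) y) e.target :=
  continuous_edist.comp_continuousOn (e.continuousOn_symm.prodMk continuousOn_const)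

namespace IsMinimizingFamily

lemma hasLinearLowerBound (h : IsMinimizingFamily e V r W N b c) (hy : y ∈ V)
    (he' : e' ∈ IsManifold.maximalAtlas (𝓡 m) ∞ M) :
    HasLinearLowerBound (fun u => edist (e'.symm u) y) e'.target := by
  intro K hK hKc
  by_cases hy' : y ∈ e'.source
  · obtain ⟨a, ha, hu⟩ := h.exists_lower_bound hy he' hy' hKc hK
    exact ⟨a, ha, e' y, hu⟩
  · obtain ⟨a, ha, hu⟩ := exists_lower_bound_of_ne (y := y) hKc hK
      (fun u hu h0 => hy' (by rw [← h0]; exact e'.map_target (hK hu)))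
    obtain ⟨R, hR0, hR⟩ := hKc.isBounded.subset_closedBall_lt 0 0
    -- When y is outside the chart the distance is bounded below by a constant on K. Since K lies in
    -- a ball of radius R, this is also a linear bound, about the origin.
    refine ⟨a / R, div_pos ha hR0, 0, fun u huK => (ENNReal.ofReal_le_ofReal ?_).trans (hu u huK)⟩
    have := mem_closedBall_zero_iff.1 (hR huK)
    rw [sub_zero, div_mul_eq_mul_div, div_le_iff₀ hR0]
    gcongr

lemma contDiffOn_toReal_edist_sq (h : IsMinimizingFamily e V r W N b c) (hy : y ∈ V)
    (he' : e' ∈ IsManifold.maximalAtlas (𝓡 m) ∞ M) :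
    ContDiffOn ℝ ∞ (fun u => (edist (e'.symm u) y).toReal ^ 2) (coordBall e' y r) :=
  (Complex.reCLM.contDiff.comp_contDiffOn (h.contDiffOn_sqDist hy he')).congr fun _ _ => (Complex.ofReal_re _).symm

end IsMinimizingFamily

lemma waveFun_eq_profile {μ : ℕ} (ha : 0 < waveExp m μ) {t : ℝ} (ht : 0 < t) {u : Euc m}
    (hu : u ∈ coordBall e y r) :
    waveFun m μ t (edist (e.symm u) y)
      = profile m μ (t ^ 2 - (edist (e.symm u) y).toReal ^ 2) :=
  waveFun_of_ne_top ha ht (hu.2.trans ENNReal.ofReal_lt_top).ne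

/-- The functions `E_μ(t, d(·, y))` vanish near the points at distance at least `δ > t`. -/
lemma waveFun_eventually_eq_zero {t : ℝ} (ht : 0 < t) (htr : t < r) {u : Euc m}
    (hu : u ∈ e.target) (hur : u ∉ coordBall e y r) :
    ∀ᶠ v in 𝓝 u, ∀ μ, waveFun m μ t (edist (e.symm v) y) = 0 := by
  have h1 : ENNReal.ofReal t < edist (e.symm u) y :=
    ((ENNReal.ofReal_lt_ofReal_iff (ht.trans htr)).2 htr).trans_le (not_lt.1 fun h => hur ⟨hu, h⟩)
  have h2 := ((continuousOn_edist_symm e y).continuousAt (e.open_target.mem_nhds hu))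
  filter_upwards [h2.eventually (lt_mem_nhds h1)] with v hv μ using waveFun_of_le hv.le

variable {μ : ℕ}

lemma waveExp_add_one_pos (ha : 0 < waveExp m μ) : 0 < waveExp m (μ + 1) := by
  rw [waveExp_succ]; linarith

/-- Inside the ball of radius δ the squared distance is smooth. Elsewhere the product vanishes
locally, as t < δ, so neither d² nor the factor β needs any regularity there. -/
lemma contDiffOn_mul_waveFun (h : IsMinimizingFamily e V r W N b c) (hy : y ∈ V)
    (he' : e' ∈ IsManifold.maximalAtlas (𝓡 m) ∞ M) (ha : 0 < waveExp m μ) {t : ℝ} (ht : 0 < t)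
    (htδ : t < δ) (hδ : δ ≤ r) {β : Euc m → ℂ} (hβ : ContDiffOn ℝ ∞ β (coordBall e' y δ)) :
    ContDiffOn ℝ 2 (fun u => β u * (waveFun m (μ + 2) t (edist (e'.symm u) y) : ℂ)) e'.target := by
  have ha2 := waveExp_add_one_pos (waveExp_add_one_pos ha)
  intro u hu
  by_cases hur : u ∈ coordBall e' y δ
  · have h1 : ContDiffOn ℝ 2 (fun u => β u * (profile m (μ + 2)
        (t ^ 2 - (edist (e'.symm u) y).toReal ^ 2) : ℂ)) (coordBall e' y δ) :=
      (hβ.of_le two_le_infty).mul (Complex.ofRealCLM.contDiff.comp_contDiffOn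
        ((contDiff_profile ha).comp_contDiffOn (contDiffOn_const.sub
          (((h.contDiffOn_toReal_edist_sq hy he').mono (coordBall_mono hδ)).of_le two_le_infty))))
    refine ContDiffAt.contDiffWithinAt ((h1.contDiffAt
      (isOpen_coordBall.mem_nhds hur)).congr_of_eventuallyEq ?_)
    filter_upwards [isOpen_coordBall.mem_nhds hur] with v hv
    rw [waveFun_eq_profile ha2 ht hv]
  · refine ContDiffAt.contDiffWithinAt ((contDiffAt_const (c := (0 : ℂ))).congr_of_eventuallyEq ?_)
    filter_upwards [waveFun_eventually_eq_zero ht htδ hu hur] with v hv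
    rw [hv]; simp

lemma pd_comp_sqDist {H : ℝ → ℝ} {H' : ℝ} {t : ℝ} {u : Euc m}
    (hs : DifferentiableAt ℝ (fun u => (edist (e.symm u) y).toReal ^ 2) u)
    (hH : HasDerivAt H H' (t ^ 2 - (edist (e.symm u) y).toReal ^ 2)) (j : Fin m) :
    pd j (fun v => (H (t ^ 2 - (edist (e.symm v) y).toReal ^ 2) : ℂ)) u
      = -(H' : ℂ) * pd j (sqDist e y) u := by
  have h1 := hH.comp_hasFDerivAt u (hs.hasFDerivAt.const_sub (t ^ 2))
  have h2 : pd j (sqDist e y) u = _ := pd_ofReal hs j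
  rw [h2]
  have h3 := pd_ofReal h1.differentiableAt j
  simp only [Function.comp_def] at h3
  rw [h3]
  have h4 := h1.fderiv
  simp only [Function.comp_def] at h4
  rw [h4]
  simp

/-- The wave equation for `α E_μ` at positive times. -/
lemma waveOp_mul_profile (h : IsMinimizingFamily e V r W N b c) (hy : y ∈ V)
    (he' : e' ∈ IsManifold.maximalAtlas (𝓡 m) ∞ M)
    (hA : ContMDiff (𝓡 m) (𝓡 m).tangent ∞ (fun x => (⟨x, A x⟩ : TangentBundle (𝓡 m) M)))
    (ha : 0 < waveExp m μ) {t : ℝ} (hδ : δ ≤ r) {β : Euc m → ℂ}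
    (hβ : ContDiffOn ℝ ∞ β (coordBall e' y δ)) {u : Euc m} (hu : u ∈ coordBall e' y δ) :
    β u * ((t : ℂ) ^ 2 / 4 * (profile m μ (t ^ 2 - (edist (e'.symm u) y).toReal ^ 2) : ℂ)
        + (profile m (μ + 1) (t ^ 2 - (edist (e'.symm u) y).toReal ^ 2) : ℂ) / 2)
      + magneticOp e' A κ
        (fun v => β v * (profile m (μ + 2) (t ^ 2 - (edist (e'.symm v) y).toReal ^ 2) : ℂ)) u
    = magneticOp e' A κ β u * (profile m (μ + 2) (t ^ 2 - (edist (e'.symm u) y).toReal ^ 2) : ℂ)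
      + (profile m (μ + 1) (t ^ 2 - (edist (e'.symm u) y).toReal ^ 2) : ℂ)
        * (((μ : ℂ) + 2) * β u + (-transportCoeff e' A y u * β u + radialDeriv e' y β u) / 2) := by
  have ha1 := waveExp_add_one_pos ha
  set D := coordBall e' y δ with hD
  have hDo : IsOpen D := isOpen_coordBall
  have hDe : D ⊆ e'.target := coordBall_subset
  set q : Euc m → ℝ := fun v => t ^ 2 - (edist (e'.symm v) y).toReal ^ 2 with hq
  have hsm := (h.contDiffOn_toReal_edist_sq hy he').mono (coordBall_mono hδ)
  have hσ := (h.contDiffOn_sqDist hy he').mono (coordBall_mono hδ)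
  have hsd := fun v (hv : v ∈ D) => hsm.differentiableAt_of_isOpen hDo hv
  have hh : ContDiffOn ℝ 2 (fun v => (profile m (μ + 2) (q v) : ℂ)) D :=
    Complex.ofRealCLM.contDiff.comp_contDiffOn ((contDiff_profile ha).comp_contDiffOn
      (contDiffOn_const.sub (hsm.of_le two_le_infty)))
  have hp1 : ∀ v ∈ D, ∀ j, pd j (fun v => (profile m (μ + 2) (q v) : ℂ)) v
      = -((profile m (μ + 1) (q v) / 4 : ℝ) : ℂ) * pd j (sqDist e' y) v := fun v hv j =>
    pd_comp_sqDist (hsd v hv) (hasDerivAt_profile ha1 _) j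
  have hg : ∀ v ∈ D, ∀ j, gradient e' (fun v => (profile m (μ + 2) (q v) : ℂ)) j v
      = (-1 / 4 * (profile m (μ + 1) (q v) : ℂ)) * gradient e' (sqDist e' y) j v := by
    intro v hv j
    simp only [gradient, hp1 v hv, Finset.mul_sum]
    refine Finset.sum_congr rfl fun k _ => ?_
    push_cast; ring
  have hp2 : ∀ j, pd j (fun v => -1 / 4 * (profile m (μ + 1) (q v) : ℂ)) u
      = (profile m μ (q u) : ℂ) / 16 * pd j (sqDist e' y) u := by
    intro j
    have hdiff : DifferentiableAt ℝ (fun v => (profile m (μ + 1) (q v) : ℂ)) u :=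
      Complex.ofRealCLM.differentiableAt.comp u
        ((hasDerivAt_profile ha (q u)).differentiableAt.comp u ((hsd u hu).const_sub (t ^ 2)))
    rw [pd_const_mul hdiff, pd_comp_sqDist (hsd u hu) (hasDerivAt_profile ha _)]
    push_cast; ring
  have hdp : DifferentiableAt ℝ (fun v => -1 / 4 * (profile m (μ + 1) (q v) : ℂ)) u :=
    DifferentiableAt.const_mul (Complex.ofRealCLM.differentiableAt.comp u
        ((hasDerivAt_profile ha (q u)).differentiableAt.comp u ((hsd u hu).const_sub (t ^ 2)))) _
  have hΔ : laplaceBeltrami e' (fun v => (profile m (μ + 2) (q v) : ℂ)) u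
      = -1 / 4 * (profile m (μ + 1) (q u) : ℂ) * laplaceBeltrami e' (sqDist e' y) u
        + (profile m μ (q u) : ℂ) / 4 * sqDist e' y u := by
    rw [laplaceBeltrami, divergence_congr (Y := fun j v => (-1 / 4 * (profile m (μ + 1) (q v) : ℂ))
      * gradient e' (sqDist e' y) j v) fun j => by
        filter_upwards [hDo.mem_nhds hu] with v hv using hg v hv j]
    rw [divergence_mul he' (hDe hu) (fun j => (contDiffOn_gradient he' hDo hDe hσ
      j).differentiableAt_of_isOpen hDo hu) hdp]
    congr 1
    -- The second derivative of the profile comes with ⟨∇σ, ∇σ⟩, which the eikonal equation replaces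
    -- by 4σ.
    have heik := h.radialDeriv_sqDist_chart hy he' (coordBall_mono hδ hu)
    rw [radialDeriv] at heik
    simp only [hp2]
    rw [show (profile m μ (q u) : ℂ) / 4 * sqDist e' y u
      = (profile m μ (q u) : ℂ) / 16 * (4 * sqDist e' y u) by ring, ← heik, Finset.mul_sum]
    exact Finset.sum_congr rfl fun j _ => by ring
  have hgp : ∑ k, gradient e' (fun v => (profile m (μ + 2) (q v) : ℂ)) k u * pd k β u
      = -1 / 4 * (profile m (μ + 1) (q u) : ℂ) * radialDeriv e' y β u := by
    rw [radialDeriv, Finset.mul_sum]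
    exact Finset.sum_congr rfl fun k _ => by rw [hg u hu]; ring
  have hAp : ∑ k, (vecCoord e' A u k : ℂ) * pd k (fun v => (profile m (μ + 2) (q v) : ℂ)) u
      = -1 / 4 * (profile m (μ + 1) (q u) : ℂ)
        * ∑ k, (vecCoord e' A u k : ℂ) * pd k (sqDist e' y) u := by
    rw [Finset.mul_sum]
    exact Finset.sum_congr rfl fun k _ => by rw [hp1 u hu]; push_cast; ring
  -- The term t²E_μ/4 from ∂_t² and the term -σE_μ/4 from the Laplacian combine into a multiple of
  -- E_{μ+1}. The exponent in that multiple supplies the dimension m in ρ.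
  have hmul : ((t : ℂ) ^ 2 - sqDist e' y u) * (profile m μ (q u) : ℂ)
      = 4 * (waveExp m (μ + 1) : ℂ) * (profile m (μ + 1) (q u) : ℂ) := by
    have := congrArg (fun x : ℝ => (x : ℂ)) (mul_profile ha (q u))
    simp only [hq, Complex.ofReal_mul, Complex.ofReal_sub, Complex.ofReal_pow,
      Complex.ofReal_ofNat] at this
    rw [← this, sqDist]
    push_cast; ring
  have hexp : (waveExp m (μ + 1) : ℂ) = (μ : ℂ) + 1 - ((m : ℂ) - 1) / 2 := by
    simp only [waveExp]; push_cast; ring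
  rw [magneticOp_mul he' hA hDo hDe (hβ.of_le two_le_infty) hh hu, hΔ, hgp, hAp, transportCoeff]
  rw [hexp] at hmul
  linear_combination β u / 4 * hmul

end RadialFunctions

/-! ### Integrals of the profiles over `ℝ^m` -/

section ProfileIntegrals

variable {m μ : ℕ}

lemma integral_betaPDFReal {a b : ℝ} (ha : 0 < a) (hb : 0 < b) :
    ∫ x, ProbabilityTheory.betaPDFReal a b x = 1 := by
  rw [integral_eq_lintegral_of_nonneg_ae]
  · change (∫⁻ x, ProbabilityTheory.betaPDF a b x).toReal = 1
    rw [ProbabilityTheory.lintegral_betaPDF_eq_one ha hb]; simp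
  · refine Filter.Eventually.of_forall fun x => ?_
    by_cases h : 0 < x ∧ x < 1
    · exact (ProbabilityTheory.betaPDFReal_pos h.1 h.2 ha hb).le
    · simp [ProbabilityTheory.betaPDFReal, h]
  · exact (ProbabilityTheory.stronglyMeasurable_betaPDFReal a b).aestronglyMeasurable

/-- The substitution s = y² turns the radial integral into Euler's Beta integral. -/
lemma integral_pow_mul_profile (hm : 1 ≤ m) (ha : 0 < waveExp m μ) :
    ∫ y in Ioi (0 : ℝ), y ^ (m - 1) • profile m μ (1 - y ^ 2)
      = (2 : ℝ) ^ (-(2 * (μ : ℝ) + 1)) * Real.pi ^ (-(((m : ℝ) - 1) / 2))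
        / Real.Gamma (waveExp m μ + 1) * ProbabilityTheory.beta ((m : ℝ) / 2) (waveExp m μ + 1)
        / 2 := by
  set C : ℝ := (2 : ℝ) ^ (-(2 * (μ : ℝ) + 1)) * Real.pi ^ (-(((m : ℝ) - 1) / 2))
        / Real.Gamma (waveExp m μ + 1) with hC
  have hm0 : (0 : ℝ) < (m : ℝ) / 2 := by
    have : (1 : ℝ) ≤ m := by exact_mod_cast hm
    linarith
  have hb0 : 0 < waveExp m μ + 1 := by linarith
  set B := ProbabilityTheory.beta ((m : ℝ) / 2) (waveExp m μ + 1) with hB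
  have hBpos : 0 < B := ProbabilityTheory.beta_pos hm0 hb0
  have h1 : ∀ s ∈ Ioi (0 : ℝ), s ^ ((m : ℝ) / 2 - 1) * profile m μ (1 - s) / 2
      = C * B / 2 * ProbabilityTheory.betaPDFReal ((m : ℝ) / 2) (waveExp m μ + 1) s := by
    intro s hs
    rw [ProbabilityTheory.betaPDFReal, ← hB]
    by_cases h : s < 1
    · rw [if_pos ⟨hs, h⟩, profile, max_eq_left (by linarith), add_sub_cancel_right]
      rw [hC]
      field_simp
    · rw [if_neg (fun h' => h h'.2), profile_of_nonpos ha (by linarith)]; simp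
  have h2 := integral_comp_rpow_Ioi_of_pos (E := ℝ)
    (g := fun s : ℝ => s ^ ((m : ℝ) / 2 - 1) * profile m μ (1 - s) / 2) (p := 2) two_pos
  have h3 : ∫ s in Ioi (0 : ℝ), ProbabilityTheory.betaPDFReal ((m : ℝ) / 2) (waveExp m μ + 1) s
      = ∫ s, ProbabilityTheory.betaPDFReal ((m : ℝ) / 2) (waveExp m μ + 1) s :=
    setIntegral_eq_integral_of_forall_compl_eq_zero fun x hx => by
      rw [ProbabilityTheory.betaPDFReal, if_neg fun h => hx h.1]
  rw [setIntegral_congr_fun measurableSet_Ioi h1, integral_const_mul, h3,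
    integral_betaPDFReal hm0 hb0, mul_one] at h2
  rw [← h2]
  refine setIntegral_congr_fun measurableSet_Ioi fun y hy => ?_
  have hy0 : (0 : ℝ) < y := hy
  have e1 : (y ^ (2 : ℝ)) ^ ((m : ℝ) / 2 - 1) * y = y ^ (m - 1) := by
    rw [← Real.rpow_mul hy0.le, ← Real.rpow_add_one hy0.ne', ← Real.rpow_natCast,
      Nat.cast_sub hm]
    congr 1; push_cast; ring
  have e2 : y ^ ((2 : ℝ) - 1) = y := by norm_num
  simp only [smul_eq_mul]
  rw [← e1, e2, Real.rpow_two]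
  ring

/-- The integral of `E_μ(1, |z|)` over `ℝ^m`. -/
def waveMass (μ : ℕ) : ℝ := (2 : ℝ) ^ (-(2 * (μ : ℝ) + 1)) * √Real.pi / Real.Gamma (μ + 3 / 2)

/-- In polar coordinates the factor Γ(m/2) in the volume of the unit ball cancels against the Beta
function, and the powers of π combine. The result does not depend on the dimension. -/
lemma integral_profile_norm (hm : 1 ≤ m) (ha : 0 < waveExp m μ) :
    ∫ z : Euc m, profile m μ (1 - ‖z‖ ^ 2) = waveMass μ := by
  have : Nonempty (Fin m) := ⟨⟨0, hm⟩⟩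
  have : Nontrivial (Euc m) := by
    refine Module.nontrivial_of_finrank_pos (R := ℝ) ?_
    rw [finrank_euclideanSpace_fin]; exact hm
  have hm' : (1 : ℝ) ≤ m := by exact_mod_cast hm
  rw [integral_fun_norm_addHaar volume fun y => profile m μ (1 - y ^ 2), finrank_euclideanSpace_fin,
    integral_pow_mul_profile hm ha, Measure.real, EuclideanSpace.volume_ball]
  simp only [ENNReal.ofReal_one, one_pow, one_mul, Fintype.card_fin, nsmul_eq_mul, smul_eq_mul]
  have hg0 : 0 < Real.Gamma ((m : ℝ) / 2) := Real.Gamma_pos_of_pos (by linarith)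
  have hg1 : 0 < Real.Gamma (waveExp m μ + 1) := Real.Gamma_pos_of_pos (by linarith)
  have hg2 : 0 < Real.Gamma ((μ : ℝ) + 3 / 2) := Real.Gamma_pos_of_pos (by positivity)
  have hsum : (m : ℝ) / 2 + (waveExp m μ + 1) = μ + 3 / 2 := by simp only [waveExp]; ring
  have hpi : √Real.pi ^ m * Real.pi ^ (-(((m : ℝ) - 1) / 2)) = √Real.pi := by
    rw [Real.sqrt_eq_rpow, ← Real.rpow_natCast, ← Real.rpow_mul Real.pi_pos.le,
      ← Real.rpow_add Real.pi_pos]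
    congr 1; ring
  rw [ENNReal.toReal_ofReal (by positivity), Real.Gamma_add_one (by linarith),
    ProbabilityTheory.beta, hsum, waveMass]
  conv_rhs => rw [← hpi]
  field_simp

/-- The total weight of the point source: the mass of E_k(1, ·), the value at t = 0 of the reduced
test function, and the factor ½ of the boundary term multiply to 1. -/
lemma waveMass_mul (k : ℕ) :
    waveMass k * (4 ^ (k + 1) * Real.Gamma ((k + 1 : ℕ) + 1 / 2) / √Real.pi) / 2 = 1 := by
  have hg2 : 0 < Real.Gamma ((k : ℝ) + 3 / 2) := Real.Gamma_pos_of_pos (by positivity)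
  have hp : 0 < √Real.pi := Real.sqrt_pos.2 Real.pi_pos
  have h1 : ((k + 1 : ℕ) : ℝ) + 1 / 2 = k + 3 / 2 := by push_cast; ring
  have h2 : (2 : ℝ) ^ (-(2 * (k : ℝ) + 1)) * 4 ^ (k + 1) = 2 := by
    rw [show (4 : ℝ) = 2 ^ (2 : ℝ) by norm_num, ← Real.rpow_natCast, ← Real.rpow_mul two_pos.le,
      ← Real.rpow_add two_pos]
    rw [show -(2 * (k : ℝ) + 1) + 2 * ((k + 1 : ℕ) : ℝ) = 1 by push_cast; ring, Real.rpow_one]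
  rw [waveMass, h1]
  field_simp
  linarith

end ProfileIntegrals

/-! ### Integrals of the profiles for the metric at a point -/

section MetricIntegral

variable {m μ : ℕ} {M : Type*} [TopologicalSpace M] [ChartedSpace (Euc m) M]
  [IsManifold (𝓡 m) ∞ M] [RiemannianBundle (fun x : M => TangentSpace (𝓡 m) x)]
  [IsContMDiffRiemannianBundle (𝓡 m) ∞ (Euc m) (fun x : M => TangentSpace (𝓡 m) x)]
  {e : OpenPartialHomeomorph M (Euc m)}

open scoped MatrixOrder in
-- Factor the positive matrix as B*B. The linear change of variables by B produces the factor
-- |g|^{-1/2} of the source.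
lemma exists_linearMap_metricForm (he : e ∈ IsManifold.maximalAtlas (𝓡 m) ∞ M) {u : Euc m}
    (hu : u ∈ e.target) : ∃ L : Euc m →ₗ[ℝ] Euc m, |LinearMap.det L| = volFactor e u ∧
      ∀ z, metricForm e u z z = ‖L z‖ ^ 2 := by
  obtain ⟨B, hB⟩ := CStarAlgebra.nonneg_iff_eq_star_mul_self.mp
    (metric_posDef he hu).posSemidef.nonneg
  refine ⟨Matrix.toLpLin 2 2 B, ?_, fun z => ?_⟩
  · rw [LinearMap.det_toLpLin, volFactor, hB, Matrix.det_mul, Matrix.star_eq_conjTranspose,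
      Matrix.det_conjTranspose, star_trivial, ← sq, Real.sqrt_sq_eq_abs]
  · rw [metricForm_apply, EuclideanSpace.norm_sq_eq, hB]
    simp only [Real.norm_eq_abs, sq_abs]
    simp only [Matrix.mul_apply, Matrix.star_apply, star_trivial, Matrix.toLpLin_apply,
      Matrix.mulVec, dotProduct, sq, Finset.sum_mul_sum]
    simp only [Finset.sum_mul]
    rw [Finset.sum_congr rfl fun j _ => Finset.sum_comm, Finset.sum_comm]
    refine Finset.sum_congr rfl fun i _ => Finset.sum_congr rfl fun j _ =>
      Finset.sum_congr rfl fun k _ => ?_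
    ring

lemma integral_profile_metricForm (hm : 1 ≤ m) (he : e ∈ IsManifold.maximalAtlas (𝓡 m) ∞ M)
    {u : Euc m} (hu : u ∈ e.target) (ha : 0 < waveExp m μ) :
    ∫ z : Euc m, profile m μ (1 - metricForm e u z z) = waveMass μ * (volFactor e u)⁻¹ := by
  obtain ⟨L, hL, hLz⟩ := exists_linearMap_metricForm he hu
  have hw := volFactor_pos he hu
  have hdet : LinearMap.det L ≠ 0 := fun h => by rw [h, abs_zero] at hL; exact hw.ne hL
  have h1 := Measure.map_linearMap_addHaar_eq_smul_addHaar (μ := (volume : Measure (Euc m))) hdet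
  have hcont : Continuous fun z : Euc m => profile m μ (1 - ‖z‖ ^ 2) :=
    (continuous_profile ha).comp (by fun_prop)
  have h2 := integral_map (μ := (volume : Measure (Euc m)))
    (L.continuous_of_finiteDimensional.measurable.aemeasurable) (hcont.aestronglyMeasurable
      (μ := Measure.map L volume))
  simp only [hLz]
  rw [← h2, h1, integral_smul_measure, integral_profile_norm hm ha, ENNReal.toReal_ofReal
    (abs_nonneg _), abs_inv, hL, smul_eq_mul, mul_comm]

end MetricIntegral

/-! ### The behaviour of the pairings as `t → 0` -/

section SmallTime

variable {m μ : ℕ} {O : Set (Euc m)} {d : Euc m → ℝ≥0∞} {δ : ℝ} {ψ : ℝ × Euc m → ℂ} {p : Euc m}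

lemma continuous_waveFun_mul_slice (ha : 0 < waveExp m μ) (hO : IsOpen O) (hd : ContinuousOn d O)
    (hψ : IsTestFunction (Iio δ ×ˢ O) ψ) {t : ℝ} (ht : 0 < t) :
    Continuous fun x => (waveFun m μ t (d x) : ℂ) * ψ (t, x) :=
  continuous_of_continuousOn_mul hO
    (Complex.continuous_ofReal.comp_continuousOn ((continuousOn_waveFun ha hd).comp
      (f := fun x => (t, x)) (Continuous.prodMk_right t).continuousOn fun _ hx => ⟨ht, hx⟩))
    (hψ.contDiff.continuous.comp (Continuous.prodMk_right t)) (slice_support hψ t).2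

/-- In the coordinates x = p + εz, homogeneity of the profile and the Jacobian ε^m give the total
power ε^{2μ+1}. The lower bound for d confines z to a fixed ball, so dominated convergence applies,
with d²/ε² tending to the quadratic form q. -/
lemma tendsto_integral_waveFun (ha : 0 < waveExp m μ) (hO : IsOpen O) (hd : ContinuousOn d O)
    (hψ : IsTestFunction (Iio δ ×ˢ O) ψ) (hp : p ∈ O) (hdp : d p = 0)
    (hlow : ∀ K ⊆ O, IsCompact K → ∃ a : ℝ, 0 < a ∧ ∀ u ∈ K, ENNReal.ofReal (a * ‖u - p‖) ≤ d u)
    {q : Euc m → ℝ} (hq : ∀ z, Filter.Tendsto (fun ε : ℝ => (d (p + ε • z)).toReal ^ 2 / ε ^ 2)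
      (𝓝[>] 0) (𝓝 (q z))) :
    Filter.Tendsto (fun ε : ℝ => ((ε : ℂ) ^ (2 * μ + 1))⁻¹
        * ∫ x, (waveFun m μ ε (d x) : ℂ) * ψ (ε, x)) (𝓝[>] 0)
      (𝓝 (((∫ z, profile m μ (1 - q z) : ℝ) : ℂ) * ψ (0, p))) := by
  obtain ⟨a, ha0, hlow'⟩ := hlow (Prod.snd '' tsupport ψ)
    (by rintro _ ⟨p, hp, rfl⟩; exact (hψ.tsupport_subset hp).2)
    (hψ.hasCompactSupport.isCompact.image continuous_snd)
  obtain ⟨B, hB⟩ := hψ.contDiff.continuous.bounded_above_of_compact_support hψ.hasCompactSupport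
  have hB0 : 0 ≤ B := (norm_nonneg _).trans (hB 0)
  set Φ : ℝ → Euc m → ℂ := fun ε z => ((ε ^ (2 * waveExp m μ) : ℝ) : ℂ)⁻¹ *
    ((waveFun m μ ε (d (p + ε • z)) : ℂ) * ψ (ε, p + ε • z)) with hΦ
  have hscale : ∀ ε : ℝ, 0 < ε → ((ε : ℂ) ^ (2 * μ + 1))⁻¹
        * ∫ x, (waveFun m μ ε (d x) : ℂ) * ψ (ε, x) = ∫ z, Φ ε z := by
    intro ε hε
    have h1 := Measure.integral_comp_smul (volume : Measure (Euc m))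
      (fun z => (waveFun m μ ε (d (p + z)) : ℂ) * ψ (ε, p + z)) ε
    rw [integral_add_left_eq_self (fun x => (waveFun m μ ε (d x) : ℂ) * ψ (ε, x)) p,
      finrank_euclideanSpace_fin, abs_of_pos (by positivity)] at h1
    have h2 := rpow_waveExp (m := m) (ν := μ) (k := 0) hε
    simp only [add_zero, mul_zero, pow_zero, mul_one] at h2
    have h3 : (ε : ℂ) ^ (2 * μ + 1) = ((ε ^ (2 * waveExp m μ) : ℝ) : ℂ) * (ε : ℂ) ^ m := by
      rw [← Complex.ofReal_pow, ← Complex.ofReal_pow, ← Complex.ofReal_mul, h2]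
    rw [hΦ]
    simp only
    rw [integral_const_mul, h1, h3, Complex.real_smul, mul_inv]
    push_cast
    ring
  have hev : ∀ᶠ ε : ℝ in 𝓝[>] 0, ∫ z, Φ ε z = ((ε : ℂ) ^ (2 * μ + 1))⁻¹
      * ∫ x, (waveFun m μ ε (d x) : ℂ) * ψ (ε, x) := by
    filter_upwards [self_mem_nhdsWithin] with ε hε using (hscale ε hε).symm
  refine Filter.Tendsto.congr' hev ?_
  rw [← integral_complex_ofReal, ← integral_mul_const]
  refine tendsto_integral_filter_of_dominated_convergence
    ((Metric.closedBall (0 : Euc m) (1 / a)).indicator fun _ => profile m μ 1 * B) ?_ ?_ ?_ ?_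
  · filter_upwards [self_mem_nhdsWithin] with ε hε
    refine (Continuous.mul continuous_const ?_).aestronglyMeasurable
    exact (continuous_waveFun_mul_slice ha hO hd hψ hε).comp
      (continuous_const.add (continuous_const_smul ε))
  · filter_upwards [self_mem_nhdsWithin] with ε hε
    have hε0 : (0 : ℝ) < ε := hε
    refine Filter.Eventually.of_forall fun z => ?_
    have hpow : 0 < ε ^ (2 * waveExp m μ) := Real.rpow_pos_of_pos hε0 _
    by_cases hz : z ∈ Metric.closedBall (0 : Euc m) (1 / a)
    · rw [indicator_of_mem hz, hΦ]
      simp only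
      rw [norm_mul, norm_mul, norm_inv, Complex.norm_real, Complex.norm_real,
        Real.norm_of_nonneg hpow.le, Real.norm_of_nonneg (waveFun_nonneg ha _ _), ← mul_assoc]
      refine mul_le_mul ?_ (hB _) (norm_nonneg _) (profile_nonneg ha 1)
      rw [inv_mul_le_iff₀ hpow]
      exact waveFun_le ha hε0 _
    · rw [indicator_of_notMem hz]
      refine le_of_eq (norm_eq_zero.2 ?_)
      rw [hΦ]
      by_cases hs : (ε, p + ε • z) ∈ tsupport ψ
      · have h1 := hlow' _ ⟨_, hs, rfl⟩
        simp only [add_sub_cancel_left, norm_smul, Real.norm_of_nonneg hε0.le] at h1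
        rw [mem_closedBall_zero_iff, not_le, div_lt_iff₀ ha0] at hz
        simp only
        rw [waveFun_of_le ((ENNReal.ofReal_le_ofReal ?_).trans h1)]
        · simp
        · nlinarith
      · simp only
        rw [image_eq_zero_of_notMem_tsupport hs]; simp
  · exact (integrable_indicator_iff measurableSet_closedBall).2
      (integrableOn_const (measure_closedBall_lt_top.ne))
  · refine Filter.Eventually.of_forall fun z => ?_
    have hlin : Filter.Tendsto (fun ε : ℝ => p + ε • z) (𝓝[>] 0) (𝓝 p) := by
      have : Continuous fun ε : ℝ => p + ε • z := by fun_prop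
      have h2 := this.tendsto 0
      rw [zero_smul, add_zero] at h2
      exact h2.mono_left nhdsWithin_le_nhds
    have hψlim : Filter.Tendsto (fun ε : ℝ => ψ (ε, p + ε • z)) (𝓝[>] 0) (𝓝 (ψ (0, p))) := by
      refine (hψ.contDiff.continuous.tendsto (0, p)).comp ?_
      exact (tendsto_nhdsWithin_of_tendsto_nhds Filter.tendsto_id).prodMk_nhds hlin
    have hprof : Filter.Tendsto (fun ε : ℝ =>
        ((profile m μ (1 - (d (p + ε • z)).toReal ^ 2 / ε ^ 2) : ℝ) : ℂ)) (𝓝[>] 0)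
        (𝓝 ((profile m μ (1 - q z) : ℝ) : ℂ)) :=
      (Complex.continuous_ofReal.tendsto _).comp
        (((continuous_profile ha).tendsto _).comp ((hq z).const_sub 1))
    refine (hprof.mul hψlim).congr' ?_
    have hfin : ∀ᶠ ε : ℝ in 𝓝[>] 0, d (p + ε • z) < ⊤ := by
      have h1 := hlin.eventually ((hd.continuousAt (hO.mem_nhds hp)).eventually
        (gt_mem_nhds (show d p < ⊤ by rw [hdp]; exact ENNReal.zero_lt_top)))
      exact h1
    filter_upwards [hfin, self_mem_nhdsWithin] with ε hε hε0
    have hε0 : (0 : ℝ) < ε := hε0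
    have hpow2 : (ε ^ 2) ^ waveExp m μ = ε ^ (2 * waveExp m μ) := by
      rw [Real.rpow_mul hε0.le, Real.rpow_two]
    rw [hΦ]
    simp only
    rw [waveFun_of_ne_top ha hε0 hε.ne, show ε ^ 2 - (d (p + ε • z)).toReal ^ 2
      = ε ^ 2 * (1 - (d (p + ε • z)).toReal ^ 2 / ε ^ 2) by field_simp, profile_mul (sq_nonneg ε), hpow2]
    have hpow : ((ε ^ (2 * waveExp m μ) : ℝ) : ℂ) ≠ 0 :=
      Complex.ofReal_ne_zero.2 (Real.rpow_pos_of_pos hε0 _).ne'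
    rw [Complex.ofReal_mul]
    field_simp

lemma integral_waveFun_eventually_zero (hψ : IsTestFunction (Iio δ ×ˢ O) ψ)
    (hlow : ∀ K ⊆ O, IsCompact K → ∃ a : ℝ, 0 < a ∧ ∀ u ∈ K, ENNReal.ofReal a ≤ d u) :
    ∀ᶠ ε : ℝ in 𝓝[>] 0, ∫ x, (waveFun m μ ε (d x) : ℂ) * ψ (ε, x) = 0 := by
  obtain ⟨a, ha0, hlow'⟩ := hlow (Prod.snd '' tsupport ψ)
    (by rintro _ ⟨p, hp, rfl⟩; exact (hψ.tsupport_subset hp).2)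
    (hψ.hasCompactSupport.isCompact.image continuous_snd)
  filter_upwards [Ioo_mem_nhdsGT ha0] with ε hε
  rw [integral_eq_zero_of_ae]
  refine Filter.Eventually.of_forall fun x => ?_
  simp only [Pi.zero_apply]
  by_cases hs : (ε, x) ∈ tsupport ψ
  · rw [waveFun_of_le ((ENNReal.ofReal_le_ofReal hε.2.le).trans (hlow' _ ⟨_, hs, rfl⟩))]; simp
  · rw [image_eq_zero_of_notMem_tsupport hs, mul_zero]

end SmallTime

/-! ### Integration by parts in time -/

section TimeFlux

variable {m μ : ℕ} {O : Set (Euc m)} {d : Euc m → ℝ≥0∞} {δ : ℝ} {φ ψ : ℝ × Euc m → ℂ}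

lemma hasDerivAt_integral_of_compact {K : Set (Euc m)} (hK : IsCompact K)
    {b b' : ℝ → Euc m → ℂ} (hb : ∀ t, 0 < t → Continuous (b t)) (hb0 : ∀ t, ∀ x ∉ K, b t x = 0)
    (hb'c : ∀ t, 0 < t → Continuous (b' t)) (hb'0 : ∀ t, ∀ x ∉ K, b' t x = 0)
    (hb' : ContinuousOn (fun p : ℝ × Euc m => b' p.1 p.2) (Ioi 0 ×ˢ K))
    (hd : ∀ t, 0 < t → ∀ x, HasDerivAt (fun s => b s x) (b' t x) t) {t : ℝ} (ht : 0 < t) :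
    Integrable (b' t) ∧ HasDerivAt (fun s => ∫ x, b s x) (∫ x, b' t x) t := by
  obtain ⟨C, hC⟩ := ((isCompact_Icc (a := t / 2) (b := 2 * t)).prod hK).exists_bound_of_continuousOn
    (hb'.mono (prod_mono (fun s hs => (half_pos ht).trans_le hs.1) subset_rfl))
  have hs : Icc (t / 2) (2 * t) ∈ 𝓝 t := Icc_mem_nhds (by linarith) (by linarith)
  refine hasDerivAt_integral_of_dominated_loc_of_deriv_le (bound := K.indicator fun _ => C)
    hs ?_ ((hb t ht).integrable_of_hasCompactSupport (HasCompactSupport.intro hK (hb0 t)))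
    (hb'c t ht).aestronglyMeasurable ?_ ?_ ?_
  · filter_upwards [Ioi_mem_nhds ht] with s hs using (hb s hs).aestronglyMeasurable
  · refine Filter.Eventually.of_forall fun x s hs => ?_
    by_cases hx : x ∈ K
    · rw [indicator_of_mem hx]; exact hC (s, x) ⟨hs, hx⟩
    · rw [indicator_of_notMem hx, hb'0 s x hx, norm_zero]
  · exact (integrable_indicator_iff hK.measurableSet).2 (integrableOn_const hK.measure_lt_top.ne)
  · exact Filter.Eventually.of_forall fun x s hs => hd s ((half_pos ht).trans_le hs.1) x

/-- The boundary term of the integration by parts in time. -/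
def timeFlux (m μ k : ℕ) (d : Euc m → ℝ≥0∞) (φ : ℝ × Euc m → ℂ) (t : ℝ) : ℂ :=
  ∫ x, (((t : ℂ) ^ (2 * k))⁻¹ * ((waveFun m (μ + 2) t (d x) : ℂ) * timeDeriv (reduced k φ) (t, x))
    - (t : ℂ) / 2 * ((t : ℂ) ^ (2 * k))⁻¹ *
      ((waveFun m (μ + 1) t (d x) : ℂ) * reduced k φ (t, x)))

/-- The integrand of the derivative of `timeFlux`. -/
def timeFluxDeriv (m μ k : ℕ) (d : Euc m → ℝ≥0∞) (φ : ℝ × Euc m → ℂ) (t : ℝ) (x : Euc m) : ℂ :=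
  ((t : ℂ) ^ (2 * k))⁻¹ * ((waveFun m (μ + 2) t (d x) : ℂ)
      * reduced k (timeDeriv (timeDeriv φ)) (t, x))
    - (t : ℂ) ^ 2 / 4 * ((t : ℂ) ^ (2 * k))⁻¹ * ((waveFun m μ t (d x) : ℂ) * reduced k φ (t, x))
    - (1 / 2 - (k : ℂ)) * ((t : ℂ) ^ (2 * k))⁻¹
      * ((waveFun m (μ + 1) t (d x) : ℂ) * reduced k φ (t, x))

/-- With R_k the reduced test function, the two terms in E_{μ+1}∂_tR_k cancel. The first remaining
term pairs with φ''; the others are minus ∂_t²E_{μ+2} paired with φ, except for the summand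
kE_{μ+1}, which comes from differentiating t^{-2k}. -/
lemma hasDerivAt_timeFlux (ha : 0 < waveExp m μ) (hO : IsOpen O) (hd : ContinuousOn d O)
    (hφ : IsTestFunction (Iio δ ×ˢ O) φ) (k : ℕ) {t : ℝ} (ht : 0 < t) :
    Integrable (timeFluxDeriv m μ k d φ t) ∧
      HasDerivAt (timeFlux m μ k d φ) (∫ x, timeFluxDeriv m μ k d φ t x) t := by
  have ha1 := waveExp_add_one_pos ha
  have ha2 := waveExp_add_one_pos ha1
  have hR := hφ.reduced (isOpen_strip hO) k
  have hR1 := hR.timeDeriv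
  have hR2 := hφ.timeDeriv.timeDeriv.reduced (isOpen_strip hO) k
  have hK := ((hR.hasCompactSupport.isCompact.union hR1.hasCompactSupport.isCompact).union
    hR2.hasCompactSupport.isCompact).image continuous_snd
  have hKO : Prod.snd '' (tsupport (reduced k φ) ∪ tsupport (timeDeriv (reduced k φ))
      ∪ tsupport (reduced k (timeDeriv (timeDeriv φ)))) ⊆ O := by
    rintro _ ⟨p, (hp | hp) | hp, rfl⟩
    exacts [(hR.tsupport_subset hp).2, (hR1.tsupport_subset hp).2, (hR2.tsupport_subset hp).2]
  have z0 : ∀ t, ∀ x ∉ Prod.snd '' (tsupport (reduced k φ) ∪ tsupport (timeDeriv (reduced k φ))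
      ∪ tsupport (reduced k (timeDeriv (timeDeriv φ)))), reduced k φ (t, x) = 0 ∧
      timeDeriv (reduced k φ) (t, x) = 0 ∧ reduced k (timeDeriv (timeDeriv φ)) (t, x) = 0 :=
    fun t x hx => ⟨image_eq_zero_of_notMem_tsupport fun h => hx ⟨_, Or.inl (Or.inl h), rfl⟩,
      image_eq_zero_of_notMem_tsupport fun h => hx ⟨_, Or.inl (Or.inr h), rfl⟩,
      image_eq_zero_of_notMem_tsupport fun h => hx ⟨_, Or.inr h, rfl⟩⟩
  have cw : ∀ μ, 0 < waveExp m μ → ContinuousOn (fun p : ℝ × Euc m => (waveFun m μ p.1 (d p.2) : ℂ))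
      (Ioi 0 ×ˢ (Prod.snd '' (tsupport (reduced k φ) ∪ tsupport (timeDeriv (reduced k φ))
      ∪ tsupport (reduced k (timeDeriv (timeDeriv φ)))))) := fun μ ha =>
    Complex.continuous_ofReal.comp_continuousOn (continuousOn_waveFun ha (hd.mono hKO))
  have ct : ContinuousOn (fun p : ℝ × Euc m => ((p.1 : ℂ) ^ (2 * k))⁻¹)
      (Ioi 0 ×ˢ (Prod.snd '' (tsupport (reduced k φ) ∪ tsupport (timeDeriv (reduced k φ))
      ∪ tsupport (reduced k (timeDeriv (timeDeriv φ)))))) :=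
    ContinuousOn.inv₀ (by fun_prop) fun p hp =>
      pow_ne_zero _ (Complex.ofReal_ne_zero.2 (ne_of_gt hp.1))
  refine hasDerivAt_integral_of_compact hK (b' := timeFluxDeriv m μ k d φ) (fun s hs => ?_)
    (fun s x hx => ?_) (fun s hs => ?_) (fun s x hx => ?_) ?_ (fun s hs x => ?_) ht
  · exact (continuous_const.mul (continuous_waveFun_mul_slice ha2 hO hd hR1 hs)).sub
      (continuous_const.mul (continuous_waveFun_mul_slice ha1 hO hd hR hs))
  · simp only [(z0 s x hx).1, (z0 s x hx).2.1]; simp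
  · exact ((continuous_const.mul (continuous_waveFun_mul_slice ha2 hO hd hR2 hs)).sub
      (continuous_const.mul (continuous_waveFun_mul_slice ha hO hd hR hs))).sub
      (continuous_const.mul (continuous_waveFun_mul_slice ha1 hO hd hR hs))
  · simp only [timeFluxDeriv, (z0 s x hx).1, (z0 s x hx).2.2]; simp
  · have c0 := hR.contDiff.continuous
    have c2 := hR2.contDiff.continuous
    refine ((ct.mul ((cw _ ha2).mul c2.continuousOn)).sub
      (((ContinuousOn.mul (by fun_prop) ct)).mul ((cw _ ha).mul c0.continuousOn))).sub
      ((continuousOn_const.mul ct).mul ((cw _ ha1).mul c0.continuousOn))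
  · have hs' : (s : ℂ) ≠ 0 := Complex.ofReal_ne_zero.2 hs.ne'
    have h1 := ((hasDerivAt_waveFun ha1 hs (d x)).ofReal_comp).fun_mul
      (hasDerivAt_reduced_timeDeriv hφ.contDiff k hs.ne' x)
    have h2 := ((hasDerivAt_ofReal_pow (2 * k) s).fun_inv (pow_ne_zero _ hs')).fun_mul
      (hasDerivAt_time (hR.contDiff.differentiable (by simp)) s x)
    have h3 := ((((hasDerivAt_ofReal_pow 1 s).fun_mul
      ((hasDerivAt_waveFun ha hs (d x)).ofReal_comp)).fun_mul h2)).const_mul (1 / 2 : ℂ)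
    refine ((h1.fun_sub h3).congr_of_eventuallyEq (Filter.Eventually.of_forall fun s => ?_)).congr_deriv
      ?_
    · simp only [pow_one]; ring
    · rw [timeFluxDeriv]
      rcases k with _ | k
      · simp
        ring
      · rw [show 2 * (k + 1) = 2 * k + 1 + 1 by ring]
        simp only [add_tsub_cancel_right, pow_succ]
        push_cast
        field_simp
        ring

end TimeFlux

/-! ### The point source -/

section PointSource

variable {m μ : ℕ} {M : Type*} [EMetricSpace M] [ChartedSpace (Euc m) M]
  [IsManifold (𝓡 m) ∞ M] [RiemannianBundle (fun x : M => TangentSpace (𝓡 m) x)]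
  [IsContMDiffRiemannianBundle (𝓡 m) ∞ (Euc m) (fun x : M => TangentSpace (𝓡 m) x)]
  {e e' : OpenPartialHomeomorph M (Euc m)} {A : (x : M) → TangentSpace (𝓡 m) x} {y : M}
  {κ δ r : ℝ} {V : Set M}
  {W N : Set (Euc m × Euc m)} {b c : Euc m × Euc m → C(unitInterval, Euc m)}
  {φ ψ : ℝ × Euc m → ℂ}

lemma pointSource_of_mem (hy : y ∈ e.source) (φ : ℝ × Euc m → ℂ) :
    pointSource e y φ = ((volFactor e (e y))⁻¹ : ℝ) * φ (0, e y) := by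
  rw [pointSource, if_pos hy]

lemma pointSource_of_notMem (hy : y ∉ e.source) (φ : ℝ × Euc m → ℂ) : pointSource e y φ = 0 := by
  rw [pointSource, if_neg hy]

lemma IsMinimizingFamily.tendsto_pointSource (h : IsMinimizingFamily e V r W N b c) (hy : y ∈ V)
    (he' : e' ∈ IsManifold.maximalAtlas (𝓡 m) ∞ M) (hm : 1 ≤ m) (ha : 0 < waveExp m μ)
    (hψ : IsTestFunction (Iio δ ×ˢ e'.target) ψ) :
    Filter.Tendsto (fun ε : ℝ => ((ε : ℂ) ^ (2 * μ + 1))⁻¹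
        * ∫ x, (waveFun m μ ε (edist (e'.symm x) y) : ℂ) * ψ (ε, x)) (𝓝[>] 0)
      (𝓝 (waveMass μ * pointSource e' y ψ)) := by
  by_cases hy' : y ∈ e'.source
  · have h1 := tendsto_integral_waveFun ha e'.open_target (continuousOn_edist_symm e' y) hψ
      (e'.map_source hy') (by rw [e'.left_inv hy', edist_self])
      (fun K hK hKc => h.exists_lower_bound hy he' hy' hKc hK)
      (fun z => h.tendsto_edist_sq hy he' hy' z)
    rw [integral_profile_metricForm hm he' (e'.map_source hy') ha] at h1
    rw [pointSource_of_mem hy', ← mul_assoc, ← Complex.ofReal_mul]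
    exact h1
  · rw [pointSource_of_notMem hy', mul_zero]
    refine tendsto_const_nhds.congr' ?_
    have h1 := integral_waveFun_eventually_zero (μ := μ) (d := fun u => edist (e'.symm u) y) hψ
      fun K hK hKc => exists_lower_bound_of_ne (y := y) hKc hK
        (fun u hu h0 => hy' (by rw [← h0]; exact e'.map_target (hK hu)))
    filter_upwards [h1] with ε hε
    rw [hε, mul_zero]

/-- By the scaling limit the two terms of the flux are of order t^{2ν+1} and t^{2ν}, so only the
second term for ν = 0 survives. Its constant is -1 by `waveMass_mul` with k = m + 1. -/
lemma IsMinimizingFamily.tendsto_timeFlux (h : IsMinimizingFamily e V r W N b c) (hy : y ∈ V)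
    (he' : e' ∈ IsManifold.maximalAtlas (𝓡 m) ∞ M) (hm : 1 ≤ m)
    (hφ : IsTestFunction (Iio δ ×ˢ e'.target) φ) (ν : ℕ) :
    Filter.Tendsto (timeFlux m (ν + m) (m + 2) (fun u => edist (e'.symm u) y) φ) (𝓝[>] 0)
      (𝓝 (if ν = 0 then -pointSource e' y φ else 0)) := by
  have ha : 0 < waveExp m (ν + m) := by
    simp only [waveExp]; push_cast
    have : (0 : ℝ) ≤ m := Nat.cast_nonneg m
    have : (0 : ℝ) ≤ ν := Nat.cast_nonneg ν
    linarith
  have ha1 := waveExp_add_one_pos ha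
  have ha2 := waveExp_add_one_pos ha1
  have hO := e'.open_target
  have hd := continuousOn_edist_symm e' y
  have hR := hφ.reduced (isOpen_strip hO) (m + 2)
  have hR1 := hR.timeDeriv
  have t2 := h.tendsto_pointSource hy he' hm ha2 hR1
  have t1 := h.tendsto_pointSource hy he' hm ha1 hR
  have hpow : ∀ n : ℕ, Filter.Tendsto (fun ε : ℝ => (ε : ℂ) ^ n) (𝓝[>] 0) (𝓝 (0 ^ n)) := fun n => by
    have : Continuous fun ε : ℝ => (ε : ℂ) ^ n := by fun_prop
    have h1 := this.tendsto 0
    rw [Complex.ofReal_zero] at h1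
    exact h1.mono_left nhdsWithin_le_nhds
  have hlim := ((hpow (2 * ν + 1)).mul t2).sub (((hpow (2 * ν)).mul t1).const_mul (1 / 2 : ℂ))
  have hval : (0 : ℂ) ^ (2 * ν + 1) * (waveMass (ν + m + 1 + 1)
        * pointSource e' y (timeDeriv (reduced (m + 2) φ)))
      - 1 / 2 * ((0 : ℂ) ^ (2 * ν) * (waveMass (ν + m + 1) * pointSource e' y (reduced (m + 2) φ)))
      = if ν = 0 then -pointSource e' y φ else 0 := by
    rcases Nat.eq_zero_or_pos ν with rfl | hν
    · have h1 : pointSource e' y (reduced (m + 2) φ) = ((4 ^ (m + 2)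
          * Real.Gamma ((m + 2 : ℕ) + 1 / 2) / √Real.pi : ℝ) : ℂ) * pointSource e' y φ := by
        by_cases hy' : y ∈ e'.source
        · rw [pointSource_of_mem hy', pointSource_of_mem hy', reduced_time_zero]; ring
        · rw [pointSource_of_notMem hy', pointSource_of_notMem hy', mul_zero]
      have h2 := congrArg (fun x : ℝ => (x : ℂ)) (waveMass_mul (m + 1))
      simp only [Complex.ofReal_mul, Complex.ofReal_div, Complex.ofReal_one,
        Complex.ofReal_ofNat] at h2
      rw [h1, if_pos rfl, zero_add]
      simp only [mul_zero, zero_add, pow_one, zero_mul, pow_zero, one_mul, Complex.ofReal_mul,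
        Complex.ofReal_div]
      linear_combination (-pointSource e' y φ) * h2
    · rw [if_neg hν.ne', zero_pow (by omega), zero_pow (by omega)]; simp
  rw [hval] at hlim
  refine hlim.congr' ?_
  filter_upwards [self_mem_nhdsWithin] with ε hε
  have hε0 : (0 : ℝ) < ε := hε
  have hε' : (ε : ℂ) ≠ 0 := Complex.ofReal_ne_zero.2 hε0.ne'
  have I2 : Integrable fun x => (waveFun m (ν + m + 2) ε (edist (e'.symm x) y) : ℂ)
      * timeDeriv (reduced (m + 2) φ) (ε, x) :=
    (continuous_waveFun_mul_slice ha2 hO hd hR1 hε0).integrable_of_hasCompactSupport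
      (slice_support hR1 ε).1.mul_left
  have I1 : Integrable fun x => (waveFun m (ν + m + 1) ε (edist (e'.symm x) y) : ℂ)
      * reduced (m + 2) φ (ε, x) :=
    (continuous_waveFun_mul_slice ha1 hO hd hR hε0).integrable_of_hasCompactSupport
      (slice_support hR ε).1.mul_left
  rw [timeFlux, integral_sub (I2.const_mul _) (I1.const_mul _), integral_const_mul,
    integral_const_mul]
  rw [show 2 * (ν + m + 1 + 1) + 1 = (2 * ν + 1) + 2 * (m + 2) by ring,
    show 2 * (ν + m + 1) + 1 = 2 * ν + (2 * m + 3) by ring,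
    show 2 * (m + 2) = (2 * m + 3) + 1 by ring, pow_add, pow_add _ (2 * ν) (2 * m + 3),
    pow_succ (ε : ℂ) (2 * m + 3)]
  field_simp
  ring

end PointSource

/-! ### The parametrix identity -/

section Parametrix

variable {m : ℕ} {M : Type*} [EMetricSpace M] [ChartedSpace (Euc m) M]
  [IsManifold (𝓡 m) ∞ M] [RiemannianBundle (fun x : M => TangentSpace (𝓡 m) x)]
  [IsContMDiffRiemannianBundle (𝓡 m) ∞ (Euc m) (fun x : M => TangentSpace (𝓡 m) x)]
  {e e' : OpenPartialHomeomorph M (Euc m)} {A : (x : M) → TangentSpace (𝓡 m) x} {y : M}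
  {κ δ r : ℝ} {V : Set M}
  {W N : Set (Euc m × Euc m)} {b c : Euc m × Euc m → C(unitInterval, Euc m)}
  {φ ψ : ℝ × Euc m → ℂ} {β : ℕ → Euc m → ℂ}

lemma waveExp_add_pos (m ν : ℕ) : 0 < waveExp m (ν + m) := by
  simp only [waveExp]; push_cast
  have : (0 : ℝ) ≤ m := Nat.cast_nonneg m
  have : (0 : ℝ) ≤ ν := Nat.cast_nonneg ν
  linarith

lemma _root_.MeasureTheory.integral_Ioi_of_hasDerivAt_of_tendsto_nhdsGT {f f' : ℝ → ℂ} {L : ℂ}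
    (hL : Filter.Tendsto f (𝓝[>] 0) (𝓝 L)) (hd : ∀ t, 0 < t → HasDerivAt f (f' t) t)
    (hf' : IntegrableOn f' (Ioi 0)) (h0 : ∀ᶠ t in Filter.atTop, f t = 0) :
    ∫ t in Ioi 0, f' t = -L := by
  have h1 := integral_Ioi_of_hasDerivAt_of_tendsto (f := Function.update f 0 L) (f' := f') (a := 0)
    (m := 0) (by rwa [continuousWithinAt_update_same, Ici_sdiff_left])
    (fun t ht => (hd t ht).congr_of_eventuallyEq (by
      filter_upwards [Ioi_mem_nhds ht] with s hs
      exact Function.update_of_ne (ne_of_gt hs) _ _)) hf'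
    (tendsto_const_nhds.congr' (by
      filter_upwards [h0, Filter.eventually_gt_atTop 0] with s hs hs0
      rw [Function.update_of_ne hs0.ne', hs]))
  rw [h1, Function.update_self, zero_sub]

/-- The transport equations turn the sum into a telescoping one. -/
lemma IsMinimizingFamily.sum_waveOp (h : IsMinimizingFamily e V r W N b c) (hy : y ∈ V)
    (he' : e' ∈ IsManifold.maximalAtlas (𝓡 m) ∞ M)
    (hA : ContMDiff (𝓡 m) (𝓡 m).tangent ∞ (fun x => (⟨x, A x⟩ : TangentBundle (𝓡 m) M)))
    (hδ : δ ≤ r) (hβ : SolvesTransport e' A κ y (coordBall e' y δ) β) {t : ℝ} (ht : 0 < t)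
    (htδ : t < δ) {u : Euc m} (hu : u ∈ e'.target) (n : ℕ) :
    ∑ ν ∈ Finset.range (n + 1), β ν u *
        ((t : ℂ) ^ 2 / 4 * (waveFun m (ν + m) t (edist (e'.symm u) y) : ℂ)
        + (1 / 2 - ((m + 2 : ℕ) : ℂ)) * (waveFun m (ν + m + 1) t (edist (e'.symm u) y) : ℂ))
      + magneticOp e' A κ (fun v => ∑ ν ∈ Finset.range (n + 1),
        β ν v * (waveFun m (ν + m + 2) t (edist (e'.symm v) y) : ℂ)) u
    = magneticOp e' A κ (β n) u * (waveFun m (n + m + 2) t (edist (e'.symm u) y) : ℂ) := by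
  have hpos := fun ν => waveExp_add_pos m ν
  rw [magneticOp_sum he' hA e'.open_target subset_rfl _ (fun ν _ =>
    contDiffOn_mul_waveFun h hy he' (hpos ν) ht htδ hδ (hβ.contDiffOn ν)) hu,
    ← Finset.sum_add_distrib]
  by_cases hur : u ∈ coordBall e' y δ
  · have hF : ∀ μ, 0 < waveExp m μ → (waveFun m μ t (edist (e'.symm u) y) : ℂ)
        = profile m μ (t ^ 2 - (edist (e'.symm u) y).toReal ^ 2) := fun μ hμ => by
      rw [waveFun_eq_profile hμ ht hur]
    -- The k = m + 2 transpositions subtract (m + 2)E_{ν+m+1} from the second time derivative. Thus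
    -- the coefficient ν + m + 2 of the shifted index becomes ν, as in the formula for E_ν itself.
    have key : ∀ ν, β ν u *
        ((t : ℂ) ^ 2 / 4 * (waveFun m (ν + m) t (edist (e'.symm u) y) : ℂ)
        + (1 / 2 - ((m + 2 : ℕ) : ℂ)) * (waveFun m (ν + m + 1) t (edist (e'.symm u) y) : ℂ))
      + magneticOp e' A κ (fun v => β ν v * (waveFun m (ν + m + 2) t (edist (e'.symm v) y) : ℂ)) u
      = magneticOp e' A κ (β ν) u * (waveFun m (ν + m + 2) t (edist (e'.symm u) y) : ℂ)
        + (waveFun m (ν + m + 1) t (edist (e'.symm u) y) : ℂ) * ((ν : ℂ) * β ν u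
          + (-transportCoeff e' A y u * β ν u + radialDeriv e' y (β ν) u) / 2) := by
      intro ν
      have h1 := waveOp_mul_profile (κ := κ) (t := t) h hy he' hA (hpos ν) hδ (hβ.contDiffOn ν) hur
      have h2 : magneticOp e' A κ
          (fun v => β ν v * (waveFun m (ν + m + 2) t (edist (e'.symm v) y) : ℂ)) u
          = magneticOp e' A κ (fun v => β ν v *
            (profile m (ν + m + 2) (t ^ 2 - (edist (e'.symm v) y).toReal ^ 2) : ℂ)) u := by
        refine magneticOp_congr ?_ κ
        filter_upwards [isOpen_coordBall.mem_nhds hur] with v hv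
        rw [waveFun_eq_profile (waveExp_add_one_pos (waveExp_add_one_pos (hpos ν))) ht hv]
      rw [h2, hF _ (hpos ν), hF _ (waveExp_add_one_pos (hpos ν)),
        hF _ (waveExp_add_one_pos (waveExp_add_one_pos (hpos ν)))]
      push_cast at h1 ⊢
      linear_combination h1
    induction n with
    | zero =>
      rw [Finset.sum_range_one, key, ← hβ.zero u hur]
      simp
    | succ n ih =>
      rw [Finset.sum_range_succ, ih, key]
      -- The remainder (Qα_n)E_{n+m+2} of the first n + 1 terms has the same index as the
      -- first-order part of the next term. The transport equation cancels them.
      have h3 := hβ.succ u hur n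
      rw [show n + 1 + m + 1 = n + m + 2 by ring]
      push_cast
      linear_combination (waveFun m (n + m + 2) t (edist (e'.symm u) y) : ℂ) / 2 * h3
  -- Outside the ball of radius δ > t all terms vanish locally, so the transport equations are not
  -- needed there.
  · have h0 := waveFun_eventually_eq_zero ht htδ hu hur
    have h1 := h0.self_of_nhds
    have h2 : ∀ ν, magneticOp e' A κ
        (fun v => β ν v * (waveFun m (ν + m + 2) t (edist (e'.symm v) y) : ℂ)) u = 0 := by
      intro ν
      rw [magneticOp_congr (g := fun _ => 0), magneticOp_zero]
      filter_upwards [h0] with v hv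
      rw [hv]; simp
    simp [h1, h2]

/-- The parametrix identity, in the chart `e'`. -/
theorem IsMinimizingFamily.distWaveOp_eq (h : IsMinimizingFamily e V r W N b c) (hy : y ∈ V)
    (he' : e' ∈ IsManifold.maximalAtlas (𝓡 m) ∞ M) (hm : 1 ≤ m)
    (hA : ContMDiff (𝓡 m) (𝓡 m).tangent ∞ (fun x => (⟨x, A x⟩ : TangentBundle (𝓡 m) M)))
    (hδ : δ ≤ r) (hβ : SolvesTransport e' A κ y (coordBall e' y δ) β)
    (hβs : ∀ ν, ContDiffOn ℝ ∞ (β ν) e'.target)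
    (hβ1 : y ∈ e'.source → β 0 (e' y) = 1)
    (hφ : IsTestFunction (Iio δ ×ˢ e'.target) φ) (n : ℕ) :
    distWaveOp e' A κ (∑ ν ∈ Finset.range (n + 1), spaceMul (β ν) (waveDist ν e' y)) φ
      = pointSource e' y φ + spaceMul (magneticOp e' A κ (β n)) (waveDist n e' y) φ := by
  have : Nontrivial (Euc m) := by
    refine Module.nontrivial_of_finrank_pos (R := ℝ) ?_
    rw [finrank_euclideanSpace_fin]; exact hm
  have hO := e'.open_target
  set d : Euc m → ℝ≥0∞ := fun u => edist (e'.symm u) y with hddef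
  have hd : ContinuousOn d e'.target := continuousOn_edist_symm e' y
  have hlow : HasLinearLowerBound d e'.target := h.hasLinearLowerBound hy he'
  -- Level m + 2 is used for all ν: it is the first beyond the definition at which two x-derivatives
  -- are guaranteed.
  have hW : ∀ ν, Represents (m + 2) δ e'.target (waveDist ν e' y)
      fun t x => (waveFun m (ν + m + 2) t (d x) : ℂ) := fun ν =>
    represents_waveFun (l := 2) hO hd hlow fun _ => rfl
  set T := ∑ ν ∈ Finset.range (n + 1), spaceMul (β ν) (waveDist ν e' y) with hTdef
  set f : ℝ → Euc m → ℂ := fun t x =>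
    ∑ ν ∈ Finset.range (n + 1), β ν x * (waveFun m (ν + m + 2) t (d x) : ℂ) with hf
  set g : ℝ → Euc m → ℂ := fun t x =>
    magneticOp e' A κ (β n) x * (waveFun m (n + m + 2) t (d x) : ℂ) with hg
  have hT : Represents (m + 2) δ e'.target T f :=
    Represents.sum hO _ fun ν _ => (hW ν).spaceMul hO (hβs ν)
  have hP := hT.magneticOp he' hA (fun t ht => ContDiffOn.sum fun ν _ =>
    contDiffOn_mul_waveFun h hy he' (waveExp_add_pos m ν) ht.1 ht.2 hδ (hβ.contDiffOn ν)) κ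
  have hG : Represents (m + 2) δ e'.target
      (spaceMul (magneticOp e' A κ (β n)) (waveDist n e' y)) g :=
    (hW n).spaceMul hO (contDiffOn_magneticOp he' hA hO subset_rfl (hβs n) κ)
  have hφ2 := hφ.timeDeriv.timeDeriv
  have hφβ : ∀ ν, IsTestFunction (Iio δ ×ˢ e'.target) fun p => β ν p.2 * φ p :=
    fun ν => hφ.spaceMul isOpen_Iio hO (hβs ν)
  -- The density in t of the left side minus the remainder term. It is the derivative of the total
  -- flux, so its integral is minus the limit of the flux at t = 0, namely the point source.
  set G : ℝ → ℂ := fun t => slicePairing (m + 2) f (timeDeriv (timeDeriv φ)) t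
    + slicePairing (m + 2) (fun t x => magneticOp e' A κ (f t) x) φ t
    - slicePairing (m + 2) g φ t with hGdef
  have hGint : IntegrableOn G (Ioi 0) :=
    ((hT.integrableOn _ hφ2).add (hP.integrableOn _ hφ)).sub (hG.integrableOn _ hφ)
  have hflux := fun ν t (ht : 0 < t) =>
    hasDerivAt_timeFlux (waveExp_add_pos m ν) hO hd (hφβ ν) (m + 2) ht
  have hR2 := hφ2.reduced (isOpen_strip hO) (m + 2)
  have hR := hφ.reduced (isOpen_strip hO) (m + 2)
  have htd : ∀ ν, timeDeriv (timeDeriv fun p => β ν p.2 * φ p)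
      = fun p => β ν p.2 * timeDeriv (timeDeriv φ) p := by
    have h1 : ∀ {χ}, IsTestFunction (Iio δ ×ˢ e'.target) χ → ∀ ν,
        timeDeriv (fun p => β ν p.2 * χ p) = fun p => β ν p.2 * timeDeriv χ p := by
      intro χ hχ ν
      funext p
      have h3 := hasDerivAt_time ((hχ.spaceMul isOpen_Iio hO (hβs ν)).contDiff.differentiable
        (by simp)) p.1 p.2
      have h4 := (hasDerivAt_time (hχ.contDiff.differentiable (by simp)) p.1 p.2).const_mul
        (β ν p.2)
      exact h3.unique h4
    intro ν
    rw [h1 hφ, h1 hφ.timeDeriv]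
  have hderiv : ∀ t, 0 < t → HasDerivAt (fun t => ∑ ν ∈ Finset.range (n + 1),
      timeFlux m (ν + m) (m + 2) d (fun p => β ν p.2 * φ p) t) (G t) t := by
    intro t ht
    refine (HasDerivAt.fun_sum fun ν _ => (hflux ν t ht).2).congr_deriv ?_
    rw [← integral_finsetSum _ fun ν _ => (hflux ν t ht).1]
    simp only [timeFluxDeriv, htd, reduced_congr_mul hO hφ2 isOpen_Iio (hβs _),
      reduced_congr_mul hO hφ isOpen_Iio (hβs _)]
    rcases lt_or_ge t δ with htδ | htδ
    · have hI : t ∈ Ioo 0 δ := ⟨ht, htδ⟩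
      have i1 := integrable_slice hO hR2 (hT.continuousOn t hI) t (((t : ℂ) ^ (2 * (m + 2)))⁻¹)
      have i2 := integrable_slice hO hR (hP.continuousOn t hI) t (((t : ℂ) ^ (2 * (m + 2)))⁻¹)
      have i3 := integrable_slice hO hR (hG.continuousOn t hI) t (((t : ℂ) ^ (2 * (m + 2)))⁻¹)
      simp only [hGdef, slicePairing]
      rw [← integral_add i1 i2, ← integral_sub (i1.fun_add i2) i3]
      refine integral_congr_ae (Filter.Eventually.of_forall fun x => ?_)
      simp only
      -- Within the chart the telescoped identity, multiplied by the reduced test function, matches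
      -- the two densities; off the chart the test functions vanish.
      by_cases hx : x ∈ e'.target
      · have h1 := h.sum_waveOp hy he' hA hδ hβ ht htδ hx n
        simp only [hf, hg]
        rw [← h1, add_mul, add_sub_add_right_eq_sub, Finset.sum_mul, Finset.sum_mul,
          ← Finset.sum_sub_distrib]
        refine Finset.sum_congr rfl fun ν _ => ?_
        simp only [hddef]
        ring
      · have z1 : reduced (m + 2) φ (t, x) = 0 := image_eq_zero_of_notMem_tsupport fun hp =>
          hx (hR.tsupport_subset hp).2
        have z2 : reduced (m + 2) (timeDeriv (timeDeriv φ)) (t, x) = 0 :=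
          image_eq_zero_of_notMem_tsupport fun hp => hx (hR2.tsupport_subset hp).2
        simp [z1, z2]
    · simp [hGdef, slicePairing, slice_eq_zero hR htδ, slice_eq_zero hR2 htδ]
  have hps : pointSource e' y (fun p => β 0 p.2 * φ p) = pointSource e' y φ := by
    by_cases hy' : y ∈ e'.source
    · rw [pointSource_of_mem hy', pointSource_of_mem hy', hβ1 hy', one_mul]
    · rw [pointSource_of_notMem hy', pointSource_of_notMem hy']
  have hlim : Filter.Tendsto (fun t => ∑ ν ∈ Finset.range (n + 1),
      timeFlux m (ν + m) (m + 2) d (fun p => β ν p.2 * φ p) t) (𝓝[>] 0)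
      (𝓝 (-pointSource e' y φ)) := by
    have h1 := tendsto_finsetSum (Finset.range (n + 1)) fun ν _ =>
      h.tendsto_timeFlux hy he' hm (hφβ ν) ν
    rw [Finset.sum_ite_eq' (Finset.range (n + 1)) 0, if_pos (by simp), hps] at h1
    exact h1
  have hzero : ∀ᶠ t in Filter.atTop, ∑ ν ∈ Finset.range (n + 1),
      timeFlux m (ν + m) (m + 2) d (fun p => β ν p.2 * φ p) t = 0 := by
    filter_upwards [Filter.eventually_ge_atTop δ] with t ht
    refine Finset.sum_eq_zero fun ν _ => ?_
    have hRν := (hφβ ν).reduced (isOpen_strip hO) (m + 2)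
    simp [timeFlux, slice_eq_zero hRν ht, slice_eq_zero hRν.timeDeriv ht]
  have hfinal := integral_Ioi_of_hasDerivAt_of_tendsto_nhdsGT hlim hderiv hGint hzero
  rw [neg_neg] at hfinal
  have e1 : distDt (distDt T) φ = T (timeDeriv (timeDeriv φ)) := by
    simp only [distDt, distDeriv, neg_neg]; rfl
  rw [distWaveOp, Pi.add_apply, e1, hT.eq_integral _ hφ2, hP.eq_integral _ hφ,
    hG.eq_integral _ hφ, ← hfinal, hGdef,
    integral_sub ((hT.integrableOn _ hφ2).fun_add (hP.integrableOn _ hφ)) (hG.integrableOn _ hφ),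
    integral_add (hT.integrableOn _ hφ2) (hP.integrableOn _ hφ)]
  ring

lemma IsMinimizingFamily.integrable_waveIntegrand (h : IsMinimizingFamily e V r W N b c)
    (hy : y ∈ V) (he' : e' ∈ IsManifold.maximalAtlas (𝓡 m) ∞ M)
    (hφ : IsTestFunction (Iio δ ×ˢ e'.target) φ) (ν : ℕ) :
    Integrable (waveIntegrand ν e' y φ) := by
  refine (integrable_waveFun_reduced (waveExp_add_pos m ν) e'.open_target
    (continuousOn_edist_symm e' y) (h.hasLinearLowerBound hy he') hφ).congr
    (Filter.Eventually.of_forall fun p => ?_)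
  by_cases hp : p.1 ≤ 0
  · simp [waveIntegrand, waveFun_of_nonpos hp]
  · simp only [waveIntegrand]
    rw [lowerTranspose_iterate hφ.contDiff m (not_le.1 hp).ne']

lemma contDiffOn_symm_of_contMDiffOn (he : e ∈ IsManifold.maximalAtlas (𝓡 m) ∞ M) {Ω : Set M}
    {a : M → M → ℂ} (ha : ContMDiffOn ((𝓡 m).prod (𝓡 m)) 𝓘(ℝ, ℂ) ∞ (fun p : M × M => a p.1 p.2)
      (univ ×ˢ Ω)) (hy : y ∈ Ω) : ContDiffOn ℝ ∞ (fun u => a (e.symm u) y) e.target := by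
  rw [← contMDiffOn_iff_contDiffOn]
  exact ha.comp ((contMDiffOn_symm_of_mem_maximalAtlas he).prodMk contMDiffOn_const)
    fun u hu => ⟨trivial, hy⟩

end Parametrix

end HadamardParametrix

end

theorem mainTheorem6 {m : ℕ} (hm : 1 ≤ m) (n : ℕ)
    {M : Type*} [EMetricSpace M] [ChartedSpace (HadamardParametrix.Euc m) M]
    [IsManifold (𝓡 m) ∞ M]
    [RiemannianBundle (fun x : M => TangentSpace (𝓡 m) x)]
    [IsContMDiffRiemannianBundle (𝓡 m) ∞ (HadamardParametrix.Euc m)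
      (fun x : M => TangentSpace (𝓡 m) x)]
    [IsRiemannianManifold (𝓡 m) M]
    (A : (x : M) → TangentSpace (𝓡 m) x)
    (hA : ContMDiff (𝓡 m) (𝓡 m).tangent ∞ (fun x => (⟨x, A x⟩ : TangentBundle (𝓡 m) M)))
    (Ω : Set M) (hΩ : IsOpen Ω) (hΩc : IsCompact (closure Ω)) :
    ∃ δ : ℝ, 0 < δ ∧ ∃ α : ℕ → M → M → ℂ,
      (∀ ν, ContMDiffOn ((𝓡 m).prod (𝓡 m)) 𝓘(ℝ, ℂ) ∞ (fun p : M × M => α ν p.1 p.2)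
        (univ ×ˢ Ω)) ∧
      (∀ y ∈ Ω, α 0 y y = 1) ∧
      ∀ y ∈ Ω, ∀ e ∈ IsManifold.maximalAtlas (𝓡 m) ∞ M,
        -- the transport equations
        (∀ u ∈ e.target, edist (e.symm u) y < ENNReal.ofReal δ →
          HadamardParametrix.transportCoeff e A y u * α 0 (e.symm u) y
              = HadamardParametrix.radialDeriv e y (fun v => α 0 (e.symm v) y) u ∧
          ∀ ν : ℕ,
            2 * ((ν : ℂ) + 1) * α (ν + 1) (e.symm u) y
              - HadamardParametrix.transportCoeff e A y u * α (ν + 1) (e.symm u) y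
              + HadamardParametrix.radialDeriv e y (fun v => α (ν + 1) (e.symm v) y) u
              + 2 * HadamardParametrix.magneticOp e A (((n : ℝ) - 2) ^ 2 / 4)
                  (fun v => α ν (e.symm v) y) u = 0) ∧
        -- the parametrix identity in the sense of distributions for `t < δ`
        ∀ φ : ℝ × HadamardParametrix.Euc m → ℂ,
          HadamardParametrix.IsTestFunction (Iio δ ×ˢ e.target) φ →
          (∀ ν, Integrable (HadamardParametrix.waveIntegrand ν e y φ)) ∧
          ∀ N : ℕ,
            HadamardParametrix.distWaveOp e A (((n : ℝ) - 2) ^ 2 / 4)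
                (∑ ν ∈ Finset.range (N + 1),
                  HadamardParametrix.spaceMul (fun u => α ν (e.symm u) y)
                    (HadamardParametrix.waveDist ν e y)) φ
              = HadamardParametrix.pointSource e y φ
                + HadamardParametrix.spaceMul
                    (HadamardParametrix.magneticOp e A (((n : ℝ) - 2) ^ 2 / 4)
                      (fun v => α N (e.symm v) y))
                    (HadamardParametrix.waveDist N e y) φ := by
  obtain ⟨δ, hδ, α, hs, h1, ht, hfam⟩ := HadamardParametrix.exists_coefficients hA
    (((n : ℝ) - 2) ^ 2 / 4) hΩc
  refine ⟨δ, hδ, α, hs, h1, fun y hy e he => ⟨fun u hu hud => ?_, fun φ hφ => ?_⟩⟩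
  · exact ⟨(ht y hy e he).zero u ⟨hu, hud⟩, (ht y hy e he).succ u ⟨hu, hud⟩⟩
  -- The geodesics live in an auxiliary chart around y with δ ≤ r, while the identity is proved in
  -- the given chart e.
  · obtain ⟨e₀, V, r, W, N, b, c, hyV, hδr, h⟩ := hfam y hy
    refine ⟨h.integrable_waveIntegrand hyV he hφ, fun k => ?_⟩
    exact h.distWaveOp_eq hyV he hm hA hδr (ht y hy e he)
      (fun ν => HadamardParametrix.contDiffOn_symm_of_contMDiffOn he (hs ν) hy)
      (fun hye => by rw [e.left_inv hye]; exact h1 y hy) hφ k
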